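/- Let $d,N\ge 1$, $m=\lfloor d/2\rfloor$, and let $g_{\mu\nu}$ be a constant Riemannian metric on $\mathbb T^d=\mathbb R^d/2\pi\mathbb Z^d$, with inverse $g^{\mu\nu}$ and $\sqrt g=\sqrt{\det (g_{\mu\nu})}$. Let $\gamma^\mu$ be hermitian $2^m\times 2^m$ matrices with $\gamma^\mu\gamma^\nu+\gamma^\nu\gamma^\mu=2g^{\mu\nu}$, let $A_\mu$ be a smooth potential on $\mathbb T^d$ with values in the anti-hermitian $N\times N$ matrices, and let $D_A=i\gamma^\mu(\partial_\mu+A_\mu)$ act on smooth $\mathbb C^{2^m}\otimes\mathbb C^N$-valued functions on $\mathbb T^d$. For $f(z)=e^{-z}$ let $\mathcal S_\Lambda(A)=\operatorname{Tr}e^{-D_A^2/\Lambda^2}$, $\Lambda>0$. For $p,q\in\mathbb Z^d$ put $p\cdot q=g^{\mu\nu}p_\mu q_\nu$, $p^2=p\cdot p$, $|p|=\sqrt{p^2}$; indices are raised with $g^{\mu\nu}$. Let $\hat\phi(k)=(2\pi)^{-d/2}\int_{[0,2\pi]^d}\phi(x)e^{-ikx}\,dx$, and let $F_{\mu\nu}=\partial_\mu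 A_\nu-\partial_\nu A_\mu$ (the field strength to first order in $A$); $\operatorname{tr}$ is the trace over $\mathbb C^N$ and $\|\cdot\|$ the Hilbert–Schmidt norm of a tensor. A mode at momentum $p$ is a tensor of the form $F_{\mu\nu}=i(p_\mu a_\nu-p_\nu a_\mu)$ with arbitrary $N\times N$ matrices $a_\mu$. There are real form factors $W_\Lambda(p)^{\mu\nu\rho\sigma}$ ($\Lambda>0$, $0\ne p\in\mathbb Z^d$), with $W_{\Lambda,p}(F',F):=\operatorname{tr}\,(F'_{\mu\nu}W_\Lambda(p)^{\mu\nu\rho\sigma}F_{\rho\sigma})$, such that the following holds. In (2), (4), (5), (7) the estimates hold for all $p\neq0$, all modes $F'$ at $-p$ and all modes $F$ at $p$. (1) For every $A$ and $\Lambda>0$, $e^{-D_{\varepsilon A}^2/\Lambda^2}$ is of trace class for all real $\varepsilon$, the sum below converges absolutely, and as $\varepsilon\to0$ $$\mathcal S_\Lambda(\varepsilon A)=\mathcal S_\Lambda(0)+\varepsilon^2\Big(Z_\Lambda(\hat A(0))+\sum_{p\ne0}W_{\Lambda,p}\big(\hat F(-p),\hat F(p)\big)\Big)+o(\varepsilon^2).$$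 Here $Z_\Lambda(\hat A(0))=\frac{2^m\Lambda^{-4}}{2(2\pi)^d}\sum_{q\in\mathbb Z^d}e^{-q^2/\Lambda^2}(2\Lambda^2g^{\mu\nu}-4q^\mu q^\nu)\operatorname{tr}\hat A_\mu(0)\hat A_\nu(0)$ comes from the constant mode of $A$, which does not enter $F$; the sum over $p$ is the quadratic-in-$F$ spectral action. (2) Large momenta. Put $$M_{\Lambda,p}(F',F)=-\frac{2^m\Lambda^{-2}}{(2\pi)^d}\sum_{q\in\mathbb Z^d}e^{-q^2/\Lambda^2}\operatorname{tr}\big(4p^{-6}\,p_\rho F'^{\rho\mu}\,p_\sigma F^{\sigma\nu}q_\mu q_\nu+2p^{-6}\,p_\rho F'^{\mu\nu}\,p_\sigma F_{\mu\nu}\,q^\rho q^\sigma\big).$$ For every $\Lambda>0$ there is $C$ with $|W_{\Lambda,p}(F',F)-M_{\Lambda,p}(F',F)|\le C|p|^{-6}\|F'\|\|F\|$. (3) The action decays exactly like $p^{-4}$: for every $\Lambda>0$ there are $c>0$, $C$ and $P$ with $c|p|^{-4}\|F\|^2\le|W_{\Lambda,p}(-F^\dagger,F)|\le C|p|^{-4}\|F\|^2$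 for all $p\ne0$ with $p^2\ge P$ and all modes $F$ at $p$. (For the field of a potential $A$, $\hat F(-p)=-\hat F(p)^\dagger$.) (4) Limit $\Lambda\to\infty$ of the large-momentum action. With $$w_\Lambda(p^2)=-\frac{2^{m+1}\sqrt g\,\Lambda^d}{(4\pi)^{d/2}}\,\frac1{p^4},$$ where $(4\pi)^{d/2}=(4\pi)^m$ if $d$ is even, one has: for every $\delta>0$ there is $\Lambda_0>0$ such that for all $\Lambda\ge\Lambda_0$: $|M_{\Lambda,p}(F',F)-w_\Lambda(p^2)\operatorname{tr}(F'_{\mu\nu}F^{\mu\nu})|\le\delta\,\Lambda^d|p|^{-4}\|F'\|\|F\|$. (5)–(6) The limits in the other order lead to the same $w_\Lambda$. Let $h(z)=\int_0^1e^{-\alpha(1-\alpha)z}d\alpha$, $q(z)=-\frac12\frac{h(z)-1}z$ and $b_\Lambda(z)=\frac{2^m\sqrt g\,\Lambda^{d-4}}{(4\pi)^{d/2}}\big(q(z/\Lambda^2)-\tfrac14h(z/\Lambda^2)\big)$. (5) There are $c>0$ and $C$ with $|W_{\Lambda,p}(F',F)-b_\Lambda(p^2)\operatorname{tr}(F'_{\mu\nu}F^{\mu\nu})|\le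 Ce^{-c\Lambda^2}\|F'\|\|F\|$ for all $\Lambda\ge1$. (6) For every $\Lambda>0$, $z^2b_\Lambda(z)\to-2^{m+1}\sqrt g\,\Lambda^d/(4\pi)^{d/2}$ as $z\to\infty$. In this sense the limits $\Lambda\to\infty$ and $p\to\infty$ commute. (7) The action is exponentially small as $\Lambda\to0$: there are $c>0$ and $C$ such that for all $0<\Lambda\le1$: $|W_{\Lambda,p}(F',F)|\le Ce^{-c/\Lambda^2}\|F'\|\|F\|$ and $|M_{\Lambda,p}(F',F)|\le Ce^{-c/\Lambda^2}|p|^{-4}\|F'\|\|F\|$. -/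

import Mathlib

open scoped ContDiff Matrix

noncomputable section

namespace TorusAction

/-! ### Fields on the torus `ℝ^d / 2πℤ^d` -/

/-- The partial derivative `∂_μ φ (x)`. -/
def partialD {d : ℕ} {E : Type*} [NormedAddCommGroup E] [NormedSpace ℝ E]
    (μ : Fin d) (φ : (Fin d → ℝ) → E) (x : Fin d → ℝ) : E :=
  fderiv ℝ φ x (Pi.single μ 1)

/-- `φ` is `2π`-periodic in every coordinate. -/
def IsPeriodic {d : ℕ} {E : Type*} (φ : (Fin d → ℝ) → E) : Prop :=
  ∀ (μ : Fin d) (x : Fin d → ℝ), φ (x + Pi.single μ (2 * Real.pi)) = φ x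

/-- A smooth gauge potential on `𝕋^d` with values in the anti-hermitian `N × N` matrices. -/
structure GaugeField (d N : ℕ) where
  A : Fin d → (Fin d → ℝ) → Matrix (Fin N) (Fin N) ℂ
  smooth : ∀ μ a b, ContDiff ℝ ∞ (fun x => A μ x a b)
  periodic : ∀ μ, IsPeriodic (A μ)
  antiherm : ∀ μ x, (A μ x)ᴴ = -A μ x

/-- The rescaled potential `ε A`, for real `ε`. -/
def GaugeField.scale {d N : ℕ} (ε : ℝ) (𝒜 : GaugeField d N) : GaugeField d N where
  A μ x := (ε : ℂ) • 𝒜.A μ x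
  smooth μ a b := by
    have h := (contDiff_const (c := (ε : ℂ))).mul (𝒜.smooth μ a b)
    simpa [Matrix.smul_apply] using h
  periodic μ ν x := by
    show (ε : ℂ) • 𝒜.A μ _ = (ε : ℂ) • 𝒜.A μ _
    rw [𝒜.periodic μ ν x]
  antiherm μ x := by
    simp [Matrix.conjTranspose_smul, 𝒜.antiherm μ x]

/-- The index set of the fibre `ℂ^(2^m) ⊗ ℂ^N`, `m = ⌊d/2⌋`: spinor index and gauge index. -/
abbrev Fib (d N : ℕ) : Type := Fin (2 ^ (d / 2)) × Fin N

/-- Smooth spinor fields on `𝕋^d` with values in `ℂ^(2^m) ⊗ ℂ^N`. -/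
def Spinors (d N : ℕ) : Submodule ℂ ((Fin d → ℝ) → Fib d N → ℂ) where
  carrier := {ψ | ContDiff ℝ ∞ ψ ∧ IsPeriodic ψ}
  add_mem' := by
    rintro φ ψ ⟨h₁, h₂⟩ ⟨h₃, h₄⟩
    refine ⟨h₁.add h₃, fun μ x => ?_⟩
    show φ _ + ψ _ = φ _ + ψ _
    rw [h₂ μ x, h₄ μ x]
  zero_mem' := ⟨contDiff_const, fun _ _ => rfl⟩
  smul_mem' := by
    rintro c ψ ⟨h₁, h₂⟩
    refine ⟨h₁.const_smul c, fun μ x => ?_⟩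
    show c • ψ _ = c • ψ _
    rw [h₂ μ x]

/-- Hermitian gamma matrices `γ^μ` of size `2^m`, with `γ^μ γ^ν + γ^ν γ^μ = 2 g^{μν}`. -/
structure IsGamma {d : ℕ} (g : Matrix (Fin d) (Fin d) ℝ)
    (γ : Fin d → Matrix (Fin (2 ^ (d / 2))) (Fin (2 ^ (d / 2))) ℂ) : Prop where
  herm : ∀ μ, (γ μ).IsHermitian
  clifford : ∀ μ ν, γ μ * γ ν + γ ν * γ μ
    = (((2 * g⁻¹ μ ν : ℝ)) : ℂ) • (1 : Matrix (Fin (2 ^ (d / 2))) (Fin (2 ^ (d / 2))) ℂ)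

/-- `(D_A ψ)(x) = i γ^μ (∂_μ ψ + A_μ ψ)(x)`. -/
def diracFun {d N : ℕ} (γ : Fin d → Matrix (Fin (2 ^ (d / 2))) (Fin (2 ^ (d / 2))) ℂ)
    (𝒜 : GaugeField d N) (ψ : (Fin d → ℝ) → Fib d N → ℂ) (x : Fin d → ℝ) (i : Fib d N) : ℂ :=
  Complex.I * ∑ μ, ∑ τ, γ μ i.1 τ *
    (partialD μ ψ x (τ, i.2) + ∑ b, 𝒜.A μ x i.2 b * ψ x (τ, b))

theorem diracFun_mem {d N : ℕ} (γ : Fin d → Matrix (Fin (2 ^ (d / 2))) (Fin (2 ^ (d / 2))) ℂ)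
    (𝒜 : GaugeField d N) {ψ : (Fin d → ℝ) → Fib d N → ℂ} (hψ : ψ ∈ Spinors d N) :
    diracFun γ 𝒜 ψ ∈ Spinors d N := by
  obtain ⟨h₁, h₂⟩ := hψ
  have hd : ∀ μ : Fin d, ContDiff ℝ ∞ (partialD μ ψ) := fun μ =>
    (h₁.fderiv_right (m := ∞) (by simp)).clm_apply contDiff_const
  constructor
  · rw [contDiff_pi]
    intro i
    refine contDiff_const.mul (ContDiff.sum fun μ _ => ContDiff.sum fun τ _ =>
      contDiff_const.mul (ContDiff.add ?_ (ContDiff.sum fun b _ => ?_)))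
    · exact contDiff_pi.1 (hd μ) (τ, i.2)
    · exact (𝒜.smooth μ i.2 b).mul (contDiff_pi.1 h₁ (τ, b))
  · intro ν x
    have hp : ∀ μ : Fin d, partialD μ ψ (x + Pi.single ν (2 * Real.pi)) = partialD μ ψ x := by
      intro μ
      have he : (fun y => ψ (y + Pi.single ν (2 * Real.pi))) = ψ := funext fun y => h₂ ν y
      have hf := fderiv_comp_add_right (𝕜 := ℝ) (f := ψ) (x := x) (Pi.single ν (2 * Real.pi))
      rw [he] at hf
      simp only [partialD, hf]
    funext i
    simp only [diracFun, hp, h₂ ν x, 𝒜.periodic _ ν x]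

/-- The Dirac operator `D_A = i γ^μ (∂_μ + A_μ)` on smooth spinor fields. -/
def dirac {d N : ℕ} (γ : Fin d → Matrix (Fin (2 ^ (d / 2))) (Fin (2 ^ (d / 2))) ℂ)
    (𝒜 : GaugeField d N) : Module.End ℂ (Spinors d N) where
  toFun ψ := ⟨diracFun γ 𝒜 ψ.1, diracFun_mem γ 𝒜 ψ.2⟩
  map_add' φ ψ := by
    apply Subtype.ext
    funext x i
    have hφ : DifferentiableAt ℝ φ.1 x := φ.2.1.differentiable (by simp) x
    have hψ : DifferentiableAt ℝ ψ.1 x := ψ.2.1.differentiable (by simp) x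
    have h : ∀ μ : Fin d, partialD μ (φ.1 + ψ.1) x = partialD μ φ.1 x + partialD μ ψ.1 x := by
      intro μ
      simp only [partialD, fderiv_add hφ hψ]
      rfl
    show diracFun γ 𝒜 (φ.1 + ψ.1) x i = diracFun γ 𝒜 φ.1 x i + diracFun γ 𝒜 ψ.1 x i
    simp only [diracFun, h, Pi.add_apply, mul_add, Finset.sum_add_distrib]
    ring
  map_smul' c ψ := by
    apply Subtype.ext
    funext x i
    have hψ : DifferentiableAt ℝ ψ.1 x := ψ.2.1.differentiable (by simp) x
    have h : ∀ μ : Fin d, partialD μ (c • ψ.1) x = c • partialD μ ψ.1 x := by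
      intro μ
      simp only [partialD, fderiv_const_smul hψ c]
      rfl
    show diracFun γ 𝒜 (c • ψ.1) x i = c * diracFun γ 𝒜 ψ.1 x i
    simp only [diracFun, h, Pi.smul_apply, smul_eq_mul, Finset.mul_sum, mul_add]
    simp only [mul_left_comm]

/-! ### The spectral action -/

/-- The multiplicity of `lam` as an eigenvalue of `D²`. -/
def mult {V : Type*} [AddCommGroup V] [Module ℂ V] (D : Module.End ℂ V) (lam : ℝ) : ℕ :=
  Module.finrank ℂ (Module.End.eigenspace (D ^ 2) (lam : ℂ))

/-- The spectral action `Tr f(D²/Λ²)`: the sum of `f(λ/Λ²)` over the eigenvalues `λ` of `D²`,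
counted with multiplicity. (`D` is symmetric, so the eigenvalues of `D²` are real.) -/
def spectralAction {V : Type*} [AddCommGroup V] [Module ℂ V] (D : Module.End ℂ V)
    (f : ℝ → ℝ) (Λ : ℝ) : ℝ :=
  ∑' lam : ℝ, (mult D lam : ℝ) * f (lam / Λ ^ 2)

/-- `f(D²/Λ²)` is of trace class: its eigenvalues, counted with multiplicity, are summable. -/
def IsTraceClassAction {V : Type*} [AddCommGroup V] [Module ℂ V] (D : Module.End ℂ V)
    (f : ℝ → ℝ) (Λ : ℝ) : Prop :=
  (∀ lam : ℝ, f (lam / Λ ^ 2) ≠ 0 →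
    FiniteDimensional ℂ (Module.End.eigenspace (D ^ 2) (lam : ℂ))) ∧
  Summable fun lam : ℝ => (mult D lam : ℝ) * f (lam / Λ ^ 2)

/-- The cut-off function `f(z) = e^{-z}`. -/
def fExp (z : ℝ) : ℝ := Real.exp (-z)

/-! ### Momenta, Fourier modes and the field strength -/

/-- The bilinear form `p · q = g^{μν} p_μ q_ν` on momenta. -/
def dot {d : ℕ} (g : Matrix (Fin d) (Fin d) ℝ) (p q : Fin d → ℤ) : ℝ :=
  ∑ μ, ∑ ν, g⁻¹ μ ν * (p μ : ℝ) * (q ν : ℝ)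

/-- `p² = g^{μν} p_μ p_ν`. -/
def sq {d : ℕ} (g : Matrix (Fin d) (Fin d) ℝ) (p : Fin d → ℤ) : ℝ := dot g p p

/-- `p^μ = g^{μν} p_ν`. -/
def up {d : ℕ} (g : Matrix (Fin d) (Fin d) ℝ) (p : Fin d → ℤ) (μ : Fin d) : ℝ :=
  ∑ ν, g⁻¹ μ ν * (p ν : ℝ)

/-- `φ̂(k) = (2π)^{-d/2} ∫_{[0,2π]^d} φ(x) e^{-ikx} dx`, so that
`φ(x) = (2π)^{-d/2} ∑_k φ̂(k) e^{ikx}`. -/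
def fourier {d : ℕ} (φ : (Fin d → ℝ) → ℂ) (k : Fin d → ℤ) : ℂ :=
  (((2 * Real.pi) ^ (-(d : ℝ) / 2) : ℝ) : ℂ) *
    ∫ x in Set.Icc (0 : Fin d → ℝ) (fun _ => 2 * Real.pi),
      φ x * Complex.exp (-Complex.I * ((∑ μ, (k μ : ℝ) * x μ : ℝ) : ℂ))

/-- Matrix-valued 2-tensors, such as the Fourier modes `F̂_{μν}(p)`. -/
abbrev Tensor2 (d N : ℕ) : Type := Fin d → Fin d → Matrix (Fin N) (Fin N) ℂ

/-- The Fourier mode `Â_μ(k)`. -/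
def modeA {d N : ℕ} (𝒜 : GaugeField d N) (k : Fin d → ℤ) (μ : Fin d) :
    Matrix (Fin N) (Fin N) ℂ :=
  fun a b => fourier (fun x => 𝒜.A μ x a b) k

/-- The Fourier mode `F̂_{μν}(k)` of `F_{μν} = ∂_μ A_ν - ∂_ν A_μ`, the field strength
up to terms of second order in `A`. -/
def modeF {d N : ℕ} (𝒜 : GaugeField d N) (k : Fin d → ℤ) : Tensor2 d N :=
  fun μ ν a b => fourier (fun x =>
    partialD μ (fun y => 𝒜.A ν y a b) x - partialD ν (fun y => 𝒜.A μ y a b) x) k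

/-- `F` is a possible mode of momentum `p` of a field strength: `F_{μν} = i (p_μ a_ν - p_ν a_μ)`. -/
def IsModeAt {d N : ℕ} (p : Fin d → ℤ) (F : Tensor2 d N) : Prop :=
  ∃ a : Fin d → Matrix (Fin N) (Fin N) ℂ, ∀ μ ν,
    F μ ν = Complex.I • ((p μ : ℂ) • a ν - (p ν : ℂ) • a μ)

/-- The mode at `-p` that belongs to the mode `F` at `p`, as `F(x)` is anti-hermitian. -/
def conjMode {d N : ℕ} (F : Tensor2 d N) : Tensor2 d N := fun μ ν => -(F μ ν)ᴴ

/-- The Hilbert--Schmidt norm of a tensor. -/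
def tnorm {d N : ℕ} (F : Tensor2 d N) : ℝ :=
  Real.sqrt (∑ μ, ∑ ν, ∑ a, ∑ b, ‖F μ ν a b‖ ^ 2)

/-- `tr (F'_{μν} F^{μν})`. -/
def pairing {d N : ℕ} (g : Matrix (Fin d) (Fin d) ℝ) (F' F : Tensor2 d N) : ℂ :=
  ∑ μ, ∑ ν, ∑ ρ, ∑ σ, ((g⁻¹ μ ρ * g⁻¹ ν σ : ℝ) : ℂ) * (F' μ ν * F ρ σ).trace

/-- The matrix `p_ρ F^{ρμ} q_μ`. -/
def contract {d N : ℕ} (g : Matrix (Fin d) (Fin d) ℝ) (p q : Fin d → ℤ) (F : Tensor2 d N) :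
    Matrix (Fin N) (Fin N) ℂ :=
  ∑ ρ, ∑ μ, ((up g p ρ * up g q μ : ℝ) : ℂ) • F ρ μ

/-- A real form factor `W^{μνρσ}` evaluated on two modes: `tr (F'_{μν} W^{μνρσ} F_{ρσ})`. -/
def evalForm {d N : ℕ} (W : Fin d → Fin d → Fin d → Fin d → ℝ) (F' F : Tensor2 d N) : ℂ :=
  ∑ μ, ∑ ν, ∑ ρ, ∑ σ, (W μ ν ρ σ : ℂ) * (F' μ ν * F ρ σ).trace

/-! ### The explicit asymptotic expressions -/

/-- The contribution of the momentum `p` to the leading large-momentum spectral action,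
`-(2^m Λ⁻² / (2π)^d) ∑_q e^{-q²/Λ²} tr (4 p⁻⁶ p_ρ F'^{ρμ} p_σ F^{σν} q_μ q_ν
  + 2 p⁻⁶ p_ρ F'^{μν} p_σ F_{μν} q^ρ q^σ)`, with `F' = F̂(-p)` and `F = F̂(p)`. -/
def largeMomentum {d N : ℕ} (g : Matrix (Fin d) (Fin d) ℝ) (Λ : ℝ) (p : Fin d → ℤ)
    (F' F : Tensor2 d N) : ℂ :=
  -((2 ^ (d / 2) * (Λ ^ 2)⁻¹ / (2 * Real.pi) ^ d : ℝ) : ℂ) *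
    ∑' q : Fin d → ℤ, ((Real.exp (-(sq g q) / Λ ^ 2) : ℝ) : ℂ) *
      (((4 / sq g p ^ 3 : ℝ) : ℂ) * (contract g p q F' * contract g p q F).trace
        + ((2 / sq g p ^ 3 * dot g p q ^ 2 : ℝ) : ℂ) * pairing g F' F)

/-- `-2^{m+1} √g Λ^d / (4π)^{d/2}`, the coefficient of `1/p⁴` in `w_Λ(p²)`. -/
def wCoeff {d : ℕ} (g : Matrix (Fin d) (Fin d) ℝ) (Λ : ℝ) : ℝ :=
  -(2 ^ (d / 2 + 1) * Real.sqrt g.det * Λ ^ d / (4 * Real.pi) ^ ((d : ℝ) / 2))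

/-- `h(z) = ∫_0^1 e^{-α(1-α)z} dα`. -/
def hFun (z : ℝ) : ℝ := ∫ α in (0 : ℝ)..1, Real.exp (-(α * (1 - α) * z))

/-- `q(z) = -(h(z) - 1) / (2z)`. -/
def qFun (z : ℝ) : ℝ := -(1 / 2) * ((hFun z - 1) / z)

/-- The form factor, as a function of `z = p²`, of the large-`Λ` approximation
`(Λ²/4π)^{d/2} √g Λ⁻⁴ ∫ tr (½ E h(-∂²/Λ²) E + F_{μν} q(-∂²/Λ²) F^{μν})` with
`E = ¼ [γ^μ, γ^ν] F_{μν}`, for which `tr E² = -½ 2^m F_{μν} F^{μν}`. -/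
def largeCutoff {d : ℕ} (g : Matrix (Fin d) (Fin d) ℝ) (Λ z : ℝ) : ℝ :=
  2 ^ (d / 2) * Real.sqrt g.det * Λ ^ d / (4 * Real.pi) ^ ((d : ℝ) / 2) * (Λ ^ 4)⁻¹ *
    (qFun (z / Λ ^ 2) - 1 / 4 * hFun (z / Λ ^ 2))

/-- The contribution of the constant mode `Â(0)`, which is not seen by `F`, to the quadratic part
of the spectral action. -/
def zeroModeTerm {d N : ℕ} (g : Matrix (Fin d) (Fin d) ℝ) (Λ : ℝ) (𝒜 : GaugeField d N) : ℂ :=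
  ((2 ^ (d / 2) * (Λ ^ 4)⁻¹ / (2 * (2 * Real.pi) ^ d) : ℝ) : ℂ) *
    ∑ μ, ∑ ν, ((∑' q : Fin d → ℤ, Real.exp (-(sq g q) / Λ ^ 2) *
        (2 * Λ ^ 2 * g⁻¹ μ ν - 4 * up g q μ * up g q ν) : ℝ) : ℂ) *
      (modeA 𝒜 0 μ * modeA 𝒜 0 ν).trace

end TorusAction

end

/-!
In Fourier space the Dirac operator of the potential `εA` is a perturbed multiplication operator:
once the symbol `-q_μ γ^μ` has been diagonalised at every momentum `q`, the operator becomes `diag μ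
+ ε B` on `ℓ²(I)`, where `I` consists of the pairs of a momentum and a fibre index, `μ²` is `q²`,
and `B` has a hermitian kernel that decays rapidly away from the diagonal. For such operators the
compact resolvents provide an orthonormal eigenbasis (`DiagonalPerturbation.exists_eigenbasis`),
whose elements are Fourier transforms of smooth spinors (`DiracModel.exists_wt_pow_mul_eig_le`), so
that the heat trace is a sum over the eigenvalues (`IsModel.spectralAction_eq`).

The heat trace is expanded without perturbation theory of the individual eigenvalues. If `k` and `n`
label the unperturbed and the perturbed eigenbasis and `f` is the Gaussian, the heat trace changes
by the sum of `|⟨k, n⟩|² (f(λ_n) - f(μ_k))` over all pairs. Expanding at `μ_k`, the linear part is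
the term of first order; since `(λ_n - μ_k) ⟨k, n⟩ = ε ⟨k, B n⟩`, the rest is exactly `ε²` times the
sum of `|⟨k, B n⟩|²` and a second divided difference of `f` (`hasSum_second_order`). This remainder
is continuous at `ε = 0` (`IsKernel.tendsto_remainder`): at fixed `k` by Lipschitz continuity, and
uniformly in `k` because the second divided difference decays and the trace of the perturbed
Gaussian is bounded, by Jensen's inequality. The term of first order is odd in the momentum and
vanishes. Traces of gamma matrices turn the term of second order into the vacuum polarisation
(`DiracModel.hasSum_quadTerm`). Its longitudinal part is elementary
(`LatticeGaussian.hasSum_loopTerm`) and drops out for a form that is read off from the divergence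
`p^μ F_{μν}` of a mode; this defines `FormFactor.formFactor`, in terms of the sums
`LatticeGaussian.actionForm` over the lattice.

The estimates concern these sums, with `t = Λ⁻²`. At large momenta the divided difference
`(e^{-t(q+p)²} - e^{-tq²}) / ((q+p)² - q²)` is expanded near `q = 0` and near `q = -p` by a
geometric series (`exists_heatDiff_expansion`); the odd terms cancel, and the leading ones form the
large-momentum action (`exists_actionForm_sub_momentumForm`), which is a definite form on the
divergences (`exists_le_neg_momentumForm`). For `Λ → ∞`, Poisson summation replaces the sums by
Gaussian integrals up to `e^{-cΛ²}` (`exists_poisson`, by induction on the dimension after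
completing the square); writing the divided difference as an integral over a Feynman parameter `α`
produces Gaussians shifted by `αp` and thereby the function `h` (`tsum_heatDiff_eq`). The
asymptotics of `h` follow from Laplace's method (`tendsto_largeCutoff`). For `Λ → 0` only the terms
at `q = 0` and `q = -p` survive, and they cancel (`exists_actionForm_small`).
-/

noncomputable section

namespace DiagonalPerturbation

open Filter Topology Module.End

attribute [local instance] InnerProductSpace.toInner

/-! ### Square-summable sequences and multiplication operators -/

/-- The Hilbert space `ℓ²(I)`. -/
abbrev Seq (I : Type) : Type := lp (fun _ : I => ℂ) 2

variable {I : Type}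

theorem summable_norm_sq (v : Seq I) : Summable fun i => ‖v i‖ ^ 2 := by
  have h := (lp.memℓp v).summable (by norm_num)
  simpa using h

theorem hasSum_norm_sq (v : Seq I) : HasSum (fun i => ‖v i‖ ^ 2) (‖v‖ ^ 2) := by
  have h := lp.hasSum_norm (p := 2) (by norm_num) v
  simpa using h

/-- The scalar product of `ℓ²(I)` in coordinates. -/
theorem hasSum_conj_mul (v w : Seq I) :
    HasSum (fun i => (starRingEnd ℂ) (v i) * w i) (inner ℂ v w) := by
  have h : HasSum (fun i => inner ℂ (v i) (w i)) (inner ℂ v w) := lp.hasSum_inner v w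
  have e : (fun i => inner ℂ (v i) (w i)) = fun i => (starRingEnd ℂ) (v i) * w i := by
    funext i
    rw [RCLike.inner_apply, mul_comm]
  rwa [e] at h

theorem memlp_two {f : I → ℂ} (h : Summable fun i => ‖f i‖ ^ 2) : Memℓp f 2 := by
  apply memℓp_gen
  simpa using h

theorem norm_le_of_pointwise {v w : Seq I} {C : ℝ} (hC : 0 ≤ C) (h : ∀ i, ‖w i‖ ≤ C * ‖v i‖) :
    ‖w‖ ≤ C * ‖v‖ := by
  have h1 : ∀ i, ‖w i‖ ^ 2 ≤ C ^ 2 * ‖v i‖ ^ 2 := fun i => by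
    rw [← mul_pow]
    exact pow_le_pow_left₀ (norm_nonneg _) (h i) 2
  have h2 := hasSum_le h1 (hasSum_norm_sq w) ((hasSum_norm_sq v).mul_left (C ^ 2))
  rw [← mul_pow] at h2
  exact le_of_sq_le_sq h2 (by positivity)

/-- The linear map underlying `diagOp`. -/
def diagLin (a : I → ℂ) (C : ℝ) (hC : ∀ i, ‖a i‖ ≤ C) : Seq I →ₗ[ℂ] Seq I where
  toFun v := ⟨fun i => a i * v i, memlp_two (by
    refine Summable.of_nonneg_of_le (fun i => by positivity) (fun i => ?_)
      ((summable_norm_sq v).mul_left (C ^ 2))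
    rw [norm_mul, mul_pow]
    have := hC i
    gcongr)⟩
  map_add' v w := by
    ext i
    exact mul_add _ _ _
  map_smul' c v := by
    ext i
    exact mul_left_comm _ _ _

theorem norm_diagLin_le (a : I → ℂ) (C : ℝ) (hC : ∀ i, ‖a i‖ ≤ C) (v : Seq I) :
    ‖diagLin a C hC v‖ ≤ max C 0 * ‖v‖ := by
  refine norm_le_of_pointwise (le_max_right _ _) fun i => ?_
  show ‖a i * v i‖ ≤ _
  rw [norm_mul]
  have := (hC i).trans (le_max_left C 0)
  gcongr

/-- The multiplication operator by a bounded sequence. -/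
def diagOp (a : I → ℂ) (C : ℝ) (hC : ∀ i, ‖a i‖ ≤ C) : Seq I →L[ℂ] Seq I :=
  (diagLin a C hC).mkContinuous (max C 0) (norm_diagLin_le a C hC)

@[simp] theorem diagOp_apply (a : I → ℂ) (C : ℝ) (hC : ∀ i, ‖a i‖ ≤ C) (v : Seq I) (i : I) :
    diagOp a C hC v i = a i * v i := rfl

theorem norm_diagOp_le (a : I → ℂ) (C : ℝ) (hC : ∀ i, ‖a i‖ ≤ C) (h0 : 0 ≤ C) :
    ‖diagOp a C hC‖ ≤ C := by
  have h := LinearMap.mkContinuous_norm_le (diagLin a C hC) (le_max_right C 0)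
    (norm_diagLin_le a C hC)
  exact h.trans_eq (max_eq_left h0)

/-- The evaluation functional `v ↦ v i`. -/
def evalAt (i : I) : Seq I →L[ℂ] ℂ :=
  LinearMap.mkContinuous { toFun := fun v : Seq I => v i
                           map_add' := fun _ _ => rfl
                           map_smul' := fun _ _ => rfl } 1 fun v => by
    rw [one_mul]
    exact lp.norm_apply_le_norm (by norm_num) v i

@[simp] theorem evalAt_apply (i : I) (v : Seq I) : evalAt i v = v i := rfl

/-- A multiplication operator whose symbol tends to zero is compact: it is the norm limit of its
finite sections. -/
theorem isCompactOperator_diagOp (a : I → ℂ) (C : ℝ) (hC : ∀ i, ‖a i‖ ≤ C)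
    (ha : Tendsto a cofinite (𝓝 0)) : IsCompactOperator (diagOp a C hC) := by
  classical
  have hCF : ∀ F : Finset I, ∀ i, ‖(if i ∈ F then a i else 0)‖ ≤ max C 0 := fun F i => by
    split_ifs
    · exact (hC i).trans (le_max_left _ _)
    · simp
  let A : Finset I → (Seq I →L[ℂ] Seq I) := fun F =>
    diagOp (fun i => if i ∈ F then a i else 0) (max C 0) (hCF F)
  refine isCompactOperator_of_tendsto (l := (atTop : Filter (Finset I))) (F := A) ?_ ?_
  · rw [tendsto_iff_norm_sub_tendsto_zero, Metric.tendsto_atTop]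
    intro η hη
    have h1 : ∀ᶠ i in cofinite, ‖a i‖ < η / 2 := by
      have := ha.norm
      simp only [norm_zero] at this
      exact this.eventually (gt_mem_nhds (by positivity))
    rw [eventually_cofinite] at h1
    refine ⟨h1.toFinset, fun F hF => ?_⟩
    have h2 : ∀ i, ‖(if i ∈ F then a i else 0) - a i‖ ≤ η / 2 := fun i => by
      split_ifs with hi
      · simp; positivity
      · have : i ∉ h1.toFinset := fun h => hi (hF h)
        simp at this
        simpa using this.le
    have h3 : A F - diagOp a C hC = diagOp _ (η / 2) h2 := by
      ext v i
      simp [A, sub_mul]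
    rw [h3, dist_zero_right, norm_norm]
    linarith [norm_diagOp_le _ (η / 2) h2 (by positivity)]
  · refine Eventually.of_forall fun F => ?_
    -- a finite section factors through a finite-dimensional space
    let P : Seq I →L[ℂ] (F → ℂ) := ContinuousLinearMap.pi fun i : F => evalAt (i : I)
    let Q : (F → ℂ) →ₗ[ℂ] Seq I := ∑ i : F,
      (lp.singleContinuousLinearMap ℂ (fun _ : I => ℂ) 2 (i : I)).toLinearMap ∘ₗ
        (a i • LinearMap.proj i)
    have hQ : A F = (LinearMap.toContinuousLinearMap Q).comp P := by
      ext v i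
      simp only [A, diagOp_apply, ContinuousLinearMap.comp_apply,
        LinearMap.coe_toContinuousLinearMap', Q, LinearMap.sum_apply, LinearMap.comp_apply]
      rw [lp.coeFn_sum, Finset.sum_apply]
      simp only [LinearMap.smul_apply, LinearMap.proj_apply, ContinuousLinearMap.coe_coe,
        lp.singleContinuousLinearMap_apply, lp.single_apply]
      by_cases hi : i ∈ F
      · rw [Finset.sum_eq_single (⟨i, hi⟩ : F)]
        · simp [hi, P]
        · intro j _ hj
          have : i ≠ (j : I) := fun h => hj (by ext; exact h.symm)
          simp [this]
        · simp
      · rw [Finset.sum_eq_zero]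
        · simp [hi]
        · intro j _
          have : i ≠ (j : I) := fun h => hi (h ▸ j.2)
          simp [this]
    rw [hQ]
    exact (isCompactOperator_of_locallyCompactSpace_rng
      (LinearMap.toContinuousLinearMap Q)).comp_clm P

end DiagonalPerturbation

namespace DiagonalPerturbation

open Filter Topology Module.End

attribute [local instance] InnerProductSpace.toInner

/-! ### Resolvents and eigenvectors of a perturbed diagonal operator -/

variable {I : Type}

/-- `v` is an eigenvector, of eigenvalue `lam`, of the perturbed diagonal operator
`diag μ + B` on `ℓ²(I)`; the equation implies that `v` is in the domain of `diag μ`. -/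
def IsEig (μ : I → ℝ) (B : Seq I →L[ℂ] Seq I) (lam : ℝ) (v : Seq I) : Prop :=
  ∀ i, (μ i : ℂ) * v i + B v i = lam * v i

theorem norm_add_mul_I_ge (x c : ℝ) : |c| ≤ ‖(x : ℂ) + c * Complex.I‖ := by
  have := Complex.abs_im_le_norm ((x : ℂ) + c * Complex.I)
  simpa using this

theorem norm_add_mul_I_ge' (x c : ℝ) : |x| ≤ ‖(x : ℂ) + c * Complex.I‖ := by
  have := Complex.abs_re_le_norm ((x : ℂ) + c * Complex.I)
  simpa using this

theorem add_mul_I_ne_zero (x : ℝ) {c : ℝ} (hc : c ≠ 0) : (x : ℂ) + c * Complex.I ≠ 0 := by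
  intro h
  have := norm_add_mul_I_ge x c
  rw [h, norm_zero] at this
  exact hc (abs_eq_zero.mp (le_antisymm this (abs_nonneg c)))

theorem norm_inv_add_mul_I_le (x c : ℝ) (hc : c ≠ 0) : ‖((x : ℂ) + c * Complex.I)⁻¹‖ ≤ |c|⁻¹ := by
  rw [norm_inv]
  exact inv_anti₀ (abs_pos.mpr hc) (norm_add_mul_I_ge x c)

/-- The free resolvent `(diag μ + i c)⁻¹`. -/
def freeRes (μ : I → ℝ) (c : ℝ) (hc : c ≠ 0) : Seq I →L[ℂ] Seq I :=
  diagOp (fun i => ((μ i : ℂ) + c * Complex.I)⁻¹) |c|⁻¹ fun i => norm_inv_add_mul_I_le (μ i) c hc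

/-- The resolvent `(diag μ + B + i c)⁻¹`, by the Neumann series; it is characterised by
`resolvent_iff`. -/
theorem exists_resolvent {μ : I → ℝ} (hμ : Tendsto (fun i => |μ i|) cofinite atTop)
    {B : Seq I →L[ℂ] Seq I} {c : ℝ} (hc : c ≠ 0) (hcB : ‖B‖ < |c|) :
    ∃ R : Seq I →L[ℂ] Seq I, IsCompactOperator R ∧
      ∀ v w, (∀ i, ((μ i : ℂ) + c * Complex.I) * w i + B w i = v i) ↔ w = R v := by
  set A := freeRes μ c hc
  have hA : ‖A‖ ≤ |c|⁻¹ := norm_diagOp_le _ _ _ (by positivity)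
  have hAc : IsCompactOperator A := by
    refine isCompactOperator_diagOp _ _ _ ?_
    refine tendsto_inv₀_cobounded.comp ?_
    rw [← tendsto_norm_atTop_iff_cobounded]
    exact tendsto_atTop_mono (fun i => norm_add_mul_I_ge' (μ i) c) hμ
  have hlt : ‖-(A * B)‖ < 1 := by
    rw [norm_neg]
    have hc0 := abs_pos.mpr hc
    calc ‖A * B‖ ≤ ‖A‖ * ‖B‖ := norm_mul_le _ _
      _ ≤ |c|⁻¹ * ‖B‖ := by gcongr
      _ < |c|⁻¹ * |c| := by gcongr
      _ = 1 := inv_mul_cancel₀ hc0.ne'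
  obtain ⟨u, hu⟩ := isUnit_one_sub_of_norm_lt_one hlt
  have hu' : ∀ w, (u : Seq I →L[ℂ] Seq I) w = w + A (B w) := fun w => by
    rw [hu]
    simp
  refine ⟨(↑u⁻¹ : Seq I →L[ℂ] Seq I) * A, hAc.clm_comp _, fun v w => ?_⟩
  have h1 : (∀ i, ((μ i : ℂ) + c * Complex.I) * w i + B w i = v i)
      ↔ (u : Seq I →L[ℂ] Seq I) w = A v := by
    rw [hu', lp.ext_iff, funext_iff]
    refine forall_congr' fun i => ?_
    have hne := add_mul_I_ne_zero (μ i) hc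
    show _ ↔ w i + ((μ i : ℂ) + c * Complex.I)⁻¹ * B w i = ((μ i : ℂ) + c * Complex.I)⁻¹ * v i
    constructor
    · intro h
      rw [← h]
      field_simp
    · intro h
      have h2 := congrArg (fun z => ((μ i : ℂ) + c * Complex.I) * z) h
      simp only [mul_add, mul_inv_cancel_left₀ hne] at h2
      rw [← h2]
  rw [h1]
  constructor
  · intro h
    show w = (↑u⁻¹ : Seq I →L[ℂ] Seq I) (A v)
    rw [← h, ← mul_apply_eq_comp, Units.inv_mul, one_apply_eq_self]
  · intro h
    rw [h]
    show (u : Seq I →L[ℂ] Seq I) ((↑u⁻¹ : Seq I →L[ℂ] Seq I) (A v)) = A v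
    rw [← mul_apply_eq_comp, Units.mul_inv, one_apply_eq_self]

/-- The symmetry of `diag μ + B`. -/
theorem inner_eq_of_relations {μ : I → ℝ} {B : Seq I →L[ℂ] Seq I}
    (hB : ∀ x y, inner ℂ (B x) y = inner ℂ x (B y)) {v w v' w' : Seq I}
    (h : ∀ i, (μ i : ℂ) * w i + B w i = v i) (h' : ∀ i, (μ i : ℂ) * w' i + B w' i = v' i) :
    inner ℂ v w' = inner ℂ w v' := by
  have h1 := (hasSum_conj_mul v w').sub (hasSum_conj_mul (B w) w')
  have h2 := (hasSum_conj_mul w v').sub (hasSum_conj_mul w (B w'))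
  have h4 : ∀ i, (starRingEnd ℂ) (v i) * w' i - (starRingEnd ℂ) (B w i) * w' i
      = (starRingEnd ℂ) (w i) * v' i - (starRingEnd ℂ) (w i) * B w' i := fun i => by
    rw [← h i, ← h' i]
    simp only [map_add, map_mul, Complex.conj_ofReal]
    ring
  rw [funext h4, hB] at h1
  have h5 := h1.unique h2
  linear_combination h5

/-- The eigenspaces of `diag μ + B`. -/
def eigSub (μ : I → ℝ) (B : Seq I →L[ℂ] Seq I) (lam : ℝ) : Submodule ℂ (Seq I) where
  carrier := {v | IsEig μ B lam v}
  add_mem' {v w} hv hw i := by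
    have h1 := hv i
    have h2 := hw i
    rw [map_add]
    show (μ i : ℂ) * (v i + w i) + (B v i + B w i) = lam * (v i + w i)
    linear_combination h1 + h2
  zero_mem' i := by
    rw [map_zero]
    simp
  smul_mem' c v hv i := by
    have h1 := hv i
    rw [map_smul]
    show (μ i : ℂ) * (c * v i) + (c * B v i) = lam * (c * v i)
    linear_combination c * h1

theorem eigSub_orthogonal {μ : I → ℝ} {B : Seq I →L[ℂ] Seq I}
    (hB : ∀ x y, inner ℂ (B x) y = inner ℂ x (B y)) {a b : ℝ} (hab : a ≠ b) {v w : Seq I}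
    (hv : IsEig μ B a v) (hw : IsEig μ B b w) : inner ℂ v w = 0 := by
  have h := inner_eq_of_relations hB (v := (a : ℂ) • v) (v' := (b : ℂ) • w) hv hw
  rw [inner_smul_left, inner_smul_right, Complex.conj_ofReal] at h
  have h2 : ((a : ℂ) - b) * inner ℂ v w = 0 := by linear_combination h
  rcases mul_eq_zero.mp h2 with h3 | h3
  · exact absurd (by exact_mod_cast sub_eq_zero.mp h3) hab
  · exact h3

section resolvents

variable {μ : I → ℝ} {B : Seq I →L[ℂ] Seq I} {c : ℝ} {R R' : Seq I →L[ℂ] Seq I}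

/-- The resolvent identity in the form `(R v - R' v)/(-2ic) = R (R' v)`. -/
theorem resolvent_comp
    (hR : ∀ v w, (∀ i, ((μ i : ℂ) + c * Complex.I) * w i + B w i = v i) ↔ w = R v)
    (hR' : ∀ v w, (∀ i, ((μ i : ℂ) + (-c : ℝ) * Complex.I) * w i + B w i = v i) ↔ w = R' v)
    (hc : c ≠ 0) (v : Seq I) :
    (2 * c * Complex.I)⁻¹ • (R' v - R v) = R (R' v) := by
  have h2 : (2 * c * Complex.I : ℂ) ≠ 0 := by simp [hc]
  rw [← hR]
  intro i
  have e1 := (hR v _).mpr rfl i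
  have e2 := (hR' v _).mpr rfl i
  rw [map_smul, map_sub]
  show ((μ i : ℂ) + c * Complex.I) * ((2 * c * Complex.I)⁻¹ * (R' v i - R v i))
    + (2 * c * Complex.I)⁻¹ * (B (R' v) i - B (R v) i) = R' v i
  push_cast at e2
  have e3 : ((μ i : ℂ) + c * Complex.I) * (R' v i - R v i) + (B (R' v) i - B (R v) i)
      = (2 * c * Complex.I) * R' v i := by linear_combination e2 - e1
  rw [mul_left_comm, ← mul_add, e3, inv_mul_cancel_left₀ h2]

end resolvents

end DiagonalPerturbation

namespace DiagonalPerturbation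

open Filter Topology Module.End

attribute [local instance] InnerProductSpace.toInner

/-! ### An orthonormal basis of eigenvectors -/

variable {I : Type}

theorem resolvent_adjoint {μ : I → ℝ} {B : Seq I →L[ℂ] Seq I} {c : ℝ} {R R' : Seq I →L[ℂ] Seq I}
    (hB : ∀ x y, inner ℂ (B x) y = inner ℂ x (B y))
    (hR : ∀ v w, (∀ i, ((μ i : ℂ) + c * Complex.I) * w i + B w i = v i) ↔ w = R v)
    (hR' : ∀ v w, (∀ i, ((μ i : ℂ) + (-c : ℝ) * Complex.I) * w i + B w i = v i) ↔ w = R' v)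
    (v w : Seq I) : inner ℂ (R v) w = inner ℂ v (R' w) := by
  have h := inner_eq_of_relations (μ := μ) hB (v := v - (c * Complex.I : ℂ) • R v) (w := R v)
    (v' := w + (c * Complex.I : ℂ) • R' w) (w' := R' w)
    (fun i => by
      have := (hR v _).mpr rfl i
      show _ = v i - (c * Complex.I : ℂ) * R v i
      linear_combination this)
    (fun i => by
      have := (hR' w _).mpr rfl i
      show _ = w i + (c * Complex.I : ℂ) * R' w i
      push_cast at this
      linear_combination this)
  rw [inner_sub_left, inner_add_right, inner_smul_left, inner_smul_right] at h
  simp only [map_mul, Complex.conj_ofReal, Complex.conj_I] at h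
  linear_combination -h

/-- A complex eigenvalue of `diag μ + B` is real. -/
theorem exists_isEig_of_complex {μ : I → ℝ} {B : Seq I →L[ℂ] Seq I}
    (hB : ∀ x y, inner ℂ (B x) y = inner ℂ x (B y)) {z : ℂ} {e : Seq I}
    (h : ∀ i, (μ i : ℂ) * e i + B e i = z * e i) : ∃ lam : ℝ, IsEig μ B lam e := by
  by_cases he : e = 0
  · exact ⟨0, by rw [he]; exact (eigSub μ B 0).zero_mem⟩
  have h1 := inner_eq_of_relations hB (v := z • e) (v' := z • e) h h
  rw [inner_smul_left, inner_smul_right] at h1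
  have h2 := mul_right_cancel₀ (inner_self_ne_zero.mpr he) h1
  obtain ⟨r, hr⟩ := Complex.conj_eq_iff_real.mp h2
  exact ⟨r, fun i => by rw [h i, hr]⟩

/-- The eigenvectors of `diag μ + B` span a dense subspace. Its resolvents `R` and `R'` at `± i c`
are adjoint to each other and commute, so that `R R'` is compact, self-adjoint and injective; the
self-adjoint operator `R + R'` acts on each of its (finite-dimensional) eigenspaces, and common
eigenvectors of the two are eigenvectors of `diag μ + B`. -/
theorem eq_zero_of_orthogonal_eigSub {μ : I → ℝ} (hμ : Tendsto (fun i => |μ i|) cofinite atTop)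
    {B : Seq I →L[ℂ] Seq I} (hB : ∀ x y, inner ℂ (B x) y = inner ℂ x (B y)) {x : Seq I}
    (hx : ∀ lam, ∀ v ∈ eigSub μ B lam, inner ℂ x v = 0) : x = 0 := by
  set c : ℝ := ‖B‖ + 1 with hcdef
  have hc0 : 0 < c := by positivity
  have hc : c ≠ 0 := hc0.ne'
  obtain ⟨R, hRc, hR⟩ := exists_resolvent hμ (B := B) hc (by rw [abs_of_pos hc0]; linarith)
  obtain ⟨R', hRc', hR'⟩ := exists_resolvent hμ (B := B) (neg_ne_zero.mpr hc)
    (by rw [abs_neg, abs_of_pos hc0]; linarith)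
  -- `R` and `R'` are adjoint to each other and commute
  have hadj := resolvent_adjoint hB hR hR'
  have hadj' : ∀ v w, inner ℂ (R' v) w = inner ℂ v (R w) := fun v w => by
    rw [← inner_conj_symm, ← hadj, inner_conj_symm]
  have hcomm : ∀ v, R (R' v) = R' (R v) := fun v => by
    rw [← resolvent_comp hR hR' hc, ← resolvent_comp (R := R') (R' := R) hR' (c := -c)
      (by rw [neg_neg]; exact hR) (neg_ne_zero.mpr hc)]
    rw [← neg_sub (R' v) (R v), smul_neg, ← neg_smul]
    congr 1
    push_cast
    rw [mul_neg, neg_mul, inv_neg, neg_neg]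
  set K : Seq I →L[ℂ] Seq I := R.comp R'
  have hK : ∀ v, K v = R (R' v) := fun _ => rfl
  have hKc : IsCompactOperator K := hRc.comp_clm R'
  have hKs : K.IsSymmetric := fun v w => by
    show inner ℂ (R (R' v)) w = inner ℂ v (R (R' w))
    rw [hadj, ← hadj']
  have hbot := ContinuousLinearMap.orthogonalComplement_iSup_eigenspaces_eq_bot hKc hKs
  have key : x ∈ (⨆ κ, eigenspace (K : Module.End ℂ (Seq I)) κ)ᗮ := by
    rw [Submodule.mem_orthogonal']
    intro u hu
    induction hu using Submodule.iSup_induction' with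
    | zero => exact inner_zero_right _
    | add a b _ _ ha hb => rw [inner_add_right, ha, hb, add_zero]
    | mem κ u hu =>
      have hinj : ∀ v, K v = 0 → v = 0 := fun v hv => by
        have h1 : R' v = 0 := by
          ext i
          have := (hR (R' v) (R (R' v))).mpr rfl i
          rw [← hK, hv, map_zero] at this
          simpa using this.symm
        ext i
        have := (hR' v (R' v)).mpr rfl i
        rw [h1, map_zero] at this
        simpa using this.symm
      -- `κ = 0` is excluded by injectivity; the other eigenspaces of `K` are finite-dimensional
      by_cases hκ : κ = 0
      · have : u = 0 := hinj u (by simpa [hκ] using mem_eigenspace_iff.mp hu)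
        rw [this, inner_zero_right]
      set E := eigenspace (K : Module.End ℂ (Seq I)) κ
      have : FiniteDimensional ℂ E := ContinuousLinearMap.finite_dimensional_eigenspace hKc κ hκ
      have hmem : ∀ v, v ∈ E ↔ R (R' v) = κ • v := fun v => mem_eigenspace_iff
      let S : Seq I →ₗ[ℂ] Seq I := (R : Seq I →ₗ[ℂ] Seq I) + (R' : Seq I →ₗ[ℂ] Seq I)
      have hSE : ∀ v ∈ E, S v ∈ E := fun v hv => by
        rw [hmem] at hv ⊢
        show R (R' (R v + R' v)) = κ • (R v + R' v)
        rw [map_add, map_add, ← hcomm, hv, hcomm (R' v), hv, map_smul, map_smul, smul_add]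
      have hSs : (S.restrict hSE).IsSymmetric := fun v w => by
        show inner ℂ (R v + R' v : Seq I) (w : Seq I) = inner ℂ (v : Seq I) (R w + R' w : Seq I)
        rw [inner_add_left, inner_add_right, hadj, hadj', add_comm]
      have hEbot := hSs.orthogonalComplement_iSup_eigenspaces_eq_bot
      rw [Submodule.orthogonal_eq_bot_iff] at hEbot
      have hall : ∀ e : E, inner ℂ x (e : Seq I) = 0 := fun e => by
        have he : e ∈ ⨆ σ, eigenspace (S.restrict hSE) σ := by rw [hEbot]; trivial
        induction he using Submodule.iSup_induction' with
        | zero => exact inner_zero_right _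
        | add a b _ _ ha hb =>
          show inner ℂ x ((a : Seq I) + b) = 0
          rw [inner_add_right, ha, hb, add_zero]
        | mem σ e he =>
          have h1 : R e + R' e = σ • (e : Seq I) := congrArg Subtype.val (mem_eigenspace_iff.mp he)
          have h2 : R (R' e) = κ • (e : Seq I) := (hmem _).mp e.2
          have h3 : R' (R e) = κ • (e : Seq I) := by rw [← hcomm, h2]
          -- if `R R' e = κ e` and `(R + R') e = σ e`, then `e` has eigenvalue `σ / (2κ)`
          obtain ⟨lam, hlam⟩ := exists_isEig_of_complex (μ := μ) hB (e := (e : Seq I))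
            (z := σ / (2 * κ)) fun i => by
              have e1 := (hR (R' e) _).mpr rfl i
              have e2 := (hR' (R e) _).mpr rfl i
              rw [h2, map_smul] at e1
              rw [h3, map_smul] at e2
              have e3 : (R e : Seq I) i + (R' e : Seq I) i = σ * (e : Seq I) i := by
                have := congrArg (fun v : Seq I => v i) h1
                exact this
              change ((μ i : ℂ) + c * Complex.I) * (κ * (e : Seq I) i) + κ * B e i = R' e i at e1
              change ((μ i : ℂ) + (-c : ℝ) * Complex.I) * (κ * (e : Seq I) i) + κ * B e i = R e i
                at e2
              push_cast at e2
              rw [div_mul_eq_mul_div, eq_div_iff (by simpa using hκ)]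
              linear_combination e1 + e2 + e3
          exact hx lam _ hlam
      exact hall ⟨u, hu⟩
  rw [hbot] at key
  exact (Submodule.mem_bot ℂ).mp key

theorem finiteDimensional_eigSub {μ : I → ℝ} (hμ : Tendsto (fun i => |μ i|) cofinite atTop)
    (B : Seq I →L[ℂ] Seq I) (lam : ℝ) : FiniteDimensional ℂ (eigSub μ B lam) := by
  have hc0 : 0 < ‖B‖ + 1 := by positivity
  obtain ⟨R, hRc, hR⟩ := exists_resolvent hμ (B := B) hc0.ne' (by rw [abs_of_pos hc0]; linarith)
  have hz := add_mul_I_ne_zero lam hc0.ne'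
  have := ContinuousLinearMap.finite_dimensional_eigenspace hRc _ (inv_ne_zero hz)
  refine Submodule.finiteDimensional_of_le
    (S₂ := eigenspace (R : Seq I →ₗ[ℂ] Seq I) ((lam : ℂ) + (‖B‖ + 1 : ℝ) * Complex.I)⁻¹) ?_
  intro v hv
  rw [mem_eigenspace_iff]
  symm
  show _ = R v
  rw [← hR]
  intro i
  have := hv i
  rw [map_smul]
  show _ * (_ * v i) + _ * B v i = v i
  rw [mul_left_comm, ← mul_add, inv_mul_eq_iff_eq_mul₀ hz]
  linear_combination this

/-- A diagonal operator with discrete spectrum, perturbed by a bounded symmetric operator, has an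
orthonormal basis of eigenvectors. -/
theorem exists_eigenbasis {μ : I → ℝ} (hμ : Tendsto (fun i => |μ i|) cofinite atTop)
    {B : Seq I →L[ℂ] Seq I} (hB : ∀ x y, inner ℂ (B x) y = inner ℂ x (B y)) :
    ∃ (J : Type) (ψ : HilbertBasis J ℂ (Seq I)) (lam : J → ℝ), ∀ n, IsEig μ B (lam n) (ψ n) := by
  have := fun lam => finiteDimensional_eigSub hμ B lam
  let b := fun lam => stdOrthonormalBasis ℂ (eigSub μ B lam)
  let J := Σ lam : ℝ, Fin (Module.finrank ℂ (eigSub μ B lam))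
  let v : J → Seq I := fun n => (b n.1 n.2 : Seq I)
  have hv : ∀ n : J, v n ∈ eigSub μ B n.1 := fun n => (b n.1 n.2).2
  have hon : Orthonormal ℂ v := by
    constructor
    · intro n
      exact (b n.1).orthonormal.1 n.2
    · rintro ⟨l, i⟩ ⟨l', i'⟩ hne
      by_cases hl : l = l'
      · subst hl
        have hi : i ≠ i' := fun h => hne (by rw [h])
        exact (b l).orthonormal.2 hi
      · exact eigSub_orthogonal hB hl (hv ⟨l, i⟩) (hv ⟨l', i'⟩)
  have hbot : (Submodule.span ℂ (Set.range v))ᗮ = ⊥ := by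
    rw [Submodule.eq_bot_iff]
    intro x hx
    rw [Submodule.mem_orthogonal'] at hx
    refine eq_zero_of_orthogonal_eigSub hμ hB fun lam u hu => hx u ?_
    have h1 : (⟨u, hu⟩ : eigSub μ B lam) ∈ Submodule.span ℂ (Set.range (b lam)) := by
      rw [← OrthonormalBasis.coe_toBasis, Module.Basis.span_eq]
      trivial
    have h2 := Submodule.mem_map_of_mem (f := (eigSub μ B lam).subtype) h1
    rw [Submodule.map_span] at h2
    refine Submodule.span_mono ?_ h2
    rintro _ ⟨_, ⟨i, rfl⟩, rfl⟩
    exact ⟨⟨lam, i⟩, rfl⟩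
  refine ⟨J, HilbertBasis.mkOfOrthogonalEqBot hon hbot, fun n => n.1, fun n => ?_⟩
  rw [HilbertBasis.coe_mkOfOrthogonalEqBot]
  exact hv n

end DiagonalPerturbation

namespace DiagonalPerturbation

open Filter Topology Module.End

attribute [local instance] InnerProductSpace.toInner

/-! ### Operators with a hermitian kernel -/

variable {I : Type}

/-- A hermitian kernel with absolutely summable rows of sum at most `M`. -/
structure IsKernel (b : I → I → ℂ) (M : ℝ) : Prop where
  pos : 0 < M
  herm : ∀ i j, b j i = (starRingEnd ℂ) (b i j)
  summable : ∀ i, Summable fun j => ‖b i j‖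
  bound : ∀ i, ∑' j, ‖b i j‖ ≤ M

namespace IsKernel

variable {b : I → I → ℂ} {M : ℝ}

theorem summable_mul (hb : IsKernel b M) (v : Seq I) (i : I) :
    Summable fun j => ‖b i j‖ * ‖v j‖ := by
  refine Summable.of_nonneg_of_le (fun j => by positivity) (fun j => ?_)
    ((hb.summable i).mul_right ‖v‖)
  have := lp.norm_apply_le_norm (by norm_num) v j
  gcongr

theorem summable_mul_sq (hb : IsKernel b M) (v : Seq I) (i : I) :
    Summable fun j => ‖b i j‖ * ‖v j‖ ^ 2 := by
  refine Summable.of_nonneg_of_le (fun j => by positivity) (fun j => ?_)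
    ((hb.summable i).mul_right (‖v‖ ^ 2))
  have := lp.norm_apply_le_norm (by norm_num) v j
  gcongr

/-- The Cauchy–Schwarz inequality for a row of the kernel, from a nonnegative variance. -/
theorem sq_tsum_le (hb : IsKernel b M) (v : Seq I) (i : I) :
    (∑' j, ‖b i j‖ * ‖v j‖) ^ 2 ≤ M * ∑' j, ‖b i j‖ * ‖v j‖ ^ 2 := by
  set a := ∑' j, ‖b i j‖ * ‖v j‖ with ha
  set e := ∑' j, ‖b i j‖ * ‖v j‖ ^ 2 with he
  have hM := hb.pos
  have h1 : HasSum (fun j => ‖b i j‖ * (‖v j‖ - a / M) ^ 2)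
      (e - 2 * (a / M) * a + (a / M) ^ 2 * ∑' j, ‖b i j‖) := by
    have := ((hb.summable_mul_sq v i).hasSum.sub
      ((hb.summable_mul v i).hasSum.mul_left (2 * (a / M)))).add
      ((hb.summable i).hasSum.mul_left ((a / M) ^ 2))
    convert! this using 2 with j
    ring
  have h2 := h1.nonneg fun j => by positivity
  have h3 : (a / M) ^ 2 * ∑' j, ‖b i j‖ ≤ (a / M) ^ 2 * M := by
    have := hb.bound i
    gcongr
  have h4 : 0 ≤ e - a ^ 2 / M := by
    have : (a / M) ^ 2 * M = a ^ 2 / M := by field_simp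
    have h5 : 2 * (a / M) * a = 2 * (a ^ 2 / M) := by ring
    linarith
  have h5 : a ^ 2 / M ≤ e := by linarith
  rwa [div_le_iff₀' hM] at h5

/-- Schur's test: Cauchy–Schwarz in the rows, then the bound on the columns. -/
theorem sum_sq_le (hb : IsKernel b M) (v : Seq I) (s : Finset I) :
    ∑ i ∈ s, ‖∑' j, b i j * v j‖ ^ 2 ≤ (M * ‖v‖) ^ 2 := by
  have hM := hb.pos
  calc ∑ i ∈ s, ‖∑' j, b i j * v j‖ ^ 2
      ≤ ∑ i ∈ s, M * ∑' j, ‖b i j‖ * ‖v j‖ ^ 2 := by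
        refine Finset.sum_le_sum fun i _ => le_trans ?_ (hb.sq_tsum_le v i)
        have h1 : Summable fun j => ‖b i j * v j‖ := by simpa using hb.summable_mul v i
        have h2 := norm_tsum_le_tsum_norm h1
        simp only [norm_mul] at h2
        gcongr
    _ = M * ∑' j, (∑ i ∈ s, ‖b i j‖) * ‖v j‖ ^ 2 := by
        rw [← Finset.mul_sum, ← Summable.tsum_finsetSum fun i _ => hb.summable_mul_sq v i]
        simp_rw [Finset.sum_mul]
    _ ≤ M * ∑' j, M * ‖v j‖ ^ 2 := by
        have hle : ∀ j, (∑ i ∈ s, ‖b i j‖) * ‖v j‖ ^ 2 ≤ M * ‖v j‖ ^ 2 := fun j => by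
          have : ∑ i ∈ s, ‖b i j‖ ≤ M := by
            have e : ∀ i, ‖b i j‖ = ‖b j i‖ := fun i => by rw [hb.herm i j]; simp
            simp_rw [e]
            exact ((hb.summable j).sum_le_tsum s fun _ _ => norm_nonneg _).trans (hb.bound j)
          gcongr
        have hs := (summable_norm_sq v).mul_left M
        exact mul_le_mul_of_nonneg_left (Summable.tsum_le_tsum hle
          (Summable.of_nonneg_of_le (fun j => by positivity) hle hs) hs) hM.le
    _ = (M * ‖v‖) ^ 2 := by
        rw [tsum_mul_left, (hasSum_norm_sq v).tsum_eq]
        ring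

/-- The linear map underlying `IsKernel.op`. -/
def opLin (hb : IsKernel b M) : Seq I →ₗ[ℂ] Seq I where
  toFun v := ⟨fun i => ∑' j, b i j * v j, memℓp_gen' (C := (M * ‖v‖) ^ 2) fun s => by
    simpa using hb.sum_sq_le v s⟩
  map_add' v w := by
    ext i
    show ∑' j, b i j * (v j + w j) = ∑' j, b i j * v j + ∑' j, b i j * w j
    rw [← Summable.tsum_add]
    · simp_rw [mul_add]
    · exact Summable.of_norm (by simpa using hb.summable_mul v i)
    · exact Summable.of_norm (by simpa using hb.summable_mul w i)
  map_smul' c v := by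
    ext i
    show ∑' j, b i j * (c * v j) = c * ∑' j, b i j * v j
    rw [← tsum_mul_left]
    simp_rw [mul_left_comm]

theorem norm_opLin_le (hb : IsKernel b M) (v : Seq I) : ‖hb.opLin v‖ ≤ M * ‖v‖ := by
  refine lp.norm_le_of_forall_sum_le (by norm_num)
    (mul_nonneg hb.pos.le (norm_nonneg _)) fun s => ?_
  have h := hb.sum_sq_le v s
  change ∑ i ∈ s, ‖hb.opLin v i‖ ^ 2 ≤ (M * ‖v‖) ^ 2 at h
  simpa using h

/-- The operator of a hermitian kernel with bounded absolute row sums (Schur's test). -/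
def op (hb : IsKernel b M) : Seq I →L[ℂ] Seq I := hb.opLin.mkContinuous M hb.norm_opLin_le

theorem norm_op_le (hb : IsKernel b M) : ‖hb.op‖ ≤ M :=
  LinearMap.mkContinuous_norm_le hb.opLin hb.pos.le hb.norm_opLin_le

theorem op_apply (hb : IsKernel b M) (v : Seq I) (i : I) : hb.op v i = ∑' j, b i j * v j := rfl

theorem hasSum_op (hb : IsKernel b M) (v : Seq I) (i : I) :
    HasSum (fun j => b i j * v j) (hb.op v i) :=
  (Summable.of_norm (by simpa using hb.summable_mul v i)).hasSum

theorem op_single [DecidableEq I] (hb : IsKernel b M) (k i : I) :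
    hb.op (lp.single 2 k 1) i = b i k := by
  rw [op_apply, tsum_eq_single k]
  · simp
  · intro j hj
    simp [hj]

theorem op_symm (hb : IsKernel b M) (x y : Seq I) : inner ℂ (hb.op x) y = inner ℂ x (hb.op y) := by
  classical
  rw [← ContinuousLinearMap.adjoint_inner_right]
  congr 1
  ext i
  have h1 : ∀ (w : Seq I) (k : I), w k = inner ℂ (lp.single 2 k (1 : ℂ) : Seq I) w := fun w k => by
    have h := hasSum_conj_mul (lp.single 2 k (1 : ℂ)) w
    refine HasSum.unique ?_ h
    convert! hasSum_ite_eq k (w k) using 2 with j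
    by_cases hj : j = k
    · subst hj; simp
    · simp [hj]
  rw [h1 _ i, ContinuousLinearMap.adjoint_inner_right]
  refine HasSum.unique (hasSum_conj_mul _ y) ?_
  convert! hb.hasSum_op y i using 2 with j
  rw [hb.op_single, hb.herm i j, RingHomCompTriple.comp_apply, RingHom.id_apply]

end IsKernel

end DiagonalPerturbation

namespace DiagonalPerturbation

open Filter Topology intervalIntegral

/-! ### Divided differences of the Gaussian -/

/-- The divided difference `(e^{-tu} - e^{-tv}) / (u - v)` of `z ↦ e^{-tz}`, written as an integral
so that it also has the right value, `-t e^{-tu}`, at `u = v`. -/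
def expDiff (t u v : ℝ) : ℝ := -t * ∫ α in (0 : ℝ)..1, Real.exp (-t * (α * u + (1 - α) * v))

theorem expDiff_mul_sub (t u v : ℝ) :
    expDiff t u v * (u - v) = Real.exp (-t * u) - Real.exp (-t * v) := by
  have h : ∀ α ∈ Set.uIcc (0 : ℝ) 1, HasDerivAt (fun α : ℝ => Real.exp (-t * (α * u + (1 - α) * v)))
      (Real.exp (-t * (α * u + (1 - α) * v)) * (-t * (u - v))) α := fun α _ => by
    have h1 : HasDerivAt (fun α : ℝ => -t * (α * u + (1 - α) * v)) (-t * (u - v)) α := by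
      have := (((hasDerivAt_id α).mul_const u).add
        (((hasDerivAt_id α).const_sub 1).mul_const v)).const_mul (-t)
      convert! this using 1
      ring
    exact h1.exp
  have h2 := integral_eq_sub_of_hasDerivAt h (by
    apply Continuous.intervalIntegrable
    fun_prop)
  rw [integral_mul_const] at h2
  rw [expDiff]
  simp only [zero_mul, sub_zero, one_mul, zero_add, sub_self, add_zero] at h2
  rw [← h2]
  ring

theorem expDiff_self (t u : ℝ) : expDiff t u u = -t * Real.exp (-t * u) := by
  rw [expDiff]
  have : ∀ α : ℝ, α * u + (1 - α) * u = u := fun α => by ring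
  simp [this]

theorem expDiff_comm (t u v : ℝ) : expDiff t u v = expDiff t v u := by
  rw [expDiff, expDiff]
  congr 1
  have := integral_comp_sub_left (a := 0) (b := 1)
    (fun α : ℝ => Real.exp (-t * (α * v + (1 - α) * u))) 1
  simp only [sub_self, sub_zero] at this
  rw [← this]
  refine integral_congr fun α _ => ?_
  show Real.exp _ = Real.exp _
  ring_nf

theorem abs_expDiff_le {t : ℝ} (ht : 0 ≤ t) (u v : ℝ) :
    |expDiff t u v| ≤ t * (Real.exp (-t * u) + Real.exp (-t * v)) := by
  rw [expDiff, abs_mul, abs_neg, abs_of_nonneg ht]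
  refine mul_le_mul_of_nonneg_left ?_ ht
  rw [← Real.norm_eq_abs]
  refine (norm_integral_le_of_norm_le_const (C := Real.exp (-t * u) + Real.exp (-t * v))
    fun α hα => ?_).trans (by simp)
  rw [Set.uIoc_of_le zero_le_one] at hα
  rw [Real.norm_eq_abs, abs_of_pos (Real.exp_pos _)]
  rcases le_total u v with h | h
  · have : Real.exp (-t * (α * u + (1 - α) * v)) ≤ Real.exp (-t * u) := by
      apply Real.exp_le_exp.mpr
      nlinarith [mul_nonneg ht (mul_nonneg (by linarith [hα.2] : 0 ≤ 1 - α) (sub_nonneg.mpr h))]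
    linarith [Real.exp_pos (-t * v)]
  · have : Real.exp (-t * (α * u + (1 - α) * v)) ≤ Real.exp (-t * v) := by
      apply Real.exp_le_exp.mpr
      nlinarith [mul_nonneg ht (mul_nonneg hα.1.le (sub_nonneg.mpr h))]
    linarith [Real.exp_pos (-t * u)]

/-- The Gaussian `x ↦ e^{-tx²}`. -/
def gauss (t x : ℝ) : ℝ := Real.exp (-t * x ^ 2)

/-- The first derivative of the Gaussian. -/
def gauss' (t x : ℝ) : ℝ := -2 * t * x * Real.exp (-t * x ^ 2)

/-- The second derivative of the Gaussian. -/
def gauss'' (t x : ℝ) : ℝ := (-2 * t + 4 * t ^ 2 * x ^ 2) * Real.exp (-t * x ^ 2)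

theorem gauss_pos (t x : ℝ) : 0 < gauss t x := Real.exp_pos _

theorem hasDerivAt_gauss (t x : ℝ) : HasDerivAt (gauss t) (gauss' t x) x := by
  have h1 : HasDerivAt (fun x : ℝ => -t * x ^ 2) (-t * (2 * x)) x := by
    simpa using (hasDerivAt_pow 2 x).const_mul (-t)
  convert! h1.exp using 1
  rw [gauss']
  ring

theorem hasDerivAt_gauss' (t x : ℝ) : HasDerivAt (gauss' t) (gauss'' t x) x := by
  have h1 : HasDerivAt (fun x : ℝ => -2 * t * x) (-2 * t) x := by
    simpa using (hasDerivAt_id x).const_mul (-2 * t)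
  convert! h1.mul (hasDerivAt_gauss t x) using 1
  rw [gauss'', gauss', gauss]
  ring

theorem hasDerivAt_gauss'' (t x : ℝ) : HasDerivAt (gauss'' t)
    ((12 * t ^ 2 * x - 8 * t ^ 3 * x ^ 3) * Real.exp (-t * x ^ 2)) x := by
  have h1 : HasDerivAt (fun x : ℝ => -2 * t + 4 * t ^ 2 * x ^ 2) (4 * t ^ 2 * (2 * x)) x := by
    simpa using ((hasDerivAt_pow 2 x).const_mul (4 * t ^ 2)).const_add (-2 * t)
  convert! h1.mul (hasDerivAt_gauss t x) using 1
  rw [gauss', gauss]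
  ring

theorem continuous_gauss'' (t : ℝ) : Continuous (gauss'' t) := by
  unfold gauss''
  fun_prop

/-- The second divided difference `(f(x) - f(y) - f'(y)(x - y)) / (x - y)²` of the Gaussian `f`, as
the integral form of the Taylor remainder. -/
def gaussDiff (t x y : ℝ) : ℝ := ∫ s in (0 : ℝ)..1, (1 - s) * gauss'' t (y + s * (x - y))

theorem gaussDiff_mul_sq (t x y : ℝ) :
    gaussDiff t x y * (x - y) ^ 2 = gauss t x - gauss t y - gauss' t y * (x - y) := by
  have hl : ∀ s : ℝ, HasDerivAt (fun s : ℝ => y + s * (x - y)) (x - y) s := fun s => by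
    simpa using ((hasDerivAt_id s).mul_const (x - y)).const_add y
  have h : ∀ s ∈ Set.uIcc (0 : ℝ) 1, HasDerivAt (fun s : ℝ =>
      (1 - s) * (gauss' t (y + s * (x - y)) * (x - y)) + gauss t (y + s * (x - y)))
      ((1 - s) * gauss'' t (y + s * (x - y)) * (x - y) ^ 2) s := fun s _ => by
    have h1 := (hasDerivAt_gauss' t _).comp s (hl s)
    have h2 := (hasDerivAt_gauss t _).comp s (hl s)
    have h3 := (((hasDerivAt_id s).const_sub 1).mul (h1.mul_const (x - y))).add h2
    convert! h3 using 1
    simp only [Function.comp_apply, id]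
    ring
  have h2 := integral_eq_sub_of_hasDerivAt h (by
    apply Continuous.intervalIntegrable
    have := continuous_gauss'' t
    fun_prop)
  rw [integral_mul_const] at h2
  rw [gaussDiff, h2]
  simp
  ring

theorem mul_exp_neg_le_one (y : ℝ) : y * Real.exp (-y) ≤ 1 := by
  have h := Real.add_one_le_exp y
  rw [Real.exp_neg]
  rw [← div_eq_mul_inv, div_le_one (Real.exp_pos y)]
  linarith

theorem abs_gauss''_le {t : ℝ} (ht : 0 < t) (x : ℝ) :
    |gauss'' t x| ≤ 10 * t * Real.exp (-(t / 2) * x ^ 2) := by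
  rw [gauss'', abs_mul, abs_of_pos (Real.exp_pos _)]
  have h1 : |-2 * t + 4 * t ^ 2 * x ^ 2| ≤ 2 * t + 4 * t ^ 2 * x ^ 2 := by
    rw [abs_le]
    constructor <;> nlinarith [sq_nonneg (t * x)]
  have h2 := mul_exp_neg_le_one (t / 2 * x ^ 2)
  have h3 : Real.exp (-t * x ^ 2)
      = Real.exp (-(t / 2 * x ^ 2)) * Real.exp (-(t / 2) * x ^ 2) := by
    rw [← Real.exp_add]
    ring_nf
  have h4 : Real.exp (-(t / 2 * x ^ 2)) ≤ 1 := by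
    rw [Real.exp_le_one_iff]
    have : 0 ≤ t / 2 * x ^ 2 := by positivity
    linarith
  rw [h3, ← mul_assoc]
  refine mul_le_mul_of_nonneg_right ?_ (Real.exp_pos _).le
  calc _ ≤ (2 * t + 4 * t ^ 2 * x ^ 2) * Real.exp (-(t / 2 * x ^ 2)) := by gcongr
    _ = 2 * t * Real.exp (-(t / 2 * x ^ 2))
        + 8 * t * (t / 2 * x ^ 2 * Real.exp (-(t / 2 * x ^ 2))) := by ring
    _ ≤ 2 * t * 1 + 8 * t * 1 := by gcongr
    _ = 10 * t := by ring

theorem abs_gaussDiff_le_of_forall {t x y C : ℝ}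
    (h : ∀ s ∈ Set.Icc (0 : ℝ) 1, |gauss'' t (y + s * (x - y))| ≤ C) : |gaussDiff t x y| ≤ C := by
  rw [gaussDiff, ← Real.norm_eq_abs]
  refine (norm_integral_le_of_norm_le_const (C := C) fun s hs => ?_).trans (by simp)
  rw [Set.uIoc_of_le zero_le_one] at hs
  have h1 := h s ⟨hs.1.le, hs.2⟩
  rw [Real.norm_eq_abs, abs_mul]
  have h2 : |1 - s| ≤ 1 := by
    rw [abs_le]
    constructor <;> linarith [hs.1, hs.2]
  calc |1 - s| * _ ≤ 1 * C := mul_le_mul h2 h1 (abs_nonneg _) zero_le_one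
    _ = C := one_mul C

theorem abs_gaussDiff_le {t : ℝ} (ht : 0 < t) (x y : ℝ) : |gaussDiff t x y| ≤ 10 * t := by
  refine abs_gaussDiff_le_of_forall fun s _ => (abs_gauss''_le ht _).trans ?_
  have : Real.exp (-(t / 2) * (y + s * (x - y)) ^ 2) ≤ 1 := by
    rw [Real.exp_le_one_iff]
    have : 0 ≤ t / 2 * (y + s * (x - y)) ^ 2 := by positivity
    linarith
  nlinarith

theorem exists_lipschitz_gauss'' {t : ℝ} (ht : 0 < t) :
    ∃ L, 0 ≤ L ∧ ∀ x y, |gauss'' t x - gauss'' t y| ≤ L * |x - y| := by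
  refine ⟨12 * t * (1 + t) + 16 * t * (1 + t), by positivity, fun x y => ?_⟩
  have := Convex.norm_image_sub_le_of_norm_hasDerivWithin_le (s := Set.univ) (x := y) (y := x)
    (f := gauss'' t) (f' := fun x => (12 * t ^ 2 * x - 8 * t ^ 3 * x ^ 3) * Real.exp (-t * x ^ 2))
    (C := 12 * t * (1 + t) + 16 * t * (1 + t))
    (fun x _ => (hasDerivAt_gauss'' t x).hasDerivWithinAt) (fun x _ => ?_) convex_univ trivial trivial
  · exact this
  rw [Real.norm_eq_abs, abs_mul, abs_of_pos (Real.exp_pos _)]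
  set z := t * x ^ 2 with hz
  have hz0 : 0 ≤ z := by positivity
  have he : Real.exp (-t * x ^ 2) = Real.exp (-z) := by rw [hz]; ring_nf
  rw [he]
  have hx : t * |x| ≤ (t + z) := by
    have : |x| ≤ 1 + x ^ 2 := by
      rw [← sq_abs]
      nlinarith [abs_nonneg x, sq_nonneg (|x| - 1)]
    nlinarith
  have h1 : |12 * t ^ 2 * x - 8 * t ^ 3 * x ^ 3| ≤ 12 * t * (t + z) + 8 * t * z * (t + z) := by
    have e1 : |12 * t ^ 2 * x - 8 * t ^ 3 * x ^ 3| ≤ |12 * t ^ 2 * x| + |8 * t ^ 3 * x ^ 3| :=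
      abs_sub _ _
    have e2 : |12 * t ^ 2 * x| = 12 * t * (t * |x|) := by
      rw [abs_mul, abs_of_pos (by positivity)]; ring
    have e3 : |8 * t ^ 3 * x ^ 3| = 8 * t * z * (t * |x|) := by
      rw [abs_mul, abs_of_pos (by positivity), abs_pow, hz, ← sq_abs]; ring
    rw [e2, e3] at e1
    refine e1.trans ?_
    gcongr
  have g1 := mul_exp_neg_le_one z
  have g0 : Real.exp (-z) ≤ 1 := by rw [Real.exp_le_one_iff]; linarith
  have g2 : z ^ 2 * Real.exp (-z) ≤ 2 := by
    have := Real.quadratic_le_exp_of_nonneg hz0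
    rw [Real.exp_neg, ← div_eq_mul_inv, div_le_iff₀ (Real.exp_pos z)]
    linarith
  have gp := Real.exp_pos (-z)
  calc _ ≤ (12 * t * (t + z) + 8 * t * z * (t + z)) * Real.exp (-z) := by gcongr
    _ = 12 * t * (t * Real.exp (-z) + z * Real.exp (-z))
        + 8 * t * (t * (z * Real.exp (-z)) + z ^ 2 * Real.exp (-z)) := by ring
    _ ≤ 12 * t * (t * 1 + 1) + 8 * t * (t * 1 + 2) := by gcongr
    _ ≤ _ := by nlinarith

theorem exists_lipschitz_gaussDiff {t : ℝ} (ht : 0 < t) :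
    ∃ L, 0 ≤ L ∧ ∀ x x' y, |gaussDiff t x y - gaussDiff t x' y| ≤ L * |x - x'| := by
  obtain ⟨L, hL, h⟩ := exists_lipschitz_gauss'' ht
  refine ⟨L, hL, fun x x' y => ?_⟩
  have hc := continuous_gauss'' t
  rw [gaussDiff, gaussDiff, ← integral_sub (by apply Continuous.intervalIntegrable; fun_prop)
    (by apply Continuous.intervalIntegrable; fun_prop), ← Real.norm_eq_abs]
  refine (norm_integral_le_of_norm_le_const (C := L * |x - x'|) fun s hs => ?_).trans (by simp)
  rw [Set.uIoc_of_le zero_le_one] at hs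
  rw [← mul_sub, Real.norm_eq_abs, abs_mul]
  have h1 := h (y + s * (x - y)) (y + s * (x' - y))
  have h3 : |y + s * (x - y) - (y + s * (x' - y))| ≤ |x - x'| := by
    rw [show y + s * (x - y) - (y + s * (x' - y)) = s * (x - x') by ring, abs_mul,
      abs_of_pos hs.1]
    nlinarith [abs_nonneg (x - x'), hs.2]
  have h2 : |1 - s| ≤ 1 := by
    rw [abs_le]
    constructor <;> linarith [hs.1, hs.2]
  calc |1 - s| * _ ≤ 1 * (L * |x - x'|) :=
        mul_le_mul h2 (h1.trans (by gcongr)) (abs_nonneg _) zero_le_one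
    _ = _ := one_mul _

/-- The second divided difference decays in both variables: it is exponentially small in `y`, up to
a term which is exponentially small in `x` and of order `y⁻²`. -/
theorem exists_gaussDiff_decay {t : ℝ} (ht : 0 < t) :
    ∃ C, 0 ≤ C ∧ ∀ x y, |gaussDiff t x y|
      ≤ C * (Real.exp (-(t / 8) * y ^ 2) + gauss t x * (1 + y ^ 2)⁻¹) := by
  refine ⟨10 * t * Real.exp (t / 8) + 24 + 8 * t, by positivity, fun x y => ?_⟩
  have hE := Real.exp_pos (-(t / 8) * y ^ 2)
  have hg := gauss_pos t x
  have hi : 0 < (1 + y ^ 2)⁻¹ := by positivity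
  have hE1 : 1 ≤ Real.exp (t / 8) := Real.one_le_exp (by positivity)
  -- far apart, the quotient itself is estimated; close together, the integrand is, for then all
  -- points between `x` and `y` have size comparable to `|y|`
  by_cases hcase : (1 + y ^ 2) / 8 ≤ (x - y) ^ 2
  · have h0 : 0 < (x - y) ^ 2 := lt_of_lt_of_le (by positivity) hcase
    have h1 : gaussDiff t x y = (gauss t x - gauss t y - gauss' t y * (x - y)) / (x - y) ^ 2 := by
      rw [← gaussDiff_mul_sq, mul_div_cancel_right₀ _ h0.ne']
    have hgy : gauss t y ≤ Real.exp (-(t / 8) * y ^ 2) := by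
      apply Real.exp_le_exp.mpr
      nlinarith [sq_nonneg y]
    have hsq : ((x - y) ^ 2)⁻¹ ≤ 8 * (1 + y ^ 2)⁻¹ := by
      rw [← div_eq_mul_inv, le_div_iff₀ (by positivity), inv_mul_le_iff₀ h0]
      linarith
    have hi1 : (1 + y ^ 2)⁻¹ ≤ 1 := inv_le_one_of_one_le₀ (by nlinarith [sq_nonneg y])
    have hd : |gauss' t y * (x - y)| * ((x - y) ^ 2)⁻¹ ≤ 8 * t * Real.exp (-(t / 8) * y ^ 2) := by
      have a1 : |gauss' t y * (x - y)| = 2 * t * gauss t y * (|y| * |x - y|) := by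
        rw [gauss', gauss, abs_mul, abs_mul, abs_mul, abs_mul, abs_of_pos (Real.exp_pos _),
          abs_of_pos ht]
        simp
        ring
      have a2 : |y| * |x - y| ≤ 4 * (x - y) ^ 2 := by
        have : |y| ^ 2 ≤ 8 * (x - y) ^ 2 := by rw [sq_abs]; nlinarith
        have e : |x - y| ^ 2 = (x - y) ^ 2 := sq_abs _
        nlinarith [sq_nonneg (|y| - 3 * |x - y|), abs_nonneg y, abs_nonneg (x - y),
          mul_nonneg (abs_nonneg y) (abs_nonneg (x - y))]
      rw [a1, ← div_eq_mul_inv, div_le_iff₀ h0]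
      calc 2 * t * gauss t y * (|y| * |x - y|)
          ≤ 2 * t * Real.exp (-(t / 8) * y ^ 2) * (4 * (x - y) ^ 2) := by gcongr
        _ = _ := by ring
    calc |gaussDiff t x y|
        ≤ (gauss t x + gauss t y + |gauss' t y * (x - y)|) * ((x - y) ^ 2)⁻¹ := by
          rw [h1, abs_div, abs_of_pos h0, div_eq_mul_inv]
          refine mul_le_mul_of_nonneg_right ?_ (by positivity)
          refine (abs_sub _ _).trans (add_le_add_left ((abs_sub _ _).trans ?_) _)
          rw [abs_of_pos hg, abs_of_pos (gauss_pos t y)]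
      _ = gauss t x * ((x - y) ^ 2)⁻¹ + gauss t y * ((x - y) ^ 2)⁻¹
          + |gauss' t y * (x - y)| * ((x - y) ^ 2)⁻¹ := by ring
      _ ≤ gauss t x * (8 * (1 + y ^ 2)⁻¹) + Real.exp (-(t / 8) * y ^ 2) * (8 * 1)
          + 8 * t * Real.exp (-(t / 8) * y ^ 2) := by
          gcongr
          exact hsq.trans (by gcongr)
      _ ≤ _ := by
          have p1 := mul_pos hg hi
          have p2 : 0 ≤ 10 * t * Real.exp (t / 8) := by positivity
          nlinarith [mul_nonneg p2 hE.le, mul_nonneg p2 p1.le, mul_pos ht p1]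
  · push Not at hcase
    refine (abs_gaussDiff_le_of_forall
      (C := 10 * t * (Real.exp (t / 8) * Real.exp (-(t / 8) * y ^ 2))) fun s hs => ?_).trans ?_
    · refine (abs_gauss''_le ht _).trans ?_
      rw [← Real.exp_add]
      refine mul_le_mul_of_nonneg_left (Real.exp_le_exp.mpr ?_) (by positivity)
      -- the points between `x` and `y` are at distance at most `√((1 + y²)/8)` from `y`
      have h1 : (s * (x - y)) ^ 2 ≤ (1 + y ^ 2) / 8 := by
        have : s ^ 2 ≤ 1 := by nlinarith [hs.1, hs.2]
        nlinarith [sq_nonneg (x - y)]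
      have h2 : y ^ 2 - 1 ≤ 4 * (y + s * (x - y)) ^ 2 := by
        nlinarith [sq_nonneg (y + 2 * (s * (x - y)))]
      nlinarith
    · have p1 := mul_pos hg hi
      have p2 : 0 ≤ 10 * t * Real.exp (t / 8) := by positivity
      nlinarith [mul_nonneg p2 p1.le, mul_pos ht p1, mul_pos ht hE]

/-- The symmetrised second divided difference, as a first divided difference of `f'`, expressed
through functions of `x²`, `y²` and `x y`. -/
theorem gaussDiff_add_gaussDiff (t x y : ℝ) :
    gaussDiff t x y + gaussDiff t y x = -(2 * t) *
      ((x ^ 2 + y ^ 2) / 2 * expDiff t (x ^ 2) (y ^ 2)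
        + (Real.exp (-t * x ^ 2) + Real.exp (-t * y ^ 2)) / 2
        + x * y * expDiff t (x ^ 2) (y ^ 2)) := by
  by_cases hxy : x = y
  · subst hxy
    have h1 : gaussDiff t x x = gauss'' t x / 2 := by
      rw [gaussDiff]
      simp only [sub_self, mul_zero, add_zero]
      rw [integral_mul_const, integral_sub (by simp) (by simp)]
      simp
      ring
    rw [h1, expDiff_self, gauss'']
    ring
  · have h0 : (x - y) ≠ 0 := sub_ne_zero.mpr hxy
    have h1 := gaussDiff_mul_sq t x y
    have h2 := gaussDiff_mul_sq t y x
    have h3 := expDiff_mul_sub t (x ^ 2) (y ^ 2)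
    rw [gauss', gauss, gauss] at h1 h2
    apply mul_right_cancel₀ (pow_ne_zero 2 h0)
    linear_combination h1 + h2 + t * (x + y) * (x - y) * h3

end DiagonalPerturbation

namespace DiagonalPerturbation

open Filter Topology

attribute [local instance] InnerProductSpace.toInner

variable {I J : Type}

/-! ### Traces over an eigenbasis -/

section basis

variable (ψ : HilbertBasis J ℂ (Seq I))

theorem hasSum_norm_inner_sq (x : Seq I) :
    HasSum (fun n => ‖(inner ℂ (ψ n) x : ℂ)‖ ^ 2) (‖x‖ ^ 2) := by
  have h := ψ.hasSum_inner_mul_inner x x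
  have h2 := Complex.hasSum_re h
  convert! h2 using 1
  · funext n
    rw [← inner_conj_symm x (ψ n), ← Complex.normSq_eq_conj_mul_self, Complex.ofReal_re,
      Complex.normSq_eq_norm_sq]
  · rw [inner_self_eq_norm_sq_to_K]
    norm_cast

theorem norm_basis_sq (n : J) : ‖ψ n‖ = 1 := ψ.orthonormal.1 n

theorem inner_single [DecidableEq I] (v : Seq I) (k : I) :
    inner ℂ (lp.single 2 k (1 : ℂ) : Seq I) v = v k := by
  have h := hasSum_conj_mul (lp.single 2 k (1 : ℂ)) v
  refine h.unique ?_
  convert! hasSum_ite_eq k (v k) using 2 with j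
  by_cases hj : j = k
  · subst hj; simp
  · simp [hj]

theorem norm_single [DecidableEq I] (k : I) : ‖(lp.single 2 k (1 : ℂ) : Seq I)‖ = 1 := by
  rw [lp.norm_single (by norm_num)]
  simp

/-- The squared coordinates of an orthonormal basis at a fixed place add up to one. -/
theorem hasSum_coord_sq (k : I) : HasSum (fun n => ‖ψ n k‖ ^ 2) 1 := by
  classical
  have h := hasSum_norm_inner_sq ψ (lp.single 2 k (1 : ℂ))
  rw [norm_single, one_pow] at h
  convert! h using 2 with n
  rw [← inner_conj_symm, inner_single]
  simp

theorem hasSum_basis_norm_sq (n : J) : HasSum (fun k => ‖ψ n k‖ ^ 2) 1 := by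
  have h := hasSum_norm_sq (ψ n)
  rwa [norm_basis_sq, one_pow] at h

/-- A nonnegative double series converges, with the value of the iterated sum. -/
theorem hasSum_prod_of_nonneg {α β : Type} {f : α × β → ℝ} (hf : ∀ p, 0 ≤ f p) {g : α → ℝ} {s : ℝ}
    (h1 : ∀ a, HasSum (fun b => f (a, b)) (g a)) (h2 : HasSum g s) : HasSum f s := by
  have hs : Summable f := by
    rw [summable_prod_of_nonneg hf]
    refine ⟨fun a => (h1 a).summable, ?_⟩
    simp_rw [fun a => (h1 a).tsum_eq]
    exact h2.summable
  have := hs.hasSum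
  rwa [(hs.hasSum.prod_fiberwise h1).unique h2] at this

/-- The trace of a nonnegative diagonal operator, computed in an arbitrary orthonormal basis. -/
theorem hasSum_weight_left {a : I → ℝ} (ha : ∀ k, 0 ≤ a k) {s : ℝ} (hs : HasSum a s) :
    HasSum (fun p : I × J => ‖ψ p.2 p.1‖ ^ 2 * a p.1) s := by
  refine hasSum_prod_of_nonneg (fun p => mul_nonneg (by positivity) (ha _)) (g := a) (fun k => ?_) hs
  simpa using (hasSum_coord_sq ψ k).mul_right (a k)

theorem hasSum_weight_right {a : J → ℝ} (ha : ∀ k, 0 ≤ a k) {s : ℝ} (hs : HasSum a s) :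
    HasSum (fun p : I × J => ‖ψ p.2 p.1‖ ^ 2 * a p.2) s := by
  rw [← (Equiv.prodComm J I).hasSum_iff]
  refine hasSum_prod_of_nonneg (fun p => mul_nonneg (by positivity) (ha _)) (g := a) (fun k => ?_) hs
  simpa using (hasSum_basis_norm_sq ψ k).mul_right (a k)

/-- Jensen's inequality for the exponential and a discrete probability distribution. -/
theorem exp_neg_le_of_hasSum {w x : I → ℝ} {X Y : ℝ} (hw0 : ∀ k, 0 ≤ w k) (hw : HasSum w 1)
    (hX : HasSum (fun k => w k * x k) X) (hY : HasSum (fun k => w k * Real.exp (-x k)) Y) :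
    Real.exp (-X) ≤ Y := by
  have h1 : HasSum (fun k => Real.exp (-X) * ((1 + X) * w k - w k * x k))
      (Real.exp (-X) * ((1 + X) * 1 - X)) := ((hw.mul_left (1 + X)).sub hX).mul_left _
  have h2 := hasSum_le (fun k => ?_) h1 hY
  · linarith
  have h3 := Real.add_one_le_exp (X - x k)
  have h4 : Real.exp (-x k) = Real.exp (-X) * Real.exp (X - x k) := by
    rw [← Real.exp_add]
    ring_nf
  rw [h4]
  have h5 := mul_le_mul_of_nonneg_left h3 (mul_nonneg (hw0 k) (Real.exp_pos (-X)).le)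
  linarith

variable {μ : I → ℝ} {B : Seq I →L[ℂ] Seq I} {lam : J → ℝ}

/-- Jensen's inequality for the weights `‖ψ n k‖²`: the mean of `μ²` is `‖diag μ (ψ n)‖²`, which is
at most `2 (lam n)² + 2 M²` because `B` is bounded. -/
theorem exp_eigenvalue_le {M : ℝ} (hM : ‖B‖ ≤ M) (h : ∀ n, IsEig μ B (lam n) (ψ n)) {s : ℝ}
    (hs : 0 < s) (n : J) :
    Real.exp (-s * lam n ^ 2) ≤ Real.exp (s * M ^ 2) *
      ∑' k, ‖ψ n k‖ ^ 2 * Real.exp (-(s / 2) * μ k ^ 2) := by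
  set w : Seq I := (lam n : ℂ) • ψ n - B (ψ n) with hw
  have hw1 : ∀ k, w k = μ k * ψ n k := fun k => by
    have := h n k
    show (lam n : ℂ) * ψ n k - B (ψ n) k = _
    linear_combination -this
  have hw2 : ‖w‖ ^ 2 ≤ 2 * lam n ^ 2 + 2 * M ^ 2 := by
    have h1 : ‖w‖ ≤ |lam n| + M := by
      refine (norm_sub_le _ _).trans (add_le_add ?_ ?_)
      · rw [norm_smul, norm_basis_sq]
        simp
      · refine (B.le_opNorm _).trans ?_
        rw [norm_basis_sq, mul_one]
        exact hM
    have h2 := pow_le_pow_left₀ (norm_nonneg w) h1 2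
    nlinarith [sq_nonneg (|lam n| - M), sq_abs (lam n)]
  have hX : HasSum (fun k => ‖ψ n k‖ ^ 2 * (s / 2 * μ k ^ 2)) (s / 2 * ‖w‖ ^ 2) := by
    convert! (hasSum_norm_sq w).mul_left (s / 2) using 2 with k
    rw [hw1, norm_mul, mul_pow, Complex.norm_real, Real.norm_eq_abs, sq_abs]
    ring
  have hY : Summable fun k => ‖ψ n k‖ ^ 2 * Real.exp (-(s / 2 * μ k ^ 2)) := by
    refine Summable.of_nonneg_of_le (fun k => by positivity) (fun k => ?_)
      (hasSum_basis_norm_sq ψ n).summable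
    refine mul_le_of_le_one_right (by positivity) ?_
    rw [Real.exp_le_one_iff, neg_nonpos]
    positivity
  have hJ := exp_neg_le_of_hasSum (fun k => by positivity) (hasSum_basis_norm_sq ψ n) hX hY.hasSum
  have e1 : ∀ k, -(s / 2) * μ k ^ 2 = -(s / 2 * μ k ^ 2) := fun k => by ring
  simp_rw [e1]
  calc Real.exp (-s * lam n ^ 2) ≤ Real.exp (s * M ^ 2) * Real.exp (-(s / 2 * ‖w‖ ^ 2)) := by
        rw [← Real.exp_add]
        apply Real.exp_le_exp.mpr
        nlinarith
    _ ≤ _ := by gcongr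

/-- The Gaussian trace of the perturbed operator is controlled by that of the diagonal one. -/
theorem summable_exp_eigenvalue {M : ℝ} (hM : ‖B‖ ≤ M) (h : ∀ n, IsEig μ B (lam n) (ψ n)) {s : ℝ}
    (hs : 0 < s) (hμ : Summable fun k => Real.exp (-(s / 2) * μ k ^ 2)) :
    (Summable fun n => Real.exp (-s * lam n ^ 2)) ∧
      ∑' n, Real.exp (-s * lam n ^ 2)
        ≤ Real.exp (s * M ^ 2) * ∑' k, Real.exp (-(s / 2) * μ k ^ 2) := by
  have h1 := hasSum_weight_left ψ (fun k => (Real.exp_pos (-(s / 2) * μ k ^ 2)).le) hμ.hasSum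
  have h2 := (Equiv.prodComm J I).hasSum_iff.mpr h1
  have h3 := h2.summable
  have h4 : HasSum (fun n => ∑' k, ‖ψ n k‖ ^ 2 * Real.exp (-(s / 2) * μ k ^ 2)) _ :=
    h2.prod_fiberwise fun n => (h3.prod_factor n).hasSum
  have h5 := h4.mul_left (Real.exp (s * M ^ 2))
  have h6 : Summable fun n => Real.exp (-s * lam n ^ 2) :=
    Summable.of_nonneg_of_le (fun n => (Real.exp_pos _).le) (exp_eigenvalue_le ψ hM h hs)
      h5.summable
  exact ⟨h6, hasSum_le (exp_eigenvalue_le ψ hM h hs) h6.hasSum h5⟩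

end basis

end DiagonalPerturbation

namespace DiagonalPerturbation

open Filter Topology

attribute [local instance] InnerProductSpace.toInner

variable {I J : Type}

/-! ### The second-order trace formula -/

section identity

variable (ψ : HilbertBasis J ℂ (Seq I)) {μ : I → ℝ} {B : Seq I →L[ℂ] Seq I} {lam : J → ℝ}

theorem apply_basis [DecidableEq I] (hB : ∀ x y, inner ℂ (B x) y = inner ℂ x (B y)) (k : I)
    (v : Seq I) : B v k = inner ℂ (B (lp.single 2 k (1 : ℂ))) v := by
  rw [hB, inner_single]

theorem hasSum_op_coord_sq [DecidableEq I] (hB : ∀ x y, inner ℂ (B x) y = inner ℂ x (B y)) (k : I) :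
    HasSum (fun n => ‖B (ψ n) k‖ ^ 2) (‖B (lp.single 2 k (1 : ℂ))‖ ^ 2) := by
  convert! hasSum_norm_inner_sq ψ (B (lp.single 2 k (1 : ℂ))) using 2 with n
  rw [apply_basis hB, ← inner_conj_symm, RCLike.norm_conj]

theorem norm_op_single_le [DecidableEq I] {M : ℝ} (hM : ‖B‖ ≤ M) (k : I) :
    ‖B (lp.single 2 k (1 : ℂ))‖ ≤ M := by
  refine (B.le_opNorm _).trans ?_
  rw [norm_single, mul_one]
  exact hM

theorem norm_op_coord {ε : ℝ} (h : ∀ n, IsEig μ ((ε : ℂ) • B) (lam n) (ψ n)) (n : J) (k : I) :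
    |lam n - μ k| * ‖ψ n k‖ = |ε| * ‖B (ψ n) k‖ := by
  have h1 : ((lam n - μ k : ℝ) : ℂ) * ψ n k = (ε : ℂ) * B (ψ n) k := by
    have h2 : (μ k : ℂ) * ψ n k + (ε : ℂ) * B (ψ n) k = lam n * ψ n k := h n k
    push_cast
    linear_combination -h2
  have h3 := congrArg norm h1
  rwa [norm_mul, norm_mul, Complex.norm_real, Complex.norm_real] at h3

/-- The diagonal part of the eigenvalue equation: the mean of `lam - μ k` over the column `k`. -/
theorem hasSum_first_order [DecidableEq I] (hB : ∀ x y, inner ℂ (B x) y = inner ℂ x (B y)) {ε : ℝ}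
    (h : ∀ n, IsEig μ ((ε : ℂ) • B) (lam n) (ψ n)) (k : I) :
    HasSum (fun n => ‖ψ n k‖ ^ 2 * (lam n - μ k))
      (ε * (B (lp.single 2 k (1 : ℂ)) k).re) := by
  have h1 := ψ.hasSum_inner_mul_inner (B (lp.single 2 k (1 : ℂ))) (lp.single 2 k (1 : ℂ))
  have h2 := (Complex.hasSum_re h1).mul_left ε
  have h0 : (inner ℂ (B (lp.single 2 k (1 : ℂ))) (lp.single 2 k (1 : ℂ) : Seq I) : ℂ)
      = B (lp.single 2 k (1 : ℂ)) k := by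
    rw [apply_basis hB]
  rw [h0] at h2
  convert! h2 using 2 with n
  rw [← apply_basis hB, ← inner_conj_symm, inner_single]
  have h3 : (μ k : ℂ) * ψ n k + (ε : ℂ) * B (ψ n) k = lam n * ψ n k := h n k
  have h4 : (ε : ℂ) * (B (ψ n) k * (starRingEnd ℂ) (ψ n k))
      = ((‖ψ n k‖ ^ 2 * (lam n - μ k) : ℝ) : ℂ) := by
    push_cast
    rw [← Complex.conj_mul']
    linear_combination (starRingEnd ℂ) (ψ n k) * h3
  have h5 := congrArg Complex.re h4
  rw [Complex.re_ofReal_mul, Complex.ofReal_re] at h5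
  exact h5.symm

/-- The trace of a Gaussian of the perturbed operator, exactly to second order in the
perturbation: the remainder is a sum over pairs of a perturbed and an unperturbed eigenvector. -/
theorem hasSum_second_order [DecidableEq I] (hB : ∀ x y, inner ℂ (B x) y = inner ℂ x (B y)) {ε : ℝ}
    (h : ∀ n, IsEig μ ((ε : ℂ) • B) (lam n) (ψ n)) {t : ℝ}
    (h1 : Summable fun n => gauss t (lam n)) (h2 : Summable fun k => gauss t (μ k))
    (h3 : Summable fun k => |gauss' t (μ k)|) :
    HasSum (fun p : I × J => ε ^ 2 * (‖B (ψ p.2) p.1‖ ^ 2 * gaussDiff t (lam p.2) (μ p.1)))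
      (∑' n, gauss t (lam n) - ∑' k, gauss t (μ k)
        - ε * ∑' k, gauss' t (μ k) * (B (lp.single 2 k (1 : ℂ)) k).re) := by
  have a1 := hasSum_weight_right ψ (fun n => (gauss_pos t (lam n)).le) h1.hasSum
  have a2 := hasSum_weight_left ψ (fun k => (gauss_pos t (μ k)).le) h2.hasSum
  have a3 : Summable fun p : I × J => gauss' t (μ p.1) * (‖ψ p.2 p.1‖ ^ 2 * (lam p.2 - μ p.1)) := by
    have b1 : HasSum (fun p : I × J => |gauss' t (μ p.1)| *
        (‖ψ p.2 p.1‖ ^ 2 + |ε| ^ 2 * ‖B (ψ p.2) p.1‖ ^ 2)) _ :=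
      hasSum_prod_of_nonneg (fun p => by positivity)
        (fun k => ((hasSum_coord_sq ψ k).add
          ((hasSum_op_coord_sq ψ hB k).mul_left (|ε| ^ 2))).mul_left |gauss' t (μ k)|)
        (Summable.of_nonneg_of_le (fun k => by positivity) (fun k => mul_le_mul_of_nonneg_left
          (add_le_add_right (mul_le_mul_of_nonneg_left
            (pow_le_pow_left₀ (norm_nonneg _) (norm_op_single_le le_rfl k) 2) (by positivity)) 1)
          (abs_nonneg _)) (h3.mul_right (1 + |ε| ^ 2 * ‖B‖ ^ 2))).hasSum
    refine Summable.of_norm_bounded b1.summable fun p => ?_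
    rw [norm_mul, Real.norm_eq_abs]
    refine mul_le_mul_of_nonneg_left ?_ (abs_nonneg _)
    have e := norm_op_coord ψ h p.2 p.1
    rw [Real.norm_eq_abs, abs_mul, abs_of_nonneg (by positivity),
      show ‖ψ p.2 p.1‖ ^ 2 * |lam p.2 - μ p.1| = ‖ψ p.2 p.1‖ * (|lam p.2 - μ p.1| * ‖ψ p.2 p.1‖) by
        ring, e]
    nlinarith [sq_nonneg (‖ψ p.2 p.1‖ - |ε| * ‖B (ψ p.2) p.1‖), sq_nonneg ‖ψ p.2 p.1‖,
      sq_nonneg (|ε| * ‖B (ψ p.2) p.1‖)]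
  have a4 := a3.hasSum.prod_fiberwise fun k =>
    (hasSum_first_order ψ hB h k).mul_left (gauss' t (μ k))
  have a5 := a3.hasSum
  rw [← a4.tsum_eq] at a5
  have a6 : ∑' k, gauss' t (μ k) * (ε * (B (lp.single 2 k (1 : ℂ)) k).re)
      = ε * ∑' k, gauss' t (μ k) * (B (lp.single 2 k (1 : ℂ)) k).re := by
    rw [← tsum_mul_left]
    simp_rw [mul_left_comm]
  rw [a6] at a5
  convert! (a1.sub a2).sub a5 using 2 with p
  have e := norm_op_coord ψ h p.2 p.1
  have e2 := gaussDiff_mul_sq t (lam p.2) (μ p.1)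
  have e3 : ε ^ 2 * ‖B (ψ p.2) p.1‖ ^ 2 = (lam p.2 - μ p.1) ^ 2 * ‖ψ p.2 p.1‖ ^ 2 := by
    rw [← sq_abs ε, ← sq_abs (lam p.2 - μ p.1), ← mul_pow, ← mul_pow, e]
  linear_combination gaussDiff t (lam p.2) (μ p.1) * e3 + ‖ψ p.2 p.1‖ ^ 2 * e2

end identity

section limit

variable {μ : I → ℝ} {b : I → I → ℂ} {M : ℝ}

theorem IsKernel.summable_column (hb : IsKernel b M) (k : I) : Summable fun j => ‖b j k‖ := by
  convert! hb.summable k using 2 with j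
  rw [hb.herm k j, RCLike.norm_conj]

theorem IsKernel.tsum_column_le (hb : IsKernel b M) (k : I) : ∑' j, ‖b j k‖ ≤ M := by
  convert! hb.bound k using 3 with j
  rw [hb.herm k j, RCLike.norm_conj]

/-- The spectral measure of a column of the kernel with respect to the perturbed operator
converges, as tested by a Lipschitz function, at rate `O(ε)`. -/
theorem IsKernel.abs_spectral_sub_le (hb : IsKernel b M) (ψ : HilbertBasis J ℂ (Seq I))
    {lam : J → ℝ} {ε : ℝ} (h : ∀ n, IsEig μ ((ε : ℂ) • hb.op) (lam n) (ψ n)) {F : ℝ → ℝ} {L C : ℝ}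
    (hL0 : 0 ≤ L) (hL : ∀ x y, |F x - F y| ≤ L * |x - y|) (hC : ∀ x, |F x| ≤ C) (k : I) :
    |∑' n, ‖hb.op (ψ n) k‖ ^ 2 * F (lam n) - ∑' j, ‖b k j‖ ^ 2 * F (μ j)| ≤ L * |ε| * M ^ 3 := by
  classical
  obtain ⟨B, hBdef⟩ : ∃ B, B = hb.op := ⟨_, rfl⟩
  have hB : ∀ x y, inner ℂ (B x) y = inner ℂ x (B y) := by
    rw [hBdef]
    exact hb.op_symm
  have hBM : ‖B‖ ≤ M := by
    rw [hBdef]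
    exact hb.norm_op_le
  rw [← hBdef] at h ⊢
  have hM := hb.pos
  obtain ⟨v, hv⟩ : ∃ v, v = B (lp.single 2 k (1 : ℂ)) := ⟨_, rfl⟩
  have hvj : ∀ j, v j = b j k := fun j => by
    rw [hv, hBdef]
    exact hb.op_single k j
  have hvM : ‖v‖ ≤ M := by
    rw [hv]
    exact norm_op_single_le hBM k
  have hCF : ∀ i, ‖((F (μ i) : ℝ) : ℂ)‖ ≤ C := fun i => by
    rw [Complex.norm_real]
    exact hC _
  obtain ⟨w, hwj⟩ : ∃ w : Seq I, ∀ j, w j = (F (μ j) : ℂ) * v j :=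
    ⟨diagOp (fun i => ((F (μ i) : ℝ) : ℂ)) C hCF v, fun j => rfl⟩
  have h1 := ψ.hasSum_inner_mul_inner v w
  have h2 : (inner ℂ v w : ℂ) = ((∑' j, ‖b k j‖ ^ 2 * F (μ j) : ℝ) : ℂ) := by
    rw [← (hasSum_conj_mul v w).tsum_eq, Complex.ofReal_tsum]
    congr 1
    funext j
    rw [hwj, hvj, hb.herm k j, RingHomCompTriple.comp_apply, RingHom.id_apply]
    push_cast
    rw [← Complex.conj_mul']
    ring
  have h3 : Summable fun n => ‖B (ψ n) k‖ ^ 2 * F (lam n) := by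
    refine Summable.of_norm_bounded ((hasSum_op_coord_sq ψ hB k).summable.mul_right C) fun n => ?_
    rw [norm_mul, norm_pow, norm_norm]
    exact mul_le_mul_of_nonneg_left (hC _) (by positivity)
  have h4 := (Complex.hasSum_ofReal.mpr h3.hasSum).sub h1
  -- the summands of the difference, expanded over the index set
  have h5 : ∀ n, HasSum (fun j => inner ℂ v (ψ n) * ((starRingEnd ℂ) (ψ n j) * v j *
      ((F (lam n) - F (μ j) : ℝ) : ℂ)))
      (((‖B (ψ n) k‖ ^ 2 * F (lam n) : ℝ) : ℂ) - inner ℂ v (ψ n) * inner ℂ (ψ n) w) := fun n => by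
    have e1 := ((hasSum_conj_mul (ψ n) v).mul_right (F (lam n) : ℂ)).sub (hasSum_conj_mul (ψ n) w)
    have e2 := e1.mul_left (inner ℂ v (ψ n))
    convert! e2 using 1
    · funext j
      rw [hwj]
      push_cast
      ring
    · rw [apply_basis hB, ← hv]
      push_cast
      rw [← Complex.mul_conj', inner_conj_symm]
      ring
  have h6 : ∀ n j, ‖inner ℂ v (ψ n) * ((starRingEnd ℂ) (ψ n j) * v j *
      ((F (lam n) - F (μ j) : ℝ) : ℂ))‖
      ≤ (L * |ε| / 2) * (‖b j k‖ * (‖B (ψ n) k‖ ^ 2 + ‖B (ψ n) j‖ ^ 2)) := fun n j => by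
    have e1 : ‖(inner ℂ v (ψ n) : ℂ)‖ = ‖B (ψ n) k‖ := by rw [apply_basis hB, ← hv]
    rw [norm_mul, norm_mul, norm_mul, e1, RCLike.norm_conj, hvj, Complex.norm_real, Real.norm_eq_abs]
    have e2 := norm_op_coord ψ h n j
    have e3 := hL (lam n) (μ j)
    calc ‖B (ψ n) k‖ * (‖ψ n j‖ * ‖b j k‖ * |F (lam n) - F (μ j)|)
        ≤ ‖B (ψ n) k‖ * (‖ψ n j‖ * ‖b j k‖ * (L * |lam n - μ j|)) := by gcongr
      _ = L * ‖b j k‖ * ‖B (ψ n) k‖ * (|lam n - μ j| * ‖ψ n j‖) := by ring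
      _ = L * |ε| * ‖b j k‖ * (‖B (ψ n) k‖ * ‖B (ψ n) j‖) := by rw [e2]; ring
      _ ≤ L * |ε| * ‖b j k‖ * ((‖B (ψ n) k‖ ^ 2 + ‖B (ψ n) j‖ ^ 2) / 2) := by
          gcongr
          nlinarith [sq_nonneg (‖B (ψ n) k‖ - ‖B (ψ n) j‖)]
      _ = _ := by ring
  have e0 : ∀ j, ‖b j k‖ * (‖v‖ ^ 2 + ‖B (lp.single 2 j (1 : ℂ))‖ ^ 2)
      ≤ ‖b j k‖ * (M ^ 2 + M ^ 2) := fun j => by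
    have := norm_op_single_le hBM j
    gcongr
  have e1 := (hb.summable_column k).mul_right (M ^ 2 + M ^ 2)
  have e2 : Summable fun j => ‖b j k‖ * (‖v‖ ^ 2 + ‖B (lp.single 2 j (1 : ℂ))‖ ^ 2) :=
    Summable.of_nonneg_of_le (fun j => by positivity) e0 e1
  have h7 : HasSum (fun p : I × J => (L * |ε| / 2) *
      (‖b p.1 k‖ * (‖B (ψ p.2) k‖ ^ 2 + ‖B (ψ p.2) p.1‖ ^ 2)))
      ((L * |ε| / 2) * ∑' j, ‖b j k‖ * (‖v‖ ^ 2 + ‖B (lp.single 2 j (1 : ℂ))‖ ^ 2)) := by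
    refine HasSum.mul_left _ (hasSum_prod_of_nonneg (fun p => by positivity) (fun j => ?_)
      e2.hasSum)
    rw [hv]
    exact ((hasSum_op_coord_sq ψ hB k).add (hasSum_op_coord_sq ψ hB j)).mul_left _
  have h8 : (L * |ε| / 2) * ∑' j, ‖b j k‖ * (‖v‖ ^ 2 + ‖B (lp.single 2 j (1 : ℂ))‖ ^ 2)
      ≤ L * |ε| * M ^ 3 := by
    calc _ ≤ L * |ε| / 2 * ∑' j, ‖b j k‖ * (M ^ 2 + M ^ 2) :=
          mul_le_mul_of_nonneg_left (e2.tsum_le_tsum e0 e1) (by positivity)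
      _ ≤ L * |ε| / 2 * (M * (M ^ 2 + M ^ 2)) := by
          rw [tsum_mul_right]
          have := hb.tsum_column_le k
          gcongr
      _ = _ := by ring
  have h9 := (Equiv.prodComm J I).hasSum_iff.mpr h7
  have h10 : HasSum (fun n => ∑' j, (L * |ε| / 2) *
      (‖b j k‖ * (‖B (ψ n) k‖ ^ 2 + ‖B (ψ n) j‖ ^ 2))) _ :=
    h9.prod_fiberwise fun n => (h9.summable.prod_factor n).hasSum
  have h11 : ‖((∑' n, ‖B (ψ n) k‖ ^ 2 * F (lam n) : ℝ) : ℂ) - inner ℂ v w‖ ≤ L * |ε| * M ^ 3 := by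
    refine le_trans ?_ h8
    rw [← h4.tsum_eq]
    refine tsum_of_norm_bounded h10 fun n => ?_
    rw [← (h5 n).tsum_eq]
    exact tsum_of_norm_bounded (h9.summable.prod_factor n).hasSum (h6 n)
  rw [h2, ← Complex.ofReal_sub, Complex.norm_real] at h11
  exact h11

end limit

end DiagonalPerturbation

namespace DiagonalPerturbation

open Filter Topology Asymptotics

attribute [local instance] InnerProductSpace.toInner

/-! ### Bounds for the second-order remainder -/

variable {I J : Type} {μ : I → ℝ} {b : I → I → ℂ} {M : ℝ}

theorem tendsto_abs_of_summable_exp (hμ : ∀ s : ℝ, 0 < s → Summable fun k => Real.exp (-s * μ k ^ 2)) :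
    Tendsto (fun k => |μ k|) cofinite atTop := by
  have h1 := (hμ 1 one_pos).tendsto_cofinite_zero
  have h2 : Tendsto (fun k => -(1 : ℝ) * μ k ^ 2) cofinite atBot := Real.tendsto_exp_comp_nhds_zero.mp h1
  have h3 : Tendsto (fun k => μ k ^ 2) cofinite atTop := by
    convert! tendsto_neg_atBot_atTop.comp h2 using 2 with k
    simp
  convert! Real.tendsto_sqrt_atTop.comp h3 using 2 with k
  exact (Real.sqrt_sq_eq_abs _).symm

theorem IsKernel.sq_le (hb : IsKernel b M) (k j : I) : ‖b k j‖ ^ 2 ≤ M * ‖b k j‖ := by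
  have h1 : ‖b k j‖ ≤ M := ((hb.summable k).le_tsum j fun _ _ => norm_nonneg _).trans (hb.bound k)
  nlinarith [norm_nonneg (b k j)]

theorem IsKernel.summable_sq (hb : IsKernel b M) (k : I) : Summable fun j => ‖b k j‖ ^ 2 :=
  Summable.of_nonneg_of_le (fun j => by positivity) (hb.sq_le k) ((hb.summable k).mul_left M)

theorem IsKernel.tsum_sq_le (hb : IsKernel b M) (k : I) : ∑' j, ‖b k j‖ ^ 2 ≤ M ^ 2 := by
  refine ((hb.summable_sq k).tsum_le_tsum (hb.sq_le k) ((hb.summable k).mul_left M)).trans ?_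
  rw [tsum_mul_left, sq]
  exact mul_le_mul_of_nonneg_left (hb.bound k) hb.pos.le

theorem IsKernel.summable_sq_mul (hb : IsKernel b M) {a : I → ℝ} (ha : ∀ k, 0 ≤ a k)
    (hs : Summable a) : Summable fun p : I × I => ‖b p.1 p.2‖ ^ 2 * a p.1 := by
  have h0 : ∀ k, 0 ≤ ∑' j, ‖b k j‖ ^ 2 := fun k => tsum_nonneg fun j => by positivity
  have h1 : Summable fun k => (∑' j, ‖b k j‖ ^ 2) * a k :=
    Summable.of_nonneg_of_le (fun k => mul_nonneg (h0 k) (ha k))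
      (fun k => mul_le_mul_of_nonneg_right (hb.tsum_sq_le k) (ha k)) (hs.mul_left (M ^ 2))
  have h2 : HasSum (fun p : I × I => ‖b p.1 p.2‖ ^ 2 * a p.1) _ :=
    hasSum_prod_of_nonneg (fun p => mul_nonneg (by positivity) (ha _))
      (fun k => (hb.summable_sq k).hasSum.mul_right (a k)) h1.hasSum
  exact h2.summable

theorem IsKernel.summable_sq_mul' (hb : IsKernel b M) {a : I → ℝ} (ha : ∀ k, 0 ≤ a k)
    (hs : Summable a) : Summable fun p : I × I => ‖b p.1 p.2‖ ^ 2 * a p.2 := by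
  convert! (Equiv.prodComm I I).summable_iff.mpr (hb.summable_sq_mul ha hs) using 2 with p
  show _ = ‖b p.2 p.1‖ ^ 2 * a p.2
  rw [hb.herm p.1 p.2, RCLike.norm_conj]

theorem IsKernel.summable_gaussDiff (hb : IsKernel b M) {t : ℝ} (ht : 0 < t)
    (hμ : ∀ s : ℝ, 0 < s → Summable fun k => Real.exp (-s * μ k ^ 2)) :
    Summable fun p : I × I => ‖b p.1 p.2‖ ^ 2 * gaussDiff t (μ p.2) (μ p.1) := by
  obtain ⟨C, hC0, hC⟩ := exists_gaussDiff_decay ht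
  have h1 := hb.summable_sq_mul (fun k => (Real.exp_pos (-(t / 8) * μ k ^ 2)).le) (hμ _ (by positivity))
  have h2 := hb.summable_sq_mul' (fun k => (gauss_pos t (μ k)).le) (hμ t ht)
  refine Summable.of_norm_bounded ((h1.add h2).mul_left C) fun p => ?_
  rw [norm_mul, Real.norm_eq_abs, Real.norm_eq_abs, abs_of_nonneg (by positivity)]
  have h3 := hC (μ p.2) (μ p.1)
  have h4 : (1 + μ p.1 ^ 2)⁻¹ ≤ 1 := inv_le_one_of_one_le₀ (by nlinarith [sq_nonneg (μ p.1)])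
  have h5 := gauss_pos t (μ p.2)
  calc _ ≤ ‖b p.1 p.2‖ ^ 2 * (C * (Real.exp (-(t / 8) * μ p.1 ^ 2) + gauss t (μ p.2) * 1)) := by
        refine mul_le_mul_of_nonneg_left (h3.trans ?_) (by positivity)
        gcongr
    _ = _ := by ring

section remainder

/-- The trace of `B f(D) B` is at most `M²` times the trace of `f(D)`. -/
theorem IsKernel.hasSum_op_gauss (hb : IsKernel b M) (ψ : HilbertBasis J ℂ (Seq I)) {a : J → ℝ}
    (ha0 : ∀ n, 0 ≤ a n) (ha : Summable a) :
    (∀ k, Summable fun n => ‖hb.op (ψ n) k‖ ^ 2 * a n) ∧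
    (Summable fun k => ∑' n, ‖hb.op (ψ n) k‖ ^ 2 * a n) ∧
      ∑' k, ∑' n, ‖hb.op (ψ n) k‖ ^ 2 * a n ≤ M ^ 2 * ∑' n, a n := by
  have hn : ∀ n, ‖hb.op (ψ n)‖ ≤ M := fun n => by
    refine (hb.op.le_opNorm _).trans ?_
    rw [norm_basis_sq, mul_one]
    exact hb.norm_op_le
  have h0 : ∀ n, ‖hb.op (ψ n)‖ ^ 2 * a n ≤ M ^ 2 * a n := fun n => by
    have := hn n
    have := ha0 n
    gcongr
  have h1 : Summable fun n => ‖hb.op (ψ n)‖ ^ 2 * a n :=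
    Summable.of_nonneg_of_le (fun n => mul_nonneg (by positivity) (ha0 n)) h0 (ha.mul_left _)
  have h2 : HasSum (fun p : J × I => ‖hb.op (ψ p.1) p.2‖ ^ 2 * a p.1) _ :=
    hasSum_prod_of_nonneg (fun p => mul_nonneg (by positivity) (ha0 _))
      (fun n => (hasSum_norm_sq (hb.op (ψ n))).mul_right (a n)) h1.hasSum
  have h3 := (Equiv.prodComm I J).hasSum_iff.mpr h2
  have h4 : HasSum (fun k => ∑' n, ‖hb.op (ψ n) k‖ ^ 2 * a n) _ :=
    h3.prod_fiberwise fun k => (h3.summable.prod_factor k).hasSum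
  refine ⟨fun k => h3.summable.prod_factor k, h4.summable, ?_⟩
  rw [h4.tsum_eq, ← tsum_mul_left]
  exact h1.tsum_le_tsum h0 (ha.mul_left _)

/-- The summand of the remainder at `k` is small for large `μ k`, uniformly in the perturbation. -/
theorem IsKernel.abs_remainder_le (hb : IsKernel b M) {t : ℝ} (ψ : HilbertBasis J ℂ (Seq I))
    {lam : J → ℝ} {C : ℝ} (hC0 : 0 ≤ C)
    (hC : ∀ x y, |gaussDiff t x y| ≤ C * (Real.exp (-(t / 8) * y ^ 2) + gauss t x * (1 + y ^ 2)⁻¹))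
    (hlam : Summable fun n => gauss t (lam n)) (k : I) :
    |∑' n, ‖hb.op (ψ n) k‖ ^ 2 * gaussDiff t (lam n) (μ k)|
      ≤ C * (M ^ 2 * Real.exp (-(t / 8) * μ k ^ 2)
        + (1 + μ k ^ 2)⁻¹ * ∑' n, ‖hb.op (ψ n) k‖ ^ 2 * gauss t (lam n)) := by
  classical
  have h1 := (hb.hasSum_op_gauss ψ (fun n => (gauss_pos t (lam n)).le) hlam).1 k
  have h2 := hasSum_op_coord_sq ψ hb.op_symm k
  have h3 := ((h2.mul_right (Real.exp (-(t / 8) * μ k ^ 2))).add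
    (h1.hasSum.mul_left ((1 + μ k ^ 2)⁻¹))).mul_left C
  rw [← Real.norm_eq_abs]
  refine (tsum_of_norm_bounded h3 fun n => ?_).trans ?_
  · rw [norm_mul, Real.norm_eq_abs, Real.norm_eq_abs, abs_of_nonneg (by positivity)]
    refine (mul_le_mul_of_nonneg_left (hC (lam n) (μ k)) (by positivity)).trans_eq ?_
    ring
  · have := norm_op_single_le hb.norm_op_le k
    gcongr

end remainder

end DiagonalPerturbation

namespace DiagonalPerturbation

open Filter Topology Asymptotics

attribute [local instance] InnerProductSpace.toInner

/-! ### The expansion of the heat trace -/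

variable {I : Type} {μ : I → ℝ} {b : I → I → ℂ} {M : ℝ}

theorem summable_gauss' {t : ℝ} (ht : 0 < t)
    (hμ : ∀ s : ℝ, 0 < s → Summable fun k => Real.exp (-s * μ k ^ 2)) :
    Summable fun k => |gauss' t (μ k)| := by
  refine Summable.of_nonneg_of_le (fun k => abs_nonneg _) (fun k => ?_)
    ((hμ (t / 2) (by positivity)).mul_left (2 * t + 4))
  rw [gauss', abs_mul, abs_of_pos (Real.exp_pos _)]
  have h1 : Real.exp (-t * μ k ^ 2) = Real.exp (-(t / 2 * μ k ^ 2)) * Real.exp (-(t / 2) * μ k ^ 2) := by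
    rw [← Real.exp_add]
    ring_nf
  have h2 : |-2 * t * μ k| ≤ 2 * t + 4 * (t / 2 * μ k ^ 2) := by
    rw [abs_mul, abs_mul, abs_of_pos ht, abs_neg, abs_two]
    have : |μ k| ≤ 1 + μ k ^ 2 := by
      rw [← sq_abs]
      nlinarith [abs_nonneg (μ k), sq_nonneg (|μ k| - 1)]
    nlinarith
  have h3 := mul_exp_neg_le_one (t / 2 * μ k ^ 2)
  have h4 : Real.exp (-(t / 2 * μ k ^ 2)) ≤ 1 := by
    rw [Real.exp_le_one_iff, neg_nonpos]
    positivity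
  rw [h1, ← mul_assoc]
  refine mul_le_mul_of_nonneg_right ?_ (Real.exp_pos _).le
  calc _ ≤ (2 * t + 4 * (t / 2 * μ k ^ 2)) * Real.exp (-(t / 2 * μ k ^ 2)) := by gcongr
    _ = 2 * t * Real.exp (-(t / 2 * μ k ^ 2))
        + 4 * (t / 2 * μ k ^ 2 * Real.exp (-(t / 2 * μ k ^ 2))) := by ring
    _ ≤ 2 * t * 1 + 4 * 1 := by gcongr
    _ = _ := by ring

/-- The second-order remainder of the trace formula is continuous in the perturbation at zero. -/
theorem IsKernel.tendsto_remainder (hb : IsKernel b M) {t : ℝ} (ht : 0 < t)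
    (hμ : ∀ s : ℝ, 0 < s → Summable fun k => Real.exp (-s * μ k ^ 2)) {J : ℝ → Type}
    (ψ : ∀ ε, HilbertBasis (J ε) ℂ (Seq I)) (lam : ∀ ε, J ε → ℝ)
    (h : ∀ (ε : ℝ) n, IsEig μ ((ε : ℂ) • hb.op) (lam ε n) (ψ ε n)) :
    Tendsto (fun ε => ∑' k, ∑' n, ‖hb.op (ψ ε n) k‖ ^ 2 * gaussDiff t (lam ε n) (μ k)) (𝓝 0)
      (𝓝 (∑' k, ∑' j, ‖b k j‖ ^ 2 * gaussDiff t (μ j) (μ k))) := by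
  obtain ⟨L, hL0, hL⟩ := exists_lipschitz_gaussDiff ht
  obtain ⟨C, hC0, hC⟩ := exists_gaussDiff_decay ht
  have hM := hb.pos
  set T := Real.exp (t * M ^ 2) * ∑' k, Real.exp (-(t / 2) * μ k ^ 2) with hT
  have hT0 : 0 ≤ T := mul_nonneg (Real.exp_pos _).le (tsum_nonneg fun k => (Real.exp_pos _).le)
  have htr : ∀ ε : ℝ, |ε| ≤ 1 → (Summable fun n => gauss t (lam ε n)) ∧
      ∑' n, gauss t (lam ε n) ≤ T := fun ε hε => by
    refine summable_exp_eigenvalue (ψ ε) ?_ (h ε) ht (hμ _ (by positivity))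
    rw [norm_smul, Complex.norm_real, Real.norm_eq_abs]
    calc |ε| * ‖hb.op‖ ≤ 1 * M := mul_le_mul hε hb.norm_op_le (norm_nonneg _) zero_le_one
      _ = M := one_mul M
  set e : I → ℝ := fun k => Real.exp (-(t / 8) * μ k ^ 2) with he
  have hes : Summable e := hμ _ (by positivity)
  set ρ₀ : I → ℝ := fun k => ∑' j, ‖b k j‖ ^ 2 * gaussDiff t (μ j) (μ k) with hρ₀
  have hρ₀s : Summable fun k => |ρ₀ k| := by
    have h1 := (hb.summable_gaussDiff ht hμ).abs
    have h2 := h1.prod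
    refine Summable.of_nonneg_of_le (fun k => abs_nonneg _) (fun k => ?_) h2
    have h3 := h1.prod_factor k
    simp only [← Real.norm_eq_abs] at h3 ⊢
    exact norm_tsum_le_tsum_norm h3
  set ρ : ℝ → I → ℝ := fun ε k => ∑' n, ‖hb.op (ψ ε n) k‖ ^ 2 * gaussDiff t (lam ε n) (μ k) with hρ
  set τ : ℝ → I → ℝ := fun ε k => ∑' n, ‖hb.op (ψ ε n) k‖ ^ 2 * gauss t (lam ε n) with hτ
  have hτ0 : ∀ ε k, 0 ≤ τ ε k := fun ε k =>
    tsum_nonneg fun n => mul_nonneg (by positivity) (gauss_pos t _).le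
  have hτs : ∀ ε, |ε| ≤ 1 → Summable (τ ε) ∧ ∑' k, τ ε k ≤ M ^ 2 * T := fun ε hε => by
    have h1 := (hb.hasSum_op_gauss (ψ ε) (fun n => (gauss_pos t (lam ε n)).le) (htr ε hε).1).2
    refine ⟨h1.1, h1.2.trans ?_⟩
    have := (htr ε hε).2
    gcongr
  have hρle : ∀ ε, |ε| ≤ 1 → ∀ k, |ρ ε k| ≤ C * (M ^ 2 * e k + (1 + μ k ^ 2)⁻¹ * τ ε k) :=
    fun ε hε k => hb.abs_remainder_le (ψ ε) hC0 hC (htr ε hε).1 k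
  have hinv : ∀ k, (1 + μ k ^ 2)⁻¹ ≤ 1 := fun k =>
    inv_le_one_of_one_le₀ (by nlinarith [sq_nonneg (μ k)])
  have hρs : ∀ ε, |ε| ≤ 1 → Summable fun k => |ρ ε k| := fun ε hε => by
    refine Summable.of_nonneg_of_le (fun k => abs_nonneg _) (fun k => (hρle ε hε k).trans ?_)
      (((hes.mul_left (M ^ 2)).add (hτs ε hε).1).mul_left C)
    have := hinv k
    have := hτ0 ε k
    refine mul_le_mul_of_nonneg_left (add_le_add_right ?_ _) hC0
    exact mul_le_of_le_one_left (hτ0 ε k) (hinv k)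
  have hdiff : ∀ ε k, |ρ ε k - ρ₀ k| ≤ L * |ε| * M ^ 3 := fun ε k =>
    hb.abs_spectral_sub_le (ψ ε) (h ε) hL0 (fun x y => hL x y (μ k))
      (fun x => abs_gaussDiff_le ht x (μ k)) k
  rw [Metric.tendsto_nhds]
  intro η hη
  -- a finite set of momenta outside of which everything is small, uniformly in `ε`
  set δ := η / (5 * (C * (M ^ 2 * T) + 1)) with hδ
  have hδ0 : 0 < δ := by positivity
  have hδ1 : C * (δ * (M ^ 2 * T)) ≤ η / 5 := by
    have e1 : C * (δ * (M ^ 2 * T)) = δ * (C * (M ^ 2 * T)) := by ring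
    have e2 : δ * (C * (M ^ 2 * T) + 1) = η / 5 := by rw [hδ]; field_simp
    nlinarith
  have hfin : {k | ¬ (1 + μ k ^ 2)⁻¹ ≤ δ}.Finite := by
    have h1 := tendsto_abs_of_summable_exp hμ
    have h2 := h1.eventually (eventually_ge_atTop (δ⁻¹ + 1))
    refine h2.mono fun k hk => ?_
    show (1 + μ k ^ 2)⁻¹ ≤ δ
    rw [inv_le_comm₀ (by positivity) hδ0, ← sq_abs]
    have : 0 < δ⁻¹ := by positivity
    nlinarith
  have hev1 : ∀ᶠ s : Finset I in atTop, C * (M ^ 2 * ∑' k : {x // x ∉ s}, e k) < η / 5 := by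
    have h1 := ((tendsto_tsum_compl_atTop_zero e).const_mul (M ^ 2)).const_mul C
    rw [mul_zero, mul_zero] at h1
    exact h1.eventually (gt_mem_nhds (by positivity))
  have hev2 : ∀ᶠ s : Finset I in atTop, ∑' k : {x // x ∉ s}, |ρ₀ k| < η / 5 :=
    (tendsto_tsum_compl_atTop_zero fun k => |ρ₀ k|).eventually (gt_mem_nhds (by positivity))
  obtain ⟨s, ⟨hs1, hs2⟩, hs3⟩ := ((hev1.and hev2).and (eventually_ge_atTop hfin.toFinset)).exists
  have hs4 : ∀ k : {x // x ∉ s}, (1 + μ k ^ 2)⁻¹ ≤ δ := fun k => by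
    by_contra hk
    exact k.2 (hs3 (hfin.mem_toFinset.mpr hk))
  have hsmall : ∀ᶠ ε : ℝ in 𝓝 0, |ε| ≤ 1 ∧ (s.card : ℝ) * (L * |ε| * M ^ 3) < η / 5 := by
    have h1 : Tendsto (fun ε : ℝ => |ε|) (𝓝 0) (𝓝 0) := by
      simpa using (continuous_abs (G := ℝ)).tendsto 0
    have h2 : Tendsto (fun ε : ℝ => (s.card : ℝ) * (L * |ε| * M ^ 3)) (𝓝 0) (𝓝 0) := by
      have := ((h1.const_mul L).mul_const (M ^ 3)).const_mul (s.card : ℝ)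
      simpa using this
    filter_upwards [h1.eventually (gt_mem_nhds one_pos),
      h2.eventually (gt_mem_nhds (by positivity : 0 < η / 5))] with ε a1 a2
    exact ⟨a1.le, a2⟩
  filter_upwards [hsmall] with ε hε
  have hρs' := hρs ε hε.1
  have e1 : ∑' k, ρ ε k - ∑' k, ρ₀ k = ∑' k, (ρ ε k - ρ₀ k) :=
    (hρs'.of_abs.tsum_sub hρ₀s.of_abs).symm
  have hds : Summable fun k => |ρ ε k - ρ₀ k| :=
    Summable.of_nonneg_of_le (fun k => abs_nonneg _) (fun k => abs_sub _ _) (hρs'.add hρ₀s)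
  have e2 : |∑' k, (ρ ε k - ρ₀ k)| ≤ ∑' k, |ρ ε k - ρ₀ k| := by
    simp only [← Real.norm_eq_abs] at hds ⊢
    exact norm_tsum_le_tsum_norm hds
  have e3 := hds.sum_add_tsum_subtype_compl s
  have e4 : ∑ k ∈ s, |ρ ε k - ρ₀ k| ≤ s.card * (L * |ε| * M ^ 3) := by
    rw [← nsmul_eq_mul]
    exact Finset.sum_le_card_nsmul _ _ _ fun k _ => hdiff ε k
  have c1 : Summable fun k : {x // x ∉ s} => |ρ ε k| := hρs'.subtype _
  have c2 : Summable fun k : {x // x ∉ s} => |ρ₀ k| := hρ₀s.subtype _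
  have c3 : Summable fun k : {x // x ∉ s} => e k := hes.subtype _
  have c4 : Summable fun k : {x // x ∉ s} => τ ε k := (hτs ε hε.1).1.subtype _
  have e5 : ∑' k : {x // x ∉ s}, |ρ ε k - ρ₀ k|
      ≤ ∑' k : {x // x ∉ s}, |ρ ε k| + ∑' k : {x // x ∉ s}, |ρ₀ k| := by
    rw [← c1.tsum_add c2]
    exact (hds.subtype _).tsum_le_tsum (fun k => abs_sub _ _) (c1.add c2)
  have e6 : ∑' k : {x // x ∉ s}, |ρ ε k|
      ≤ C * (M ^ 2 * ∑' k : {x // x ∉ s}, e k + δ * ∑' k : {x // x ∉ s}, τ ε k) := by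
    rw [← tsum_mul_left, ← tsum_mul_left, ← (c3.mul_left _).tsum_add (c4.mul_left _),
      ← tsum_mul_left]
    refine c1.tsum_le_tsum (fun k => (hρle ε hε.1 k).trans ?_)
      (((c3.mul_left _).add (c4.mul_left _)).mul_left C)
    exact mul_le_mul_of_nonneg_left (add_le_add_right
      (mul_le_mul_of_nonneg_right (hs4 k) (hτ0 ε k)) _) hC0
  have e7 : ∑' k : {x // x ∉ s}, τ ε k ≤ M ^ 2 * T :=
    (Summable.tsum_subtype_le (τ ε) {x | x ∉ s} (hτ0 ε) (hτs ε hε.1).1).trans (hτs ε hε.1).2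
  have e8 : C * (δ * ∑' k : {x // x ∉ s}, τ ε k) ≤ η / 5 :=
    (mul_le_mul_of_nonneg_left (mul_le_mul_of_nonneg_left e7 hδ0.le) hC0).trans hδ1
  rw [Real.dist_eq, e1]
  rw [mul_add] at e6
  have := hε.2
  linarith

/-- Second-order perturbation theory for the Gaussian trace of `diag μ + ε B`. -/
theorem IsKernel.trace_expansion [DecidableEq I] (hb : IsKernel b M) {t : ℝ} (ht : 0 < t)
    (hμ : ∀ s : ℝ, 0 < s → Summable fun k => Real.exp (-s * μ k ^ 2)) {J : ℝ → Type}
    (ψ : ∀ ε, HilbertBasis (J ε) ℂ (Seq I)) (lam : ∀ ε, J ε → ℝ)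
    (h : ∀ (ε : ℝ) n, IsEig μ ((ε : ℂ) • hb.op) (lam ε n) (ψ ε n)) :
    (fun ε : ℝ => ∑' n, gauss t (lam ε n) - ∑' k, gauss t (μ k)
        - ε * ∑' k, gauss' t (μ k) * (b k k).re
        - ε ^ 2 * ∑' p : I × I, ‖b p.1 p.2‖ ^ 2 * gaussDiff t (μ p.2) (μ p.1))
      =o[𝓝 0] fun ε : ℝ => ε ^ 2 := by
  have h1 := hb.tendsto_remainder ht hμ ψ lam h
  rw [← (hb.summable_gaussDiff ht hμ).tsum_prod] at h1
  have h2 := (isBigO_refl (fun ε : ℝ => ε ^ 2) (𝓝 0)).mul_isLittleO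
    ((isLittleO_one_iff ℝ).mpr (tendsto_sub_nhds_zero_iff.mpr h1))
  simp only [mul_one] at h2
  refine h2.congr_left fun ε => ?_
  have htr : Summable fun n => gauss t (lam ε n) :=
    (summable_exp_eigenvalue (ψ ε) le_rfl (h ε) ht (hμ _ (by positivity))).1
  have h3 := hasSum_second_order (ψ ε) hb.op_symm (h ε) htr (hμ t ht) (summable_gauss' ht hμ)
  simp only [hb.op_single] at h3
  rw [← h3.tsum_eq, h3.summable.tsum_prod]
  simp_rw [tsum_mul_left]
  ring

end DiagonalPerturbation

namespace DiagonalPerturbation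

open Filter Topology

attribute [local instance] InnerProductSpace.toInner

/-! ### Operators modelled on a perturbed diagonal operator -/

/-- `T` identifies the operator `D` on `V` with `diag μ + B` on a subspace of `ℓ²(I)` that contains
all eigenvectors of the latter. -/
structure IsModel {I V : Type} [AddCommGroup V] [Module ℂ V] (D : Module.End ℂ V) (μ : I → ℝ)
    (B : Seq I →L[ℂ] Seq I) (T : V →ₗ[ℂ] Seq I) : Prop where
  injective : Function.Injective T
  apply_eq : ∀ v i, T (D v) i = (μ i : ℂ) * T v i + B (T v) i
  exists_of_isEig : ∀ lam w, IsEig μ B lam w → ∃ v, T v = w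

namespace IsModel

variable {I J V : Type} [AddCommGroup V] [Module ℂ V] {D : Module.End ℂ V} {μ : I → ℝ}
  {B : Seq I →L[ℂ] Seq I} {T : V →ₗ[ℂ] Seq I}

theorem inner_apply (hB : ∀ x y, inner ℂ (B x) y = inner ℂ x (B y)) (hT : IsModel D μ B T)
    {lam : ℝ} {w : Seq I} (hw : IsEig μ B lam w) (v : V) :
    inner ℂ w (T (D v)) = (lam : ℂ) * inner ℂ w (T v) := by
  have h := inner_eq_of_relations hB (v := (lam : ℂ) • w) (w := w) (v' := T (D v)) (w' := T v) hw
    fun i => (hT.apply_eq v i).symm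
  rw [inner_smul_left, Complex.conj_ofReal] at h
  exact h.symm

theorem finite_fiber {lam : J → ℝ} {t : ℝ} (hs : Summable fun n => gauss t (lam n)) (x : ℝ) :
    Finite {n // lam n ^ 2 = x} := by
  have h1 := hs.comp_injective (i := fun n : {n // lam n ^ 2 = x} => n.1) Subtype.val_injective
  have h2 : Summable fun _ : {n // lam n ^ 2 = x} => Real.exp (-t * x) := by
    convert! h1 using 2 with n
    rw [Function.comp_apply, gauss, n.2]
  by_contra hinf
  rw [not_finite_iff_infinite] at hinf
  exact (Real.exp_pos (-t * x)).ne' ((summable_const_iff _).mp h2)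

/-- The eigenspaces of `D²` are spanned by eigenvectors from an eigenbasis of the model. -/
theorem finrank_eigenspace (hB : ∀ x y, inner ℂ (B x) y = inner ℂ x (B y)) (hT : IsModel D μ B T)
    (ψ : HilbertBasis J ℂ (Seq I)) {lam : J → ℝ} (h : ∀ n, IsEig μ B (lam n) (ψ n)) (x : ℝ)
    [Finite {n // lam n ^ 2 = x}] :
    FiniteDimensional ℂ (Module.End.eigenspace (D ^ 2) (x : ℂ)) ∧
      TorusAction.mult D x = Nat.card {n // lam n ^ 2 = x} := by
  have := Fintype.ofFinite {n // lam n ^ 2 = x}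
  choose u hu using fun n => hT.exists_of_isEig (lam n) (ψ n) (h n)
  have hDu : ∀ n, D (u n) = (lam n : ℂ) • u n := fun n => by
    apply hT.injective
    ext i
    rw [hT.apply_eq, map_smul, hu]
    exact h n i
  have hli : LinearIndependent ℂ fun n : {n // lam n ^ 2 = x} => u n := by
    apply LinearIndependent.of_comp T
    have h1 := ψ.orthonormal.linearIndependent.comp (fun n : {n // lam n ^ 2 = x} => n.1)
      Subtype.val_injective
    convert! h1 using 1
    funext n
    exact hu _
  have hspan : Module.End.eigenspace (D ^ 2) (x : ℂ)
      = Submodule.span ℂ (Set.range fun n : {n // lam n ^ 2 = x} => u n) := by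
    apply le_antisymm
    · intro v hv
      rw [Module.End.mem_eigenspace_iff] at hv
      have h1 : ∀ n, lam n ^ 2 ≠ x → inner ℂ (ψ n) (T v) = (0 : ℂ) := fun n hn => by
        have e1 := hT.inner_apply hB (h n) (D v)
        rw [hT.inner_apply hB (h n) v] at e1
        have e2 : D (D v) = (x : ℂ) • v := by rw [← hv, pow_two]; rfl
        rw [e2, map_smul, inner_smul_right] at e1
        have e3 : ((lam n : ℂ) ^ 2 - x) * inner ℂ (ψ n) (T v) = 0 := by linear_combination -e1
        rcases mul_eq_zero.mp e3 with e4 | e4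
        · exact absurd (by exact_mod_cast sub_eq_zero.mp e4) hn
        · exact e4
      have h2 : HasSum (fun n => (inner ℂ (ψ n) (T v) : ℂ) • ψ n) (T v) := by
        simpa only [HilbertBasis.repr_apply_apply] using ψ.hasSum_repr (T v)
      have h3 : HasSum (fun n => (inner ℂ (ψ n) (T v) : ℂ) • ψ n)
          (∑ n : {n // lam n ^ 2 = x}, (inner ℂ (ψ n) (T v) : ℂ) • ψ n) := by
        have := hasSum_fintype fun n : {n // lam n ^ 2 = x} => (inner ℂ (ψ n) (T v) : ℂ) • ψ n
        refine (hasSum_subtype_iff_of_support_subset (s := {n | lam n ^ 2 = x}) ?_).mp this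
        intro n hn
        by_contra hne
        exact hn (by
          show (inner ℂ (ψ n) (T v) : ℂ) • ψ n = 0
          rw [h1 n hne, zero_smul])
      have h4 : v = ∑ n : {n // lam n ^ 2 = x}, (inner ℂ (ψ n) (T v) : ℂ) • u n := by
        apply hT.injective
        rw [map_sum, h2.unique h3]
        refine Finset.sum_congr rfl fun n _ => ?_
        rw [map_smul, hu, ← h2.unique h3]
      rw [h4]
      exact Submodule.sum_mem _ fun n _ => Submodule.smul_mem _ _ (Submodule.subset_span ⟨n, rfl⟩)
    · rw [Submodule.span_le]
      rintro _ ⟨n, rfl⟩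
      show u n ∈ Module.End.eigenspace (D ^ 2) (x : ℂ)
      have e : (x : ℂ) = (lam n : ℂ) * lam n := by
        rw [← pow_two]
        exact_mod_cast n.2.symm
      rw [Module.End.mem_eigenspace_iff, pow_two, Module.End.mul_apply, hDu, map_smul, hDu,
        smul_smul, e]
  constructor
  · rw [hspan]
    exact FiniteDimensional.span_of_finite ℂ (Set.finite_range _)
  · rw [TorusAction.mult, hspan, finrank_span_eq_card hli, Nat.card_eq_fintype_card]

/-- The heat trace of `D²` is the sum of `e^{-λ²/Λ²}` over an eigenbasis of the model. -/
theorem spectralAction_eq (hB : ∀ x y, inner ℂ (B x) y = inner ℂ x (B y)) (hT : IsModel D μ B T)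
    (ψ : HilbertBasis J ℂ (Seq I)) {lam : J → ℝ} (h : ∀ n, IsEig μ B (lam n) (ψ n)) {Λ : ℝ}
    (hs : Summable fun n => gauss (Λ ^ 2)⁻¹ (lam n)) :
    TorusAction.IsTraceClassAction D TorusAction.fExp Λ ∧
      TorusAction.spectralAction D TorusAction.fExp Λ = ∑' n, gauss (Λ ^ 2)⁻¹ (lam n) := by
  have hfin := finite_fiber hs
  have hm := fun x => hT.finrank_eigenspace hB ψ h x
  have h1 := (Equiv.sigmaFiberEquiv fun n => lam n ^ 2).hasSum_iff.mpr hs.hasSum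
  have h2 : HasSum (fun x : ℝ => (TorusAction.mult D x : ℝ) * TorusAction.fExp (x / Λ ^ 2))
      (∑' n, gauss (Λ ^ 2)⁻¹ (lam n)) := by
    refine h1.sigma fun x => ?_
    have := Fintype.ofFinite {n // lam n ^ 2 = x}
    have h3 := hasSum_fintype fun n : {n // lam n ^ 2 = x} => gauss (Λ ^ 2)⁻¹ (lam n)
    have h4 : ∀ n : {n // lam n ^ 2 = x}, gauss (Λ ^ 2)⁻¹ (lam n) = TorusAction.fExp (x / Λ ^ 2) :=
      fun n => by
        rw [gauss, TorusAction.fExp, n.2]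
        ring_nf
    rw [Finset.sum_congr rfl fun n _ => h4 n, Finset.sum_const, nsmul_eq_mul, Finset.card_univ,
      ← Nat.card_eq_fintype_card, ← (hm x).2] at h3
    exact h3
  exact ⟨⟨fun x _ => (hm x).1, h2.summable⟩, h2.tsum_eq⟩

end IsModel

/-- Second-order expansion of the spectral action of a family of operators modelled on
`diag μ + ε B`. -/
theorem IsKernel.spectralAction_expansion {I V : Type} [AddCommGroup V] [Module ℂ V]
    {μ : I → ℝ} {b : I → I → ℂ} {M : ℝ} (hb : IsKernel b M) {Λ : ℝ} (hΛ : 0 < Λ)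
    (hμ : ∀ s : ℝ, 0 < s → Summable fun k => Real.exp (-s * μ k ^ 2))
    {D : ℝ → Module.End ℂ V} {T : V →ₗ[ℂ] Seq I}
    (hT : ∀ ε : ℝ, IsModel (D ε) μ ((ε : ℂ) • hb.op) T) :
    (∀ ε, TorusAction.IsTraceClassAction (D ε) TorusAction.fExp Λ) ∧
    (fun ε : ℝ => TorusAction.spectralAction (D ε) TorusAction.fExp Λ
        - TorusAction.spectralAction (D 0) TorusAction.fExp Λ
        - ε * ∑' k, gauss' (Λ ^ 2)⁻¹ (μ k) * (b k k).re
        - ε ^ 2 * ∑' p : I × I, ‖b p.1 p.2‖ ^ 2 * gaussDiff (Λ ^ 2)⁻¹ (μ p.2) (μ p.1))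
      =o[𝓝 0] fun ε : ℝ => ε ^ 2 := by
  classical
  have ht : 0 < (Λ ^ 2)⁻¹ := by positivity
  have hB : ∀ ε : ℝ, ∀ x y, inner ℂ (((ε : ℂ) • hb.op) x) y = inner ℂ x (((ε : ℂ) • hb.op) y) :=
    fun ε x y => by
      show inner ℂ ((ε : ℂ) • hb.op x) y = inner ℂ x ((ε : ℂ) • hb.op y)
      rw [inner_smul_left, inner_smul_right, Complex.conj_ofReal, hb.op_symm]
  choose J ψ lam h using fun ε => exists_eigenbasis (tendsto_abs_of_summable_exp hμ) (hB ε)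
  have htr : ∀ ε, Summable fun n => gauss (Λ ^ 2)⁻¹ (lam ε n) := fun ε =>
    (summable_exp_eigenvalue (ψ ε) le_rfl (h ε) ht (hμ _ (by positivity))).1
  have h1 := fun ε => (hT ε).spectralAction_eq (hB ε) (ψ ε) (h ε) (htr ε)
  refine ⟨fun ε => (h1 ε).1, ?_⟩
  have h0 : ∑' n, gauss (Λ ^ 2)⁻¹ (lam 0 n) = ∑' k, gauss (Λ ^ 2)⁻¹ (μ k) := by
    have h3 := hasSum_second_order (ψ 0) hb.op_symm (h 0) (htr 0) (hμ _ ht) (summable_gauss' ht hμ)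
    simp only [ne_eq, OfNat.ofNat_ne_zero, not_false_eq_true, zero_pow, zero_mul, sub_zero] at h3
    linarith [hasSum_zero.unique h3]
  refine (hb.trace_expansion ht hμ ψ lam h).congr_left fun ε => ?_
  rw [(h1 ε).2, (h1 0).2, h0]

end DiagonalPerturbation

namespace LatticeGaussian

open Real Filter Topology

/-! ### Gaussian sums over the integers -/

theorem summable_pow_mul_exp_neg_mul_sq (k : ℕ) {b : ℝ} (hb : 0 < b) :
    Summable fun n : ℤ => |(n : ℝ)| ^ k * exp (-b * (n : ℝ) ^ 2) := by
  have h := summable_pow_mul_jacobiTheta₂_term_bound 0 (T := b / π) (by positivity) k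
  refine h.congr fun n => ?_
  rw [Int.cast_abs]
  congr 2
  field_simp
  ring

theorem exists_pow_mul_exp_le (k : ℕ) {ε : ℝ} (hε : 0 < ε) :
    ∃ C, 0 < C ∧ ∀ y, 0 ≤ y → y ^ k * exp (-ε * y) ≤ C := by
  refine ⟨k.factorial / ε ^ k, by positivity, fun y hy => ?_⟩
  have h := Real.pow_div_factorial_le_exp (ε * y) (by positivity) k
  rw [mul_pow, div_le_iff₀ (by positivity)] at h
  rw [neg_mul, exp_neg, ← div_eq_mul_inv, div_le_div_iff₀ (exp_pos _) (by positivity)]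
  linarith

/-- Powers of `1/t` are absorbed by the exponential. -/
theorem exists_inv_pow_mul_exp_le (k : ℕ) {c c' : ℝ} (h : c' < c) :
    ∃ C, 0 < C ∧ ∀ t : ℝ, 0 < t → t⁻¹ ^ k * exp (-c / t) ≤ C * exp (-c' / t) := by
  obtain ⟨C, hC, h1⟩ := exists_pow_mul_exp_le k (sub_pos.mpr h)
  refine ⟨C, hC, fun t ht => ?_⟩
  have h2 : exp (-c / t) = exp (-(c - c') * t⁻¹) * exp (-c' / t) := by
    rw [← exp_add]
    ring_nf
  rw [h2, ← mul_assoc]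
  exact mul_le_mul_of_nonneg_right (h1 _ (by positivity)) (exp_pos _).le

/-- The nonzero terms of the dual side of Poisson's formula are exponentially small. -/
theorem exists_tsum_dual_le (k : ℕ) {X : ℝ} (hX : 0 < X) :
    ∃ C, 0 < C ∧ ∀ x, 0 < x → x ≤ X →
      ∑' n : ℤ, (if n = 0 then 0 else |(n : ℝ)| ^ k * exp (-π * (n : ℝ) ^ 2 * (1 / x)))
        ≤ C * exp (-(π / 2) / x) ∧
      Summable fun n : ℤ => (if n = 0 then 0 else |(n : ℝ)| ^ k * exp (-π * (n : ℝ) ^ 2 * (1 / x))) := by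
  have hs := summable_pow_mul_exp_neg_mul_sq k (b := π / (2 * X)) (by positivity)
  refine ⟨∑' n : ℤ, |(n : ℝ)| ^ k * exp (-(π / (2 * X)) * (n : ℝ) ^ 2) + 1,
    add_pos_of_nonneg_of_pos (tsum_nonneg fun n => by positivity) one_pos, fun x hx hxX => ?_⟩
  have h1 : ∀ n : ℤ, (if n = 0 then 0 else |(n : ℝ)| ^ k * exp (-π * (n : ℝ) ^ 2 * (1 / x)))
      ≤ |(n : ℝ)| ^ k * exp (-(π / (2 * X)) * (n : ℝ) ^ 2) * exp (-(π / 2) / x) := fun n => by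
    split_ifs with hn
    · positivity
    · rw [mul_assoc (|(n : ℝ)| ^ k), ← exp_add]
      refine mul_le_mul_of_nonneg_left (exp_le_exp.mpr ?_) (by positivity)
      have h2 : (1 : ℝ) ≤ (n : ℝ) ^ 2 := by
        have : 0 < n ^ 2 := by positivity
        have : 1 ≤ n ^ 2 := by linarith
        exact_mod_cast this
      have h3 : π / (2 * X) ≤ π / (2 * x) := by gcongr
      have h4 : -π * (n : ℝ) ^ 2 * (1 / x)
        = -(π / (2 * x)) * (n : ℝ) ^ 2 - (π / (2 * x)) * (n : ℝ) ^ 2 := by field_simp; ring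
      have h5 : -(π / 2) / x = - (π / (2 * x)) := by field_simp
      have h6 : 0 < π / (2 * x) := by positivity
      rw [h4, h5]
      nlinarith
  have h0 : ∀ n : ℤ, 0 ≤ (if n = 0 then (0 : ℝ) else |(n : ℝ)| ^ k * exp (-π * (n : ℝ) ^ 2 * (1 / x))) :=
    fun n => by split_ifs <;> positivity
  have h2 := Summable.of_nonneg_of_le h0 h1 (hs.mul_right _)
  refine ⟨(h2.tsum_le_tsum h1 (hs.mul_right _)).trans ?_, h2⟩
  rw [tsum_mul_right]
  exact mul_le_mul_of_nonneg_right (by linarith) (exp_pos _).le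

theorem norm_cexp_two_pi (s : ℝ) (n : ℤ) : ‖Complex.exp (2 * π * Complex.I * s * n)‖ = 1 := by
  have : (2 * π * Complex.I * s * n : ℂ) = ((2 * π * s * n : ℝ) : ℂ) * Complex.I := by
    push_cast; ring
  rw [this, Complex.norm_exp_ofReal_mul_I]

theorem one_div_rpow_le {x a : ℝ} (hx : 0 < x) (ha : 0 ≤ a) (ha2 : a ≤ 2) :
    1 / x ^ a ≤ 1 + x⁻¹ ^ 2 := by
  rw [one_div, ← inv_rpow hx.le]
  have hy : 0 < x⁻¹ := by positivity
  rcases le_total x⁻¹ 1 with h | h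
  · have := rpow_le_one hy.le h ha
    nlinarith [sq_nonneg x⁻¹]
  · have := rpow_le_rpow_of_exponent_le h ha2
    rw [rpow_two] at this
    linarith

/-- Exponentially small dual sums, with a power of `1/x` in front. -/
theorem exists_rpow_mul_tsum_dual_le (k : ℕ) {X a : ℝ} (hX : 0 < X) (ha : 0 ≤ a) (ha2 : a ≤ 2) :
    ∃ C, 0 < C ∧ ∀ x, 0 < x → x ≤ X →
      1 / x ^ a * ∑' n : ℤ, (if n = 0 then 0 else |(n : ℝ)| ^ k * exp (-π * (n : ℝ) ^ 2 * (1 / x)))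
        ≤ C * exp (-1 / x) := by
  obtain ⟨C, hC, h⟩ := exists_tsum_dual_le k hX
  obtain ⟨C0, hC0, h0⟩ := exists_inv_pow_mul_exp_le 0 (c := π / 2) (c' := 1)
    (by linarith [pi_gt_three])
  obtain ⟨C2, hC2, h2⟩ := exists_inv_pow_mul_exp_le 2 (c := π / 2) (c' := 1)
    (by linarith [pi_gt_three])
  refine ⟨C * (C0 + C2), by positivity, fun x hx hxX => ?_⟩
  have e0 := h0 x hx
  have e2 := h2 x hx
  rw [pow_zero, one_mul] at e0
  calc _ ≤ (1 + x⁻¹ ^ 2) * (C * exp (-(π / 2) / x)) := by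
        refine mul_le_mul (one_div_rpow_le hx ha ha2) (h x hx hxX).1
          (tsum_nonneg fun n => by split_ifs <;> positivity) (by positivity)
    _ = C * (exp (-(π / 2) / x) + x⁻¹ ^ 2 * exp (-(π / 2) / x)) := by ring
    _ ≤ C * (C0 * exp (-1 / x) + C2 * exp (-1 / x)) := by gcongr
    _ = _ := by ring

/-- The zeroth moment, from the functional equation of the even Hurwitz kernel. -/
theorem exists_gaussian_zero {X : ℝ} (hX : 0 < X) : ∃ C, 0 < C ∧ ∀ x, 0 < x → x ≤ X → ∀ s : ℝ,
    ∃ S, HasSum (fun n : ℤ => exp (-π * (n + s) ^ 2 * x)) S ∧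
      |S - 1 / x ^ (1 / 2 : ℝ)| ≤ C * exp (-1 / x) := by
  obtain ⟨C, hC, h⟩ := exists_rpow_mul_tsum_dual_le 0 (a := 1 / 2) hX (by norm_num) (by norm_num)
  refine ⟨C, hC, fun x hx hxX s => ⟨_, HurwitzZeta.hasSum_int_evenKernel s hx, ?_⟩⟩
  refine le_trans ?_ (h x hx hxX)
  rw [HurwitzZeta.evenKernel_functional_equation]
  have hx' : 0 < 1 / x := by positivity
  have h1 := HurwitzZeta.hasSum_int_cosKernel s hx'
  have h2 := h1.sub (hasSum_ite_eq (0 : ℤ) (1 : ℂ))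
  obtain ⟨_, _, h4⟩ := exists_tsum_dual_le 0 hX
  have h3 := tsum_of_norm_bounded (f := fun n : ℤ => Complex.exp (2 * π * Complex.I * s * n)
    * (rexp (-π * n ^ 2 * (1 / x)) : ℂ) - (if n = 0 then (1 : ℂ) else 0))
    (h4 x hx hxX).2.hasSum fun n => by
      split_ifs with hn
      · simp [hn]
      · rw [sub_zero, norm_mul, norm_cexp_two_pi, Complex.norm_real, norm_of_nonneg (exp_pos _).le,
          pow_zero]
  rw [h2.tsum_eq] at h3
  have h5 : ‖(HurwitzZeta.cosKernel s (1 / x) : ℂ) - 1‖ = |HurwitzZeta.cosKernel s (1 / x) - 1| := by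
    rw [← Complex.ofReal_one, ← Complex.ofReal_sub, Complex.norm_real, norm_eq_abs]
  rw [h5] at h3
  have h6 : 0 ≤ 1 / x ^ (1 / 2 : ℝ) := by positivity
  rw [← mul_sub_one, abs_mul, abs_of_nonneg h6]
  exact mul_le_mul_of_nonneg_left h3 h6

/-- The first moment, from the functional equation of the odd Hurwitz kernel. -/
theorem exists_gaussian_one {X : ℝ} (hX : 0 < X) : ∃ C, 0 < C ∧ ∀ x, 0 < x → x ≤ X → ∀ s : ℝ,
    ∃ S, HasSum (fun n : ℤ => (n + s) * exp (-π * (n + s) ^ 2 * x)) S ∧ |S| ≤ C * exp (-1 / x) := by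
  obtain ⟨C, hC, h⟩ := exists_rpow_mul_tsum_dual_le 1 (a := 3 / 2) hX (by norm_num) (by norm_num)
  refine ⟨C, hC, fun x hx hxX s => ⟨_, HurwitzZeta.hasSum_int_oddKernel s hx, ?_⟩⟩
  refine le_trans ?_ (h x hx hxX)
  rw [HurwitzZeta.oddKernel_functional_equation]
  have hx' : 0 < 1 / x := by positivity
  have h1 := HurwitzZeta.hasSum_int_sinKernel s hx'
  obtain ⟨_, _, h4⟩ := exists_tsum_dual_le 1 hX
  have h3 := tsum_of_norm_bounded (f := fun n : ℤ => -Complex.I * n *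
    Complex.exp (2 * π * Complex.I * s * n) * (rexp (-π * n ^ 2 * (1 / x)) : ℂ))
    (h4 x hx hxX).2.hasSum fun n => by
      split_ifs with hn
      · simp [hn]
      · rw [norm_mul, norm_mul, norm_cexp_two_pi, Complex.norm_real, norm_of_nonneg (exp_pos _).le,
          pow_one]
        simp
  rw [h1.tsum_eq, Complex.norm_real, norm_eq_abs] at h3
  have h6 : 0 ≤ 1 / x ^ (3 / 2 : ℝ) := by positivity
  rw [abs_mul, abs_of_nonneg h6]
  exact mul_le_mul_of_nonneg_left h3 h6

theorem summable_sq_mul_gaussian {x : ℝ} (hx : 0 < x) (s : ℝ) :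
    Summable fun n : ℤ => ((n : ℝ) + s) ^ 2 * exp (-π * (n + s) ^ 2 * x) := by
  have h := (HurwitzZeta.hasSum_int_evenKernel s (half_pos hx)).summable
  refine Summable.of_nonneg_of_le (fun n => by positivity) (fun n => ?_) (h.mul_left (2 / (π * x)))
  have h1 : exp (-π * (n + s) ^ 2 * x)
      = exp (-(π * (n + s) ^ 2 * (x / 2))) * exp (-π * (n + s) ^ 2 * (x / 2)) := by
    rw [← exp_add]
    ring_nf
  rw [h1, ← mul_assoc]
  refine mul_le_mul_of_nonneg_right ?_ (exp_pos _).le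
  have h2 := Real.add_one_le_exp (π * (n + s) ^ 2 * (x / 2))
  rw [exp_neg, ← div_eq_mul_inv, div_le_div_iff₀ (exp_pos _) (by positivity)]
  nlinarith

/-- Differentiating Poisson's formula for the odd Gaussian sum yields the second moment. -/
theorem gaussian_two_eq {x : ℝ} (hx : 0 < x) (s : ℝ) :
    ((∑' n : ℤ, (exp (-π * (n + s) ^ 2 * x)
        - 2 * π * x * ((n + s) ^ 2 * exp (-π * (n + s) ^ 2 * x))) : ℝ) : ℂ)
      = ((1 / x ^ (3 / 2 : ℝ) : ℝ) : ℂ) * ∑' n : ℤ, (-Complex.I * n *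
        (2 * π * Complex.I * n * Complex.exp (2 * π * Complex.I * s * n))
          * (rexp (-π * n ^ 2 * (1 / x)) : ℂ)) := by
  have hx' : 0 < 1 / x := by positivity
  have hL : HasDerivAt (fun y : ℝ => ∑' n : ℤ, (n + y) * exp (-π * (n + y) ^ 2 * x))
      (∑' n : ℤ, (exp (-π * (n + s) ^ 2 * x)
        - 2 * π * x * ((n + s) ^ 2 * exp (-π * (n + s) ^ 2 * x)))) s := by
    set R := |s| + 1 with hR
    have hsum : Summable fun n : ℤ => 3 * exp (π * x / 2 * R ^ 2) *
        (|(n : ℝ)| ^ 0 * exp (-(π * x / 4) * (n : ℝ) ^ 2)) :=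
      (summable_pow_mul_exp_neg_mul_sq 0 (by positivity)).mul_left _
    refine hasDerivAt_tsum_of_isPreconnected (𝕜 := ℝ) (F := ℝ)
      (g := fun (n : ℤ) (y : ℝ) => (n + y) * exp (-π * (n + y) ^ 2 * x))
      (g' := fun (n : ℤ) (y : ℝ) => exp (-π * (n + y) ^ 2 * x)
        - 2 * π * x * ((n + y) ^ 2 * exp (-π * (n + y) ^ 2 * x))) (y₀ := s) hsum (t := Set.Ioo (-R) R) isOpen_Ioo
      isPreconnected_Ioo (fun n y _ => ?_) (fun n y hy => ?_) ?_ ?_ ?_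
    · have h1 : HasDerivAt (fun y : ℝ => (n : ℝ) + y) 1 y := (hasDerivAt_id y).const_add _
      have h2 := h1.mul (((h1.pow 2).const_mul (-π)).mul_const x).exp
      refine h2.congr_deriv ?_
      simp only [Pi.pow_apply]
      push_cast
      ring
    · have hy2 : y ^ 2 ≤ R ^ 2 := by
        rw [sq_le_sq, abs_of_pos (show 0 < R by positivity)]
        exact abs_le.mpr ⟨hy.1.le, hy.2.le⟩
      set v := π * x / 2 * ((n : ℝ) + y) ^ 2 with hv
      have hv0 : 0 ≤ v := by positivity
      have e1 : exp (-π * (n + y) ^ 2 * x) = exp (-v) * exp (-v) := by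
        rw [← exp_add]
        congr 1
        rw [hv]
        ring
      have e2 : exp (-π * (n + y) ^ 2 * x) - 2 * π * x * ((n + y) ^ 2 * exp (-π * (n + y) ^ 2 * x))
          = (exp (-v) - 4 * (v * exp (-v))) * exp (-v) := by
        rw [e1, hv]
        ring
      have e3 : v * exp (-v) ≤ 1 / 2 := by
        have := Real.two_mul_le_exp (x := v)
        rw [exp_neg, ← div_eq_mul_inv, div_le_iff₀ (exp_pos _)]
        linarith
      have e4 : exp (-v) ≤ 1 := exp_le_one_iff.mpr (by linarith)
      have e5 : 0 ≤ v * exp (-v) := by positivity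
      rw [e2, norm_eq_abs, abs_mul, abs_of_pos (exp_pos _), pow_zero, one_mul, mul_assoc 3, ← exp_add]
      refine mul_le_mul ?_ (exp_le_exp.mpr ?_) (exp_pos _).le (by norm_num)
      · rw [abs_le]
        constructor <;> linarith [exp_pos (-v)]
      · have : (n : ℝ) ^ 2 ≤ 2 * (n + y) ^ 2 + 2 * R ^ 2 := by nlinarith [sq_nonneg ((n : ℝ) + 2 * y)]
        have h0 : 0 < π * x / 4 := by positivity
        rw [hv]
        nlinarith
    · exact abs_lt.mp (by rw [hR]; linarith)
    · exact (HurwitzZeta.hasSum_int_oddKernel s hx).summable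
    · exact abs_lt.mp (by rw [hR]; linarith)
  have hRd : HasDerivAt (fun y : ℝ => ∑' n : ℤ, -Complex.I * n *
        Complex.exp (2 * π * Complex.I * y * n) * (rexp (-π * n ^ 2 * (1 / x)) : ℂ))
      (∑' n : ℤ, (-Complex.I * n *
        (2 * π * Complex.I * n * Complex.exp (2 * π * Complex.I * s * n))
          * (rexp (-π * n ^ 2 * (1 / x)) : ℂ))) s := by
    have hsum : Summable fun n : ℤ => 2 * π *
        (|(n : ℝ)| ^ 2 * exp (-(π * (1 / x)) * (n : ℝ) ^ 2)) :=
      (summable_pow_mul_exp_neg_mul_sq 2 (by positivity)).mul_left _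
    refine hasDerivAt_tsum (𝕜 := ℝ) (F := ℂ)
      (g := fun (n : ℤ) (y : ℝ) => -Complex.I * n *
        Complex.exp (2 * π * Complex.I * y * n) * (rexp (-π * n ^ 2 * (1 / x)) : ℂ))
      (g' := fun (n : ℤ) (y : ℝ) => -Complex.I * n *
        (2 * π * Complex.I * n * Complex.exp (2 * π * Complex.I * y * n))
          * (rexp (-π * n ^ 2 * (1 / x)) : ℂ)) hsum (y₀ := s) (fun n y => ?_) (fun n y => ?_) ?_ s
    · have h1 : HasDerivAt (fun y : ℝ => 2 * π * Complex.I * (y : ℂ) * n)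
          (2 * π * Complex.I * 1 * n) y :=
        ((Complex.ofRealCLM.hasDerivAt (x := y)).const_mul (2 * π * Complex.I)).mul_const (n : ℂ)
      refine ((h1.cexp.const_mul (-Complex.I * n)).mul_const _).congr_deriv ?_
      ring
    · rw [norm_mul, norm_mul, norm_mul, norm_mul (2 * π * Complex.I * n : ℂ), norm_cexp_two_pi, Complex.norm_real,
        norm_of_nonneg (exp_pos _).le]
      simp only [norm_mul, norm_neg, Complex.norm_I, Complex.norm_intCast, Complex.norm_ofNat,
        Complex.norm_real, norm_of_nonneg pi_pos.le]
      apply le_of_eq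
      ring_nf
    · exact (HurwitzZeta.hasSum_int_sinKernel s hx').summable
  have heq : (fun y : ℝ => ((∑' n : ℤ, (n + y) * exp (-π * (n + y) ^ 2 * x) : ℝ) : ℂ))
      = fun y : ℝ => ((1 / x ^ (3 / 2 : ℝ) : ℝ) : ℂ) * ∑' n : ℤ, -Complex.I * n *
        Complex.exp (2 * π * Complex.I * y * n) * (rexp (-π * n ^ 2 * (1 / x)) : ℂ) := by
    funext y
    rw [(HurwitzZeta.hasSum_int_oddKernel y hx).tsum_eq,
      (HurwitzZeta.hasSum_int_sinKernel y hx').tsum_eq, HurwitzZeta.oddKernel_functional_equation,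
      Complex.ofReal_mul]
  have h1 := hL.ofReal_comp
  rw [heq] at h1
  exact h1.unique (hRd.const_mul _)

/-- The second moment. -/
theorem exists_gaussian_two {X : ℝ} (hX : 0 < X) : ∃ C, 0 < C ∧ ∀ x, 0 < x → x ≤ X → ∀ s : ℝ,
    ∃ S, HasSum (fun n : ℤ => (n + s) ^ 2 * exp (-π * (n + s) ^ 2 * x)) S ∧
      |S - 1 / x ^ (1 / 2 : ℝ) / (2 * π * x)| ≤ C / x * exp (-1 / x) := by
  obtain ⟨C0, hC0, h0⟩ := exists_gaussian_zero hX
  obtain ⟨C, hC, h⟩ := exists_rpow_mul_tsum_dual_le 2 (a := 3 / 2) hX (by norm_num) (by norm_num)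
  refine ⟨(C0 + 2 * π * C) / (2 * π), by positivity, fun x hx hxX s =>
    ⟨_, (summable_sq_mul_gaussian hx s).hasSum, ?_⟩⟩
  obtain ⟨S0, hS0, hb⟩ := h0 x hx hxX s
  have h1 := gaussian_two_eq hx s
  rw [(hS0.sub ((summable_sq_mul_gaussian hx s).hasSum.mul_left (2 * π * x))).tsum_eq] at h1
  set S2 := ∑' n : ℤ, ((n : ℝ) + s) ^ 2 * exp (-π * (n + s) ^ 2 * x)
  obtain ⟨_, _, h4⟩ := exists_tsum_dual_le 2 hX
  have h3 := tsum_of_norm_bounded (f := fun n : ℤ => -Complex.I * n *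
        (2 * π * Complex.I * n * Complex.exp (2 * π * Complex.I * s * n))
          * (rexp (-π * n ^ 2 * (1 / x)) : ℂ))
    ((h4 x hx hxX).2.hasSum.mul_left (2 * π)) fun n => by
      split_ifs with hn
      · simp [hn]
      · rw [norm_mul, norm_mul, norm_mul, norm_mul (2 * π * Complex.I * n : ℂ), norm_cexp_two_pi, Complex.norm_real,
          norm_of_nonneg (exp_pos _).le]
        simp only [norm_mul, norm_neg, Complex.norm_I, Complex.norm_intCast, Complex.norm_ofNat,
          Complex.norm_real, norm_of_nonneg pi_pos.le]
        apply le_of_eq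
        ring
  have h5 := congrArg norm h1
  rw [norm_mul, Complex.norm_real, Complex.norm_real, norm_eq_abs, norm_eq_abs,
    abs_of_nonneg (show 0 ≤ 1 / x ^ (3 / 2 : ℝ) by positivity)] at h5
  have h6 : |S0 - 2 * π * x * S2| ≤ 2 * π * C * exp (-1 / x) := by
    rw [h5]
    have h7 := mul_le_mul_of_nonneg_left h3 (show 0 ≤ 1 / x ^ (3 / 2 : ℝ) by positivity)
    have h8 := h x hx hxX
    have h9 : 0 < 2 * π := by positivity
    nlinarith
  have h7 : S2 - 1 / x ^ (1 / 2 : ℝ) / (2 * π * x)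
      = ((S0 - 1 / x ^ (1 / 2 : ℝ)) - (S0 - 2 * π * x * S2)) / (2 * π * x) := by
    field_simp
    ring
  rw [h7, abs_div, abs_of_pos (show 0 < 2 * π * x by positivity), div_le_iff₀ (by positivity)]
  refine (abs_sub _ _).trans ((add_le_add hb h6).trans (le_of_eq ?_))
  field_simp

/-- Poisson summation for a Gaussian with quadratic weight, in one dimension. -/
theorem exists_poisson_one {a : ℝ} (ha : 0 < a) : ∃ c C, 0 < c ∧ 0 < C ∧ ∀ t, 0 < t → t ≤ 1 →
    ∀ s κ η : ℝ, ∃ S, HasSum (fun n : ℤ => (κ + η * (n + s)) ^ 2 * exp (-t * (a * (n + s) ^ 2))) S ∧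
      |S - √(π / (t * a)) * (κ ^ 2 + η ^ 2 / (2 * (t * a)))|
        ≤ C * exp (-c / t) * (κ ^ 2 + η ^ 2) := by
  have hX : 0 < a / π := by positivity
  obtain ⟨C0, hC0, h0⟩ := exists_gaussian_zero hX
  obtain ⟨C1, hC1, h1⟩ := exists_gaussian_one hX
  obtain ⟨C2, hC2, h2⟩ := exists_gaussian_two hX
  obtain ⟨C3, hC3, h3⟩ := exists_inv_pow_mul_exp_le 1 (c := π / a) (c' := π / (2 * a))
    (by rw [mul_comm, ← div_div]; exact half_lt_self (by positivity))
  obtain ⟨C4, hC4, h4⟩ := exists_inv_pow_mul_exp_le 0 (c := π / a) (c' := π / (2 * a))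
    (by rw [mul_comm, ← div_div]; exact half_lt_self (by positivity))
  refine ⟨π / (2 * a), (C0 + C1) * C4 + C1 * C4 + C2 * (π / a) * C3, by positivity, by positivity,
    fun t ht ht1 s κ η => ?_⟩
  have hx : 0 < t * a / π := by positivity
  have hxX : t * a / π ≤ a / π := by
    gcongr
    nlinarith
  obtain ⟨S0, hS0, b0⟩ := h0 _ hx hxX s
  obtain ⟨S1, hS1, b1⟩ := h1 _ hx hxX s
  obtain ⟨S2, hS2, b2⟩ := h2 _ hx hxX s
  refine ⟨κ ^ 2 * S0 + 2 * κ * η * S1 + η ^ 2 * S2, ?_, ?_⟩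
  · convert! ((hS0.mul_left (κ ^ 2)).add (hS1.mul_left (2 * κ * η))).add (hS2.mul_left (η ^ 2))
      using 2 with n
    have : -t * (a * (n + s) ^ 2) = -π * (n + s) ^ 2 * (t * a / π) := by field_simp
    rw [this]
    ring
  · have e1 : 1 / (t * a / π) ^ (1 / 2 : ℝ) = √(π / (t * a)) := by
      rw [← sqrt_eq_rpow, one_div, ← sqrt_inv, inv_div]
    have e2 : 2 * π * (t * a / π) = 2 * (t * a) := by field_simp
    have e3 : -1 / (t * a / π) = -(π / a) / t := by field_simp
    rw [e1, e3] at b0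
    rw [e3] at b1
    rw [e1, e2, e3] at b2
    have e4 := h4 t ht
    have e5 := h3 t ht
    rw [pow_zero, one_mul] at e4
    rw [pow_one] at e5
    set E := exp (-(π / a) / t)
    set E' := exp (-(π / (2 * a)) / t)
    have e6 : C2 / (t * a / π) * E ≤ C2 * (π / a) * (C3 * E') := by
      have : C2 / (t * a / π) * E = C2 * (π / a) * (t⁻¹ * E) := by field_simp
      rw [this]
      gcongr
    have e7 : |2 * κ * η| ≤ κ ^ 2 + η ^ 2 := by
      rw [abs_le]
      constructor <;> nlinarith [sq_nonneg (κ + η), sq_nonneg (κ - η)]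
    have e8 : κ ^ 2 * S0 + 2 * κ * η * S1 + η ^ 2 * S2
        - √(π / (t * a)) * (κ ^ 2 + η ^ 2 / (2 * (t * a)))
        = κ ^ 2 * (S0 - √(π / (t * a))) + 2 * κ * η * S1
          + η ^ 2 * (S2 - √(π / (t * a)) / (2 * (t * a))) := by ring
    rw [e8]
    refine (abs_add_three _ _ _).trans ?_
    rw [abs_mul, abs_mul (2 * κ * η), abs_mul (η ^ 2), abs_of_nonneg (sq_nonneg κ),
      abs_of_nonneg (sq_nonneg η)]
    have f0 : κ ^ 2 * |S0 - √(π / (t * a))| ≤ κ ^ 2 * (C0 * (C4 * E')) := by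
      gcongr
      nlinarith
    have f1 : |2 * κ * η| * |S1| ≤ (κ ^ 2 + η ^ 2) * (C1 * (C4 * E')) :=
      mul_le_mul e7 (by nlinarith) (abs_nonneg _) (by positivity)
    have f2 : η ^ 2 * |S2 - √(π / (t * a)) / (2 * (t * a))| ≤ η ^ 2 * (C2 * (π / a) * (C3 * E')) := by
      gcongr
      linarith
    have g1 : 0 ≤ η ^ 2 * (C0 * (C4 * E')) := by positivity
    have g2 : 0 ≤ κ ^ 2 * (C2 * (π / a) * (C3 * E')) := by positivity
    have g3 : 0 ≤ (κ ^ 2 + η ^ 2) * (C1 * (C4 * E')) := by positivity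
    nlinarith

end LatticeGaussian

namespace LatticeGaussian

open Real Filter Topology

/-! ### Quadratic forms and completing the square -/

/-- The bilinear form `xᵀ Q y`. -/
def bil {ι : Type*} [Fintype ι] (Q : Matrix ι ι ℝ) (x y : ι → ℝ) : ℝ := ∑ i, ∑ j, Q i j * x i * y j

section bil

variable {ι : Type*} [Fintype ι] {Q : Matrix ι ι ℝ}

theorem bil_eq_dotProduct (Q : Matrix ι ι ℝ) (x y : ι → ℝ) : bil Q x y = x ⬝ᵥ (Q *ᵥ y) := by
  simp only [bil, dotProduct, Matrix.mulVec, Finset.mul_sum]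
  exact Finset.sum_congr rfl fun i _ => Finset.sum_congr rfl fun j _ => by ring

theorem bil_add_left (Q : Matrix ι ι ℝ) (x y z : ι → ℝ) : bil Q (x + y) z = bil Q x z + bil Q y z := by
  simp only [bil_eq_dotProduct, add_dotProduct]

theorem bil_add_right (Q : Matrix ι ι ℝ) (x y z : ι → ℝ) : bil Q x (y + z) = bil Q x y + bil Q x z := by
  simp only [bil_eq_dotProduct, Matrix.mulVec_add, dotProduct_add]

theorem bil_smul_left (Q : Matrix ι ι ℝ) (c : ℝ) (x y : ι → ℝ) : bil Q (c • x) y = c * bil Q x y := by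
  simp only [bil_eq_dotProduct, smul_dotProduct, smul_eq_mul]

theorem bil_smul_right (Q : Matrix ι ι ℝ) (c : ℝ) (x y : ι → ℝ) : bil Q x (c • y) = c * bil Q x y := by
  simp only [bil_eq_dotProduct, Matrix.mulVec_smul, dotProduct_smul, smul_eq_mul]

theorem bil_neg_left (Q : Matrix ι ι ℝ) (x y : ι → ℝ) : bil Q (-x) y = -bil Q x y := by
  simp only [bil_eq_dotProduct, neg_dotProduct]

theorem bil_neg_right (Q : Matrix ι ι ℝ) (x y : ι → ℝ) : bil Q x (-y) = -bil Q x y := by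
  simp only [bil_eq_dotProduct, Matrix.mulVec_neg, dotProduct_neg]

theorem bil_comm (hQ : Q.IsHermitian) (x y : ι → ℝ) : bil Q x y = bil Q y x := by
  rw [bil, Finset.sum_comm, bil]
  refine Finset.sum_congr rfl fun i _ => Finset.sum_congr rfl fun j _ => ?_
  have : Q j i = Q i j := by simpa using hQ.apply i j
  rw [this]
  ring

theorem bil_pos (hQ : Q.PosDef) {x : ι → ℝ} (hx : x ≠ 0) : 0 < bil Q x x := by
  have := hQ.dotProduct_mulVec_pos hx
  rwa [star_trivial, ← bil_eq_dotProduct] at this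

theorem bil_nonneg (hQ : Q.PosDef) (x : ι → ℝ) : 0 ≤ bil Q x x := by
  rcases eq_or_ne x 0 with rfl | hx
  · simp [bil]
  · exact (bil_pos hQ hx).le

/-- The Cauchy–Schwarz inequality for a positive definite form. -/
theorem sq_bil_le (hQ : Q.PosDef) (x y : ι → ℝ) : bil Q x y ^ 2 ≤ bil Q x x * bil Q y y := by
  rcases eq_or_ne y 0 with rfl | hy
  · simp [bil]
  · have h := bil_nonneg hQ (bil Q y y • x + (-bil Q x y) • y)
    rw [bil_add_left, bil_add_right, bil_add_right, bil_smul_left, bil_smul_left, bil_smul_left,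
      bil_smul_left, bil_smul_right, bil_smul_right, bil_smul_right, bil_smul_right,
      bil_comm hQ.isHermitian y x] at h
    have hp := bil_pos hQ hy
    have : 0 ≤ bil Q y y * (bil Q x x * bil Q y y - bil Q x y ^ 2) := by nlinarith
    have := nonneg_of_mul_nonneg_right this hp
    linarith

theorem abs_bil_le (Q : Matrix ι ι ℝ) (x : ι → ℝ) :
    |bil Q x x| ≤ (∑ i, ∑ j, |Q i j|) * ∑ k, x k ^ 2 := by
  rw [bil, Finset.sum_mul]
  refine (Finset.abs_sum_le_sum_abs _ _).trans (Finset.sum_le_sum fun i _ => ?_)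
  rw [Finset.sum_mul]
  refine (Finset.abs_sum_le_sum_abs _ _).trans (Finset.sum_le_sum fun j _ => ?_)
  rw [mul_assoc, abs_mul]
  refine mul_le_mul_of_nonneg_left ?_ (abs_nonneg _)
  have h1 : x i ^ 2 ≤ ∑ k, x k ^ 2 :=
    Finset.single_le_sum (f := fun k => x k ^ 2) (fun k _ => sq_nonneg _) (Finset.mem_univ i)
  have h2 : x j ^ 2 ≤ ∑ k, x k ^ 2 :=
    Finset.single_le_sum (f := fun k => x k ^ 2) (fun k _ => sq_nonneg _) (Finset.mem_univ j)
  rw [abs_le]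
  constructor <;> nlinarith [sq_nonneg (x i + x j), sq_nonneg (x i - x j)]

end bil

/-- The Schur complement of the upper left entry of `Q`. -/
def schur {n : ℕ} (Q : Matrix (Fin (n + 1)) (Fin (n + 1)) ℝ) : Matrix (Fin n) (Fin n) ℝ :=
  fun i j => Q i.succ j.succ - Q 0 i.succ * Q 0 j.succ / Q 0 0

/-- The shift of the first coordinate that completes the square. -/
def shift {n : ℕ} (Q : Matrix (Fin (n + 1)) (Fin (n + 1)) ℝ) (x : Fin n → ℝ) : ℝ :=
  (∑ i, Q 0 i.succ * x i) / Q 0 0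

variable {n : ℕ} {Q : Matrix (Fin (n + 1)) (Fin (n + 1)) ℝ}

theorem bil_complete_square (hQ : Q.IsHermitian) (h0 : Q 0 0 ≠ 0) (x y : Fin (n + 1) → ℝ) :
    bil Q x y = Q 0 0 * (x 0 + shift Q (Fin.tail x)) * (y 0 + shift Q (Fin.tail y))
      + bil (schur Q) (Fin.tail x) (Fin.tail y) := by
  have hsymm : ∀ i : Fin n, Q i.succ 0 = Q 0 i.succ := fun i => by simpa using hQ.apply 0 i.succ
  have h1 : bil (schur Q) (Fin.tail x) (Fin.tail y) = ∑ i : Fin n, ∑ j : Fin n,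
        Q i.succ j.succ * x i.succ * y j.succ
      - (∑ i : Fin n, Q 0 i.succ * x i.succ) * (∑ j : Fin n, Q 0 j.succ * y j.succ) / Q 0 0 := by
    rw [Finset.sum_mul_sum, Finset.sum_div, ← Finset.sum_sub_distrib, bil]
    refine Finset.sum_congr rfl fun i _ => ?_
    rw [Finset.sum_div, ← Finset.sum_sub_distrib]
    refine Finset.sum_congr rfl fun j _ => ?_
    simp only [schur, Fin.tail]
    ring
  have h2 : bil Q x y = Q 0 0 * x 0 * y 0 + x 0 * (∑ j : Fin n, Q 0 j.succ * y j.succ)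
      + y 0 * (∑ i : Fin n, Q 0 i.succ * x i.succ)
      + ∑ i : Fin n, ∑ j : Fin n, Q i.succ j.succ * x i.succ * y j.succ := by
    simp only [bil, Fin.sum_univ_succ, hsymm, Finset.sum_add_distrib, Finset.mul_sum]
    have e1 : ∀ j : Fin n, Q 0 j.succ * x 0 * y j.succ = x 0 * (Q 0 j.succ * y j.succ) :=
      fun j => by ring
    have e2 : ∀ j : Fin n, Q 0 j.succ * x j.succ * y 0 = y 0 * (Q 0 j.succ * x j.succ) :=
      fun j => by ring
    simp only [e1, e2]
    ring
  rw [h1, h2, shift, shift]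
  simp only [Fin.tail]
  field_simp
  ring

theorem schur_posDef (hQ : Q.PosDef) : (schur Q).PosDef := by
  have h0 : 0 < Q 0 0 := hQ.diag_pos
  refine Matrix.PosDef.of_dotProduct_mulVec_pos ?_ fun x hx => ?_
  · ext i j
    have : Q j.succ i.succ = Q i.succ j.succ := by simpa using hQ.isHermitian.apply i.succ j.succ
    simp only [Matrix.conjTranspose_apply, star_trivial, schur, this]
    ring
  · rw [star_trivial, ← bil_eq_dotProduct]
    have h1 := bil_complete_square hQ.isHermitian h0.ne' (Fin.cons (-shift Q x) x)
      (Fin.cons (-shift Q x) x)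
    rw [Fin.tail_cons, Fin.cons_zero, neg_add_cancel, mul_zero, zero_add] at h1
    rw [← h1]
    refine bil_pos hQ fun h => hx ?_
    rw [← Fin.tail_cons (α := fun _ => ℝ) (-shift Q x) x, h]
    rfl

theorem det_eq_mul_det_schur (hQ : Q.IsHermitian) (h0 : Q 0 0 ≠ 0) :
    Q.det = Q 0 0 * (schur Q).det := by
  have hsymm : ∀ i : Fin n, Q i.succ 0 = Q 0 i.succ := fun i => by simpa using hQ.apply 0 i.succ
  let B : Matrix (Fin (n + 1)) (Fin (n + 1)) ℝ :=
    Fin.cons (Q 0) fun i => Fin.cons 0 (schur Q i)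
  have h1 : Q.det = B.det := by
    refine Matrix.det_eq_of_forall_row_eq_smul_add_const (Fin.cons 0 fun i => Q 0 i.succ / Q 0 0) 0
      rfl fun i j => ?_
    refine Fin.cases ?_ (fun i => ?_) i
    · simp [B]
    · refine Fin.cases ?_ (fun j => ?_) j
      · simp [B, hsymm, h0]
      · simp only [B, Fin.cons_succ, Fin.cons_zero, schur]
        ring
  rw [h1, Matrix.det_succ_column_zero, Fin.sum_univ_succ]
  have h2 : ∀ i : Fin n, B i.succ 0 = 0 := fun i => rfl
  simp only [h2, mul_zero, zero_mul, Finset.sum_const_zero, add_zero, Fin.val_zero, pow_zero, one_mul]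
  rfl

/-! ### Poisson summation for Gaussians on a lattice -/

theorem sqrt_le_self {y : ℝ} (hy : 1 ≤ y) : √y ≤ y := by
  rw [sqrt_le_left (by linarith)]
  nlinarith

set_option maxHeartbeats 800000 in
/-- The error terms of the induction step below. -/
theorem poisson_step_error {n : ℕ} {a D B B' C₁ C₂ E₁ E₂ E t P P' η2 bS κ2 SA SB Δ : ℝ} (ha : 0 < a)
    (hD0 : 0 < D) (hB0 : 0 ≤ B) (hB'0 : 0 ≤ B') (hC₁ : 0 < C₁) (hC₂ : 0 < C₂) (ht : 0 < t)
    (ht1 : t ≤ 1) (hE0 : 0 < E) (hE1 : E₁ ≤ E) (hE2 : E₂ ≤ E) (hE3 : E₂ ≤ 1) (_ : 0 ≤ E₂)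
    (hη0 : 0 ≤ η2) (hηP : η2 ≤ B * P) (hP0 : 0 ≤ P) (hSn : 0 ≤ bS) (hSP : bS ≤ B' * P)
    (hκ0 : 0 ≤ κ2) (hκ : κ2 ≤ P) (hP'0 : 0 ≤ P') (hP' : P' ≤ P)
    (bA : |SA - √(π / t) ^ n / D * (κ2 + bS / (2 * t))| ≤ C₂ * E₂ * P')
    (bB : |SB - √(π / t) ^ n / D| ≤ C₂ * E₂) (hSA0 : 0 ≤ SA) (hSB0 : 0 ≤ SB)
    (hnorm : |Δ| ≤ C₁ * E₁ * (SA + η2 * SB)) :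
    |Δ + √(π / (t * a)) * (SA + η2 / (2 * (t * a)) * SB)
        - √(π / t) ^ (n + 1) / (√a * D) * (κ2 + (η2 / a + bS) / (2 * t))|
      ≤ (√(π / a) * (1 + 1 / (2 * a)) * C₂ * (1 + B)
          + C₁ * (π ^ n / D * (1 + B') + C₂) * (1 + B)) * (t⁻¹ ^ (n + 2) * E) * P := by
  have hu : 1 ≤ t⁻¹ := (one_le_inv₀ ht).mpr ht1
  obtain ⟨u, hu_def⟩ : ∃ u, u = t⁻¹ := ⟨_, rfl⟩
  rw [← hu_def] at hu ⊢
  have hu0 : 0 < u := by linarith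
  have hup : ∀ k, k ≤ n + 2 → u ^ k ≤ u ^ (n + 2) := fun k hk => pow_le_pow_right₀ hu hk
  obtain ⟨r, hr⟩ : ∃ r, r = √(π / t) := ⟨_, rfl⟩
  obtain ⟨m, hm⟩ : ∃ m, m = √(π / (t * a)) := ⟨_, rfl⟩
  obtain ⟨p, hp⟩ : ∃ p, p = √(π / a) := ⟨_, rfl⟩
  have hr0 : 0 ≤ r := hr ▸ sqrt_nonneg _
  have hm0 : 0 ≤ m := hm ▸ sqrt_nonneg _
  have hp0 : 0 ≤ p := hp ▸ sqrt_nonneg _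
  have hmr : m = r / √a := by
    rw [hm, hr, ← sqrt_div (by positivity), div_div]
  have hmp : m ≤ p * u := by
    have e1 : m = p * √u := by
      rw [hm, hp, ← sqrt_mul (by positivity), hu_def]
      congr 1
      field_simp
    rw [e1]
    exact mul_le_mul_of_nonneg_left (sqrt_le_self hu) hp0
  have hrn : r ^ n ≤ π ^ n * u ^ n := by
    rw [← mul_pow]
    refine pow_le_pow_left₀ hr0 ?_ n
    rw [hr, hu_def, ← div_eq_mul_inv]
    refine sqrt_le_self ?_
    rw [le_div_iff₀ ht]
    linarith [pi_gt_three]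
  rw [← hr] at bA bB ⊢
  rw [← hm, ← hp]
  obtain ⟨mA, hmA⟩ : ∃ mA, mA = r ^ n / D * (κ2 + bS / (2 * t)) := ⟨_, rfl⟩
  obtain ⟨mB, hmB⟩ : ∃ mB, mB = r ^ n / D := ⟨_, rfl⟩
  have htarget : r ^ (n + 1) / (√a * D) * (κ2 + (η2 / a + bS) / (2 * t))
      = m * (mA + η2 / (2 * (t * a)) * mB) := by
    rw [hmr, hmA, hmB]
    have : 0 < √a := sqrt_pos.mpr ha
    field_simp
    ring
  rw [← hmA] at bA
  rw [← hmB] at bB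
  have f1 : |SA - mA| ≤ C₂ * E * P := bA.trans (by gcongr)
  have f2 : |SB - mB| ≤ C₂ * E := bB.trans (by gcongr)
  have f3 : mB ≤ π ^ n / D * u ^ n := by
    rw [hmB, div_mul_eq_mul_div]
    gcongr
  have hmB0 : 0 ≤ mB := by rw [hmB]; positivity
  have f4 : mA ≤ π ^ n / D * (1 + B') * u ^ (n + 1) * P := by
    have e1 : κ2 + bS / (2 * t) ≤ (1 + B') * u * P := by
      have e2 : bS / (2 * t) = bS * u / 2 := by
        rw [hu_def]
        field_simp
      have e4 : bS * u ≤ B' * P * u := by gcongr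
      have e5 : 0 ≤ B' * P * u := by positivity
      have e6 : P ≤ P * u := le_mul_of_one_le_right hP0 hu
      rw [e2]
      linarith
    calc mA ≤ (π ^ n / D * u ^ n) * ((1 + B') * u * P) := by
          rw [hmA, ← hmB]
          exact mul_le_mul f3 e1 (by positivity) (by positivity)
      _ = _ := by ring
  have f5 : SA ≤ (π ^ n / D * (1 + B') + C₂) * u ^ (n + 1) * P := by
    have e1 : SA ≤ mA + |SA - mA| := by linarith [le_abs_self (SA - mA)]
    have e2 : |SA - mA| ≤ C₂ * P := bA.trans (by
      calc C₂ * E₂ * P' ≤ C₂ * 1 * P := by gcongr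
        _ = _ := by ring)
    have e3 : C₂ * P ≤ C₂ * u ^ (n + 1) * P := by
      have h1 : 1 ≤ u ^ (n + 1) := one_le_pow₀ hu
      exact mul_le_mul_of_nonneg_right (le_mul_of_one_le_right hC₂.le h1) hP0
    linarith
  have f6 : SB ≤ (π ^ n / D * (1 + B') + C₂) * u ^ (n + 1) := by
    have e1 : SB ≤ mB + |SB - mB| := by linarith [le_abs_self (SB - mB)]
    have e2 : |SB - mB| ≤ C₂ := bB.trans (mul_le_of_le_one_right hC₂.le hE3)
    have e3 : C₂ ≤ C₂ * u ^ (n + 1) := le_mul_of_one_le_right hC₂.le (one_le_pow₀ hu)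
    have e4 : π ^ n / D * u ^ n ≤ π ^ n / D * (1 + B') * u ^ (n + 1) := by
      have g1 : u ^ n ≤ u ^ (n + 1) := pow_le_pow_right₀ hu (by lia)
      have g2 : π ^ n / D ≤ π ^ n / D * (1 + B') :=
        le_mul_of_one_le_right (by positivity) (by linarith)
      gcongr
    linarith
  obtain ⟨K₀, hK₀⟩ : ∃ K₀, K₀ = π ^ n / D * (1 + B') + C₂ := ⟨_, rfl⟩
  have hK₀0 : 0 ≤ K₀ := by rw [hK₀]; positivity
  rw [← hK₀] at f5 f6 ⊢
  have g1 : |Δ| ≤ C₁ * K₀ * (1 + B) * (u ^ (n + 2) * E) * P := by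
    calc |Δ| ≤ C₁ * E₁ * (SA + η2 * SB) := hnorm
      _ ≤ C₁ * E * (K₀ * u ^ (n + 1) * P + (B * P) * (K₀ * u ^ (n + 1))) := by gcongr
      _ = C₁ * K₀ * (1 + B) * (u ^ (n + 1) * E) * P := by ring
      _ ≤ _ := by
        have := hup (n + 1) (by lia)
        gcongr
  have g2 : |m * (SA + η2 / (2 * (t * a)) * SB) - m * (mA + η2 / (2 * (t * a)) * mB)|
      ≤ p * (1 + 1 / (2 * a)) * C₂ * (1 + B) * (u ^ (n + 2) * E) * P := by
    have e1 : m * (SA + η2 / (2 * (t * a)) * SB) - m * (mA + η2 / (2 * (t * a)) * mB)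
        = m * ((SA - mA) + η2 / (2 * (t * a)) * (SB - mB)) := by ring
    have e2 : η2 / (2 * (t * a)) ≤ B * P * u * (1 / (2 * a)) := by
      have : η2 / (2 * (t * a)) = η2 * u * (1 / (2 * a)) := by
        rw [hu_def]
        field_simp
      rw [this]
      gcongr
    rw [e1, abs_mul, abs_of_nonneg hm0]
    have e3 := hup 1 (by lia)
    have e4 := hup 2 (by lia)
    calc m * |(SA - mA) + η2 / (2 * (t * a)) * (SB - mB)|
        ≤ (p * u) * (C₂ * E * P + B * P * u * (1 / (2 * a)) * (C₂ * E)) := by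
          refine mul_le_mul hmp ?_ (abs_nonneg _) (by positivity)
          refine (abs_add_le _ _).trans (add_le_add f1 ?_)
          rw [abs_mul, abs_of_nonneg (show 0 ≤ η2 / (2 * (t * a)) by positivity)]
          exact mul_le_mul e2 f2 (abs_nonneg _) (by positivity)
      _ = p * C₂ * (u ^ 1 + B * (1 / (2 * a)) * u ^ 2) * E * P := by ring
      _ ≤ p * C₂ * (u ^ (n + 2) + B * (1 / (2 * a)) * u ^ (n + 2)) * E * P := by gcongr
      _ = p * (1 + B * (1 / (2 * a))) * C₂ * (u ^ (n + 2) * E) * P := by ring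
      _ ≤ p * ((1 + 1 / (2 * a)) * (1 + B)) * C₂ * (u ^ (n + 2) * E) * P := by
          have e5 : 0 ≤ 1 / (2 * a) := by positivity
          have e6 : 1 + B * (1 / (2 * a)) ≤ (1 + 1 / (2 * a)) * (1 + B) := by nlinarith
          gcongr
      _ = _ := by ring
  rw [htarget, add_sub_assoc]
  calc _ ≤ C₁ * K₀ * (1 + B) * (u ^ (n + 2) * E) * P
        + p * (1 + 1 / (2 * a)) * C₂ * (1 + B) * (u ^ (n + 2) * E) * P :=
        (abs_add_le _ _).trans (add_le_add g1 g2)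
    _ = _ := by ring

set_option maxHeartbeats 1000000 in
/-- Gaussian sums over `ℤⁿ` with the square of an affine function as weight: up to exponentially
small terms, they agree with the corresponding integrals, uniformly in the shift and the weight. -/
theorem exists_poisson (n : ℕ) : ∀ Q : Matrix (Fin n) (Fin n) ℝ, Q.PosDef →
    ∃ c C, 0 < c ∧ 0 < C ∧ ∀ t, 0 < t → t ≤ 1 → ∀ (s : Fin n → ℝ) (κ : ℝ) (β : Fin n → ℝ),
      ∃ S, HasSum (fun q : Fin n → ℤ => (κ + bil Q β (fun i => q i + s i)) ^ 2
        * exp (-t * bil Q (fun i => q i + s i) (fun i => q i + s i))) S ∧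
      |S - √(π / t) ^ n / √Q.det * (κ ^ 2 + bil Q β β / (2 * t))|
        ≤ C * exp (-c / t) * (κ ^ 2 + ∑ i, β i ^ 2) := by
  induction n with
  | zero =>
    intro Q hQ
    refine ⟨1, 1, one_pos, one_pos, fun t ht _ s κ β => ⟨κ ^ 2, ?_, ?_⟩⟩
    · simp [bil]
    · simp only [bil, Finset.univ_eq_empty, Finset.sum_empty, pow_zero, Matrix.det_isEmpty, sqrt_one,
        zero_div, add_zero, div_one, one_mul, sub_self, abs_zero]
      positivity
  | succ n ih =>
    intro Q hQ
    have ha : 0 < Q 0 0 := hQ.diag_pos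
    have hdet : 0 < Q.det := hQ.det_pos
    have hS := schur_posDef hQ
    have hdet' := det_eq_mul_det_schur hQ.isHermitian ha.ne'
    have hSdet : 0 < (schur Q).det := hS.det_pos
    obtain ⟨c₁, C₁, hc₁, hC₁, h₁⟩ := exists_poisson_one ha
    obtain ⟨c₂, C₂, hc₂, hC₂, h₂⟩ := ih (schur Q) hS
    set a := Q 0 0 with ha_def
    obtain ⟨c, hc_def⟩ : ∃ c, c = min c₁ c₂ := ⟨_, rfl⟩
    have hc : 0 < c := hc_def ▸ lt_min hc₁ hc₂
    obtain ⟨K, hK, hexp⟩ := exists_inv_pow_mul_exp_le (n + 2) (c := c) (c' := c / 2) (half_lt_self hc)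
    -- bounds for `η = (Qβ)₀` and for the Schur complement
    obtain ⟨B, hB⟩ : ∃ B, B = a * ∑ i, ∑ j, |Q i j| := ⟨_, rfl⟩
    obtain ⟨B', hB'⟩ : ∃ B', B' = ∑ i, ∑ j, |schur Q i j| := ⟨_, rfl⟩
    have hB0 : 0 ≤ B := by rw [hB]; positivity
    have hB'0 : 0 ≤ B' := by rw [hB']; positivity
    set D : ℝ := √(schur Q).det with hD
    have hD0 : 0 < D := sqrt_pos.mpr hSdet
    -- the constant, collected from the error terms below
    obtain ⟨C, hC_def⟩ : ∃ C, C = √(π / a) * (1 + 1 / (2 * a)) * C₂ * (1 + B)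
      + C₁ * (π ^ n / D * (1 + B') + C₂) * (1 + B) := ⟨_, rfl⟩
    have hC : 0 < C := by rw [hC_def]; positivity
    refine ⟨c / 2, C * K, half_pos hc, mul_pos hC hK, fun t ht ht1 s κ β => ?_⟩
    set β' : Fin n → ℝ := Fin.tail β with hβ'
    set η : ℝ := a * (β 0 + shift Q β') with hη
    have hsplit := bil_complete_square hQ.isHermitian ha.ne' β β
    rw [← ha_def, ← hβ'] at hsplit
    have hSn := bil_nonneg hS β'
    have hηeq : η ^ 2 / a + bil (schur Q) β' β' = bil Q β β := by
      rw [hsplit, hη]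
      field_simp
    set P := κ ^ 2 + ∑ i, β i ^ 2 with hP
    have hβsum : ∑ i, β i ^ 2 = β 0 ^ 2 + ∑ i, β' i ^ 2 := Fin.sum_univ_succ _
    have hβ'0 : 0 ≤ ∑ i, β' i ^ 2 := Finset.sum_nonneg fun i _ => sq_nonneg _
    have hP0 : 0 ≤ P := by positivity
    have hP' : κ ^ 2 + ∑ i, β' i ^ 2 ≤ P := by nlinarith [sq_nonneg (β 0)]
    have hηP : η ^ 2 ≤ B * P := by
      have e1 : η ^ 2 = a * (η ^ 2 / a) := by field_simp
      have e2 : η ^ 2 / a ≤ bil Q β β := by linarith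
      have e3 := (le_abs_self _).trans (abs_bil_le Q β)
      have e4 : ∑ i, β i ^ 2 ≤ P := by nlinarith [sq_nonneg κ]
      rw [e1, hB, mul_assoc]
      refine mul_le_mul_of_nonneg_left (e2.trans (e3.trans ?_)) ha.le
      exact mul_le_mul_of_nonneg_left e4 (by positivity)
    have hSP : bil (schur Q) β' β' ≤ B' * P := by
      refine ((le_abs_self _).trans (abs_bil_le _ β')).trans ?_
      rw [hB']
      exact mul_le_mul_of_nonneg_left (by nlinarith [sq_nonneg κ]) (by positivity)
    obtain ⟨SA, hSA, bA⟩ := h₂ t ht ht1 (Fin.tail s) κ β'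
    obtain ⟨SB, hSB, bB⟩ := h₂ t ht ht1 (Fin.tail s) 1 0
    have hbil0 : ∀ x, bil (schur Q) 0 x = 0 := fun x => by simp [bil]
    simp only [hbil0, add_zero, one_pow, one_mul, zero_div, mul_one] at hSB bB
    simp only [Pi.zero_apply, ne_eq, OfNat.ofNat_ne_zero, not_false_eq_true, zero_pow,
      Finset.sum_const_zero, add_zero, mul_one] at bB
    -- the coordinates after completing the square
    let x' : (Fin n → ℤ) → Fin n → ℝ := fun q i => q i + Fin.tail s i
    let κ' : (Fin n → ℤ) → ℝ := fun q => κ + bil (schur Q) β' (x' q)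
    let w : (Fin n → ℤ) → ℝ := fun q => exp (-t * bil (schur Q) (x' q) (x' q))
    have hw : ∀ q, 0 < w q := fun q => exp_pos _
    choose S₁ hS₁ b₁ using fun q => h₁ t ht ht1 (s 0 + shift Q (x' q)) (κ' q) η
    set m := √(π / (t * a)) with hm
    have hmain : HasSum (fun q => m * (κ' q ^ 2 + η ^ 2 / (2 * (t * a))) * w q)
        (m * (SA + η ^ 2 / (2 * (t * a)) * SB)) := by
      convert! (hSA.add (hSB.mul_left (η ^ 2 / (2 * (t * a))))).mul_left m using 2 with q
      ring
    have hbound : HasSum (fun q => C₁ * exp (-c₁ / t) * (κ' q ^ 2 + η ^ 2) * w q)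
        (C₁ * exp (-c₁ / t) * (SA + η ^ 2 * SB)) := by
      convert! (hSA.add (hSB.mul_left (η ^ 2))).mul_left (C₁ * exp (-c₁ / t)) using 2 with q
      ring
    have herr : ∀ q, ‖S₁ q * w q - m * (κ' q ^ 2 + η ^ 2 / (2 * (t * a))) * w q‖
        ≤ C₁ * exp (-c₁ / t) * (κ' q ^ 2 + η ^ 2) * w q := fun q => by
      rw [← sub_mul, norm_mul, norm_eq_abs, norm_of_nonneg (hw q).le]
      exact mul_le_mul_of_nonneg_right (b₁ q) (hw q).le
    have hdiff := (Summable.of_norm_bounded hbound.summable herr).hasSum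
    have hS₁w := hdiff.add hmain
    simp only [sub_add_cancel] at hS₁w
    have hnorm := tsum_of_norm_bounded hbound herr
    set Δ := ∑' q, (S₁ q * w q - m * (κ' q ^ 2 + η ^ 2 / (2 * (t * a))) * w q) with hΔ
    refine ⟨Δ + m * (SA + η ^ 2 / (2 * (t * a)) * SB), ?_, ?_⟩
    · rw [← (Fin.consEquiv fun _ => ℤ).hasSum_iff, ← (Equiv.prodComm _ _).hasSum_iff]
      refine DiagonalPerturbation.hasSum_prod_of_nonneg (fun p => by
        simp only [Function.comp_apply]; positivity) (fun q => ?_) hS₁w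
      convert! (hS₁ q).mul_right (w q) using 2 with k
      simp only [Function.comp_apply, Equiv.prodComm_apply, Prod.swap_prod_mk, Fin.consEquiv_apply]
      rw [bil_complete_square hQ.isHermitian ha.ne', bil_complete_square hQ.isHermitian ha.ne']
      have ht1 : Fin.tail (fun i => ((Fin.cons k q : Fin (n + 1) → ℤ) i : ℝ) + s i) = x' q := rfl
      have ht2 : ((Fin.cons k q : Fin (n + 1) → ℤ) 0 : ℝ) + s 0 = k + s 0 := rfl
      have e1 : exp (-t * (Q 0 0 * (k + s 0 + shift Q (x' q)) * (k + s 0 + shift Q (x' q))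
            + bil (schur Q) (x' q) (x' q)))
          = exp (-t * (a * (k + (s 0 + shift Q (x' q))) ^ 2)) * w q := by
        show _ = _ * exp _
        rw [← exp_add, ha_def]
        congr 1
        ring
      rw [ht1, ht2, e1, ← mul_assoc]
      simp only [κ', hη, hβ', ha_def]
      ring
    · have hSB0 : 0 ≤ SB := hSB.nonneg fun q => (exp_pos _).le
      have hSA0 : 0 ≤ SA := hSA.nonneg fun q => by positivity
      have h5 := poisson_step_error (E := exp (-c / t)) (P := κ ^ 2 + ∑ i, β i ^ 2) ha hD0 hB0 hB'0
        hC₁ hC₂ ht ht1 (exp_pos _)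
        (exp_le_exp.mpr (div_le_div_of_nonneg_right (by linarith [hc_def, min_le_left c₁ c₂]) ht.le))
        (exp_le_exp.mpr (div_le_div_of_nonneg_right (by linarith [hc_def, min_le_right c₁ c₂]) ht.le))
        (exp_le_one_iff.mpr (div_nonpos_of_nonpos_of_nonneg (by linarith) ht.le)) (exp_pos _).le (sq_nonneg η)
        hηP hP0 hSn hSP (sq_nonneg κ) (by linarith) (by positivity) hP' bA bB hSA0 hSB0 hnorm
      rw [hdet', sqrt_mul ha.le, ← hηeq]
      rw [← hC_def] at h5
      refine h5.trans ?_
      rw [mul_assoc C K]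
      exact mul_le_mul_of_nonneg_right (mul_le_mul_of_nonneg_left (hexp t ht) hC.le) hP0

end LatticeGaussian

namespace LatticeGaussian

open Real Filter Topology

/-! ### Lattice geometry of a positive definite form -/

theorem abs_entry_le {ι : Type*} [Fintype ι] (Q : Matrix ι ι ℝ) (i j : ι) :
    |Q i j| ≤ ∑ k, ∑ l, |Q k l| :=
  (Finset.single_le_sum (f := fun l => |Q i l|) (fun _ _ => abs_nonneg _) (Finset.mem_univ j)).trans
    (Finset.single_le_sum (f := fun k => ∑ l, |Q k l|)
      (fun _ _ => Finset.sum_nonneg fun _ _ => abs_nonneg _) (Finset.mem_univ i))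

/-- Coercivity of a positive definite form. -/
theorem exists_sum_sq_le {ι : Type*} [Fintype ι] [DecidableEq ι] {Q : Matrix ι ι ℝ} (hQ : Q.PosDef) :
    ∃ C, 0 < C ∧ ∀ x : ι → ℝ, ∑ i, x i ^ 2 ≤ C * bil Q x x := by
  have hdet : IsUnit Q.det := (Matrix.isUnit_iff_isUnit_det Q).mp hQ.isUnit
  let w : ι → ι → ℝ := fun i => Q⁻¹ *ᵥ Pi.single i 1
  have h1 : ∀ i x, bil Q x (w i) = x i := fun i x => by
    rw [bil_eq_dotProduct, Matrix.mulVec_mulVec, Matrix.mul_nonsing_inv Q hdet, Matrix.one_mulVec,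
      dotProduct_single, mul_one]
  refine ⟨∑ i, bil Q (w i) (w i) + 1,
    add_pos_of_nonneg_of_pos (Finset.sum_nonneg fun i _ => bil_nonneg hQ _) one_pos, fun x => ?_⟩
  have h2 : ∑ i, x i ^ 2 ≤ (∑ i, bil Q (w i) (w i)) * bil Q x x := by
    rw [Finset.sum_mul]
    refine Finset.sum_le_sum fun i _ => ?_
    have := sq_bil_le hQ x (w i)
    rw [h1] at this
    linarith
  nlinarith [bil_nonneg hQ x]

variable {d : ℕ}

/-- An integer vector, as a real vector. -/
def vec (q : Fin d → ℤ) : Fin d → ℝ := fun i => q i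

/-- The inner product `p · q`. -/
def ip (Q : Matrix (Fin d) (Fin d) ℝ) (p q : Fin d → ℤ) : ℝ := bil Q (vec p) (vec q)

/-- The square `q²`. -/
def qf (Q : Matrix (Fin d) (Fin d) ℝ) (q : Fin d → ℤ) : ℝ := bil Q (vec q) (vec q)

/-- The component `q^ν` with raised index. -/
def upper (Q : Matrix (Fin d) (Fin d) ℝ) (q : Fin d → ℤ) (ν : Fin d) : ℝ := ∑ σ, Q ν σ * (q σ : ℝ)

variable {Q : Matrix (Fin d) (Fin d) ℝ}

theorem vec_add (p q : Fin d → ℤ) : vec (p + q) = vec p + vec q := by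
  funext i
  simp [vec]

theorem vec_neg (p : Fin d → ℤ) : vec (-p) = -vec p := by
  funext i
  simp [vec]

theorem vec_ne_zero {p : Fin d → ℤ} (hp : p ≠ 0) : vec p ≠ 0 := fun h =>
  hp (funext fun i => by simpa [vec] using congrFun h i)

theorem bil_single (x : Fin d → ℝ) (ν : Fin d) :
    bil Q (Pi.single ν 1) x = ∑ σ, Q ν σ * x σ := by
  rw [bil_eq_dotProduct, single_one_dotProduct]
  rfl

theorem upper_eq (q : Fin d → ℤ) (ν : Fin d) : upper Q q ν = bil Q (Pi.single ν 1) (vec q) :=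
  (bil_single _ _).symm

theorem bil_single_single (ν σ : Fin d) : bil Q (Pi.single ν 1) (Pi.single σ 1) = Q ν σ := by
  rw [bil_single]
  simp [Pi.single_apply]

theorem upper_add (p q : Fin d → ℤ) (ν : Fin d) : upper Q (p + q) ν = upper Q p ν + upper Q q ν := by
  simp only [upper_eq, vec_add, bil_add_right]

theorem sum_upper_mul (p q : Fin d → ℤ) : ∑ ν, upper Q p ν * (q ν : ℝ) = ip Q q p := by
  simp only [upper, ip, bil, Finset.sum_mul, vec]
  exact Finset.sum_congr rfl fun i _ => Finset.sum_congr rfl fun j _ => by ring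

theorem sum_upper_mul_self (p : Fin d → ℤ) : ∑ ν, upper Q p ν * (p ν : ℝ) = qf Q p :=
  sum_upper_mul p p

theorem qf_nonneg (hQ : Q.PosDef) (q : Fin d → ℤ) : 0 ≤ qf Q q := bil_nonneg hQ _

theorem qf_pos (hQ : Q.PosDef) {q : Fin d → ℤ} (hq : q ≠ 0) : 0 < qf Q q := bil_pos hQ (vec_ne_zero hq)

theorem qf_zero : qf Q 0 = 0 := by simp [qf, bil, vec]

theorem qf_neg (q : Fin d → ℤ) : qf Q (-q) = qf Q q := by
  rw [qf, vec_neg, bil_neg_left, bil_neg_right, neg_neg, qf]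

theorem ip_neg_right (p q : Fin d → ℤ) : ip Q p (-q) = -ip Q p q := by
  rw [ip, vec_neg, bil_neg_right, ip]

theorem ip_add_right (p q r : Fin d → ℤ) : ip Q p (q + r) = ip Q p q + ip Q p r := by
  rw [ip, vec_add, bil_add_right, ip, ip]

theorem ip_self (p : Fin d → ℤ) : ip Q p p = qf Q p := rfl

theorem ip_comm (hQ : Q.PosDef) (p q : Fin d → ℤ) : ip Q p q = ip Q q p := bil_comm hQ.isHermitian _ _

theorem qf_add (hQ : Q.PosDef) (q p : Fin d → ℤ) : qf Q (q + p) = qf Q q + 2 * ip Q p q + qf Q p := by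
  simp only [qf, vec_add, bil_add_left, bil_add_right, ip, bil_comm hQ.isHermitian (vec q) (vec p)]
  ring

theorem sq_ip_le (hQ : Q.PosDef) (p q : Fin d → ℤ) : ip Q p q ^ 2 ≤ qf Q p * qf Q q := sq_bil_le hQ _ _

theorem sq_upper_le (hQ : Q.PosDef) (q : Fin d → ℤ) (ν : Fin d) : upper Q q ν ^ 2 ≤ Q ν ν * qf Q q := by
  rw [upper_eq, ← bil_single_single (Q := Q) ν ν]
  exact sq_bil_le hQ _ _

theorem exists_le_qf (hQ : Q.PosDef) : ∃ c, 0 < c ∧ ∀ q : Fin d → ℤ, q ≠ 0 → c ≤ qf Q q := by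
  obtain ⟨C, hC, h⟩ := exists_sum_sq_le hQ
  refine ⟨1 / C, by positivity, fun q hq => ?_⟩
  obtain ⟨i, hi⟩ := Function.ne_iff.mp hq
  have h1 : (1 : ℝ) ≤ (q i : ℝ) ^ 2 := by
    have h2 : 0 < q i ^ 2 := by
      have : q i ≠ 0 := hi
      positivity
    exact_mod_cast (by linarith : 1 ≤ q i ^ 2)
  have h3 : (q i : ℝ) ^ 2 ≤ ∑ j, vec q j ^ 2 :=
    Finset.single_le_sum (f := fun j => vec q j ^ 2) (fun j _ => sq_nonneg _) (Finset.mem_univ i)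
  rw [div_le_iff₀ hC, mul_comm]
  exact (h1.trans h3).trans (h _)

/-- The basis vector `e_ν`, made orthogonal to `p`. -/
def transverse (Q : Matrix (Fin d) (Fin d) ℝ) (p : Fin d → ℤ) (ν : Fin d) : Fin d → ℝ :=
  Pi.single ν 1 + (-(upper Q p ν / qf Q p)) • vec p

/-- The component `q^ν` of the part of `q` orthogonal to `p`. -/
def perp (Q : Matrix (Fin d) (Fin d) ℝ) (p q : Fin d → ℤ) (ν : Fin d) : ℝ :=
  bil Q (transverse Q p ν) (vec q)

theorem perp_eq (p q : Fin d → ℤ) (ν : Fin d) :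
    perp Q p q ν = upper Q q ν - upper Q p ν / qf Q p * ip Q p q := by
  rw [perp, transverse, bil_add_left, bil_smul_left, ← upper_eq, ip]
  ring

theorem perp_self (hQ : Q.PosDef) {p : Fin d → ℤ} (hp : p ≠ 0) (ν : Fin d) : perp Q p p ν = 0 := by
  rw [perp_eq, ip_self, div_mul_cancel₀ _ (qf_pos hQ hp).ne', sub_self]

theorem bil_transverse_vec (hQ : Q.PosDef) {p : Fin d → ℤ} (hp : p ≠ 0) (ν : Fin d) :
    bil Q (transverse Q p ν) (vec p) = 0 := perp_self hQ hp ν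

theorem perp_neg (p q : Fin d → ℤ) (ν : Fin d) : perp Q p (-q) ν = -perp Q p q ν := by
  rw [perp, vec_neg, bil_neg_right, perp]

theorem perp_add (hQ : Q.PosDef) {p : Fin d → ℤ} (hp : p ≠ 0) (q : Fin d → ℤ) (ν : Fin d) :
    perp Q p (q + p) ν = perp Q p q ν := by
  rw [perp, vec_add, bil_add_right, bil_transverse_vec hQ hp, add_zero, perp]

theorem bil_transverse (hQ : Q.PosDef) {p : Fin d → ℤ} (hp : p ≠ 0) (ν σ : Fin d) :
    bil Q (transverse Q p ν) (transverse Q p σ)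
      = Q ν σ - upper Q p ν * upper Q p σ / qf Q p := by
  nth_rewrite 2 [transverse]
  rw [bil_add_right, bil_smul_right, bil_transverse_vec hQ hp, mul_zero, add_zero, transverse,
    bil_add_left, bil_smul_left, bil_single_single, bil_comm hQ.isHermitian (vec p), ← upper_eq]
  ring

theorem bil_transverse_self_le (hQ : Q.PosDef) {p : Fin d → ℤ} (hp : p ≠ 0) (ν : Fin d) :
    bil Q (transverse Q p ν) (transverse Q p ν) ≤ Q ν ν := by
  rw [bil_transverse hQ hp]
  have : 0 ≤ upper Q p ν * upper Q p ν / qf Q p :=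
    div_nonneg (mul_self_nonneg _) (qf_nonneg hQ p)
  linarith

theorem sq_perp_le (hQ : Q.PosDef) {p : Fin d → ℤ} (hp : p ≠ 0) (q : Fin d → ℤ) (ν : Fin d) :
    perp Q p q ν ^ 2 ≤ Q.trace * qf Q q := by
  refine (sq_bil_le hQ _ _).trans (mul_le_mul_of_nonneg_right ?_ (qf_nonneg hQ q))
  refine (bil_transverse_self_le hQ hp ν).trans ?_
  exact Finset.single_le_sum (f := fun i => Q i i) (fun i _ => (hQ.diag_pos).le) (Finset.mem_univ ν)

theorem abs_perp_mul_le (hQ : Q.PosDef) {p : Fin d → ℤ} (hp : p ≠ 0) (q : Fin d → ℤ) (ν σ : Fin d) :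
    |perp Q p q ν * perp Q p q σ| ≤ Q.trace * qf Q q := by
  have h1 := sq_perp_le hQ hp q ν
  have h2 := sq_perp_le hQ hp q σ
  rw [abs_le]
  constructor <;> nlinarith [sq_nonneg (perp Q p q ν + perp Q p q σ),
    sq_nonneg (perp Q p q ν - perp Q p q σ)]

theorem exists_sum_sq_transverse_le (hQ : Q.PosDef) : ∃ C, 0 < C ∧ ∀ p : Fin d → ℤ, p ≠ 0 → ∀ ν,
    ∑ i, transverse Q p ν i ^ 2 ≤ C := by
  obtain ⟨C, hC, h⟩ := exists_sum_sq_le hQ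
  have hT : 0 ≤ Q.trace := hQ.posSemidef.trace_nonneg
  refine ⟨C * (Q.trace + 1), mul_pos hC (by linarith), fun p hp ν => (h _).trans ?_⟩
  refine mul_le_mul_of_nonneg_left ((bil_transverse_self_le hQ hp ν).trans ?_) hC.le
  have : Q ν ν ≤ Q.trace :=
    Finset.single_le_sum (f := fun i => Q i i) (fun i _ => (hQ.diag_pos).le) (Finset.mem_univ ν)
  linarith

/-! ### Summability -/

/-- The heat weight `e^{-t q²}`. -/
def heat (Q : Matrix (Fin d) (Fin d) ℝ) (t : ℝ) (q : Fin d → ℤ) : ℝ := exp (-t * qf Q q)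

theorem heat_pos (t : ℝ) (q : Fin d → ℤ) : 0 < heat Q t q := exp_pos _

theorem heat_neg (t : ℝ) (q : Fin d → ℤ) : heat Q t (-q) = heat Q t q := by rw [heat, qf_neg, heat]

theorem heat_zero (t : ℝ) : heat Q t 0 = 1 := by rw [heat, qf_zero, mul_zero, exp_zero]

theorem heat_anti (hQ : Q.PosDef) {s t : ℝ} (h : s ≤ t) (q : Fin d → ℤ) : heat Q t q ≤ heat Q s q :=
  exp_le_exp.mpr (by nlinarith [qf_nonneg hQ q])

theorem summable_heat (hQ : Q.PosDef) {t : ℝ} (ht : 0 < t) : Summable (heat Q t) := by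
  obtain ⟨c, C, _, _, h⟩ := exists_poisson d Q hQ
  obtain ⟨S, hS, _⟩ := h (min t 1) (lt_min ht one_pos) (min_le_right _ _) 0 1 0
  have h1 : Summable (heat Q (min t 1)) := by
    refine hS.summable.congr fun q => ?_
    simp [bil, heat, qf, vec]
  exact h1.of_nonneg_of_le (fun q => (heat_pos t q).le) fun q => heat_anti hQ (min_le_left _ _) q

theorem exists_qf_pow_mul_heat_le (hQ : Q.PosDef) (k : ℕ) {s t : ℝ} (h : s < t) :
    ∃ C, 0 < C ∧ ∀ q, qf Q q ^ k * heat Q t q ≤ C * heat Q s q := by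
  obtain ⟨C, hC, h1⟩ := exists_pow_mul_exp_le k (sub_pos.mpr h)
  refine ⟨C, hC, fun q => ?_⟩
  have h2 : heat Q t q = exp (-(t - s) * qf Q q) * heat Q s q := by
    rw [heat, heat, ← exp_add]
    ring_nf
  rw [h2, ← mul_assoc]
  exact mul_le_mul_of_nonneg_right (h1 _ (qf_nonneg hQ q)) (heat_pos s q).le

theorem summable_qf_pow_mul_heat (hQ : Q.PosDef) (k : ℕ) {t : ℝ} (ht : 0 < t) :
    Summable fun q => qf Q q ^ k * heat Q t q := by
  obtain ⟨C, _, h⟩ := exists_qf_pow_mul_heat_le hQ k (half_lt_self ht)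
  exact Summable.of_nonneg_of_le
    (fun q => mul_nonneg (pow_nonneg (qf_nonneg hQ q) k) (heat_pos t q).le) h
    ((summable_heat hQ (half_pos ht)).mul_left C)

/-- Summability against a weight of polynomial growth. -/
theorem summable_mul_heat (hQ : Q.PosDef) {t : ℝ} (ht : 0 < t) {f : (Fin d → ℤ) → ℝ} {C : ℝ} {k : ℕ}
    (hf : ∀ q, |f q| ≤ C * qf Q q ^ k) : Summable fun q => f q * heat Q t q := by
  refine Summable.of_norm_bounded ((summable_qf_pow_mul_heat hQ k ht).mul_left C) fun q => ?_
  rw [norm_mul, norm_eq_abs, norm_of_nonneg (heat_pos t q).le, ← mul_assoc]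
  exact mul_le_mul_of_nonneg_right (hf q) (heat_pos t q).le

theorem abs_tsum_le_of_abs_le {ι : Type*} {f g : ι → ℝ} (hg : Summable g) (h : ∀ i, |f i| ≤ g i) :
    |∑' i, f i| ≤ ∑' i, g i := by
  rw [← norm_eq_abs]
  exact tsum_of_norm_bounded hg.hasSum h

/-- For large `t` the nonzero lattice points contribute exponentially little. -/
theorem exists_tsum_ne_zero_le (hQ : Q.PosDef) (k : ℕ) : ∃ c C, 0 < c ∧ 0 < C ∧ ∀ t, 1 ≤ t →
    t ^ 2 * ∑' q : Fin d → ℤ, (if q = 0 then 0 else qf Q q ^ k * heat Q t q) ≤ C * exp (-c * t) ∧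
    Summable fun q : Fin d → ℤ => (if q = 0 then 0 else qf Q q ^ k * heat Q t q) := by
  obtain ⟨c, hc, hcq⟩ := exists_le_qf hQ
  obtain ⟨D, hD, hexp⟩ := exists_pow_mul_exp_le 2 (ε := c / 4) (by positivity)
  have hs := summable_qf_pow_mul_heat hQ k (t := 1 / 2) (by norm_num)
  have hs0 : ∀ q, 0 ≤ qf Q q ^ k * heat Q (1 / 2) q := fun q =>
    mul_nonneg (pow_nonneg (qf_nonneg hQ q) k) (heat_pos _ q).le
  refine ⟨c / 4, D * (∑' q, qf Q q ^ k * heat Q (1 / 2) q + 1), by positivity,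
    mul_pos hD (add_pos_of_nonneg_of_pos (tsum_nonneg hs0) one_pos), fun t ht => ?_⟩
  have h0 : ∀ q, 0 ≤ (if q = 0 then 0 else qf Q q ^ k * heat Q t q) := fun q => by
    split_ifs
    · exact le_rfl
    · exact mul_nonneg (pow_nonneg (qf_nonneg hQ q) k) (heat_pos _ q).le
  have h1 : ∀ q, (if q = 0 then 0 else qf Q q ^ k * heat Q t q)
      ≤ exp (-(c / 2) * t) * (qf Q q ^ k * heat Q (1 / 2) q) := fun q => by
    split_ifs with hq
    · exact mul_nonneg (exp_pos _).le (hs0 q)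
    · rw [mul_left_comm]
      refine mul_le_mul_of_nonneg_left ?_ (pow_nonneg (qf_nonneg hQ q) k)
      rw [heat, heat, ← exp_add]
      refine exp_le_exp.mpr ?_
      nlinarith [hcq q hq]
  have h2 := Summable.of_nonneg_of_le h0 h1 (hs.mul_left _)
  refine ⟨?_, h2⟩
  have h3 := h2.tsum_le_tsum h1 (hs.mul_left _)
  rw [tsum_mul_left] at h3
  have h4 := hexp t (by linarith)
  have h5 : exp (-(c / 2) * t) = exp (-(c / 4) * t) * exp (-(c / 4) * t) := by
    rw [← exp_add]
    ring_nf
  set Z := ∑' q, qf Q q ^ k * heat Q (1 / 2) q with hZ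
  have hZ0 : 0 ≤ Z := tsum_nonneg hs0
  calc _ ≤ t ^ 2 * (exp (-(c / 2) * t) * Z) := mul_le_mul_of_nonneg_left h3 (sq_nonneg t)
    _ = (t ^ 2 * exp (-(c / 4) * t)) * Z * exp (-(c / 4) * t) := by rw [h5]; ring
    _ ≤ D * (Z + 1) * exp (-(c / 4) * t) := by
        gcongr
        linarith

end LatticeGaussian

namespace LatticeGaussian

open Real Filter Topology DiagonalPerturbation

variable {d : ℕ} {Q : Matrix (Fin d) (Fin d) ℝ}

/-! ### The scalar form factors -/

/-- The divided difference of `z ↦ e^{-tz}` between `(q+p)²` and `q²`. -/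
def heatDiff (Q : Matrix (Fin d) (Fin d) ℝ) (t : ℝ) (p q : Fin d → ℤ) : ℝ :=
  expDiff t (qf Q (q + p)) (qf Q q)

/-- The form factor of the spectral action, up to the factor `2^m t (2π)^{-d} p⁻⁴`, as a form on
vectors orthogonal to `p`. -/
def actionForm (Q : Matrix (Fin d) (Fin d) ℝ) (t : ℝ) (p : Fin d → ℤ) (ν σ : Fin d) : ℝ :=
  Q ν σ * (qf Q p / 2 * ∑' q, heatDiff Q t p q + ∑' q, heat Q t q)
    + 2 * ∑' q, perp Q p q ν * perp Q p q σ * heatDiff Q t p q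

/-- The form factor of the large-momentum action, normalised as `actionForm`. -/
def momentumForm (Q : Matrix (Fin d) (Fin d) ℝ) (t : ℝ) (p : Fin d → ℤ) (ν σ : Fin d) : ℝ :=
  -∑' q, (4 / qf Q p * (perp Q p q ν * perp Q p q σ) + 4 / qf Q p ^ 2 * ip Q p q ^ 2 * Q ν σ)
    * heat Q t q

theorem abs_heatDiff_le {t : ℝ} (ht : 0 ≤ t) (p q : Fin d → ℤ) :
    |heatDiff Q t p q| ≤ t * (heat Q t (q + p) + heat Q t q) := abs_expDiff_le ht _ _

theorem summable_comp_add {f : (Fin d → ℤ) → ℝ} (hf : Summable f) (p : Fin d → ℤ) :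
    Summable fun q => f (q + p) := (Equiv.addRight p).summable_iff.mpr hf

theorem tsum_comp_add (f : (Fin d → ℤ) → ℝ) (p : Fin d → ℤ) :
    ∑' q, f (q + p) = ∑' q, f q := (Equiv.addRight p).tsum_eq f

theorem tsum_comp_neg (f : (Fin d → ℤ) → ℝ) : ∑' q, f (-q) = ∑' q, f q :=
  (Equiv.neg _).tsum_eq f

theorem tsum_odd {f : (Fin d → ℤ) → ℝ} (hf : ∀ q, f (-q) = -f q) : ∑' q, f q = 0 := by
  have := tsum_comp_neg f
  simp only [hf, tsum_neg] at this
  linarith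

/-- Sums against `heatDiff` of functions that do not change under translation by `p`. -/
theorem summable_mul_heatDiff (hQ : Q.PosDef) {t : ℝ} (ht : 0 < t) {p : Fin d → ℤ}
    {f : (Fin d → ℤ) → ℝ} (hfp : ∀ q, f (q + p) = f q) {C : ℝ} {k : ℕ}
    (hf : ∀ q, |f q| ≤ C * qf Q q ^ k) : Summable fun q => f q * heatDiff Q t p q := by
  have h1 := summable_mul_heat hQ ht hf
  have h2 := summable_comp_add h1 p
  refine Summable.of_norm_bounded (((h2.abs).add h1.abs).mul_left t) fun q => ?_
  rw [norm_mul, norm_eq_abs, norm_eq_abs, hfp, abs_mul, abs_mul, abs_of_pos (heat_pos _ _),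
    abs_of_pos (heat_pos _ _)]
  calc |f q| * |heatDiff Q t p q| ≤ |f q| * (t * (heat Q t (q + p) + heat Q t q)) :=
        mul_le_mul_of_nonneg_left (abs_heatDiff_le ht.le p q) (abs_nonneg _)
    _ = _ := by ring

theorem summable_heatDiff (hQ : Q.PosDef) {t : ℝ} (ht : 0 < t) (p : Fin d → ℤ) :
    Summable fun q => heatDiff Q t p q := by
  have := summable_mul_heatDiff hQ ht (p := p) (f := fun _ => 1) (fun _ => rfl) (C := 1) (k := 0)
    (fun q => by simp)
  simpa using this

theorem summable_perp_mul_heatDiff (hQ : Q.PosDef) {t : ℝ} (ht : 0 < t) {p : Fin d → ℤ} (hp : p ≠ 0)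
    (ν σ : Fin d) : Summable fun q => perp Q p q ν * perp Q p q σ * heatDiff Q t p q :=
  summable_mul_heatDiff hQ ht (fun q => by rw [perp_add hQ hp, perp_add hQ hp]) (k := 1)
    fun q => by simpa using abs_perp_mul_le hQ hp q ν σ

theorem summable_perp_mul_heat (hQ : Q.PosDef) {t : ℝ} (ht : 0 < t) {p : Fin d → ℤ} (hp : p ≠ 0)
    (ν σ : Fin d) : Summable fun q => perp Q p q ν * perp Q p q σ * heat Q t q :=
  summable_mul_heat hQ ht (k := 1) fun q => by simpa using abs_perp_mul_le hQ hp q ν σ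

theorem summable_ip_pow_mul_heat (hQ : Q.PosDef) {t : ℝ} (ht : 0 < t) (p : Fin d → ℤ) (k : ℕ) :
    Summable fun q => ip Q p q ^ (2 * k) * heat Q t q := by
  refine summable_mul_heat hQ ht (C := qf Q p ^ k) (k := k) fun q => ?_
  rw [← mul_pow, pow_mul, abs_of_nonneg (pow_nonneg (sq_nonneg _) k)]
  exact pow_le_pow_left₀ (sq_nonneg _) (sq_ip_le hQ p q) k

/-! ### Small cut-off: large `t` -/

theorem abs_momentumForm_le (hQ : Q.PosDef) {t : ℝ} (ht : 0 < t) {p : Fin d → ℤ} (hp : p ≠ 0)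
    (ν σ : Fin d) : |momentumForm Q t p ν σ|
      ≤ 4 * (Q.trace + |Q ν σ|) / qf Q p * ∑' q, (if q = 0 then 0 else qf Q q ^ 1 * heat Q t q) := by
  have hP := qf_pos hQ hp
  have h0 := summable_qf_pow_mul_heat hQ 1 ht
  have h1 : (fun q : Fin d → ℤ => if q = 0 then 0 else qf Q q ^ 1 * heat Q t q)
      = fun q => qf Q q ^ 1 * heat Q t q := by
    funext q
    split_ifs with hq
    · rw [hq, qf_zero]; ring
    · rfl
  rw [h1, ← tsum_mul_left, momentumForm, abs_neg]
  refine abs_tsum_le_of_abs_le (h0.mul_left _) fun q => ?_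
  rw [abs_mul, abs_of_pos (heat_pos t q), ← mul_assoc (4 * (Q.trace + |Q ν σ|) / qf Q p)]
  refine mul_le_mul_of_nonneg_right ?_ (heat_pos t q).le
  have h2 := abs_perp_mul_le hQ hp q ν σ
  have h3 := sq_ip_le hQ p q
  refine (abs_add_le _ _).trans ?_
  rw [abs_mul, abs_of_pos (show 0 < 4 / qf Q p by positivity),
    abs_mul (4 / qf Q p ^ 2 * ip Q p q ^ 2),
    abs_of_nonneg (show 0 ≤ 4 / qf Q p ^ 2 * ip Q p q ^ 2 by positivity)]
  calc _ ≤ 4 / qf Q p * (Q.trace * qf Q q) + 4 / qf Q p ^ 2 * (qf Q p * qf Q q) * |Q ν σ| := by gcongr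
    _ = _ := by field_simp

/-- For `t ≥ 1` the large-momentum form is exponentially small: its summand vanishes at `q = 0`. -/
theorem exists_momentumForm_small (hQ : Q.PosDef) : ∃ c C, 0 < c ∧ 0 < C ∧ ∀ t, 1 ≤ t →
    ∀ p : Fin d → ℤ, p ≠ 0 → ∀ ν σ, t * |momentumForm Q t p ν σ| ≤ C * exp (-c * t) / qf Q p := by
  obtain ⟨c, C, hc, hC, h⟩ := exists_tsum_ne_zero_le hQ 1
  have hT : 0 ≤ Q.trace := hQ.posSemidef.trace_nonneg
  refine ⟨c, 4 * (Q.trace + ∑ i, ∑ j, |Q i j|) * C + 1, hc, by positivity, fun t ht p hp ν σ => ?_⟩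
  have hP := qf_pos hQ hp
  have h1 := abs_momentumForm_le hQ (by linarith : 0 < t) hp ν σ
  have h2 : |Q ν σ| ≤ ∑ i, ∑ j, |Q i j| := abs_entry_le Q ν σ
  have hZ0 : 0 ≤ ∑' q : Fin d → ℤ, (if q = 0 then 0 else qf Q q ^ 1 * heat Q t q) :=
    tsum_nonneg fun q => by
      split_ifs
      exacts [le_rfl, mul_nonneg (pow_nonneg (qf_nonneg hQ q) 1) (heat_pos t q).le]
  have h3 : t * ∑' q : Fin d → ℤ, (if q = 0 then 0 else qf Q q ^ 1 * heat Q t q)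
      ≤ C * exp (-c * t) :=
    (mul_le_mul_of_nonneg_right (by nlinarith) hZ0).trans (h t ht).1
  have h4 := exp_pos (-c * t)
  have h5 := mul_nonneg (by linarith : 0 ≤ t) hZ0
  calc _ ≤ t * (4 * (Q.trace + |Q ν σ|) / qf Q p
          * ∑' q, (if q = 0 then 0 else qf Q q ^ 1 * heat Q t q)) :=
        mul_le_mul_of_nonneg_left h1 (by linarith)
    _ = 4 * (Q.trace + |Q ν σ|) / qf Q p
          * (t * ∑' q, (if q = 0 then 0 else qf Q q ^ 1 * heat Q t q)) := by ring
    _ ≤ 4 * (Q.trace + ∑ i, ∑ j, |Q i j|) / qf Q p * (C * exp (-c * t)) := by gcongr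
    _ = (4 * (Q.trace + ∑ i, ∑ j, |Q i j|) * C) * exp (-c * t) / qf Q p := by ring
    _ ≤ _ := by
        gcongr
        linarith

/-- The terms `q = 0` and `q = -p` of the first sum in `actionForm` cancel the term `q = 0` of the
second sum, up to `e^{-tp²}`. -/
theorem abs_heatDiff_sum_le (hQ : Q.PosDef) {t : ℝ} (ht : 0 < t) {p : Fin d → ℤ} (hp : p ≠ 0) :
    |qf Q p / 2 * ∑' q, heatDiff Q t p q + ∑' q, heat Q t q|
      ≤ heat Q t p + (qf Q p * t + 1) * ∑' q, (if q = 0 then 0 else qf Q q ^ 0 * heat Q t q) := by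
  classical
  have hP := qf_pos hQ hp
  have hs := summable_heat hQ ht
  set H : (Fin d → ℤ) → ℝ := fun q => if q = 0 then 0 else heat Q t q with hH
  have hH0 : ∀ q, 0 ≤ H q := fun q => by
    simp only [hH]
    split_ifs
    exacts [le_rfl, (heat_pos t q).le]
  have hHs : Summable H := hs.of_nonneg_of_le hH0 fun q => by
    simp only [hH]
    split_ifs
    exacts [(heat_pos t q).le, le_rfl]
  have hHeq : ∑' q, heat Q t q = 1 + ∑' q, H q := by
    rw [hs.tsum_eq_add_tsum_ite 0, heat_zero]
  have hG0 : heatDiff Q t p 0 = (heat Q t p - 1) / qf Q p := by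
    have := expDiff_mul_sub t (qf Q (0 + p)) (qf Q 0)
    rw [zero_add, qf_zero, mul_zero, exp_zero, sub_zero] at this
    rw [eq_div_iff hP.ne', heatDiff, zero_add, qf_zero]
    exact this
  have hGp : heatDiff Q t p (-p) = (heat Q t p - 1) / qf Q p := by
    rw [← hG0, heatDiff, heatDiff, neg_add_cancel, zero_add, qf_neg, expDiff_comm]
  have hne : (0 : Fin d → ℤ) ≠ -p := fun h => hp (by simpa using h.symm)
  have hGs := summable_heatDiff hQ ht p
  have hGeq : ∑' q, heatDiff Q t p q = 2 * ((heat Q t p - 1) / qf Q p)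
      + ∑' q, (if q = -p then 0 else if q = 0 then 0 else heatDiff Q t p q) := by
    have hs1 : Summable fun q => (if q = 0 then 0 else heatDiff Q t p q) :=
      Summable.of_norm_bounded hGs.norm fun q => by
        split_ifs
        · simp
        · exact le_rfl
    rw [hGs.tsum_eq_add_tsum_ite 0, hs1.tsum_eq_add_tsum_ite (-p), if_neg hne.symm, hG0, hGp]
    ring
  have hrest : |∑' q, (if q = -p then 0 else if q = 0 then 0 else heatDiff Q t p q)|
      ≤ 2 * t * ∑' q, H q := by
    have h1 := ((summable_comp_add hHs p).add hHs).mul_left t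
    have h2 : ∑' q, t * (H (q + p) + H q) = 2 * t * ∑' q, H q := by
      rw [tsum_mul_left, (summable_comp_add hHs p).tsum_add hHs, tsum_comp_add H p]
      ring
    rw [← h2]
    refine abs_tsum_le_of_abs_le h1 fun q => ?_
    split_ifs with ha hb
    · rw [abs_zero]
      exact mul_nonneg ht.le (add_nonneg (hH0 _) (hH0 _))
    · rw [abs_zero]
      exact mul_nonneg ht.le (add_nonneg (hH0 _) (hH0 _))
    · have hc : q + p ≠ 0 := fun h => ha (eq_neg_of_add_eq_zero_left h)
      simp only [hH, hb, hc, if_false]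
      exact abs_heatDiff_le ht.le p q
  have hHH : ∑' q, (if q = 0 then 0 else qf Q q ^ 0 * heat Q t q) = ∑' q, H q := by
    simp only [hH, pow_zero, one_mul]
  rw [hHH, hGeq, hHeq]
  set R := ∑' q, (if q = -p then 0 else if q = 0 then 0 else heatDiff Q t p q)
  have e1 : qf Q p / 2 * (2 * ((heat Q t p - 1) / qf Q p) + R) + (1 + ∑' q, H q)
      = heat Q t p + qf Q p / 2 * R + ∑' q, H q := by
    field_simp
    ring
  rw [e1]
  have h5 : 0 ≤ ∑' q, H q := tsum_nonneg hH0
  refine (abs_add_three _ _ _).trans ?_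
  rw [abs_of_pos (heat_pos t p), abs_of_nonneg h5, abs_mul, abs_of_pos (half_pos hP)]
  have : qf Q p / 2 * |R| ≤ qf Q p / 2 * (2 * t * ∑' q, H q) :=
    mul_le_mul_of_nonneg_left hrest (half_pos hP).le
  linarith

/-- The transverse sum has no terms at `q = 0` and `q = -p`, where `q` is parallel to `p`. -/
theorem abs_perp_heatDiff_sum_le (hQ : Q.PosDef) {t : ℝ} (ht : 0 < t) {p : Fin d → ℤ} (hp : p ≠ 0)
    (ν σ : Fin d) : |∑' q, perp Q p q ν * perp Q p q σ * heatDiff Q t p q|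
      ≤ 2 * Q.trace * (t * ∑' q, (if q = 0 then 0 else qf Q q ^ 1 * heat Q t q)) := by
  have h0 := summable_qf_pow_mul_heat hQ 1 ht
  have h1 : (fun q : Fin d → ℤ => if q = 0 then 0 else qf Q q ^ 1 * heat Q t q)
      = fun q => qf Q q ^ 1 * heat Q t q := by
    funext q
    split_ifs with hq
    · rw [hq, qf_zero]; ring
    · rfl
  have h2 := ((summable_comp_add h0 p).add h0).mul_left (t * Q.trace)
  have h3 : ∑' q, t * Q.trace * (qf Q (q + p) ^ 1 * heat Q t (q + p) + qf Q q ^ 1 * heat Q t q)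
      = 2 * Q.trace * (t * ∑' q, qf Q q ^ 1 * heat Q t q) := by
    rw [tsum_mul_left, (summable_comp_add h0 p).tsum_add h0,
      tsum_comp_add (fun q => qf Q q ^ 1 * heat Q t q) p]
    ring
  rw [h1, ← h3]
  refine abs_tsum_le_of_abs_le h2 fun q => ?_
  have h4 := abs_perp_mul_le hQ hp q ν σ
  have h5 := abs_perp_mul_le hQ hp (q + p) ν σ
  rw [perp_add hQ hp, perp_add hQ hp] at h5
  rw [abs_mul, pow_one, pow_one]
  have h6 := heat_pos (Q := Q) t q
  have h7 := heat_pos (Q := Q) t (q + p)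
  calc _ ≤ |perp Q p q ν * perp Q p q σ| * (t * (heat Q t (q + p) + heat Q t q)) :=
        mul_le_mul_of_nonneg_left (abs_heatDiff_le ht.le p q) (abs_nonneg _)
    _ = t * (|perp Q p q ν * perp Q p q σ| * heat Q t (q + p)
          + |perp Q p q ν * perp Q p q σ| * heat Q t q) := by ring
    _ ≤ t * (Q.trace * qf Q (q + p) * heat Q t (q + p) + Q.trace * qf Q q * heat Q t q) := by gcongr
    _ = _ := by ring

/-- For `t ≥ 1` the form factor is exponentially small. -/
theorem exists_actionForm_small (hQ : Q.PosDef) : ∃ c C, 0 < c ∧ 0 < C ∧ ∀ t, 1 ≤ t →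
    ∀ p : Fin d → ℤ, p ≠ 0 → ∀ ν σ, t * |actionForm Q t p ν σ| ≤ C * exp (-c * t) * qf Q p := by
  obtain ⟨c₀, C₀, hc₀, hC₀, h₀⟩ := exists_tsum_ne_zero_le hQ 0
  obtain ⟨c₁, C₁, hc₁, hC₁, h₁⟩ := exists_tsum_ne_zero_le hQ 1
  obtain ⟨b, hb, hbq⟩ := exists_le_qf hQ
  obtain ⟨D, hD, hexp⟩ := exists_pow_mul_exp_le 1 (ε := b / 2) (by positivity)
  have hT : 0 ≤ Q.trace := hQ.posSemidef.trace_nonneg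
  obtain ⟨B, hB⟩ : ∃ B, B = ∑ i, ∑ j, |Q i j| := ⟨_, rfl⟩
  have hB0 : 0 ≤ B := by rw [hB]; positivity
  obtain ⟨c, hc⟩ : ∃ c, c = min (b / 2) (min c₀ c₁) := ⟨_, rfl⟩
  have hc0 : 0 < c := by rw [hc]; positivity
  have hcb : c ≤ b / 2 := hc ▸ min_le_left _ _
  have hcc₀ : c ≤ c₀ := hc ▸ (min_le_right _ _).trans (min_le_left _ _)
  have hcc₁ : c ≤ c₁ := hc ▸ (min_le_right _ _).trans (min_le_right _ _)
  refine ⟨c, B * (D / b + C₀ + C₀ / b) + 4 * Q.trace * C₁ / b + 1, hc0, by positivity,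
    fun t ht p hp ν σ => ?_⟩
  have ht0 : 0 < t := by linarith
  have hbP := hbq p hp
  have hP : 0 < qf Q p := by linarith
  have hQB : |Q ν σ| ≤ B := hB ▸ abs_entry_le Q ν σ
  have e₀ := (h₀ t ht).1
  have e₁ := (h₁ t ht).1
  have a₀ := abs_heatDiff_sum_le hQ ht0 hp
  have a₁ := abs_perp_heatDiff_sum_le hQ ht0 hp ν σ
  obtain ⟨Z₀, hZ₀⟩ : ∃ Z, Z = ∑' q : Fin d → ℤ, (if q = 0 then 0 else qf Q q ^ 0 * heat Q t q) :=
    ⟨_, rfl⟩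
  obtain ⟨Z₁, hZ₁⟩ : ∃ Z, Z = ∑' q : Fin d → ℤ, (if q = 0 then 0 else qf Q q ^ 1 * heat Q t q) :=
    ⟨_, rfl⟩
  have hZ₀0 : 0 ≤ Z₀ := hZ₀ ▸ tsum_nonneg fun q => by
    split_ifs
    exacts [le_rfl, mul_nonneg (pow_nonneg (qf_nonneg hQ q) 0) (heat_pos t q).le]
  rw [← hZ₀] at e₀ a₀
  rw [← hZ₁] at e₁ a₁
  obtain ⟨E, hE⟩ : ∃ E, E = exp (-c * t) := ⟨_, rfl⟩
  have hE0 : 0 < E := hE ▸ exp_pos _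
  have f₀ : t ^ 2 * Z₀ ≤ C₀ * E := e₀.trans (by rw [hE]; gcongr)
  have f₁ : t ^ 2 * Z₁ ≤ C₁ * E := e₁.trans (by rw [hE]; gcongr)
  have f₂ : t * heat Q t p ≤ D * E := by
    have g1 : heat Q t p ≤ exp (-(b / 2) * t) * exp (-(b / 2) * t) := by
      rw [heat, ← exp_add]
      exact exp_le_exp.mpr (by nlinarith)
    have g2 : exp (-(b / 2) * t) ≤ E := hE ▸ exp_le_exp.mpr (by nlinarith)
    have g3 := hexp t ht0.le
    rw [pow_one] at g3
    calc t * heat Q t p ≤ t * (exp (-(b / 2) * t) * exp (-(b / 2) * t)) := by gcongr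
      _ = (t * exp (-(b / 2) * t)) * exp (-(b / 2) * t) := by ring
      _ ≤ D * E := by gcongr
  have f₃ : t * Z₀ ≤ C₀ * E := (mul_le_mul_of_nonneg_right (by nlinarith) hZ₀0).trans f₀
  have hPb : 1 ≤ qf Q p / b := (one_le_div hb).mpr hbP
  have main : t * |actionForm Q t p ν σ| ≤ B * (D * E + qf Q p * (C₀ * E) + C₀ * E)
      + 4 * Q.trace * (C₁ * E) := by
    have g1 : |actionForm Q t p ν σ| ≤ B * (heat Q t p + (qf Q p * t + 1) * Z₀)
        + 2 * (2 * Q.trace * (t * Z₁)) := by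
      rw [actionForm]
      refine (abs_add_le _ _).trans (add_le_add ?_ ?_)
      · rw [abs_mul]
        exact mul_le_mul hQB a₀ (abs_nonneg _) hB0
      · rw [abs_mul, abs_two]
        exact mul_le_mul_of_nonneg_left a₁ (by norm_num)
    calc t * |actionForm Q t p ν σ| ≤ t * (B * (heat Q t p + (qf Q p * t + 1) * Z₀)
        + 2 * (2 * Q.trace * (t * Z₁))) := mul_le_mul_of_nonneg_left g1 ht0.le
      _ = B * (t * heat Q t p + qf Q p * (t ^ 2 * Z₀) + t * Z₀) + 4 * Q.trace * (t ^ 2 * Z₁) := by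
        ring
      _ ≤ _ := by gcongr
  rw [← hE]
  refine main.trans ?_
  calc _ = (B * (D + C₀) + 4 * Q.trace * C₁) * E * 1 + B * C₀ * E * qf Q p := by ring
    _ ≤ (B * (D + C₀) + 4 * Q.trace * C₁) * E * (qf Q p / b) + B * C₀ * E * qf Q p
          + E * qf Q p := by
        have : 0 ≤ E * qf Q p := by positivity
        have : (B * (D + C₀) + 4 * Q.trace * C₁) * E * 1
          ≤ (B * (D + C₀) + 4 * Q.trace * C₁) * E * (qf Q p / b) := by gcongr
        linarith
    _ = _ := by ring

/-! ### Large momenta -/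

/-- The part of the large-momentum expansion of `heatDiff` that is concentrated at small `q`; the
rest is its mirror image under `q ↦ -q - p`. -/
def heatTail (Q : Matrix (Fin d) (Fin d) ℝ) (t : ℝ) (p q : Fin d → ℤ) : ℝ :=
  -heat Q t q * (1 / qf Q p - 2 * ip Q p q / qf Q p ^ 2 + 4 * ip Q p q ^ 2 / qf Q p ^ 3
    - 8 * ip Q p q ^ 3 / qf Q p ^ 4)

theorem abs_geom_le {P x : ℝ} (hP : 0 < P) (hx : |x| ≤ P) :
    |1 / P - 2 * x / P ^ 2 + 4 * x ^ 2 / P ^ 3 - 8 * x ^ 3 / P ^ 4| ≤ 15 / P := by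
  have h : |x / P| ≤ 1 := by
    rw [abs_div, abs_of_pos hP, div_le_one hP]
    exact hx
  have e : 1 / P - 2 * x / P ^ 2 + 4 * x ^ 2 / P ^ 3 - 8 * x ^ 3 / P ^ 4
      = (1 - 2 * (x / P) + 4 * (x / P) ^ 2 - 8 * (x / P) ^ 3) / P := by
    field_simp
  rw [e, abs_div, abs_of_pos hP]
  refine div_le_div_of_nonneg_right ?_ hP.le
  obtain ⟨h1, h2⟩ := abs_le.mp h
  have h3 : |(x / P) ^ 3| ≤ 1 := by rw [abs_pow]; exact pow_le_one₀ (abs_nonneg _) h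
  obtain ⟨h4, h5⟩ := abs_le.mp h3
  rw [abs_le]
  constructor <;> nlinarith

/-- Remainder of the geometric series for `1/(P + 2x)`. -/
theorem geom_remainder {P x : ℝ} (hP : 0 < P) (hs : P + 2 * x ≠ 0) :
    1 / (P + 2 * x) - (1 / P - 2 * x / P ^ 2 + 4 * x ^ 2 / P ^ 3 - 8 * x ^ 3 / P ^ 4)
      = 16 * x ^ 4 / (P ^ 4 * (P + 2 * x)) := by
  field_simp
  ring

set_option maxHeartbeats 800000 in
/-- Pointwise large-momentum expansion of the divided difference. -/
theorem exists_heatDiff_expansion (hQ : Q.PosDef) {t : ℝ} (ht : 0 < t) :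
    ∃ C, 0 < C ∧ ∀ p : Fin d → ℤ, p ≠ 0 → ∀ q,
      |heatDiff Q t p q - heatTail Q t p q - heatTail Q t p (-(q + p))|
        ≤ C / qf Q p ^ 3 * (heat Q (t / 2) q + heat Q (t / 2) (q + p)) := by
  obtain ⟨C₁, hC₁, h₁⟩ := exists_qf_pow_mul_heat_le hQ 2 (half_lt_self ht)
  obtain ⟨C₂, hC₂, h₂⟩ := exists_pow_mul_exp_le 2 (ε := t / 32) (by positivity)
  obtain ⟨C₃, hC₃, h₃⟩ := exists_pow_mul_exp_le 3 (ε := t / 32) (by positivity)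
  refine ⟨32 * C₁ + 15 * C₂ + t * C₃, by positivity, fun p hp q => ?_⟩
  have hP := qf_pos hQ hp
  set P := qf Q p with hPdef
  set x := ip Q p q with hx
  have hk : qf Q (q + p) = qf Q q + (P + 2 * x) := by rw [qf_add hQ]; ring
  have hx' : ip Q p (-(q + p)) = -x - P := by
    rw [ip_neg_right, ip_add_right, ip_self]; ring
  have hG : heatDiff Q t p q * (P + 2 * x) = heat Q t (q + p) - heat Q t q := by
    have := expDiff_mul_sub t (qf Q (q + p)) (qf Q q)
    rw [hk, add_sub_cancel_left] at this
    rw [heatDiff, heat, heat, hk]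
    exact this
  have hτ : heatTail Q t p q = -heat Q t q * (1 / P - 2 * x / P ^ 2 + 4 * x ^ 2 / P ^ 3
      - 8 * x ^ 3 / P ^ 4) := rfl
  have hτ' : heatTail Q t p (-(q + p)) = -heat Q t (q + p) * (1 / P - 2 * (-x - P) / P ^ 2
      + 4 * (-x - P) ^ 2 / P ^ 3 - 8 * (-x - P) ^ 3 / P ^ 4) := by
    rw [heatTail, hx', heat_neg]
  have hxq : x ^ 2 ≤ P * qf Q q := sq_ip_le hQ p q
  have hxk : (-x - P) ^ 2 ≤ P * qf Q (q + p) := by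
    have := sq_ip_le hQ p (-(q + p))
    rwa [hx', qf_neg] at this
  have hq0 := qf_nonneg hQ q
  have hk0 := qf_nonneg hQ (q + p)
  have eq0 := heat_pos (Q := Q) t q
  have ek0 := heat_pos (Q := Q) t (q + p)
  have dq0 := heat_pos (Q := Q) (t / 2) q
  have dk0 := heat_pos (Q := Q) (t / 2) (q + p)
  rw [hτ, hτ']
  clear_value P x
  rcases le_or_gt (P / 2) |P + 2 * x| with hs | hs
  · -- away from the diagonal, `heatDiff` is an honest quotient
    have hne : P + 2 * x ≠ 0 := fun h => by
      rw [h, abs_zero] at hs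
      linarith
    have hne' : P + 2 * (-x - P) ≠ 0 := fun h => hne (by linarith)
    have hGq : heatDiff Q t p q = -heat Q t q * (1 / (P + 2 * x))
        + -heat Q t (q + p) * (1 / (P + 2 * (-x - P))) := by
      have e1 : P + 2 * (-x - P) = -(P + 2 * x) := by ring
      rw [e1, eq_div_of_mul_eq hne hG]
      field_simp
      ring
    have e2 : heatDiff Q t p q - -heat Q t q * (1 / P - 2 * x / P ^ 2 + 4 * x ^ 2 / P ^ 3
        - 8 * x ^ 3 / P ^ 4) - -heat Q t (q + p) * (1 / P - 2 * (-x - P) / P ^ 2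
        + 4 * (-x - P) ^ 2 / P ^ 3 - 8 * (-x - P) ^ 3 / P ^ 4)
        = -heat Q t q * (16 * x ^ 4 / (P ^ 4 * (P + 2 * x)))
          + -heat Q t (q + p) * (16 * (-x - P) ^ 4 / (P ^ 4 * (P + 2 * (-x - P)))) := by
      rw [hGq, ← geom_remainder hP hne, ← geom_remainder hP hne']
      ring
    have key : ∀ y r : ℝ, 0 ≤ r → y ^ 2 ≤ P * r → P / 2 ≤ |P + 2 * y| →
        |16 * y ^ 4 / (P ^ 4 * (P + 2 * y))| ≤ 32 / P ^ 3 * r ^ 2 := fun y r hr hy hsy => by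
      rw [abs_div, abs_mul (P ^ 4), abs_of_nonneg (by positivity : 0 ≤ 16 * y ^ 4),
        abs_of_pos (by positivity : 0 < P ^ 4)]
      have g1 : y ^ 4 ≤ P ^ 2 * r ^ 2 := by
        have := pow_le_pow_left₀ (sq_nonneg y) hy 2
        nlinarith
      calc 16 * y ^ 4 / (P ^ 4 * |P + 2 * y|) ≤ 16 * (P ^ 2 * r ^ 2) / (P ^ 4 * (P / 2)) := by gcongr
        _ = _ := by field_simp; ring
    have hs' : P / 2 ≤ |P + 2 * (-x - P)| := by
      have e1 : P + 2 * (-x - P) = -(P + 2 * x) := by ring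
      rwa [e1, abs_neg]
    rw [e2]
    refine (abs_add_le _ _).trans ?_
    rw [abs_mul, abs_mul, abs_neg, abs_neg, abs_of_pos eq0, abs_of_pos ek0]
    have k1 := mul_le_mul_of_nonneg_left (key x _ hq0 hxq hs) eq0.le
    have k2 := mul_le_mul_of_nonneg_left (key (-x - P) _ hk0 hxk hs') ek0.le
    have m1 := h₁ q
    have m2 := h₁ (q + p)
    calc _ ≤ 32 / P ^ 3 * (qf Q q ^ 2 * heat Q t q) + 32 / P ^ 3 * (qf Q (q + p) ^ 2 * heat Q t (q + p)) := by
          linarith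
      _ ≤ 32 / P ^ 3 * (C₁ * heat Q (t / 2) q) + 32 / P ^ 3 * (C₁ * heat Q (t / 2) (q + p)) := by
          gcongr
      _ = 32 * C₁ / P ^ 3 * (heat Q (t / 2) q + heat Q (t / 2) (q + p)) := by ring
      _ ≤ _ := by
          gcongr
          have : 0 ≤ 15 * C₂ + t * C₃ := by positivity
          linarith
  · -- near the diagonal both `q²` and `(q+p)²` are at least `p²/16`
    obtain ⟨s1, s2⟩ := abs_lt.mp hs
    have hq16 : P / 16 ≤ qf Q q := by
      have : P ^ 2 / 16 ≤ P * qf Q q := by nlinarith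
      nlinarith
    have hk16 : P / 16 ≤ qf Q (q + p) := by
      have : P ^ 2 / 16 ≤ P * qf Q (q + p) := by nlinarith
      nlinarith
    have small : ∀ r : Fin d → ℤ, P / 16 ≤ qf Q r →
        heat Q t r ≤ exp (-(t / 32) * P) * heat Q (t / 2) r := fun r hr => by
      rw [heat, heat, ← exp_add]
      exact exp_le_exp.mpr (by nlinarith)
    have sq := small q hq16
    have sk := small (q + p) hk16
    have hx1 : |x| ≤ P := abs_le.mpr ⟨by linarith, by linarith⟩
    have hx2 : |-x - P| ≤ P := abs_le.mpr ⟨by linarith, by linarith⟩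
    have b0 := abs_heatDiff_le (Q := Q) ht.le p q
    have b1 := abs_geom_le hP hx1
    have b2 := abs_geom_le hP hx2
    have ex0 := exp_pos (-(t / 32) * P)
    have p2 : exp (-(t / 32) * P) / P ≤ C₂ / P ^ 3 := by
      rw [div_le_div_iff₀ hP (by positivity)]
      nlinarith [h₂ P hP.le]
    have p3 : exp (-(t / 32) * P) ≤ C₃ / P ^ 3 := by
      rw [le_div_iff₀ (by positivity)]
      linarith [h₃ P hP.le]
    refine (abs_sub _ _).trans ((add_le_add (abs_sub _ _) le_rfl).trans ?_)
    rw [abs_mul (-heat Q t q), abs_mul (-heat Q t (q + p)), abs_neg, abs_neg, abs_of_pos eq0,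
      abs_of_pos ek0]
    calc _ ≤ t * (heat Q t (q + p) + heat Q t q) + heat Q t q * (15 / P)
          + heat Q t (q + p) * (15 / P) := by gcongr
      _ = (heat Q t q + heat Q t (q + p)) * (t + 15 / P) := by ring
      _ ≤ (exp (-(t / 32) * P) * heat Q (t / 2) q + exp (-(t / 32) * P) * heat Q (t / 2) (q + p))
            * (t + 15 / P) := by gcongr
      _ = (15 * (exp (-(t / 32) * P) / P) + t * exp (-(t / 32) * P))
            * (heat Q (t / 2) q + heat Q (t / 2) (q + p)) := by ring
      _ ≤ (15 * (C₂ / P ^ 3) + t * (C₃ / P ^ 3))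
            * (heat Q (t / 2) q + heat Q (t / 2) (q + p)) := by gcongr
      _ = (15 * C₂ + t * C₃) / P ^ 3 * (heat Q (t / 2) q + heat Q (t / 2) (q + p)) := by ring
      _ ≤ _ := by
          gcongr
          have : 0 ≤ 32 * C₁ := by positivity
          linarith

end LatticeGaussian

namespace LatticeGaussian

open Real Filter Topology DiagonalPerturbation

/-! ### The form factors at large momenta -/

variable {d : ℕ} {Q : Matrix (Fin d) (Fin d) ℝ}

theorem heatTail_eq (t : ℝ) (p q : Fin d → ℤ) (P : ℝ) (hP : qf Q p = P) : heatTail Q t p q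
    = (-1 / P) * heat Q t q + (-4 / P ^ 3) * (ip Q p q ^ 2 * heat Q t q)
      + (2 / P ^ 2 + 8 / P ^ 4 * ip Q p q ^ 2) * ip Q p q * heat Q t q := by
  rw [heatTail, hP]
  ring

/-- The expansion of `heatDiff`, summed against an even function that does not change under
translation by `p`. -/
theorem exists_tsum_heatDiff_expansion (hQ : Q.PosDef) {t : ℝ} (ht : 0 < t) (k : ℕ) :
    ∃ C, 0 < C ∧ ∀ p : Fin d → ℤ, p ≠ 0 → ∀ f : (Fin d → ℤ) → ℝ, (∀ q, f (q + p) = f q) →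
      (∀ q, f (-q) = f q) → ∀ B, 0 ≤ B → (∀ q, |f q| ≤ B * qf Q q ^ k) →
      |∑' q, f q * heatDiff Q t p q + 2 / qf Q p * ∑' q, f q * heat Q t q
        + 8 / qf Q p ^ 3 * ∑' q, f q * ip Q p q ^ 2 * heat Q t q| ≤ C * B / qf Q p ^ 3 := by
  obtain ⟨C, hC, h⟩ := exists_heatDiff_expansion hQ ht
  have hZ := summable_qf_pow_mul_heat hQ k (half_pos ht)
  have hZ0 : 0 ≤ ∑' q, qf Q q ^ k * heat Q (t / 2) q := tsum_nonneg fun q =>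
    mul_nonneg (pow_nonneg (qf_nonneg hQ q) k) (heat_pos _ q).le
  refine ⟨C * (2 * ∑' q, qf Q q ^ k * heat Q (t / 2) q) + 1, by positivity,
    fun p hp f hfp hfn B hB hf => ?_⟩
  have hP := qf_pos hQ hp
  have s0 := summable_mul_heat hQ ht hf
  have s2 : Summable fun q => f q * ip Q p q ^ 2 * heat Q t q := by
    refine summable_mul_heat hQ ht (C := B * qf Q p) (k := k + 1) fun q => ?_
    rw [abs_mul, abs_of_nonneg (sq_nonneg (ip Q p q))]
    calc |f q| * ip Q p q ^ 2 ≤ (B * qf Q q ^ k) * (qf Q p * qf Q q) :=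
          mul_le_mul (hf q) (sq_ip_le hQ p q) (sq_nonneg _)
            (mul_nonneg hB (pow_nonneg (qf_nonneg hQ q) k))
      _ = _ := by ring
  -- the odd part of the expansion
  have s3 : Summable fun q => f q * ((2 / qf Q p ^ 2 + 8 / qf Q p ^ 4 * ip Q p q ^ 2) * ip Q p q)
      * heat Q t q := by
    have r0 : ∀ q, |f q * ip Q p q| ≤ B * (1 + qf Q p) * (qf Q q ^ k * (1 + qf Q q)) := fun q => by
      have g1 : |ip Q p q| ≤ 1 + ip Q p q ^ 2 := by
        rw [abs_le]
        constructor <;> nlinarith [sq_nonneg (ip Q p q + 1), sq_nonneg (ip Q p q - 1)]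
      have g2 := sq_ip_le hQ p q
      have g3 := qf_nonneg hQ q
      rw [abs_mul]
      calc |f q| * |ip Q p q| ≤ (B * qf Q q ^ k) * ((1 + qf Q p) * (1 + qf Q q)) :=
            mul_le_mul (hf q) (by nlinarith) (abs_nonneg _) (by positivity)
        _ = _ := by ring
    have r1 : Summable fun q => f q * ip Q p q * heat Q t q := by
      have z := ((summable_qf_pow_mul_heat hQ k ht).add
        (summable_qf_pow_mul_heat hQ (k + 1) ht)).mul_left (B * (1 + qf Q p))
      refine Summable.of_norm_bounded z fun q => ?_
      rw [norm_mul, norm_eq_abs, norm_of_nonneg (heat_pos t q).le]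
      refine (mul_le_mul_of_nonneg_right (r0 q) (heat_pos t q).le).trans (le_of_eq ?_)
      ring
    have r3 : Summable fun q => f q * ip Q p q * ip Q p q ^ 2 * heat Q t q := by
      have z := ((summable_qf_pow_mul_heat hQ (k + 1) ht).add
        (summable_qf_pow_mul_heat hQ (k + 2) ht)).mul_left (B * (1 + qf Q p) * qf Q p)
      refine Summable.of_norm_bounded z fun q => ?_
      rw [norm_mul, norm_eq_abs, norm_of_nonneg (heat_pos t q).le, abs_mul,
        abs_of_nonneg (sq_nonneg (ip Q p q))]
      have g3 := qf_nonneg hQ q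
      have g4 := mul_le_mul (r0 q) (sq_ip_le hQ p q) (sq_nonneg _) (by positivity)
      refine (mul_le_mul_of_nonneg_right g4 (heat_pos t q).le).trans (le_of_eq ?_)
      ring
    refine ((r1.mul_left (2 / qf Q p ^ 2)).add (r3.mul_left (8 / qf Q p ^ 4))).congr fun q => ?_
    ring
  have hodd : ∑' q, f q * ((2 / qf Q p ^ 2 + 8 / qf Q p ^ 4 * ip Q p q ^ 2) * ip Q p q)
      * heat Q t q = 0 := tsum_odd fun q => by
    rw [hfn, ip_neg_right, heat_neg]
    ring
  have hτs : HasSum (fun q => f q * heatTail Q t p q)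
      ((-1 / qf Q p) * ∑' q, f q * heat Q t q
        + (-4 / qf Q p ^ 3) * ∑' q, f q * ip Q p q ^ 2 * heat Q t q) := by
    have := ((s0.hasSum.mul_left (-1 / qf Q p)).add (s2.hasSum.mul_left (-4 / qf Q p ^ 3))).add
      s3.hasSum
    rw [hodd, add_zero] at this
    refine this.congr_fun fun q => ?_
    rw [heatTail_eq t p q _ rfl]
    ring
  have hτs' : HasSum (fun q => f q * heatTail Q t p (-(q + p)))
      ((-1 / qf Q p) * ∑' q, f q * heat Q t q
        + (-4 / qf Q p ^ 3) * ∑' q, f q * ip Q p q ^ 2 * heat Q t q) := by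
    have := ((Equiv.addRight p).trans (Equiv.neg _)).hasSum_iff.mpr hτs
    refine this.congr_fun fun q => ?_
    simp only [Function.comp_apply, Equiv.trans_apply, Equiv.coe_addRight, Equiv.neg_apply]
    rw [hfn, hfp]
  have hG := (summable_mul_heatDiff hQ ht hfp hf).hasSum
  have hdiff := (hG.sub hτs).sub hτs'
  have hbound := ((summable_comp_add hZ p).add hZ).mul_left (C * B / qf Q p ^ 3)
  have hb := abs_tsum_le_of_abs_le (f := fun q => f q * heatDiff Q t p q - f q * heatTail Q t p q
    - f q * heatTail Q t p (-(q + p))) hbound fun q => by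
      rw [← mul_sub, ← mul_sub, abs_mul]
      have g1 := hf q
      have g2 := hf (q + p)
      rw [hfp] at g2
      have d1 := heat_pos (Q := Q) (t / 2) q
      have d2 := heat_pos (Q := Q) (t / 2) (q + p)
      calc _ ≤ |f q| * (C / qf Q p ^ 3 * (heat Q (t / 2) q + heat Q (t / 2) (q + p))) :=
            mul_le_mul_of_nonneg_left (h p hp q) (abs_nonneg _)
        _ = C / qf Q p ^ 3 * (|f q| * heat Q (t / 2) (q + p) + |f q| * heat Q (t / 2) q) := by ring
        _ ≤ C / qf Q p ^ 3 * (B * qf Q (q + p) ^ k * heat Q (t / 2) (q + p)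
              + B * qf Q q ^ k * heat Q (t / 2) q) := by gcongr
        _ = _ := by ring
  rw [hdiff.tsum_eq, tsum_mul_left, (summable_comp_add hZ p).tsum_add hZ,
    tsum_comp_add (fun q => qf Q q ^ k * heat Q (t / 2) q) p] at hb
  set S0 := ∑' q, f q * heat Q t q
  set S2 := ∑' q, f q * ip Q p q ^ 2 * heat Q t q
  set SG := ∑' q, f q * heatDiff Q t p q
  set Z := ∑' q, qf Q q ^ k * heat Q (t / 2) q
  have e1 : SG + 2 / qf Q p * S0 + 8 / qf Q p ^ 3 * S2
      = SG - (-1 / qf Q p * S0 + -4 / qf Q p ^ 3 * S2) - (-1 / qf Q p * S0 + -4 / qf Q p ^ 3 * S2) := by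
    ring
  rw [e1]
  refine hb.trans ?_
  calc _ = C * (2 * Z) * B / qf Q p ^ 3 := by ring
    _ ≤ _ := by
      gcongr
      linarith

theorem momentumForm_eq (hQ : Q.PosDef) {t : ℝ} (ht : 0 < t) {p : Fin d → ℤ} (hp : p ≠ 0)
    (ν σ : Fin d) : momentumForm Q t p ν σ
      = -(4 / qf Q p * ∑' q, perp Q p q ν * perp Q p q σ * heat Q t q
        + 4 / qf Q p ^ 2 * Q ν σ * ∑' q, ip Q p q ^ 2 * heat Q t q) := by
  have sx : Summable fun q => ip Q p q ^ 2 * heat Q t q := by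
    simpa using summable_ip_pow_mul_heat hQ ht p 1
  rw [momentumForm, ← tsum_mul_left, ← tsum_mul_left, ← ((summable_perp_mul_heat hQ ht hp ν σ).mul_left
    _).tsum_add (sx.mul_left _)]
  congr 1
  exact tsum_congr fun q => by ring

/-- The form factor agrees with its large-momentum form to relative order `p⁻²`: the leading term of
the sum of `heatDiff`, which is `-2/p²` times the heat trace, cancels in `actionForm`. -/
theorem exists_actionForm_sub_momentumForm (hQ : Q.PosDef) {t : ℝ} (ht : 0 < t) :
    ∃ C, 0 < C ∧ ∀ p : Fin d → ℤ, p ≠ 0 → ∀ ν σ,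
      |actionForm Q t p ν σ - momentumForm Q t p ν σ| ≤ C / qf Q p ^ 2 := by
  obtain ⟨C₀, hC₀, h₀⟩ := exists_tsum_heatDiff_expansion hQ ht 0
  obtain ⟨C₁, hC₁, h₁⟩ := exists_tsum_heatDiff_expansion hQ ht 1
  obtain ⟨b, hb, hbq⟩ := exists_le_qf hQ
  have hT : 0 ≤ Q.trace := hQ.posSemidef.trace_nonneg
  have hB0 : 0 ≤ ∑ i, ∑ j, |Q i j| := by positivity
  have hZ := summable_qf_pow_mul_heat hQ 2 ht
  obtain ⟨Z, hZe⟩ : ∃ Z, Z = ∑' q, qf Q q ^ 2 * heat Q t q := ⟨_, rfl⟩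
  have hZ0 : 0 ≤ Z := hZe ▸ tsum_nonneg fun q =>
    mul_nonneg (pow_nonneg (qf_nonneg hQ q) 2) (heat_pos _ q).le
  obtain ⟨B, hB⟩ : ∃ B, B = ∑ i, ∑ j, |Q i j| := ⟨_, rfl⟩
  rw [← hB] at hB0
  refine ⟨B * C₀ / 2 + 2 * (C₁ * Q.trace) / b + 16 * (Q.trace * Z) + 1, by positivity,
    fun p hp ν σ => ?_⟩
  have hbP := hbq p hp
  have hP := qf_pos hQ hp
  have hQB : |Q ν σ| ≤ B := hB ▸ abs_entry_le Q ν σ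
  have a₀ := h₀ p hp (fun _ => 1) (fun _ => rfl) (fun _ => rfl) 1 zero_le_one (fun q => by simp)
  have a₁ := h₁ p hp (fun q => perp Q p q ν * perp Q p q σ)
    (fun q => by rw [perp_add hQ hp, perp_add hQ hp])
    (fun q => by rw [perp_neg, perp_neg]; ring) Q.trace hT
    (fun q => by simpa using abs_perp_mul_le hQ hp q ν σ)
  simp only [one_mul, mul_one] at a₀
  have hM := momentumForm_eq hQ ht hp ν σ
  have a₂ : |∑' q, perp Q p q ν * perp Q p q σ * ip Q p q ^ 2 * heat Q t q|
      ≤ Q.trace * qf Q p * Z := by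
    rw [hZe, ← tsum_mul_left]
    refine abs_tsum_le_of_abs_le (hZ.mul_left _) fun q => ?_
    rw [abs_mul _ (heat Q t q), abs_mul _ (ip Q p q ^ 2), abs_of_pos (heat_pos t q),
      abs_of_nonneg (sq_nonneg (ip Q p q)), ← mul_assoc]
    refine mul_le_mul_of_nonneg_right ?_ (heat_pos t q).le
    calc _ ≤ (Q.trace * qf Q q) * (qf Q p * qf Q q) :=
          mul_le_mul (abs_perp_mul_le hQ hp q ν σ) (sq_ip_le hQ p q) (sq_nonneg _)
            (mul_nonneg hT (qf_nonneg hQ q))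
      _ = _ := by ring
  rw [hM, actionForm]
  set P := qf Q p
  set SG := ∑' q, heatDiff Q t p q
  set S0 := ∑' q, heat Q t q
  set Sx := ∑' q, ip Q p q ^ 2 * heat Q t q
  set SyG := ∑' q, perp Q p q ν * perp Q p q σ * heatDiff Q t p q
  set Sy := ∑' q, perp Q p q ν * perp Q p q σ * heat Q t q
  set Syx := ∑' q, perp Q p q ν * perp Q p q σ * ip Q p q ^ 2 * heat Q t q
  clear_value P SG S0 Sx SyG Sy Syx
  have e : Q ν σ * (P / 2 * SG + S0) + 2 * SyG - -(4 / P * Sy + 4 / P ^ 2 * Q ν σ * Sx)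
      = Q ν σ * (P / 2 * (SG + 2 / P * S0 + 8 / P ^ 3 * Sx))
        + 2 * (SyG + 2 / P * Sy + 8 / P ^ 3 * Syx) + -(16 / P ^ 3 * Syx) := by
    field_simp
    ring
  rw [e]
  refine (abs_add_three _ _ _).trans ?_
  rw [abs_mul, abs_mul (P / 2), abs_mul 2, abs_neg, abs_mul (16 / P ^ 3), abs_two,
    abs_of_pos (half_pos hP), abs_of_pos (show 0 < 16 / P ^ 3 by positivity)]
  have hPb : 1 / P ≤ 1 / b := one_div_le_one_div_of_le hb hbP
  calc _ ≤ B * (P / 2 * (C₀ / P ^ 3)) + 2 * (C₁ * Q.trace / P ^ 3)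
        + 16 / P ^ 3 * (Q.trace * P * Z) := by gcongr
    _ = B * C₀ / 2 / P ^ 2 + 2 * (C₁ * Q.trace) * (1 / P) / P ^ 2 + 16 * (Q.trace * Z) / P ^ 2 := by
        field_simp
    _ ≤ B * C₀ / 2 / P ^ 2 + 2 * (C₁ * Q.trace) * (1 / b) / P ^ 2 + 16 * (Q.trace * Z) / P ^ 2 := by
        gcongr
    _ = (B * C₀ / 2 + 2 * (C₁ * Q.trace) / b + 16 * (Q.trace * Z)) / P ^ 2 := by ring
    _ ≤ _ := div_le_div_of_nonneg_right (by linarith) (by positivity)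

/-- `∑_q e^{-tq²} (p·q)²` is bounded below by a multiple of `p²`. -/
theorem exists_le_tsum_ip_sq (hQ : Q.PosDef) {t : ℝ} (ht : 0 < t) : ∃ c, 0 < c ∧ ∀ p : Fin d → ℤ,
    c * qf Q p ≤ ∑' q, ip Q p q ^ 2 * heat Q t q := by
  classical
  -- `p² = Q⁻¹(p^·, p^·)` is dominated by `∑ (p^μ)²`, to which the basis vectors contribute
  let e : Fin d → Fin d → ℤ := fun μ => Pi.single μ 1
  have he : Function.Injective e := fun μ ν h => by
    by_contra hne
    have := congrFun h μ
    simp [e, hne] at this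
  have hvec : ∀ μ, vec (e μ) = Pi.single μ 1 := fun μ => by
    funext i
    simp only [vec, e, Pi.single_apply]
    split_ifs <;> simp
  obtain ⟨c₁, hc₁, h₁⟩ : ∃ c₁ : ℝ, 0 < c₁ ∧ ∀ μ, c₁ ≤ heat Q t (e μ) :=
    ⟨exp (-t * Q.trace), exp_pos _, fun μ => exp_le_exp.mpr (by
      have h2 : qf Q (e μ) = Q μ μ := by rw [qf, hvec, bil_single_single]
      have h3 : Q μ μ ≤ Q.trace :=
        Finset.single_le_sum (f := fun i => Q i i) (fun i _ => (hQ.diag_pos).le) (Finset.mem_univ μ)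
      rw [h2]
      nlinarith)⟩
  obtain ⟨C, hC, h2⟩ := exists_sum_sq_le hQ
  refine ⟨c₁ / C, by positivity, fun p => ?_⟩
  have hs : Summable fun q => ip Q p q ^ 2 * heat Q t q := by
    simpa using summable_ip_pow_mul_heat hQ ht p 1
  have h3 : ∑ μ, ip Q p (e μ) ^ 2 * heat Q t (e μ) ≤ ∑' q, ip Q p q ^ 2 * heat Q t q := by
    have := hs.sum_le_tsum (Finset.univ.map ⟨e, he⟩) fun q _ => by
      have := heat_pos (Q := Q) t q
      positivity
    rwa [Finset.sum_map] at this
  have h4 : ∀ μ, ip Q p (e μ) = upper Q p μ := fun μ => by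
    rw [ip_comm hQ, ip, hvec, ← upper_eq]
  have h5 : c₁ * ∑ μ, upper Q p μ ^ 2 ≤ ∑ μ, ip Q p (e μ) ^ 2 * heat Q t (e μ) := by
    rw [Finset.mul_sum]
    refine Finset.sum_le_sum fun μ _ => ?_
    rw [h4, mul_comm]
    exact mul_le_mul_of_nonneg_left (h₁ μ) (sq_nonneg _)
  have h6 : qf Q p ^ 2 ≤ (∑ μ, upper Q p μ ^ 2) * (C * qf Q p) := by
    have h7 := Finset.sum_mul_sq_le_sq_mul_sq Finset.univ (upper Q p) (vec p)
    have h8 : ∑ μ, upper Q p μ * vec p μ = qf Q p := sum_upper_mul_self p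
    rw [h8] at h7
    exact h7.trans (mul_le_mul_of_nonneg_left (h2 _) (Finset.sum_nonneg fun μ _ => sq_nonneg _))
  have h9 : qf Q p / C ≤ ∑ μ, upper Q p μ ^ 2 := by
    rcases (qf_nonneg hQ p).eq_or_lt with h0 | h0
    · rw [← h0, zero_div]
      exact Finset.sum_nonneg fun μ _ => sq_nonneg _
    · rw [div_le_iff₀ hC]
      nlinarith
  calc c₁ / C * qf Q p = c₁ * (qf Q p / C) := by ring
    _ ≤ c₁ * ∑ μ, upper Q p μ ^ 2 := by gcongr
    _ ≤ _ := h5.trans h3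

end LatticeGaussian

namespace LatticeGaussian

open Real Filter Topology DiagonalPerturbation

variable {d : ℕ} {Q : Matrix (Fin d) (Fin d) ℝ}

/-! ### Large cut-off: small `t` -/

/-- The Gaussian integral `∫ e^{-t Q(x)} dx`. -/
def gaussInt (Q : Matrix (Fin d) (Fin d) ℝ) (t : ℝ) : ℝ := √(π / t) ^ d / √Q.det

/-- The bilinear version of Poisson's formula for Gaussians. -/
theorem exists_poisson_bil (hQ : Q.PosDef) : ∃ c C, 0 < c ∧ 0 < C ∧ ∀ t, 0 < t → t ≤ 1 →
    ∀ s β β' : Fin d → ℝ, ∃ S, HasSum (fun q : Fin d → ℤ => bil Q β (vec q + s) * bil Q β' (vec q + s)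
        * exp (-t * bil Q (vec q + s) (vec q + s))) S ∧
      |S - gaussInt Q t * (bil Q β β' / (2 * t))|
        ≤ C * exp (-c / t) * (∑ i, β i ^ 2 + ∑ i, β' i ^ 2) := by
  obtain ⟨c, C, hc, hC, h⟩ := exists_poisson d Q hQ
  refine ⟨c, C, hc, hC, fun t ht ht1 s β β' => ?_⟩
  obtain ⟨S₁, hS₁, b₁⟩ := h t ht ht1 s 0 (β + β')
  obtain ⟨S₂, hS₂, b₂⟩ := h t ht ht1 s 0 (β + (-1 : ℝ) • β')
  refine ⟨(S₁ - S₂) / 4, ?_, ?_⟩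
  · convert! (hS₁.sub hS₂).div_const 4 using 2 with q
    show bil Q β (vec q + s) * bil Q β' (vec q + s) * _
      = ((0 + bil Q (β + β') (vec q + s)) ^ 2 * exp (-t * bil Q (vec q + s) (vec q + s))
        - (0 + bil Q (β + (-1 : ℝ) • β') (vec q + s)) ^ 2
          * exp (-t * bil Q (vec q + s) (vec q + s))) / 4
    rw [bil_add_left Q β β', bil_add_left Q β, bil_smul_left]
    ring
  · have e1 : bil Q (β + β') (β + β') = bil Q β β + 2 * bil Q β β' + bil Q β' β' := by
      rw [bil_add_left, bil_add_right, bil_add_right, bil_comm hQ.isHermitian β' β]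
      ring
    have e2 : bil Q (β + (-1 : ℝ) • β') (β + (-1 : ℝ) • β')
        = bil Q β β - 2 * bil Q β β' + bil Q β' β' := by
      rw [bil_add_left, bil_add_right, bil_add_right, bil_smul_left, bil_smul_left, bil_smul_right,
        bil_smul_right, bil_comm hQ.isHermitian β' β]
      ring
    have e3 : ∑ i, (β + β') i ^ 2 + ∑ i, (β + (-1 : ℝ) • β') i ^ 2
        = 2 * (∑ i, β i ^ 2 + ∑ i, β' i ^ 2) := by
      rw [← Finset.sum_add_distrib, ← Finset.sum_add_distrib, Finset.mul_sum]
      refine Finset.sum_congr rfl fun i _ => ?_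
      simp only [Pi.add_apply, Pi.smul_apply, smul_eq_mul]
      ring
    rw [e1] at b₁
    rw [e2] at b₂
    rw [← gaussInt] at b₁ b₂
    set E := C * exp (-c / t)
    have hE : 0 < E := by positivity
    have e4 : (S₁ - S₂) / 4 - gaussInt Q t * (bil Q β β' / (2 * t))
        = ((S₁ - gaussInt Q t * (0 ^ 2 + (bil Q β β + 2 * bil Q β β' + bil Q β' β') / (2 * t)))
          - (S₂ - gaussInt Q t * (0 ^ 2 + (bil Q β β - 2 * bil Q β β' + bil Q β' β') / (2 * t)))) / 4 := by
      ring
    rw [e4, abs_div, abs_of_pos (show (0 : ℝ) < 4 by norm_num), div_le_iff₀ (by norm_num)]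
    refine (abs_sub _ _).trans ((add_le_add b₁ b₂).trans ?_)
    rw [← mul_add, zero_pow two_ne_zero, zero_add, zero_add, e3]
    have : 0 ≤ E * (∑ i, β i ^ 2 + ∑ i, β' i ^ 2) := by positivity
    linarith

theorem exists_poisson_heat (hQ : Q.PosDef) : ∃ c C, 0 < c ∧ 0 < C ∧ ∀ t, 0 < t → t ≤ 1 →
    ∀ s : Fin d → ℝ, ∃ S, HasSum (fun q : Fin d → ℤ => exp (-t * bil Q (vec q + s) (vec q + s))) S ∧
      |S - gaussInt Q t| ≤ C * exp (-c / t) := by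
  obtain ⟨c, C, hc, hC, h⟩ := exists_poisson d Q hQ
  refine ⟨c, C, hc, hC, fun t ht ht1 s => ?_⟩
  obtain ⟨S, hS, b⟩ := h t ht ht1 s 1 0
  have h0 : ∀ x, bil Q 0 x = 0 := fun x => by simp [bil]
  refine ⟨S, ?_, ?_⟩
  · simp only [h0, add_zero, one_pow, one_mul] at hS
    exact hS
  · simpa [h0, gaussInt] using b

/-- The limit `t → 0` of the large-momentum form, up to exponentially small errors. -/
theorem exists_momentumForm_large (hQ : Q.PosDef) : ∃ c C, 0 < c ∧ 0 < C ∧ ∀ t, 0 < t → t ≤ 1 →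
    ∀ p : Fin d → ℤ, p ≠ 0 → ∀ ν σ,
      |momentumForm Q t p ν σ - (-4 * gaussInt Q t / (t * qf Q p) * Q ν σ
        + 2 * gaussInt Q t / (t * qf Q p ^ 2) * (upper Q p ν * upper Q p σ))|
        ≤ C * exp (-c / t) / qf Q p := by
  obtain ⟨c, C, hc, hC, h⟩ := exists_poisson_bil hQ
  obtain ⟨C₁, hC₁, h₁⟩ := exists_sum_sq_le hQ
  obtain ⟨C₂, hC₂, h₂⟩ := exists_sum_sq_transverse_le hQ
  obtain ⟨B, hB⟩ : ∃ B, B = ∑ i, ∑ j, |Q i j| := ⟨_, rfl⟩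
  have hB0 : 0 ≤ B := by rw [hB]; positivity
  refine ⟨c, 4 * C * (C₂ + C₂) + 4 * B * C * (C₁ + C₁), hc, by positivity,
    fun t ht ht1 p hp ν σ => ?_⟩
  have hP := qf_pos hQ hp
  have hQB : |Q ν σ| ≤ B := hB ▸ abs_entry_le Q ν σ
  obtain ⟨Sy, hSy, by'⟩ := h t ht ht1 0 (transverse Q p ν) (transverse Q p σ)
  obtain ⟨Sx, hSx, bx⟩ := h t ht ht1 0 (vec p) (vec p)
  simp only [add_zero] at hSy hSx
  have hM : momentumForm Q t p ν σ = -(4 / qf Q p * Sy + 4 / qf Q p ^ 2 * Q ν σ * Sx) := by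
    rw [momentumForm, ← ((hSy.mul_left _).add (hSx.mul_left _)).tsum_eq]
    congr 1
    refine tsum_congr fun q => ?_
    show _ = 4 / qf Q p * (perp Q p q ν * perp Q p q σ * heat Q t q)
      + 4 / qf Q p ^ 2 * Q ν σ * (ip Q p q * ip Q p q * heat Q t q)
    ring
  rw [bil_transverse hQ hp] at by'
  have hxx : bil Q (vec p) (vec p) = qf Q p := rfl
  have b1 := by'.trans (mul_le_mul_of_nonneg_left (add_le_add (h₂ p hp ν) (h₂ p hp σ))
    (by positivity))
  have b2 := bx.trans (mul_le_mul_of_nonneg_left (add_le_add (h₁ (vec p)) (h₁ (vec p)))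
    (by positivity))
  rw [hxx] at b2
  rw [hM]
  set P := qf Q p
  set θ := gaussInt Q t
  set E := exp (-c / t)
  have hE : 0 < E := exp_pos _
  set w := upper Q p ν * upper Q p σ
  clear_value P θ E w
  have e : -(4 / P * Sy + 4 / P ^ 2 * Q ν σ * Sx) - (-4 * θ / (t * P) * Q ν σ + 2 * θ / (t * P ^ 2) * w)
      = -(4 / P * (Sy - θ * ((Q ν σ - w / P) / (2 * t))))
        + -(4 / P ^ 2 * Q ν σ * (Sx - θ * (P / (2 * t)))) := by
    field_simp
    ring
  rw [e]
  refine (abs_add_le _ _).trans ?_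
  rw [abs_neg, abs_neg, abs_mul, abs_mul (4 / P ^ 2 * Q ν σ), abs_mul (4 / P ^ 2),
    abs_of_pos (show 0 < 4 / P by positivity), abs_of_pos (show 0 < 4 / P ^ 2 by positivity)]
  calc _ ≤ 4 / P * (C * E * (C₂ + C₂)) + 4 / P ^ 2 * B * (C * E * (C₁ * P + C₁ * P)) := by gcongr
    _ = _ := by field_simp

/-- Sums against `heatDiff` as averages, over a shift along `p`, of Gaussian sums. -/
theorem tsum_heatDiff_eq (hQ : Q.PosDef) {t : ℝ} (ht : 0 < t) {p : Fin d → ℤ}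
    {f : (Fin d → ℤ) → ℝ} (hfp : ∀ q, f (q + p) = f q) {B : ℝ} {k : ℕ}
    (hf : ∀ q, |f q| ≤ B * qf Q q ^ k) {m E : ℝ}
    (h : ∀ α ∈ Set.Icc (0 : ℝ) 1, ∃ S, HasSum (fun q => f q
      * exp (-t * bil Q (vec q + α • vec p) (vec q + α • vec p))) S ∧ |S - m| ≤ E) :
    |∑' q, f q * heatDiff Q t p q + t * m * TorusAction.hFun (t * qf Q p)| ≤ t * E := by
  have hP := qf_nonneg hQ p
  -- `α (q+p)² + (1-α) q² = (q+αp)² + α(1-α) p²`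
  have hconv : ∀ α : ℝ, ∀ q, exp (-t * (α * qf Q (q + p) + (1 - α) * qf Q q))
      = exp (-(α * (1 - α) * (t * qf Q p)))
        * exp (-t * bil Q (vec q + α • vec p) (vec q + α • vec p)) := fun α q => by
    rw [← exp_add]
    congr 1
    rw [qf_add hQ, bil_add_left, bil_add_right, bil_add_right, bil_smul_left, bil_smul_left,
      bil_smul_right, bil_smul_right, bil_comm hQ.isHermitian (vec q) (vec p)]
    simp only [qf, ip]
    ring
  have hdom : ∀ α ∈ Set.Icc (0 : ℝ) 1, ∀ q,
      ‖f q * exp (-t * (α * qf Q (q + p) + (1 - α) * qf Q q))‖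
        ≤ |f (q + p) * heat Q t (q + p)| + |f q * heat Q t q| := fun α hα q => by
    rw [norm_mul, norm_eq_abs, norm_of_nonneg (exp_pos _).le, hfp, abs_mul, abs_mul,
      abs_of_pos (heat_pos _ _), abs_of_pos (heat_pos _ _), ← mul_add]
    refine mul_le_mul_of_nonneg_left ?_ (abs_nonneg _)
    have h1 := heat_pos (Q := Q) t q
    have h2 := heat_pos (Q := Q) t (q + p)
    rcases le_total (qf Q (q + p)) (qf Q q) with hle | hle
    · have : exp (-t * (α * qf Q (q + p) + (1 - α) * qf Q q)) ≤ heat Q t (q + p) :=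
        exp_le_exp.mpr (by
          nlinarith [mul_nonneg ht.le (mul_nonneg (sub_nonneg.mpr hα.2) (sub_nonneg.mpr hle))])
      linarith
    · have : exp (-t * (α * qf Q (q + p) + (1 - α) * qf Q q)) ≤ heat Q t q :=
        exp_le_exp.mpr (by nlinarith [mul_nonneg ht.le (mul_nonneg hα.1 (sub_nonneg.mpr hle))])
      linarith
  have hsum := ((summable_comp_add (summable_mul_heat hQ ht hf).abs p)).add
    (summable_mul_heat hQ ht hf).abs
  have hcont : ∀ q, Continuous fun α : ℝ =>
      f q * exp (-t * (α * qf Q (q + p) + (1 - α) * qf Q q)) := fun q => by fun_prop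
  set F : ℝ → ℝ := fun α => ∑' q, f q * exp (-t * (α * qf Q (q + p) + (1 - α) * qf Q q)) with hF
  have hFc : ContinuousOn F (Set.Icc 0 1) :=
    continuousOn_tsum (fun q => (hcont q).continuousOn) hsum fun q α hα => hdom α hα q
  have hFi : IntervalIntegrable F MeasureTheory.volume 0 1 :=
    ContinuousOn.intervalIntegrable (by rwa [Set.uIcc_of_le zero_le_one])
  have hmem : ∀ α ∈ Set.uIoc (0 : ℝ) 1, α ∈ Set.Icc (0 : ℝ) 1 := fun α hα => by
    rw [Set.uIoc_of_le zero_le_one] at hα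
    exact ⟨hα.1.le, hα.2⟩
  have hint : HasSum (fun q => ∫ α in (0 : ℝ)..1,
      f q * exp (-t * (α * qf Q (q + p) + (1 - α) * qf Q q))) (∫ α in (0 : ℝ)..1, F α) := by
    refine intervalIntegral.hasSum_integral_of_dominated_convergence
      (fun q _ => |f (q + p) * heat Q t (q + p)| + |f q * heat Q t q|)
      (fun q => (hcont q).aestronglyMeasurable)
      (fun q => Eventually.of_forall fun α hα => hdom α (hmem α hα) q)
      (Eventually.of_forall fun α _ => hsum) intervalIntegrable_const
      (Eventually.of_forall fun α hα => ?_)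
    exact (Summable.of_norm_bounded hsum fun q => hdom α (hmem α hα) q).hasSum
  have hG : ∑' q, f q * heatDiff Q t p q = -t * ∫ α in (0 : ℝ)..1, F α := by
    rw [← hint.tsum_eq, ← tsum_mul_left]
    refine tsum_congr fun q => ?_
    rw [heatDiff, expDiff, intervalIntegral.integral_const_mul]
    ring
  have hw : Continuous fun α : ℝ => exp (-(α * (1 - α) * (t * qf Q p))) * m := by fun_prop
  have hdiff : ∫ α in (0 : ℝ)..1, (F α - exp (-(α * (1 - α) * (t * qf Q p))) * m)
      = (∫ α in (0 : ℝ)..1, F α) - TorusAction.hFun (t * qf Q p) * m := by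
    rw [intervalIntegral.integral_sub hFi (hw.intervalIntegrable _ _),
      intervalIntegral.integral_mul_const, TorusAction.hFun]
  have hE : 0 ≤ E := by
    obtain ⟨S, _, hS⟩ := h 0 ⟨le_rfl, zero_le_one⟩
    exact (abs_nonneg _).trans hS
  have hb : |∫ α in (0 : ℝ)..1, (F α - exp (-(α * (1 - α) * (t * qf Q p))) * m)| ≤ E := by
    have := intervalIntegral.norm_integral_le_of_norm_le_const (a := 0) (b := 1) (C := E)
      (f := fun α => F α - exp (-(α * (1 - α) * (t * qf Q p))) * m) fun α hα => by
        have hα' := hmem α hα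
        obtain ⟨S, hS, hSm⟩ := h α hα'
        have hFS : F α = exp (-(α * (1 - α) * (t * qf Q p))) * S := by
          rw [hF, ← hS.tsum_eq, ← tsum_mul_left]
          refine tsum_congr fun q => ?_
          rw [hconv]
          ring
        rw [hFS, ← mul_sub, norm_mul, norm_eq_abs, norm_eq_abs, abs_of_pos (exp_pos _)]
        have h1 : exp (-(α * (1 - α) * (t * qf Q p))) ≤ 1 := by
          rw [exp_le_one_iff, neg_nonpos]
          exact mul_nonneg (mul_nonneg hα'.1 (sub_nonneg.mpr hα'.2)) (mul_nonneg ht.le hP)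
        calc _ ≤ 1 * E := mul_le_mul h1 hSm (abs_nonneg _) zero_le_one
          _ = E := one_mul E
    simpa using this
  have e : ∑' q, f q * heatDiff Q t p q + t * m * TorusAction.hFun (t * qf Q p)
      = -t * ((∫ α in (0 : ℝ)..1, F α) - TorusAction.hFun (t * qf Q p) * m) := by
    rw [hG]
    ring
  rw [e, ← hdiff, abs_mul, abs_neg, abs_of_pos ht]
  exact mul_le_mul_of_nonneg_left hb ht.le

/-- The limit `t → 0` of the form factor, up to exponentially small errors: the heat trace and the
sum of `heatDiff` combine to `hFun`, and the term in `p^ν p^σ` is longitudinal. -/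
theorem exists_actionForm_large (hQ : Q.PosDef) : ∃ c C, 0 < c ∧ 0 < C ∧ ∀ t, 0 < t → t ≤ 1 →
    ∀ p : Fin d → ℤ, p ≠ 0 → ∀ ν σ,
      |actionForm Q t p ν σ - (gaussInt Q t * (1 - TorusAction.hFun (t * qf Q p)
          - t * qf Q p * TorusAction.hFun (t * qf Q p) / 2) * Q ν σ
        + gaussInt Q t * TorusAction.hFun (t * qf Q p) / qf Q p * (upper Q p ν * upper Q p σ))|
        ≤ C * exp (-c / t) * qf Q p := by
  obtain ⟨c₁, C₁, hc₁, hC₁, h₁⟩ := exists_poisson_bil hQ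
  obtain ⟨c₀, C₀, hc₀, hC₀, h₀⟩ := exists_poisson_heat hQ
  obtain ⟨C₂, hC₂, h₂⟩ := exists_sum_sq_transverse_le hQ
  obtain ⟨b, hb, hbq⟩ := exists_le_qf hQ
  obtain ⟨B, hB⟩ : ∃ B, B = ∑ i, ∑ j, |Q i j| := ⟨_, rfl⟩
  have hB0 : 0 ≤ B := by rw [hB]; positivity
  obtain ⟨c, hc⟩ : ∃ c, c = min c₀ c₁ := ⟨_, rfl⟩
  have hcpos : 0 < c := hc ▸ lt_min hc₀ hc₁
  refine ⟨c, B * C₀ + B * C₀ / b + 4 * (C₁ * (C₂ + C₂)) / b + 1, hcpos,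
    by positivity, fun t ht ht1 p hp ν σ => ?_⟩
  have hP := qf_pos hQ hp
  have hbP := hbq p hp
  have hQB : |Q ν σ| ≤ B := hB ▸ abs_entry_le Q ν σ
  obtain ⟨E, hE⟩ : ∃ E, E = exp (-c / t) := ⟨_, rfl⟩
  have hE0 : 0 < E := hE ▸ exp_pos _
  have hE₀ : exp (-c₀ / t) ≤ E := hE ▸ exp_le_exp.mpr
    (div_le_div_of_nonneg_right (by linarith [hc ▸ min_le_left c₀ c₁]) ht.le)
  have hE₁ : exp (-c₁ / t) ≤ E := hE ▸ exp_le_exp.mpr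
    (div_le_div_of_nonneg_right (by linarith [hc ▸ min_le_right c₀ c₁]) ht.le)
  obtain ⟨S0, hS0, b0⟩ := h₀ t ht ht1 0
  simp only [add_zero] at hS0
  have hS0' : ∑' q, heat Q t q = S0 := hS0.tsum_eq
  have aG := tsum_heatDiff_eq hQ ht (p := p) (f := fun _ => 1) (fun _ => rfl) (B := 1) (k := 0)
    (fun q => by simp) (m := gaussInt Q t) (E := C₀ * E) fun α _ => by
      obtain ⟨S, hS, bS⟩ := h₀ t ht ht1 (α • vec p)
      exact ⟨S, by simpa using hS, bS.trans (by gcongr)⟩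
  have aY := tsum_heatDiff_eq hQ ht (p := p) (f := fun q => perp Q p q ν * perp Q p q σ)
    (fun q => by rw [perp_add hQ hp, perp_add hQ hp]) (B := Q.trace) (k := 1)
    (fun q => by simpa using abs_perp_mul_le hQ hp q ν σ)
    (m := gaussInt Q t * (bil Q (transverse Q p ν) (transverse Q p σ) / (2 * t)))
    (E := C₁ * E * (C₂ + C₂)) fun α _ => by
      obtain ⟨S, hS, bS⟩ := h₁ t ht ht1 (α • vec p) (transverse Q p ν) (transverse Q p σ)
      refine ⟨S, hS.congr_fun fun q => ?_, bS.trans ?_⟩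
      · simp only [bil_add_right, bil_smul_right, bil_transverse_vec hQ hp, mul_zero, add_zero]
        rfl
      · have g1 := h₂ p hp ν
        have g2 := h₂ p hp σ
        gcongr
  simp only [one_mul] at aG
  rw [bil_transverse hQ hp] at aY
  have b0' : |S0 - gaussInt Q t| ≤ C₀ * E := b0.trans (by gcongr)
  rw [actionForm, hS0', ← hE]
  set P := qf Q p
  set θ := gaussInt Q t
  set h := TorusAction.hFun (t * P)
  set w := upper Q p ν * upper Q p σ
  set SG := ∑' q, heatDiff Q t p q
  set SY := ∑' q, perp Q p q ν * perp Q p q σ * heatDiff Q t p q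
  clear_value P θ h w SG SY
  have e : Q ν σ * (P / 2 * SG + S0) + 2 * SY - (θ * (1 - h - t * P * h / 2) * Q ν σ + θ * h / P * w)
      = Q ν σ * (P / 2 * (SG + t * θ * h) + (S0 - θ))
        + 2 * (SY + t * (θ * ((Q ν σ - w / P) / (2 * t))) * h) := by
    field_simp
    ring
  rw [e]
  have hPb : 1 ≤ P / b := (one_le_div hb).mpr hbP
  have f1 : |P / 2 * (SG + t * θ * h) + (S0 - θ)| ≤ P * (C₀ * E) + C₀ * E := by
    refine (abs_add_le _ _).trans (add_le_add ?_ b0')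
    rw [abs_mul, abs_of_pos (half_pos hP)]
    calc P / 2 * |SG + t * θ * h| ≤ P / 2 * (t * (C₀ * E)) := by gcongr
      _ ≤ P / 2 * (1 * (C₀ * E)) := by gcongr
      _ ≤ _ := by
        have : 0 ≤ P * (C₀ * E) := by positivity
        linarith
  refine (abs_add_le _ _).trans ?_
  rw [abs_mul, abs_mul 2, abs_two]
  calc _ ≤ B * (P * (C₀ * E) + C₀ * E) + 2 * (1 * (C₁ * E * (C₂ + C₂))) := by
        have := aY.trans (mul_le_mul_of_nonneg_right ht1 (show 0 ≤ C₁ * E * (C₂ + C₂) by positivity))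
        gcongr
    _ = B * C₀ * E * P + (B * C₀ * E + 2 * (C₁ * (C₂ + C₂)) * E) * 1 := by ring
    _ ≤ B * C₀ * E * P + (B * C₀ * E + 2 * (C₁ * (C₂ + C₂)) * E) * (P / b) := by gcongr
    _ = (B * C₀ + B * C₀ / b + 2 * (C₁ * (C₂ + C₂)) / b) * E * P := by ring
    _ ≤ _ := by
        have g1 : 2 * (C₁ * (C₂ + C₂)) / b ≤ 4 * (C₁ * (C₂ + C₂)) / b := by gcongr; norm_num
        have g2 : B * C₀ + B * C₀ / b + 2 * (C₁ * (C₂ + C₂)) / b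
          ≤ B * C₀ + B * C₀ / b + 4 * (C₁ * (C₂ + C₂)) / b + 1 := by linarith
        exact mul_le_mul_of_nonneg_right (mul_le_mul_of_nonneg_right g2 hE0.le) hP.le

end LatticeGaussian

namespace LatticeGaussian

open Real Filter Topology MeasureTheory

/-! ### The heat kernel form factor at large momenta -/

/-- Integrating `(1-2α)² e^{-α(1-α)y}` by parts. -/
theorem hFun_parts (y : ℝ) :
    y / 2 - y * TorusAction.hFun y / 2 - y ^ 2 * TorusAction.hFun y / 4
      = -(y ^ 2 * ∫ α in (0 : ℝ)..1, α * (1 - α) * exp (-(α * (1 - α) * y))) := by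
  have h1 : ∀ α ∈ Set.uIcc (0 : ℝ) 1, HasDerivAt (fun α : ℝ => -(1 - 2 * α) * exp (-(α * (1 - α) * y)))
      ((2 + y) * exp (-(α * (1 - α) * y)) - 4 * y * (α * (1 - α) * exp (-(α * (1 - α) * y)))) α :=
    fun α _ => by
      have e1 : HasDerivAt (fun α : ℝ => -(1 - 2 * α)) 2 α := by
        have := (((hasDerivAt_id α).const_mul 2).const_sub 1).neg
        convert! this using 1
        ring
      have e2 : HasDerivAt (fun α : ℝ => -(α * (1 - α) * y)) (-((1 - 2 * α) * y)) α := by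
        have := (((hasDerivAt_id α).mul ((hasDerivAt_id α).const_sub 1)).mul_const y).neg
        convert! this using 1
        simp only [id]
        ring
      refine (e1.mul e2.exp).congr_deriv ?_
      ring
  have c1 : Continuous fun α : ℝ => (2 + y) * exp (-(α * (1 - α) * y)) := by fun_prop
  have c2 : Continuous fun α : ℝ => 4 * y * (α * (1 - α) * exp (-(α * (1 - α) * y))) := by fun_prop
  have h2 := intervalIntegral.integral_eq_sub_of_hasDerivAt h1 ((c1.sub c2).intervalIntegrable _ _)
  rw [intervalIntegral.integral_sub (c1.intervalIntegrable _ _) (c2.intervalIntegrable _ _),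
    intervalIntegral.integral_const_mul, intervalIntegral.integral_const_mul] at h2
  norm_num at h2
  rw [TorusAction.hFun]
  linear_combination (-y / 4) * h2

theorem integral_mul_exp_neg : ∫ β in Set.Ioi (0 : ℝ), β * exp (-β) = 1 := by
  have := Real.Gamma_eq_integral (s := 2) two_pos
  rw [Real.Gamma_two] at this
  rw [this]
  refine setIntegral_congr_fun measurableSet_Ioi fun β _ => ?_
  norm_num
  ring

theorem integral_eq_half (y : ℝ) : ∫ α in (0 : ℝ)..1, α * (1 - α) * exp (-(α * (1 - α) * y))
    = 2 * ∫ α in (0 : ℝ)..1 / 2, α * (1 - α) * exp (-(α * (1 - α) * y)) := by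
  have hc : Continuous fun α : ℝ => α * (1 - α) * exp (-(α * (1 - α) * y)) := by fun_prop
  rw [← intervalIntegral.integral_add_adjacent_intervals (b := 1 / 2) (hc.intervalIntegrable _ _)
    (hc.intervalIntegrable _ _), two_mul]
  congr 1
  have := intervalIntegral.integral_comp_sub_left (a := 0) (b := 1 / 2)
    (fun α : ℝ => α * (1 - α) * exp (-(α * (1 - α) * y))) 1
  rw [sub_zero] at this
  norm_num at this
  norm_num
  rw [← this]
  refine intervalIntegral.integral_congr fun α _ => ?_
  show (1 - α) * α * exp (-((1 - α) * α * y)) = _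
  rw [mul_comm (1 - α) α]

/-- Laplace's method at the two end points of `[0, 1]`. -/
theorem tendsto_sq_mul_integral : Tendsto (fun y : ℝ =>
    y ^ 2 * ∫ α in (0 : ℝ)..1, α * (1 - α) * exp (-(α * (1 - α) * y))) atTop (𝓝 2) := by
  let F : ℝ → ℝ → ℝ := fun y => Set.indicator (Set.Ioc 0 (y / 2)) fun β =>
    β * (1 - β / y) * exp (-(β * (1 - β / y)))
  have h1 : Tendsto (fun y => ∫ β in Set.Ioi (0 : ℝ), F y β) atTop
      (𝓝 (∫ β in Set.Ioi (0 : ℝ), β * exp (-β))) := by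
    refine tendsto_integral_filter_of_dominated_convergence (fun β => β * exp (-(1 / 2) * β))
      (Eventually.of_forall fun y => ?_) ?_ ?_ ?_
    · refine Measurable.aestronglyMeasurable (Measurable.indicator ?_ measurableSet_Ioc)
      fun_prop
    · filter_upwards [eventually_gt_atTop 0] with y hy
      filter_upwards [ae_restrict_mem measurableSet_Ioi] with β hβ
      have hβ' : 0 < β := hβ
      simp only [F]
      by_cases hm : β ∈ Set.Ioc 0 (y / 2)
      · rw [Set.indicator_of_mem hm]
        have g1 : β / y ≤ 1 / 2 := by
          rw [div_le_iff₀ hy]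
          linarith [hm.2]
        have g2 : 0 ≤ β / y := by positivity
        rw [norm_mul, norm_of_nonneg (exp_pos _).le, norm_of_nonneg (by nlinarith)]
        exact mul_le_mul (by nlinarith) (exp_le_exp.mpr (by nlinarith)) (exp_pos _).le hβ'.le
      · rw [Set.indicator_of_notMem hm, norm_zero]
        positivity
    · have h : IntegrableOn (fun β : ℝ => β * exp (-(1 / 2) * β)) (Set.Ioi 0) := by
        simpa using integrableOn_rpow_mul_exp_neg_mul_rpow (s := 1) (p := 1) (b := 1 / 2)
          (by norm_num) one_pos (by norm_num)
      exact h
    · filter_upwards [ae_restrict_mem measurableSet_Ioi] with β hβ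
      have hβ' : 0 < β := hβ
      have g1 : Tendsto (fun y : ℝ => β * (1 - β / y) * exp (-(β * (1 - β / y)))) atTop
          (𝓝 (β * (1 - 0) * exp (-(β * (1 - 0))))) := by
        have g2 : Tendsto (fun y : ℝ => β * (1 - β / y)) atTop (𝓝 (β * (1 - 0))) :=
          ((tendsto_const_nhds.div_atTop tendsto_id).const_sub 1).const_mul β
        exact g2.mul ((Real.continuous_exp.tendsto _).comp g2.neg)
      rw [sub_zero, mul_one] at g1
      refine g1.congr' ?_
      filter_upwards [eventually_ge_atTop (2 * β)] with y hy
      have hm : β ∈ Set.Ioc 0 (y / 2) := ⟨hβ', by linarith⟩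
      simp only [F]
      rw [Set.indicator_of_mem hm]
  rw [integral_mul_exp_neg] at h1
  have h2 := h1.const_mul 2
  rw [mul_one] at h2
  refine h2.congr' ?_
  filter_upwards [eventually_gt_atTop 0] with y hy
  rw [integral_eq_half, setIntegral_indicator measurableSet_Ioc,
    Set.inter_eq_self_of_subset_right Set.Ioc_subset_Ioi_self,
    ← intervalIntegral.integral_of_le (by positivity)]
  have h3 := intervalIntegral.integral_comp_div (a := 0) (b := y / 2)
    (fun α : ℝ => α * (1 - α) * exp (-(α * (1 - α) * y))) hy.ne'
  rw [zero_div, div_right_comm, div_self hy.ne', smul_eq_mul] at h3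
  have h4 : ∫ β in (0 : ℝ)..y / 2, β * (1 - β / y) * exp (-(β * (1 - β / y)))
      = y * ∫ β in (0 : ℝ)..y / 2, β / y * (1 - β / y) * exp (-(β / y * (1 - β / y) * y)) := by
    rw [← intervalIntegral.integral_const_mul]
    refine intervalIntegral.integral_congr fun β _ => ?_
    show β * (1 - β / y) * exp (-(β * (1 - β / y)))
      = y * (β / y * (1 - β / y) * exp (-(β / y * (1 - β / y) * y)))
    have e1 : β / y * (1 - β / y) * y = β * (1 - β / y) := by field_simp
    rw [e1]
    field_simp
  rw [h4, h3]
  ring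

/-- The large-momentum limit of the large cut-off form factor; integration by parts expresses it
through the integral of `α(1-α) e^{-α(1-α)y}`. -/
theorem tendsto_largeCutoff {d : ℕ} (g : Matrix (Fin d) (Fin d) ℝ) {Λ : ℝ} (hΛ : 0 < Λ) :
    Tendsto (fun z : ℝ => z ^ 2 * TorusAction.largeCutoff g Λ z) atTop
      (𝓝 (TorusAction.wCoeff g Λ)) := by
  have h1 : Tendsto (fun z : ℝ => z / Λ ^ 2) atTop atTop :=
    tendsto_id.atTop_div_const (by positivity)
  have h2 := ((tendsto_sq_mul_integral.comp h1).neg).const_mul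
    (2 ^ (d / 2) * √g.det * Λ ^ d / (4 * π) ^ ((d : ℝ) / 2))
  have h3 : (2 ^ (d / 2) * √g.det * Λ ^ d / (4 * π) ^ ((d : ℝ) / 2)) * -2
      = TorusAction.wCoeff g Λ := by
    rw [TorusAction.wCoeff]
    ring
  rw [h3] at h2
  refine h2.congr' ?_
  filter_upwards [eventually_gt_atTop 0] with z hz
  rw [Function.comp_apply, ← hFun_parts, TorusAction.largeCutoff, TorusAction.qFun]
  field_simp
  ring

end LatticeGaussian

namespace FormFactor

open LatticeGaussian Finset TorusAction

/-! ### Contraction of field modes with the form factors -/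

variable {d N : ℕ} {g : Matrix (Fin d) (Fin d) ℝ} {p : Fin d → ℤ}
  {F F' : Tensor2 d N}

theorem sq_eq (g : Matrix (Fin d) (Fin d) ℝ) (p : Fin d → ℤ) : TorusAction.sq g p = qf g⁻¹ p := rfl

theorem dot_eq (g : Matrix (Fin d) (Fin d) ℝ) (p q : Fin d → ℤ) :
    TorusAction.dot g p q = ip g⁻¹ p q := rfl

theorem up_eq (g : Matrix (Fin d) (Fin d) ℝ) (p : Fin d → ℤ) : TorusAction.up g p = upper g⁻¹ p := rfl

/-- The divergence `u_ν = p^μ F_{μν}`. -/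
def divg (g : Matrix (Fin d) (Fin d) ℝ) (p : Fin d → ℤ) (F : Tensor2 d N) (ν : Fin d) :
    Matrix (Fin N) (Fin N) ℂ :=
  ∑ μ, (upper g⁻¹ p μ : ℂ) • F μ ν

/-- The traces `tr u'_ν u_σ`. -/
def divPair (g : Matrix (Fin d) (Fin d) ℝ) (p : Fin d → ℤ) (F' F : Tensor2 d N)
    (ν σ : Fin d) : ℂ := (divg g p F' ν * divg g p F σ).trace

theorem isModeAt_of_neg (h : IsModeAt (-p) F) : IsModeAt p F := by
  obtain ⟨a, ha⟩ := h
  refine ⟨fun μ => -a μ, fun μ ν => ?_⟩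
  rw [ha]
  simp

theorem antisymm_of_isModeAt (h : IsModeAt p F) (μ ν : Fin d) : F μ ν = -F ν μ := by
  obtain ⟨a, ha⟩ := h
  rw [ha, ha, ← smul_neg, neg_sub]

theorem divg_of_isModeAt {a : Fin d → Matrix (Fin N) (Fin N) ℂ}
    (ha : ∀ μ ν, F μ ν = Complex.I • ((p μ : ℂ) • a ν - (p ν : ℂ) • a μ)) (ν : Fin d) :
    divg g p F ν = Complex.I • ((qf g⁻¹ p : ℂ) • a ν - (p ν : ℂ) • ∑ μ, (upper g⁻¹ p μ : ℂ) • a μ) := by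
  have h : (qf g⁻¹ p : ℂ) = ∑ μ, (upper g⁻¹ p μ : ℂ) * (p μ : ℂ) := by
    rw [← sum_upper_mul_self]
    push_cast
    rfl
  rw [divg, h, sum_smul, smul_sum, ← sum_sub_distrib, smul_sum]
  refine sum_congr rfl fun μ _ => ?_
  rw [ha, smul_comm, smul_sub, smul_smul, smul_comm (p ν : ℂ)]

/-- A mode is determined by its divergence. -/
theorem sq_smul_mode (h : IsModeAt p F) (μ ν : Fin d) :
    (qf g⁻¹ p : ℂ) • F μ ν = (p μ : ℂ) • divg g p F ν - (p ν : ℂ) • divg g p F μ := by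
  obtain ⟨a, ha⟩ := h
  rw [divg_of_isModeAt ha, divg_of_isModeAt ha, ha]
  simp only [smul_sub, smul_smul]
  module

theorem sum_upper_smul_divg (h : IsModeAt p F) :
    ∑ ν, (upper g⁻¹ p ν : ℂ) • divg g p F ν = 0 := by
  have h1 : ∑ ν, (upper g⁻¹ p ν : ℂ) • divg g p F ν = -∑ ν, (upper g⁻¹ p ν : ℂ) • divg g p F ν := by
    conv_lhs => simp only [divg, smul_sum]
    rw [sum_comm, ← sum_neg_distrib]
    refine sum_congr rfl fun μ _ => ?_
    rw [divg, smul_sum, ← sum_neg_distrib]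
    refine sum_congr rfl fun ν _ => ?_
    rw [antisymm_of_isModeAt h μ ν, smul_neg, smul_neg, smul_comm]
  have h2 : (2 : ℂ) • ∑ ν, (upper g⁻¹ p ν : ℂ) • divg g p F ν = 0 := by
    rw [two_smul]
    nth_rewrite 1 [h1]
    exact neg_add_cancel _
  exact (smul_eq_zero.1 h2).resolve_left two_ne_zero

theorem sum_upper_mul_divPair_left (h : IsModeAt p F') (σ : Fin d) :
    ∑ ν, (upper g⁻¹ p ν : ℂ) * divPair g p F' F ν σ = 0 := by
  have : ∑ ν, (upper g⁻¹ p ν : ℂ) * divPair g p F' F ν σ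
      = ((∑ ν, (upper g⁻¹ p ν : ℂ) • divg g p F' ν) * divg g p F σ).trace := by
    rw [Matrix.sum_mul, Matrix.trace_sum]
    refine sum_congr rfl fun ν _ => ?_
    rw [Matrix.smul_mul, Matrix.trace_smul, smul_eq_mul, divPair]
  rw [this, sum_upper_smul_divg h, Matrix.zero_mul, Matrix.trace_zero]

/-- Pairing of a real form with two modes. -/
def contractForm (g : Matrix (Fin d) (Fin d) ℝ) (p : Fin d → ℤ) (T : Fin d → Fin d → ℝ)
    (F' F : Tensor2 d N) : ℂ :=
  ∑ ν, ∑ σ, (T ν σ : ℂ) * divPair g p F' F ν σ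

theorem contractForm_sub (T S : Fin d → Fin d → ℝ) :
    contractForm g p T F' F - contractForm g p S F' F
      = contractForm g p (fun ν σ => T ν σ - S ν σ) F' F := by
  simp only [contractForm, ← sum_sub_distrib]
  refine sum_congr rfl fun ν _ => sum_congr rfl fun σ _ => ?_
  push_cast
  ring

/-- Terms proportional to `p^ν p^σ` do not contribute. -/
theorem contractForm_upper (h : IsModeAt p F') (a b : ℝ) (T : Fin d → Fin d → ℝ) :
    contractForm g p (fun ν σ => a * T ν σ + b * (upper g⁻¹ p ν * upper g⁻¹ p σ)) F' F
      = a * contractForm g p T F' F := by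
  have h0 : ∑ ν, ∑ σ, (b : ℂ) * (upper g⁻¹ p ν * upper g⁻¹ p σ) * divPair g p F' F ν σ = 0 := by
    rw [sum_comm]
    refine sum_eq_zero fun σ _ => ?_
    have : ∀ ν, (b : ℂ) * (upper g⁻¹ p ν * upper g⁻¹ p σ) * divPair g p F' F ν σ
        = (b * upper g⁻¹ p σ : ℂ) * (upper g⁻¹ p ν * divPair g p F' F ν σ) := fun ν => by ring
    simp only [this]
    rw [← mul_sum, sum_upper_mul_divPair_left h, mul_zero]
  rw [← add_zero ((a : ℂ) * _), ← h0, contractForm, contractForm, mul_sum, ← sum_add_distrib]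
  refine sum_congr rfl fun ν _ => ?_
  rw [mul_sum, ← sum_add_distrib]
  refine sum_congr rfl fun σ _ => ?_
  push_cast
  ring

/-- `tr F'_{μν} F^{μν} = (2/p²) g^{νσ} tr u'_ν u_σ`. -/
theorem pairing_eq (hg : g.PosDef) (hp : p ≠ 0) (h' : IsModeAt p F')
    (h : IsModeAt p F) :
    pairing g F' F = (2 / qf g⁻¹ p : ℝ) * contractForm g p (fun ν σ => g⁻¹ ν σ) F' F := by
  have hP : (qf g⁻¹ p : ℂ) ≠ 0 := by exact_mod_cast (qf_pos hg.inv hp).ne'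
  have hsymm : ∀ i j, g⁻¹ i j = g⁻¹ j i := fun i j => by simpa using hg.inv.isHermitian.apply j i
  have e1 : ∀ μ ν ρ σ, (qf g⁻¹ p : ℂ) * (F' μ ν * F ρ σ).trace
      = (p ρ : ℂ) * (F' μ ν * divg g p F σ).trace - (p σ : ℂ) * (F' μ ν * divg g p F ρ).trace :=
    fun μ ν ρ σ => by
      have := congrArg (fun M => (F' μ ν * M).trace) (sq_smul_mode (g := g) h ρ σ)
      simpa only [Matrix.mul_smul, Matrix.mul_sub, Matrix.trace_smul, Matrix.trace_sub,
        smul_eq_mul] using this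
  have hup : ∀ μ, (upper g⁻¹ p μ : ℂ) = ∑ ρ, (g⁻¹ μ ρ : ℂ) * (p ρ : ℂ) := fun μ => by
    rw [upper]
    push_cast
    rfl
  -- the first term of `e1`
  have e2 : ∑ μ, ∑ ν, ∑ ρ, ∑ σ, ((g⁻¹ μ ρ * g⁻¹ ν σ : ℝ) : ℂ)
        * ((p ρ : ℂ) * (F' μ ν * divg g p F σ).trace) = contractForm g p (fun ν σ => g⁻¹ ν σ) F' F := by
    rw [contractForm, sum_comm]
    refine sum_congr rfl fun ν _ => ?_
    have : ∀ σ, (g⁻¹ ν σ : ℂ) * divPair g p F' F ν σ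
        = ∑ μ, (g⁻¹ ν σ : ℂ) * (upper g⁻¹ p μ * (F' μ ν * divg g p F σ).trace) := fun σ => by
      rw [divPair, divg, Matrix.sum_mul, Matrix.trace_sum, mul_sum]
      simp only [Matrix.smul_mul, Matrix.trace_smul, smul_eq_mul]
    refine (sum_congr rfl fun μ _ => sum_comm).trans ?_
    rw [sum_comm]
    refine sum_congr rfl fun σ _ => ?_
    refine Eq.trans ?_ (this σ).symm
    refine sum_congr rfl fun μ _ => ?_
    rw [hup, sum_mul, mul_sum]
    refine sum_congr rfl fun ρ _ => ?_
    push_cast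
    ring
  -- the second term is the opposite of the first, by antisymmetry
  have e3 : ∑ μ, ∑ ν, ∑ ρ, ∑ σ, ((g⁻¹ μ ρ * g⁻¹ ν σ : ℝ) : ℂ)
        * ((p σ : ℂ) * (F' μ ν * divg g p F ρ).trace) = -contractForm g p (fun ν σ => g⁻¹ ν σ) F' F := by
    rw [← e2, ← sum_neg_distrib, sum_comm]
    refine sum_congr rfl fun μ _ => ?_
    rw [← sum_neg_distrib]
    refine sum_congr rfl fun ν _ => ?_
    rw [← sum_neg_distrib, sum_comm]
    refine sum_congr rfl fun ρ _ => ?_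
    rw [← sum_neg_distrib]
    refine sum_congr rfl fun σ _ => ?_
    rw [antisymm_of_isModeAt h' ν μ, Matrix.neg_mul, Matrix.trace_neg]
    push_cast
    ring
  have e4 : (qf g⁻¹ p : ℂ) * pairing g F' F = 2 * contractForm g p (fun ν σ => g⁻¹ ν σ) F' F := by
    rw [two_mul]
    nth_rewrite 2 [← neg_neg (contractForm g p (fun ν σ => g⁻¹ ν σ) F' F)]
    rw [← e3, ← sub_eq_add_neg, ← e2, pairing]
    simp only [mul_sum, ← sum_sub_distrib]
    refine sum_congr rfl fun μ _ => sum_congr rfl fun ν _ => sum_congr rfl fun ρ _ =>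
      sum_congr rfl fun σ _ => ?_
    rw [← mul_sub, ← e1]
    ring
  push_cast
  rw [div_mul_eq_mul_div, ← e4, mul_div_cancel_left₀ _ hP]

end FormFactor

namespace FormFactor

open LatticeGaussian Finset TorusAction

/-! ### The form factors on field modes -/

variable {d N : ℕ} {g : Matrix (Fin d) (Fin d) ℝ} {p : Fin d → ℤ}
  {F F' : Tensor2 d N}

theorem divPair_eq (ν σ : Fin d) : divPair g p F' F ν σ
    = ∑ μ, ∑ ρ, ((upper g⁻¹ p μ * upper g⁻¹ p ρ : ℝ) : ℂ) * (F' μ ν * F ρ σ).trace := by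
  rw [divPair, divg, Matrix.sum_mul, Matrix.trace_sum]
  refine sum_congr rfl fun μ _ => ?_
  rw [divg, Matrix.mul_sum, Matrix.trace_sum]
  refine sum_congr rfl fun ρ _ => ?_
  rw [Matrix.smul_mul, Matrix.mul_smul, Matrix.trace_smul, Matrix.trace_smul, smul_eq_mul,
    smul_eq_mul]
  push_cast
  ring

/-- The common prefactor `2^m Λ⁻² (2π)^{-d}`. -/
def formConst (d : ℕ) (Λ : ℝ) : ℝ := 2 ^ (d / 2) * (Λ ^ 2)⁻¹ / (2 * Real.pi) ^ d

/-- The form factor of the quadratic spectral action, `2^m Λ⁻² (2π)^{-d} p⁻⁴ p^μ p^ρ T^{νσ}` with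
`T` the form `actionForm`. -/
def formFactor (g : Matrix (Fin d) (Fin d) ℝ) (Λ : ℝ) (p : Fin d → ℤ) (μ ν ρ σ : Fin d) : ℝ :=
  formConst d Λ / qf g⁻¹ p ^ 2 * (upper g⁻¹ p μ * upper g⁻¹ p ρ) * actionForm g⁻¹ (Λ ^ 2)⁻¹ p ν σ

theorem evalForm_formFactor (Λ : ℝ) : evalForm (formFactor g Λ p) F' F
    = (formConst d Λ / qf g⁻¹ p ^ 2 : ℝ) * contractForm g p (actionForm g⁻¹ (Λ ^ 2)⁻¹ p) F' F := by
  rw [evalForm, contractForm, mul_sum, sum_comm]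
  refine sum_congr rfl fun ν _ => ?_
  rw [mul_sum]
  refine (sum_congr rfl fun μ _ => sum_comm).trans ?_
  rw [sum_comm]
  refine sum_congr rfl fun σ _ => ?_
  rw [divPair_eq, mul_sum, mul_sum]
  refine sum_congr rfl fun μ _ => ?_
  rw [mul_sum, mul_sum]
  refine sum_congr rfl fun ρ _ => ?_
  rw [formFactor]
  push_cast
  ring

/-- The divergence is transverse, so that only the part of `q` orthogonal to `p` contributes. -/
theorem contract_eq (h : IsModeAt p F) (q : Fin d → ℤ) :
    TorusAction.contract g p q F = ∑ ν, (perp g⁻¹ p q ν : ℂ) • divg g p F ν := by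
  have h1 : TorusAction.contract g p q F = ∑ ν, (upper g⁻¹ q ν : ℂ) • divg g p F ν := by
    rw [TorusAction.contract, sum_comm]
    refine sum_congr rfl fun ν _ => ?_
    rw [divg, smul_sum]
    refine sum_congr rfl fun μ _ => ?_
    rw [smul_smul, up_eq, up_eq]
    congr 1
    push_cast
    ring
  have h2 : ∀ ν, (perp g⁻¹ p q ν : ℂ) • divg g p F ν = (upper g⁻¹ q ν : ℂ) • divg g p F ν
      - (ip g⁻¹ p q / qf g⁻¹ p : ℂ) • ((upper g⁻¹ p ν : ℂ) • divg g p F ν) := fun ν => by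
    rw [smul_smul, ← sub_smul, perp_eq]
    congr 1
    push_cast
    ring
  simp only [h2]
  rw [sum_sub_distrib, ← smul_sum, sum_upper_smul_divg h, smul_zero, sub_zero, h1]

theorem trace_contract_mul (h' : IsModeAt p F') (h : IsModeAt p F)
    (q : Fin d → ℤ) :
    (TorusAction.contract g p q F' * TorusAction.contract g p q F).trace
      = contractForm g p (fun ν σ => perp g⁻¹ p q ν * perp g⁻¹ p q σ) F' F := by
  rw [contract_eq h', contract_eq h, Matrix.sum_mul, Matrix.trace_sum, contractForm]
  refine sum_congr rfl fun ν _ => ?_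
  rw [Matrix.mul_sum, Matrix.trace_sum]
  refine sum_congr rfl fun σ _ => ?_
  rw [Matrix.smul_mul, Matrix.mul_smul, Matrix.trace_smul, Matrix.trace_smul, divPair, smul_eq_mul,
    smul_eq_mul]
  push_cast
  ring

/-- The large-momentum action is the pairing of the divergences by `momentumForm`. -/
theorem largeMomentum_eq (hg : g.PosDef) {Λ : ℝ} (hΛ : 0 < Λ) (hp : p ≠ 0)
    (h' : IsModeAt p F') (h : IsModeAt p F) :
    largeMomentum g Λ p F' F = (formConst d Λ / qf g⁻¹ p ^ 2 : ℝ)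
      * contractForm g p (momentumForm g⁻¹ (Λ ^ 2)⁻¹ p) F' F := by
  have ht : 0 < (Λ ^ 2)⁻¹ := by positivity
  have hP := (qf_pos hg.inv hp).ne'
  have hPc : (qf g⁻¹ p : ℂ) ≠ 0 := by exact_mod_cast hP
  obtain ⟨f, hf⟩ : ∃ f : Fin d → Fin d → (Fin d → ℤ) → ℝ, f = fun ν σ q =>
    (4 / qf g⁻¹ p * (perp g⁻¹ p q ν * perp g⁻¹ p q σ) + 4 / qf g⁻¹ p ^ 2 * ip g⁻¹ p q ^ 2 * g⁻¹ ν σ)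
      * heat g⁻¹ (Λ ^ 2)⁻¹ q := ⟨_, rfl⟩
  have hs : ∀ ν σ, Summable (f ν σ) := fun ν σ => by
    have sx : Summable fun q => ip g⁻¹ p q ^ 2 * heat g⁻¹ (Λ ^ 2)⁻¹ q := by
      simpa using summable_ip_pow_mul_heat hg.inv ht p 1
    refine (((summable_perp_mul_heat hg.inv ht hp ν σ).mul_left (4 / qf g⁻¹ p)).add
      (sx.mul_left (4 / qf g⁻¹ p ^ 2 * g⁻¹ ν σ))).congr fun q => ?_
    rw [hf]
    ring
  have hM : ∀ ν σ, momentumForm g⁻¹ (Λ ^ 2)⁻¹ p ν σ = -∑' q, f ν σ q := fun ν σ => by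
    rw [momentumForm, hf]
  have hterm : ∀ q, ((Real.exp (-(TorusAction.sq g q) / Λ ^ 2) : ℝ) : ℂ) *
      (((4 / TorusAction.sq g p ^ 3 : ℝ) : ℂ)
          * (TorusAction.contract g p q F' * TorusAction.contract g p q F).trace
        + ((2 / TorusAction.sq g p ^ 3 * TorusAction.dot g p q ^ 2 : ℝ) : ℂ)
          * pairing g F' F)
      = ((qf g⁻¹ p ^ 2)⁻¹ : ℝ) * ∑ ν, ∑ σ, (f ν σ q : ℂ) * divPair g p F' F ν σ := fun q => by
    have he : Real.exp (-(TorusAction.sq g q) / Λ ^ 2) = heat g⁻¹ (Λ ^ 2)⁻¹ q := by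
      rw [heat, sq_eq]
      congr 1
      ring
    rw [he, trace_contract_mul h' h, pairing_eq hg hp h' h, sq_eq, dot_eq, contractForm, contractForm]
    simp only [mul_sum, ← sum_add_distrib]
    refine sum_congr rfl fun ν _ => sum_congr rfl fun σ _ => ?_
    rw [hf]
    push_cast
    field_simp
    ring
  have hsum : ∑' q, ∑ ν, ∑ σ, (f ν σ q : ℂ) * divPair g p F' F ν σ
      = -contractForm g p (momentumForm g⁻¹ (Λ ^ 2)⁻¹ p) F' F := by
    have hc : ∀ ν σ, Summable fun q => (f ν σ q : ℂ) * divPair g p F' F ν σ := fun ν σ =>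
      (Complex.hasSum_ofReal.2 (hs ν σ).hasSum).summable.mul_right _
    rw [Summable.tsum_finsetSum fun ν _ => summable_sum fun σ _ => hc ν σ, contractForm,
      ← sum_neg_distrib]
    refine sum_congr rfl fun ν _ => ?_
    rw [Summable.tsum_finsetSum fun σ _ => hc ν σ, ← sum_neg_distrib]
    refine sum_congr rfl fun σ _ => ?_
    rw [tsum_mul_right, hM, ← Complex.ofReal_tsum]
    push_cast
    ring
  rw [largeMomentum]
  simp only [hterm]
  rw [tsum_mul_left, hsum, formConst]
  push_cast
  ring

theorem norm_entry_le_tnorm (F : Tensor2 d N) (μ ν : Fin d) (a b : Fin N) :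
    ‖F μ ν a b‖ ≤ tnorm F := by
  refine Real.le_sqrt_of_sq_le ?_
  refine le_trans ?_ (single_le_sum (f := fun μ => ∑ ν, ∑ a, ∑ b, ‖F μ ν a b‖ ^ 2)
    (fun _ _ => by positivity) (mem_univ μ))
  refine le_trans ?_ (single_le_sum (f := fun ν => ∑ a, ∑ b, ‖F μ ν a b‖ ^ 2)
    (fun _ _ => by positivity) (mem_univ ν))
  refine le_trans ?_ (single_le_sum (f := fun a => ∑ b, ‖F μ ν a b‖ ^ 2)
    (fun _ _ => by positivity) (mem_univ a))
  exact single_le_sum (f := fun b => ‖F μ ν a b‖ ^ 2) (fun _ _ => by positivity) (mem_univ b)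

theorem norm_divg_le (hg : g.PosDef) (ν : Fin d) (a b : Fin N) :
    ‖divg g p F ν a b‖ ≤ d * (√(g⁻¹.trace * qf g⁻¹ p) * tnorm F) := by
  rw [divg, Matrix.sum_apply]
  refine (norm_sum_le _ _).trans ?_
  refine (sum_le_card_nsmul _ _ (√(g⁻¹.trace * qf g⁻¹ p) * tnorm F) fun μ _ => ?_).trans
    (by simp)
  rw [Matrix.smul_apply, smul_eq_mul, norm_mul, Complex.norm_real, Real.norm_eq_abs]
  refine mul_le_mul (Real.abs_le_sqrt ?_) (norm_entry_le_tnorm F μ ν a b) (norm_nonneg _)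
    (Real.sqrt_nonneg _)
  refine (sq_upper_le hg.inv p μ).trans (mul_le_mul_of_nonneg_right ?_ (qf_nonneg hg.inv p))
  exact single_le_sum (f := fun i => g⁻¹ i i) (fun i _ => (hg.inv.diag_pos).le) (mem_univ μ)

theorem exists_norm_contractForm_le (hg : g.PosDef) (N : ℕ) : ∃ C, 0 ≤ C ∧ ∀ (p : Fin d → ℤ)
    (T : Fin d → Fin d → ℝ) (τ : ℝ) (F' F : Tensor2 d N), (∀ ν σ, |T ν σ| ≤ τ) →
    ‖contractForm g p T F' F‖
      ≤ C * τ * qf g⁻¹ p * tnorm F' * tnorm F := by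
  have hT : 0 ≤ g⁻¹.trace := hg.inv.posSemidef.trace_nonneg
  refine ⟨d * d * (N * N * (d * d * g⁻¹.trace)), by positivity, fun p T τ F' F h => ?_⟩
  have hP := qf_nonneg hg.inv p
  have hF' : 0 ≤ tnorm F' := Real.sqrt_nonneg _
  have hF : 0 ≤ tnorm F := Real.sqrt_nonneg _
  have h1 : ∀ ν σ, ‖divPair g p F' F ν σ‖ ≤ N * N * (d * d * (g⁻¹.trace * qf g⁻¹ p)
      * (tnorm F' * tnorm F)) := fun ν σ => by
    have h2 : ∀ a b, ‖divg g p F' ν a b * divg g p F σ b a‖ ≤ d * d * (g⁻¹.trace * qf g⁻¹ p)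
        * (tnorm F' * tnorm F) := fun a b => by
      rw [norm_mul]
      refine (mul_le_mul (norm_divg_le hg ν a b) (norm_divg_le hg σ b a) (norm_nonneg _)
        (by positivity)).trans (le_of_eq ?_)
      have := Real.mul_self_sqrt (mul_nonneg hT hP)
      linear_combination (d * d * (tnorm F' * tnorm F) : ℝ) * this
    rw [divPair, Matrix.trace]
    simp only [Matrix.diag_apply, Matrix.mul_apply]
    refine (norm_sum_le _ _).trans ?_
    refine (sum_le_card_nsmul _ _ _ fun a _ => (norm_sum_le _ _).trans
      (sum_le_card_nsmul _ _ _ fun b _ => h2 a b)).trans (le_of_eq ?_)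
    simp
    ring
  refine (norm_sum_le _ _).trans ?_
  refine (sum_le_card_nsmul _ _ _ fun ν _ => (norm_sum_le _ _).trans
    (sum_le_card_nsmul _ _ (τ * (N * N * (d * d * (g⁻¹.trace * qf g⁻¹ p)
      * (tnorm F' * tnorm F)))) fun σ _ => ?_)).trans (le_of_eq ?_)
  · rw [norm_mul, Complex.norm_real, Real.norm_eq_abs]
    exact mul_le_mul (h ν σ) (h1 ν σ) (norm_nonneg _) ((abs_nonneg _).trans (h ν σ))
  · simp
    ring

end FormFactor

namespace FormFactor

open LatticeGaussian Finset TorusAction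

/-! ### Estimates for the quadratic action -/

variable {d N : ℕ} {g : Matrix (Fin d) (Fin d) ℝ} {p : Fin d → ℤ}
  {F F' : Tensor2 d N}

theorem formConst_pos {Λ : ℝ} (hΛ : 0 < Λ) : 0 < formConst d Λ := by
  unfold formConst
  positivity

theorem tnorm_nonneg (F : Tensor2 d N) : 0 ≤ tnorm F := Real.sqrt_nonneg _

/-- An entrywise bound on a form bounds its contraction with two modes, prefactor included. -/
theorem exists_norm_le (hg : g.PosDef) (N : ℕ) : ∃ C, 0 ≤ C ∧ ∀ (Λ : ℝ) (p : Fin d → ℤ)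
    (T : Fin d → Fin d → ℝ) (τ : ℝ) (F' F : Tensor2 d N), 0 < Λ → p ≠ 0 →
    (∀ ν σ, |T ν σ| ≤ τ) →
    ‖((formConst d Λ / qf g⁻¹ p ^ 2 : ℝ) : ℂ) * contractForm g p T F' F‖
      ≤ C * ((Λ ^ 2)⁻¹ * τ / qf g⁻¹ p) * tnorm F' * tnorm F := by
  obtain ⟨C, hC, h⟩ := exists_norm_contractForm_le hg N
  refine ⟨2 ^ (d / 2) / (2 * Real.pi) ^ d * C, by positivity, fun Λ p T τ F' F hΛ hp hT => ?_⟩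
  have hP := qf_pos hg.inv hp
  have hK := formConst_pos (d := d) hΛ
  rw [norm_mul, Complex.norm_real, Real.norm_eq_abs, abs_of_nonneg (by positivity)]
  refine (mul_le_mul_of_nonneg_left (h p T τ F' F hT) (by positivity)).trans (le_of_eq ?_)
  rw [formConst]
  field_simp

/-- The action at large momenta is the large-momentum action, to relative order `p⁻²`. -/
theorem exists_form_sub_largeMomentum (hg : g.PosDef) (N : ℕ) {Λ : ℝ} (hΛ : 0 < Λ) :
    ∃ C, 0 < C ∧ ∀ p : Fin d → ℤ, p ≠ 0 → ∀ F' F : Tensor2 d N,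
      IsModeAt p F' → IsModeAt p F →
      ‖evalForm (formFactor g Λ p) F' F - largeMomentum g Λ p F' F‖
        ≤ C / TorusAction.sq g p ^ 3 * tnorm F' * tnorm F := by
  obtain ⟨C₀, hC₀, h₀⟩ := exists_norm_le hg N
  obtain ⟨C, hC, h⟩ := exists_actionForm_sub_momentumForm hg.inv (inv_pos.2 (pow_pos hΛ 2))
  refine ⟨C₀ * ((Λ ^ 2)⁻¹ * C) + 1, by positivity, fun p hp F' F hF' hF => ?_⟩
  have hP := qf_pos hg.inv hp
  have h1 := tnorm_nonneg F
  have h2 := tnorm_nonneg F'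
  rw [evalForm_formFactor, largeMomentum_eq hg hΛ hp hF' hF, ← mul_sub, contractForm_sub, sq_eq]
  refine (h₀ Λ p _ _ F' F hΛ hp (h p hp)).trans ?_
  refine mul_le_mul_of_nonneg_right (mul_le_mul_of_nonneg_right ?_ h2) h1
  rw [le_div_iff₀ (by positivity)]
  have : C₀ * ((Λ ^ 2)⁻¹ * (C / qf g⁻¹ p ^ 2) / qf g⁻¹ p) * qf g⁻¹ p ^ 3 = C₀ * ((Λ ^ 2)⁻¹ * C) := by
    field_simp
  linarith

theorem formConst_mul_gaussInt (hg : g.PosDef) {Λ : ℝ} (hΛ : 0 < Λ) :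
    formConst d Λ * gaussInt g⁻¹ (Λ ^ 2)⁻¹ * (2 * Λ ^ 2) = -wCoeff g Λ := by
  have hdet := hg.det_pos
  have h1 : √(Real.pi / (Λ ^ 2)⁻¹) = √Real.pi * Λ := by
    rw [div_inv_eq_mul, Real.sqrt_mul Real.pi_pos.le, Real.sqrt_sq hΛ.le]
  have h2 : (4 * Real.pi) ^ ((d : ℝ) / 2) = (2 * √Real.pi) ^ d := by
    rw [Real.rpow_div_two_eq_sqrt _ (by positivity), Real.rpow_natCast]
    congr 1
    rw [Real.sqrt_mul (by norm_num), show (4 : ℝ) = 2 ^ 2 by norm_num, Real.sqrt_sq (by norm_num)]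
  have h3 : (2 * Real.pi) ^ d = (2 * √Real.pi) ^ d * √Real.pi ^ d := by
    rw [← mul_pow, mul_assoc, Real.mul_self_sqrt Real.pi_pos.le]
  have h4 : √(g⁻¹).det = (√g.det)⁻¹ := by
    rw [Matrix.det_nonsing_inv, Ring.inverse_eq_inv', Real.sqrt_inv]
  have h5 : 0 < √g.det := Real.sqrt_pos.2 hdet
  have h6 : 0 < √Real.pi := Real.sqrt_pos.2 Real.pi_pos
  rw [formConst, gaussInt, h1, h3, h4, wCoeff, h2, mul_pow (√Real.pi), pow_succ]
  field_simp
  rw [pow_succ]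

/-- The action for a large cut-off, up to errors that are exponentially small in `Λ²`. -/
theorem exists_form_sub_largeCutoff (hg : g.PosDef) (N : ℕ) : ∃ c C : ℝ, 0 < c ∧
    ∀ Λ : ℝ, 1 ≤ Λ → ∀ p : Fin d → ℤ, p ≠ 0 → ∀ F' F : Tensor2 d N,
      IsModeAt p F' → IsModeAt p F →
      ‖evalForm (formFactor g Λ p) F' F
          - (largeCutoff g Λ (TorusAction.sq g p) : ℂ) * pairing g F' F‖
        ≤ C * Real.exp (-c * Λ ^ 2) * tnorm F' * tnorm F := by
  obtain ⟨C₀, hC₀, h₀⟩ := exists_norm_le hg N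
  obtain ⟨c, C, hc, hC, h⟩ := exists_actionForm_large hg.inv
  refine ⟨c, C₀ * C, hc, fun Λ hΛ p hp F' F hF' hF => ?_⟩
  have hΛ0 : 0 < Λ := by linarith
  have hP := qf_pos hg.inv hp
  have ht1 : (Λ ^ 2)⁻¹ ≤ 1 := inv_le_one_of_one_le₀ (by nlinarith)
  have hcon := h _ (by positivity) ht1 p hp
  obtain ⟨H, hH⟩ : ∃ H, H = TorusAction.hFun ((Λ ^ 2)⁻¹ * qf g⁻¹ p) := ⟨_, rfl⟩
  obtain ⟨θ, hθ⟩ : ∃ θ, θ = gaussInt g⁻¹ (Λ ^ 2)⁻¹ := ⟨_, rfl⟩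
  have hK := formConst_pos (d := d) hΛ0
  rw [← hH, ← hθ] at hcon
  have hb : largeCutoff g Λ (qf g⁻¹ p) = formConst d Λ / qf g⁻¹ p ^ 2
      * (θ * (1 - H - (Λ ^ 2)⁻¹ * qf g⁻¹ p * H / 2)) * (qf g⁻¹ p / 2) := by
    have hw := formConst_mul_gaussInt hg hΛ0
    rw [← hθ] at hw
    have hw2 : 2 ^ (d / 2) * √g.det * Λ ^ d / (4 * Real.pi) ^ ((d : ℝ) / 2)
        = formConst d Λ * θ * Λ ^ 2 := by
      rw [wCoeff, pow_succ] at hw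
      linear_combination (-1 / 2 : ℝ) * hw
    rw [largeCutoff, hw2, TorusAction.qFun, show qf g⁻¹ p / Λ ^ 2
      = (Λ ^ 2)⁻¹ * qf g⁻¹ p by ring, ← hH]
    field_simp
    ring
  have key : evalForm (formFactor g Λ p) F' F
      - (largeCutoff g Λ (TorusAction.sq g p) : ℂ) * pairing g F' F
      = ((formConst d Λ / qf g⁻¹ p ^ 2 : ℝ) : ℂ) * contractForm g p (fun ν σ =>
        actionForm g⁻¹ (Λ ^ 2)⁻¹ p ν σ - ((θ * (1 - H - (Λ ^ 2)⁻¹ * qf g⁻¹ p * H / 2)) * g⁻¹ ν σ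
          + θ * H / qf g⁻¹ p * (upper g⁻¹ p ν * upper g⁻¹ p σ))) F' F := by
    rw [← contractForm_sub, contractForm_upper hF' _ _ (fun ν σ => g⁻¹ ν σ), evalForm_formFactor,
      sq_eq, hb, pairing_eq hg hp hF' hF]
    have hPc : (qf g⁻¹ p : ℂ) ≠ 0 := by exact_mod_cast hP.ne'
    push_cast
    field_simp
  rw [key]
  refine (h₀ Λ p _ _ F' F hΛ0 hp hcon).trans ?_
  refine mul_le_mul_of_nonneg_right (mul_le_mul_of_nonneg_right ?_ (tnorm_nonneg _)) (tnorm_nonneg _)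
  have he : -c / (Λ ^ 2)⁻¹ = -c * Λ ^ 2 := by rw [div_inv_eq_mul]
  have h3 : C₀ * ((Λ ^ 2)⁻¹ * (C * Real.exp (-c * Λ ^ 2) * qf g⁻¹ p) / qf g⁻¹ p)
      = (Λ ^ 2)⁻¹ * (C₀ * C * Real.exp (-c * Λ ^ 2)) := by
    field_simp
  rw [he, h3]
  exact mul_le_of_le_one_left (by positivity) ht1

/-- The large-momentum action for a large cut-off. -/
theorem exists_largeMomentum_sub_wCoeff (hg : g.PosDef) (N : ℕ) {δ : ℝ} (hδ : 0 < δ) :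
    ∃ Λ₀ : ℝ, 0 < Λ₀ ∧ ∀ Λ : ℝ, Λ₀ ≤ Λ → ∀ p : Fin d → ℤ, p ≠ 0 →
      ∀ F' F : Tensor2 d N, IsModeAt p F' → IsModeAt p F →
        ‖largeMomentum g Λ p F' F
            - ((wCoeff g Λ / TorusAction.sq g p ^ 2 : ℝ) : ℂ)
              * pairing g F' F‖
          ≤ δ * Λ ^ d / TorusAction.sq g p ^ 2 * tnorm F' * tnorm F := by
  obtain ⟨C₀, hC₀, h₀⟩ := exists_norm_le hg N
  obtain ⟨c, C, hc, hC, h⟩ := exists_momentumForm_large hg.inv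
  refine ⟨max 1 (C₀ * C / (c * δ)), by positivity, fun Λ hΛ' p hp F' F hF' hF => ?_⟩
  have hΛ : 1 ≤ Λ := (le_max_left _ _).trans hΛ'
  have hΛ2 : C₀ * C / (c * δ) ≤ Λ := (le_max_right _ _).trans hΛ'
  have hΛ0 : 0 < Λ := by linarith
  have hP := qf_pos hg.inv hp
  have ht1 : (Λ ^ 2)⁻¹ ≤ 1 := inv_le_one_of_one_le₀ (by nlinarith)
  have hcon := h _ (by positivity) ht1 p hp
  obtain ⟨θ, hθ⟩ : ∃ θ, θ = gaussInt g⁻¹ (Λ ^ 2)⁻¹ := ⟨_, rfl⟩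
  have hK := formConst_pos (d := d) hΛ0
  have hw := formConst_mul_gaussInt hg hΛ0
  rw [← hθ] at hcon hw
  have key : largeMomentum g Λ p F' F
      - ((wCoeff g Λ / TorusAction.sq g p ^ 2 : ℝ) : ℂ) * pairing g F' F
      = ((formConst d Λ / qf g⁻¹ p ^ 2 : ℝ) : ℂ) * contractForm g p (fun ν σ =>
        momentumForm g⁻¹ (Λ ^ 2)⁻¹ p ν σ - (-4 * θ / ((Λ ^ 2)⁻¹ * qf g⁻¹ p) * g⁻¹ ν σ
          + 2 * θ / ((Λ ^ 2)⁻¹ * qf g⁻¹ p ^ 2) * (upper g⁻¹ p ν * upper g⁻¹ p σ))) F' F := by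
    rw [← contractForm_sub, contractForm_upper hF' _ _ (fun ν σ => g⁻¹ ν σ),
      largeMomentum_eq hg hΛ0 hp hF' hF, sq_eq, ← neg_eq_iff_eq_neg.2 hw, pairing_eq hg hp hF' hF]
    have hPc : (qf g⁻¹ p : ℂ) ≠ 0 := by exact_mod_cast hP.ne'
    have hΛc : (Λ : ℂ) ≠ 0 := by exact_mod_cast hΛ0.ne'
    push_cast
    field_simp
    ring
  rw [key]
  refine (h₀ Λ p _ _ F' F hΛ0 hp hcon).trans ?_
  refine mul_le_mul_of_nonneg_right (mul_le_mul_of_nonneg_right ?_ (tnorm_nonneg _)) (tnorm_nonneg _)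
  have he : -c / (Λ ^ 2)⁻¹ = -c * Λ ^ 2 := by rw [div_inv_eq_mul]
  rw [he, sq_eq]
  have h1 : Real.exp (-c * Λ ^ 2) ≤ 1 / (c * Λ) := by
    rw [neg_mul, Real.exp_neg, ← one_div]
    refine one_div_le_one_div_of_le (by positivity) ?_
    have := Real.add_one_le_exp (c * Λ ^ 2)
    nlinarith [mul_pos hc hΛ0, mul_nonneg (mul_pos hc hΛ0).le (sub_nonneg.2 hΛ)]
  have h2 : C₀ * C * Real.exp (-c * Λ ^ 2) ≤ δ := by
    refine (mul_le_mul_of_nonneg_left h1 (by positivity)).trans ?_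
    rw [div_le_iff₀ (by positivity)] at hΛ2
    rw [mul_one_div, div_le_iff₀ (by positivity)]
    linarith
  have h3 : C₀ * ((Λ ^ 2)⁻¹ * (C * Real.exp (-c * Λ ^ 2) / qf g⁻¹ p) / qf g⁻¹ p)
      = (Λ ^ 2)⁻¹ * (C₀ * C * Real.exp (-c * Λ ^ 2)) / qf g⁻¹ p ^ 2 := by
    field_simp
  rw [h3]
  refine div_le_div_of_nonneg_right ?_ (by positivity)
  calc (Λ ^ 2)⁻¹ * (C₀ * C * Real.exp (-c * Λ ^ 2)) ≤ C₀ * C * Real.exp (-c * Λ ^ 2) :=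
        mul_le_of_le_one_left (by positivity) ht1
    _ ≤ δ := h2
    _ ≤ δ * Λ ^ d := le_mul_of_one_le_right hδ.le (one_le_pow₀ hΛ)

/-- Both actions are exponentially small for a small cut-off. -/
theorem exists_form_small (hg : g.PosDef) (N : ℕ) : ∃ c C : ℝ, 0 < c ∧
    ∀ Λ : ℝ, 0 < Λ → Λ ≤ 1 → ∀ p : Fin d → ℤ, p ≠ 0 → ∀ F' F : Tensor2 d N,
      IsModeAt p F' → IsModeAt p F →
      ‖evalForm (formFactor g Λ p) F' F‖
        ≤ C * Real.exp (-c / Λ ^ 2) * tnorm F' * tnorm F ∧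
      ‖largeMomentum g Λ p F' F‖
        ≤ C * Real.exp (-c / Λ ^ 2) / TorusAction.sq g p ^ 2
          * tnorm F' * tnorm F := by
  obtain ⟨C₀, hC₀, h₀⟩ := exists_norm_le hg N
  obtain ⟨c₁, C₁, hc₁, hC₁, h₁⟩ := exists_actionForm_small hg.inv
  obtain ⟨c₂, C₂, hc₂, hC₂, h₂⟩ := exists_momentumForm_small hg.inv
  refine ⟨min c₁ c₂, C₀ * max C₁ C₂, lt_min hc₁ hc₂, fun Λ hΛ hΛ1 p hp F' F hF' hF => ?_⟩
  have hP := qf_pos hg.inv hp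
  have ht : 1 ≤ (Λ ^ 2)⁻¹ := (one_le_inv₀ (by positivity)).2 (pow_le_one₀ hΛ.le hΛ1)
  have ht0 : 0 < (Λ ^ 2)⁻¹ := by positivity
  have hexp : ∀ c, min c₁ c₂ ≤ c →
      Real.exp (-c * (Λ ^ 2)⁻¹) ≤ Real.exp (-(min c₁ c₂) / Λ ^ 2) := fun c h => by
    rw [div_eq_mul_inv]
    exact Real.exp_le_exp.2 (mul_le_mul_of_nonneg_right (neg_le_neg h) ht0.le)
  constructor
  · rw [evalForm_formFactor]
    refine (h₀ Λ p _ _ F' F hΛ hp fun ν σ => (le_div_iff₀' ht0).2 (h₁ _ ht p hp ν σ)).trans ?_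
    refine mul_le_mul_of_nonneg_right (mul_le_mul_of_nonneg_right ?_ (tnorm_nonneg _))
      (tnorm_nonneg _)
    rw [mul_div_cancel₀ _ ht0.ne', mul_div_assoc, div_self hP.ne', mul_one, mul_assoc C₀]
    exact mul_le_mul_of_nonneg_left (mul_le_mul (le_max_left _ _) (hexp _ (min_le_left _ _))
      (Real.exp_pos _).le (by positivity)) hC₀
  · rw [largeMomentum_eq hg hΛ hp hF' hF]
    refine (h₀ Λ p _ _ F' F hΛ hp fun ν σ => (le_div_iff₀' ht0).2 (h₂ _ ht p hp ν σ)).trans ?_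
    refine mul_le_mul_of_nonneg_right (mul_le_mul_of_nonneg_right ?_ (tnorm_nonneg _))
      (tnorm_nonneg _)
    rw [mul_div_cancel₀ _ ht0.ne', div_div, ← pow_two, sq_eq, mul_assoc C₀, mul_div_assoc C₀]
    refine mul_le_mul_of_nonneg_left (div_le_div_of_nonneg_right ?_ (by positivity)) hC₀
    exact mul_le_mul (le_max_right _ _) (hexp _ (min_le_right _ _)) (Real.exp_pos _).le
      (by positivity)

end FormFactor

namespace FormFactor

open LatticeGaussian Finset TorusAction

/-! ### Two-sided bounds for the action -/

variable {d N : ℕ} {g : Matrix (Fin d) (Fin d) ℝ} {p : Fin d → ℤ}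
  {F F' : Tensor2 d N}

theorem isModeAt_conjMode (h : IsModeAt p F) :
    IsModeAt p (conjMode F) := by
  obtain ⟨a, ha⟩ := h
  refine ⟨fun μ => (a μ)ᴴ, fun μ ν => ?_⟩
  rw [conjMode, ha]
  simp [Matrix.conjTranspose_smul]

theorem tnorm_conjMode (F : Tensor2 d N) :
    tnorm (conjMode F) = tnorm F := by
  rw [tnorm, tnorm]
  congr 1
  refine sum_congr rfl fun μ _ => sum_congr rfl fun ν _ => ?_
  rw [sum_comm]
  refine sum_congr rfl fun a _ => sum_congr rfl fun b _ => ?_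
  simp [conjMode, Matrix.conjTranspose_apply]

theorem divg_conjMode (ν : Fin d) :
    divg g p (conjMode F) ν = -(divg g p F ν)ᴴ := by
  rw [divg, divg, Matrix.conjTranspose_sum, ← sum_neg_distrib]
  refine sum_congr rfl fun μ _ => ?_
  rw [conjMode, Matrix.conjTranspose_smul, smul_neg]
  simp

theorem divPair_conjMode (ν σ : Fin d) : divPair g p (conjMode F) F ν σ
    = -∑ a, ∑ b, star (divg g p F ν a b) * divg g p F σ a b := by
  rw [divPair, divg_conjMode, Matrix.neg_mul, Matrix.trace_neg, Matrix.trace, sum_comm]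
  simp only [Matrix.diag_apply, Matrix.mul_apply, Matrix.conjTranspose_apply]

theorem contractForm_conjMode_re (T : Fin d → Fin d → ℝ) :
    (contractForm g p T (conjMode F) F).re
      = ∑ a, ∑ b, (∑ ν, ∑ σ, -T ν σ * (divg g p F ν a b).re * (divg g p F σ a b).re
        + ∑ ν, ∑ σ, -T ν σ * (divg g p F ν a b).im * (divg g p F σ a b).im) := by
  have h : (contractForm g p T (conjMode F) F).re = ∑ ν, ∑ σ, ∑ a, ∑ b,
      (-T ν σ * (divg g p F ν a b).re * (divg g p F σ a b).re
        + -T ν σ * (divg g p F ν a b).im * (divg g p F σ a b).im) := by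
    rw [contractForm, Complex.re_sum]
    refine sum_congr rfl fun ν _ => ?_
    rw [Complex.re_sum]
    refine sum_congr rfl fun σ _ => ?_
    rw [divPair_conjMode, Complex.re_ofReal_mul, Complex.neg_re, Complex.re_sum, mul_neg, mul_sum,
      ← sum_neg_distrib]
    refine sum_congr rfl fun a _ => ?_
    rw [Complex.re_sum, mul_sum, ← sum_neg_distrib]
    refine sum_congr rfl fun b _ => ?_
    simp only [Complex.mul_re, RCLike.star_def, Complex.conj_re, Complex.conj_im]
    ring
  rw [h]
  simp only [← sum_add_distrib]
  refine (sum_congr rfl fun ν _ => sum_comm).trans ?_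
  rw [sum_comm]
  refine sum_congr rfl fun a _ => ?_
  refine (sum_congr rfl fun ν _ => sum_comm).trans ?_
  rw [sum_comm]

/-- The large-momentum form is negative definite: it is the sum of a transverse term, which is minus
a sum of squares, and a negative multiple of the inverse metric. -/
theorem exists_le_neg_momentumForm (hg : g.PosDef) {Λ : ℝ} (hΛ : 0 < Λ) : ∃ c, 0 < c ∧
    ∀ p : Fin d → ℤ, p ≠ 0 → ∀ x : Fin d → ℝ, c / qf g⁻¹ p * ∑ ν, x ν ^ 2
      ≤ ∑ ν, ∑ σ, -momentumForm g⁻¹ (Λ ^ 2)⁻¹ p ν σ * x ν * x σ := by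
  have ht : 0 < (Λ ^ 2)⁻¹ := by positivity
  obtain ⟨c, hc, h⟩ := exists_le_tsum_ip_sq hg.inv ht
  obtain ⟨C, hC, h1⟩ := exists_sum_sq_le hg.inv
  refine ⟨4 * c / C, by positivity, fun p hp x => ?_⟩
  have hP := qf_pos hg.inv hp
  have hps := fun ν σ => summable_perp_mul_heat hg.inv ht hp ν σ
  have hnn : 0 ≤ ∑ ν, ∑ σ, (∑' q, perp g⁻¹ p q ν * perp g⁻¹ p q σ * heat g⁻¹ (Λ ^ 2)⁻¹ q)
      * x ν * x σ := by
    have e : ∑ ν, ∑ σ, (∑' q, perp g⁻¹ p q ν * perp g⁻¹ p q σ * heat g⁻¹ (Λ ^ 2)⁻¹ q) * x ν * x σ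
        = ∑' q, (∑ ν, x ν * perp g⁻¹ p q ν) ^ 2 * heat g⁻¹ (Λ ^ 2)⁻¹ q := by
      have hs : ∀ ν σ, Summable fun q =>
          perp g⁻¹ p q ν * perp g⁻¹ p q σ * heat g⁻¹ (Λ ^ 2)⁻¹ q * x ν * x σ := fun ν σ =>
        ((hps ν σ).mul_right _).mul_right _
      simp only [← tsum_mul_right]
      simp only [← Summable.tsum_finsetSum fun σ _ => hs _ σ]
      rw [← Summable.tsum_finsetSum fun ν _ => summable_sum fun σ _ => hs ν σ]
      refine tsum_congr fun q => ?_
      rw [pow_two (∑ ν, x ν * perp g⁻¹ p q ν), sum_mul_sum, sum_mul]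
      refine sum_congr rfl fun ν _ => ?_
      rw [sum_mul]
      exact sum_congr rfl fun σ _ => by ring
    rw [e]
    exact tsum_nonneg fun q => mul_nonneg (sq_nonneg _) (heat_pos _ _).le
  obtain ⟨X, hX⟩ : ∃ X, X = ∑' q, ip g⁻¹ p q ^ 2 * heat g⁻¹ (Λ ^ 2)⁻¹ q := ⟨_, rfl⟩
  have hsplit : ∑ ν, ∑ σ, -momentumForm g⁻¹ (Λ ^ 2)⁻¹ p ν σ * x ν * x σ
      = 4 / qf g⁻¹ p * ∑ ν, ∑ σ, (∑' q, perp g⁻¹ p q ν * perp g⁻¹ p q σ * heat g⁻¹ (Λ ^ 2)⁻¹ q)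
        * x ν * x σ + 4 / qf g⁻¹ p ^ 2 * X * bil g⁻¹ x x := by
    rw [bil, mul_sum, mul_sum, ← sum_add_distrib]
    refine sum_congr rfl fun ν _ => ?_
    rw [mul_sum, mul_sum, ← sum_add_distrib]
    refine sum_congr rfl fun σ _ => ?_
    rw [momentumForm_eq hg.inv ht hp, ← hX]
    ring
  have h2 : c * qf g⁻¹ p ≤ X := hX ▸ h p
  have h3 : ∑ ν, x ν ^ 2 ≤ C * bil g⁻¹ x x := h1 x
  have hB := bil_nonneg hg.inv x
  rw [hsplit]
  refine le_trans ?_ (le_add_of_nonneg_left (by positivity))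
  calc 4 * c / C / qf g⁻¹ p * ∑ ν, x ν ^ 2 ≤ 4 * c / C / qf g⁻¹ p * (C * bil g⁻¹ x x) :=
        mul_le_mul_of_nonneg_left h3 (by positivity)
    _ = 4 / qf g⁻¹ p ^ 2 * (c * qf g⁻¹ p) * bil g⁻¹ x x := by field_simp
    _ ≤ _ := mul_le_mul_of_nonneg_right (mul_le_mul_of_nonneg_left h2 (by positivity)) hB

/-- A mode is bounded by its divergence. -/
theorem exists_tnorm_sq_le (hg : g.PosDef) (N : ℕ) : ∃ C, 0 < C ∧ ∀ p : Fin d → ℤ, p ≠ 0 →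
    ∀ F : Tensor2 d N, IsModeAt p F →
      qf g⁻¹ p * tnorm F ^ 2 ≤ C * ∑ a, ∑ b, ∑ ν, ‖divg g p F ν a b‖ ^ 2 := by
  obtain ⟨C, hC, h⟩ := exists_sum_sq_le hg.inv
  refine ⟨4 * C, by positivity, fun p hp F hF => ?_⟩
  have hP := qf_pos hg.inv hp
  have hpt : ∀ μ ν a b, qf g⁻¹ p ^ 2 * ‖F μ ν a b‖ ^ 2
      ≤ 2 * ((p μ : ℝ) ^ 2 * ‖divg g p F ν a b‖ ^ 2 + (p ν : ℝ) ^ 2 * ‖divg g p F μ a b‖ ^ 2) :=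
    fun μ ν a b => by
    have h1 := congrArg (fun M => ‖M a b‖) (sq_smul_mode (g := g) hF μ ν)
    simp only [Matrix.smul_apply, Matrix.sub_apply, smul_eq_mul, norm_mul, Complex.norm_real,
      Real.norm_eq_abs, abs_of_pos hP] at h1
    have h2 : qf g⁻¹ p * ‖F μ ν a b‖ ≤ |(p μ : ℝ)| * ‖divg g p F ν a b‖
        + |(p ν : ℝ)| * ‖divg g p F μ a b‖ := by
      rw [h1]
      refine (norm_sub_le _ _).trans (le_of_eq ?_)
      rw [norm_mul, norm_mul]
      simp [Complex.norm_intCast]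
    rw [← mul_pow]
    refine (pow_le_pow_left₀ (by positivity) h2 2).trans ?_
    rw [← sq_abs (p μ : ℝ), ← sq_abs (p ν : ℝ)]
    nlinarith [sq_nonneg (|(p μ : ℝ)| * ‖divg g p F ν a b‖ - |(p ν : ℝ)| * ‖divg g p F μ a b‖)]
  have hU : (∑ a, ∑ b, ∑ ν, ‖divg g p F ν a b‖ ^ 2) = ∑ ν, ∑ a, ∑ b, ‖divg g p F ν a b‖ ^ 2 := by
    refine (sum_congr rfl fun a _ => sum_comm).trans ?_
    rw [sum_comm]
  have h3 : qf g⁻¹ p ^ 2 * tnorm F ^ 2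
      ≤ 4 * (∑ μ, (p μ : ℝ) ^ 2) * ∑ a, ∑ b, ∑ ν, ‖divg g p F ν a b‖ ^ 2 := by
    obtain ⟨V, hV⟩ : ∃ V : Fin d → ℝ, V = fun ν => ∑ a, ∑ b, ‖divg g p F ν a b‖ ^ 2 := ⟨_, rfl⟩
    have hUV : ∑ ν, ∑ a, ∑ b, ‖divg g p F ν a b‖ ^ 2 = ∑ ν, V ν := by rw [hV]
    have hpV : ∀ μ ν, qf g⁻¹ p ^ 2 * ∑ a, ∑ b, ‖F μ ν a b‖ ^ 2
        ≤ 2 * ((p μ : ℝ) ^ 2 * V ν + (p ν : ℝ) ^ 2 * V μ) := fun μ ν => by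
      have e : 2 * ((p μ : ℝ) ^ 2 * V ν + (p ν : ℝ) ^ 2 * V μ) = ∑ a, ∑ b,
          2 * ((p μ : ℝ) ^ 2 * ‖divg g p F ν a b‖ ^ 2 + (p ν : ℝ) ^ 2 * ‖divg g p F μ a b‖ ^ 2) := by
        rw [hV]
        simp only [← mul_sum, sum_add_distrib]
      rw [e, mul_sum]
      refine sum_le_sum fun a _ => ?_
      rw [mul_sum]
      exact sum_le_sum fun b _ => hpt μ ν a b
    have hn : tnorm F ^ 2 = ∑ μ, ∑ ν, ∑ a, ∑ b, ‖F μ ν a b‖ ^ 2 :=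
      Real.sq_sqrt (sum_nonneg fun μ _ => sum_nonneg fun ν _ => sum_nonneg fun a _ =>
        sum_nonneg fun b _ => sq_nonneg _)
    rw [hn, hU, hUV, mul_sum]
    calc ∑ μ, qf g⁻¹ p ^ 2 * ∑ ν, ∑ a, ∑ b, ‖F μ ν a b‖ ^ 2
        ≤ ∑ μ, ∑ ν, 2 * ((p μ : ℝ) ^ 2 * V ν + (p ν : ℝ) ^ 2 * V μ) := by
          refine sum_le_sum fun μ _ => ?_
          rw [mul_sum]
          exact sum_le_sum fun ν _ => hpV μ ν
      _ = 2 * (∑ μ, ∑ ν, (p μ : ℝ) ^ 2 * V ν + ∑ μ, ∑ ν, (p ν : ℝ) ^ 2 * V μ) := by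
          simp only [← mul_sum, sum_add_distrib]
      _ = 2 * ((∑ μ, (p μ : ℝ) ^ 2) * ∑ ν, V ν + (∑ μ, (p μ : ℝ) ^ 2) * ∑ ν, V ν) := by
          rw [sum_comm (f := fun μ ν => (p ν : ℝ) ^ 2 * V μ), sum_mul_sum]
      _ = _ := by ring
  have h4 : ∑ μ, (p μ : ℝ) ^ 2 ≤ C * qf g⁻¹ p := h (vec p)
  have h5 : 0 ≤ ∑ a, ∑ b, ∑ ν, ‖divg g p F ν a b‖ ^ 2 := by positivity
  have h6 : qf g⁻¹ p * (qf g⁻¹ p * tnorm F ^ 2)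
      ≤ qf g⁻¹ p * (4 * C * ∑ a, ∑ b, ∑ ν, ‖divg g p F ν a b‖ ^ 2) := by
    have := mul_le_mul_of_nonneg_right h4 h5
    linarith
  exact le_of_mul_le_mul_left h6 hP

/-- On a mode and its adjoint the action is of exact order `p⁻⁴`: the leading term has a definite
sign. -/
theorem exists_form_bounds (hg : g.PosDef) (N : ℕ) {Λ : ℝ} (hΛ : 0 < Λ) :
    ∃ c C P : ℝ, 0 < c ∧ ∀ p : Fin d → ℤ, p ≠ 0 → P ≤ TorusAction.sq g p →
      ∀ F : Tensor2 d N, IsModeAt p F →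
        c / TorusAction.sq g p ^ 2 * tnorm F ^ 2
          ≤ ‖evalForm (formFactor g Λ p) (conjMode F) F‖ ∧
        ‖evalForm (formFactor g Λ p) (conjMode F) F‖
          ≤ C / TorusAction.sq g p ^ 2 * tnorm F ^ 2 := by
  have ht : 0 < (Λ ^ 2)⁻¹ := by positivity
  obtain ⟨C₀, hC₀, h₀⟩ := exists_norm_le hg N
  obtain ⟨C₂, hC₂, h₂⟩ := exists_form_sub_largeMomentum hg N hΛ
  obtain ⟨c₁, hc₁, h₁⟩ := exists_le_neg_momentumForm hg hΛ
  obtain ⟨C₃, hC₃, h₃⟩ := exists_tnorm_sq_le hg N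
  have hK := formConst_pos (d := d) hΛ
  have hT : 0 ≤ g⁻¹.trace := hg.inv.posSemidef.trace_nonneg
  obtain ⟨S, hS⟩ : ∃ S, S = ∑' q : Fin d → ℤ, (if q = 0 then 0
      else qf g⁻¹ q ^ 1 * heat g⁻¹ (Λ ^ 2)⁻¹ q) := ⟨_, rfl⟩
  have hS0 : 0 ≤ S := hS ▸ tsum_nonneg fun q => by
    split_ifs
    · exact le_rfl
    · exact mul_nonneg (pow_nonneg (qf_nonneg hg.inv q) _) (heat_pos _ _).le
  obtain ⟨G, hG⟩ : ∃ G, G = ∑ i, ∑ j, |g⁻¹ i j| := ⟨_, rfl⟩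
  have hG0 : 0 ≤ G := by rw [hG]; positivity
  have hGij : ∀ ν σ, |g⁻¹ ν σ| ≤ G := fun ν σ => hG ▸ abs_entry_le _ ν σ
  obtain ⟨c, hc⟩ : ∃ c, c = formConst d Λ * (c₁ / C₃) := ⟨_, rfl⟩
  have hc0 : 0 < c := by rw [hc]; positivity
  refine ⟨c / 2, C₀ * ((Λ ^ 2)⁻¹ * (4 * (g⁻¹.trace + G) * S)) + c / 2, 2 * C₂ / c, by positivity,
    fun p hp hpP F hF => ?_⟩
  have hP := qf_pos hg.inv hp
  have hF' := isModeAt_conjMode hF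
  have hn : 0 ≤ tnorm F ^ 2 := sq_nonneg _
  rw [sq_eq] at hpP ⊢
  -- the correction to the leading term
  have e1 : ‖evalForm (formFactor g Λ p) (conjMode F) F
      - largeMomentum g Λ p (conjMode F) F‖
        ≤ c / 2 / qf g⁻¹ p ^ 2 * tnorm F ^ 2 := by
    refine (h₂ p hp _ F hF' hF).trans ?_
    rw [tnorm_conjMode, mul_assoc, ← pow_two, sq_eq]
    refine mul_le_mul_of_nonneg_right ?_ hn
    rw [div_le_iff₀ hc0] at hpP
    rw [div_le_div_iff₀ (by positivity) (by positivity)]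
    have := mul_le_mul_of_nonneg_right hpP (sq_nonneg (qf g⁻¹ p))
    linarith
  -- upper bound of the leading term
  have e2 : ‖largeMomentum g Λ p (conjMode F) F‖
      ≤ C₀ * ((Λ ^ 2)⁻¹ * (4 * (g⁻¹.trace + G) * S)) / qf g⁻¹ p ^ 2 * tnorm F ^ 2 := by
    rw [largeMomentum_eq hg hΛ hp hF' hF]
    refine (h₀ Λ p _ (4 * (g⁻¹.trace + G) / qf g⁻¹ p * S) _ F hΛ hp fun ν σ => ?_).trans
      (le_of_eq ?_)
    · refine (abs_momentumForm_le hg.inv ht hp ν σ).trans ?_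
      rw [← hS]
      refine mul_le_mul_of_nonneg_right (div_le_div_of_nonneg_right ?_ hP.le) hS0
      have := hGij ν σ
      linarith
    · rw [tnorm_conjMode]
      field_simp
  -- lower bound of the leading term
  have e3 : c / qf g⁻¹ p ^ 2 * tnorm F ^ 2
      ≤ ‖largeMomentum g Λ p (conjMode F) F‖ := by
    have h4 : c₁ / qf g⁻¹ p * ∑ a, ∑ b, ∑ ν, ‖divg g p F ν a b‖ ^ 2
        ≤ (contractForm g p (momentumForm g⁻¹ (Λ ^ 2)⁻¹ p) (conjMode F) F).re := by
      rw [contractForm_conjMode_re, mul_sum]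
      refine sum_le_sum fun a _ => ?_
      rw [mul_sum]
      refine sum_le_sum fun b _ => ?_
      refine le_trans (le_of_eq ?_) (add_le_add (h₁ p hp fun ν => (divg g p F ν a b).re)
        (h₁ p hp fun ν => (divg g p F ν a b).im))
      rw [← mul_add, ← sum_add_distrib]
      congr 1
      refine sum_congr rfl fun ν _ => ?_
      rw [Complex.sq_norm, Complex.normSq_apply]
      ring
    have h5 := h₃ p hp F hF
    rw [largeMomentum_eq hg hΛ hp hF' hF, norm_mul, Complex.norm_real, Real.norm_eq_abs,
      abs_of_nonneg (by positivity)]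
    have h6 : c / qf g⁻¹ p ^ 2 * tnorm F ^ 2 = formConst d Λ / qf g⁻¹ p ^ 2
        * (c₁ / qf g⁻¹ p * ((qf g⁻¹ p * tnorm F ^ 2) / C₃)) := by
      rw [hc]
      field_simp
    rw [h6]
    refine mul_le_mul_of_nonneg_left (le_trans ?_ (h4.trans (Complex.re_le_norm _))) (by positivity)
    refine mul_le_mul_of_nonneg_left ?_ (by positivity)
    rw [div_le_iff₀ hC₃]
    linarith
  have e4 : c / 2 / qf g⁻¹ p ^ 2 * tnorm F ^ 2
      + c / 2 / qf g⁻¹ p ^ 2 * tnorm F ^ 2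
      = c / qf g⁻¹ p ^ 2 * tnorm F ^ 2 := by ring
  constructor
  · have := norm_sub_norm_le (largeMomentum g Λ p (conjMode F) F)
      (evalForm (formFactor g Λ p) (conjMode F) F)
    rw [norm_sub_rev] at this
    linarith
  · have := norm_sub_norm_le (evalForm (formFactor g Λ p) (conjMode F) F)
      (largeMomentum g Λ p (conjMode F) F)
    rw [add_div, add_mul]
    linarith

end FormFactor

namespace TorusFourier

open MeasureTheory Filter Topology

variable {d : ℕ}

/-! ### Plane waves and Fourier coefficients on the torus -/

/-- The linear form `x ↦ k · x`. -/
def phase (k : Fin d → ℤ) : (Fin d → ℝ) →L[ℝ] ℝ :=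
  ∑ μ, (k μ : ℝ) • ContinuousLinearMap.proj (R := ℝ) (φ := fun _ : Fin d => ℝ) μ

theorem phase_apply (k : Fin d → ℤ) (x : Fin d → ℝ) : phase k x = ∑ μ, (k μ : ℝ) * x μ := by
  simp [phase]

theorem phase_add (k l : Fin d → ℤ) (x : Fin d → ℝ) : phase (k + l) x = phase k x + phase l x := by
  simp [phase_apply, add_mul, Finset.sum_add_distrib]

theorem phase_neg (k : Fin d → ℤ) (x : Fin d → ℝ) : phase (-k) x = -phase k x := by
  simp [phase_apply]

theorem phase_single (k : Fin d → ℤ) (μ : Fin d) (s : ℝ) : phase k (Pi.single μ s) = k μ * s := by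
  simp [phase_apply, Pi.single_apply]

/-- The plane wave `e^{ikx}`. -/
def wave (k : Fin d → ℤ) (x : Fin d → ℝ) : ℂ := Complex.exp (Complex.I * (phase k x : ℂ))

theorem norm_wave (k : Fin d → ℤ) (x : Fin d → ℝ) : ‖wave k x‖ = 1 := by
  rw [wave, mul_comm, Complex.norm_exp_ofReal_mul_I]

theorem wave_add (k l : Fin d → ℤ) (x : Fin d → ℝ) : wave (k + l) x = wave k x * wave l x := by
  rw [wave, wave, wave, phase_add, ← Complex.exp_add]
  push_cast
  ring_nf

theorem wave_zero (x : Fin d → ℝ) : wave 0 x = 1 := by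
  simp [wave, phase_apply]

theorem wave_neg (k : Fin d → ℤ) (x : Fin d → ℝ) : wave (-k) x = (starRingEnd ℂ) (wave k x) := by
  rw [wave, wave, phase_neg, ← Complex.exp_conj, map_mul, Complex.conj_I, Complex.conj_ofReal]
  push_cast
  ring_nf

theorem contDiff_wave (k : Fin d → ℤ) : ContDiff ℝ ∞ (wave k) :=
  Complex.contDiff_exp.comp (contDiff_const.mul
    (Complex.ofRealCLM.contDiff.comp (phase k).contDiff))

theorem isPeriodic_wave (k : Fin d → ℤ) : TorusAction.IsPeriodic (wave k) := fun μ x => by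
  rw [wave, map_add, phase_single, wave, Complex.ofReal_add, mul_add, Complex.exp_add]
  have : Complex.exp (Complex.I * ((k μ * (2 * Real.pi) : ℝ) : ℂ)) = 1 := by
    rw [Complex.exp_eq_one_iff]
    exact ⟨k μ, by push_cast; ring⟩
  rw [this, mul_one]

theorem partialD_wave (k : Fin d → ℤ) (μ : Fin d) (x : Fin d → ℝ) :
    TorusAction.partialD μ (wave k) x = Complex.I * (k μ : ℂ) * wave k x := by
  have h1 : HasFDerivAt (fun x => Complex.I * (phase k x : ℂ))
      (Complex.I • (Complex.ofRealCLM.comp (phase k))) x :=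
    ((Complex.ofRealCLM.hasFDerivAt (x := phase k x)).comp x (phase k).hasFDerivAt).const_mul _
  have h2 := h1.cexp
  rw [TorusAction.partialD, show wave k = fun x => Complex.exp (Complex.I * (phase k x : ℂ)) from rfl,
    h2.fderiv]
  simp [phase_single]
  ring

/-- Smooth functions on the torus. -/
def Smooth (φ : (Fin d → ℝ) → ℂ) : Prop := ContDiff ℝ ∞ φ ∧ TorusAction.IsPeriodic φ

namespace Smooth

variable {φ ψ : (Fin d → ℝ) → ℂ}

theorem continuous (h : Smooth φ) : Continuous φ := h.1.continuous

theorem differentiable (h : Smooth φ) : Differentiable ℝ φ := h.1.differentiable (by simp)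

theorem mul (h : Smooth φ) (h' : Smooth ψ) : Smooth fun x => φ x * ψ x :=
  ⟨h.1.mul h'.1, fun μ x => by
    show φ _ * ψ _ = _
    rw [h.2, h'.2]⟩

theorem const_mul (h : Smooth φ) (c : ℂ) : Smooth fun x => c * φ x :=
  ⟨contDiff_const.mul h.1, fun μ x => by
    show c * φ _ = _
    rw [h.2]⟩

theorem partialD (h : Smooth φ) (μ : Fin d) : Smooth (TorusAction.partialD μ φ) := by
  refine ⟨(h.1.fderiv_right (m := ∞) (by simp)).clm_apply contDiff_const, fun ν x => ?_⟩
  have he : (fun y => φ (y + Pi.single ν (2 * Real.pi))) = φ := funext fun y => h.2 ν y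
  have hf := fderiv_comp_add_right (𝕜 := ℝ) (f := φ) (x := x) (Pi.single ν (2 * Real.pi))
  rw [he] at hf
  simp only [TorusAction.partialD, hf]

end Smooth

theorem smooth_wave (k : Fin d → ℤ) : Smooth (wave k) := ⟨contDiff_wave k, isPeriodic_wave k⟩

/-- The fundamental cell `[0, 2π]^d`. -/
def cell (d : ℕ) : Set (Fin d → ℝ) := Set.Icc 0 fun _ => 2 * Real.pi

/-- The Fourier coefficients, normalised by `φ(x) = ∑_k c_k e^{ikx}`. -/
def coef (φ : (Fin d → ℝ) → ℂ) (k : Fin d → ℤ) : ℂ :=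
  (((2 * Real.pi) ^ d : ℝ) : ℂ)⁻¹ * ∫ x in cell d, φ x * wave (-k) x

theorem integrableOn_cell {φ : (Fin d → ℝ) → ℂ} (h : Continuous φ) : IntegrableOn φ (cell d) :=
  h.continuousOn.integrableOn_compact isCompact_Icc

theorem integrableOn_mul_wave {φ : (Fin d → ℝ) → ℂ} (h : Continuous φ) (k : Fin d → ℤ) :
    IntegrableOn (fun x => φ x * wave k x) (cell d) :=
  integrableOn_cell (h.mul (contDiff_wave k).continuous)

theorem volume_real_cell : volume.real (cell d) = (2 * Real.pi) ^ d := by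
  rw [Measure.real, cell, Real.volume_Icc_pi]
  simp [ENNReal.toReal_ofReal Real.pi_pos.le]

theorem fourier_eq_coef (φ : (Fin d → ℝ) → ℂ) (k : Fin d → ℤ) :
    TorusAction.fourier φ k = (((2 * Real.pi) ^ ((d : ℝ) / 2) : ℝ) : ℂ) * coef φ k := by
  have h1 : ((2 * Real.pi) ^ (-(d : ℝ) / 2) : ℝ)
      = (2 * Real.pi) ^ ((d : ℝ) / 2) * ((2 * Real.pi) ^ d)⁻¹ := by
    rw [← Real.rpow_natCast, ← Real.rpow_neg (by positivity), ← Real.rpow_add (by positivity)]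
    congr 1
    ring
  rw [TorusAction.fourier, coef, h1, ← mul_assoc, Complex.ofReal_mul, Complex.ofReal_inv]
  congr 1
  refine integral_congr_ae (Eventually.of_forall fun x => ?_)
  show φ x * _ = φ x * _
  rw [wave, phase_neg, phase_apply]
  push_cast
  ring_nf

theorem coef_add {φ ψ : (Fin d → ℝ) → ℂ} (h : Continuous φ) (h' : Continuous ψ) (k : Fin d → ℤ) :
    coef (fun x => φ x + ψ x) k = coef φ k + coef ψ k := by
  rw [coef, coef, coef, ← mul_add, ← integral_add
    (integrableOn_mul_wave h _) (integrableOn_mul_wave h' _)]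
  simp only [add_mul]

theorem coef_const_mul (c : ℂ) (φ : (Fin d → ℝ) → ℂ) (k : Fin d → ℤ) :
    coef (fun x => c * φ x) k = c * coef φ k := by
  rw [coef, coef]
  simp only [mul_assoc]
  rw [integral_const_mul]
  ring

theorem coef_sum {ι : Type*} (s : Finset ι) {f : ι → (Fin d → ℝ) → ℂ}
    (h : ∀ i ∈ s, Continuous (f i)) (k : Fin d → ℤ) :
    coef (fun x => ∑ i ∈ s, f i x) k = ∑ i ∈ s, coef (f i) k := by
  simp only [coef]
  simp only [Finset.sum_mul]
  rw [integral_finsetSum s fun i hi => integrableOn_mul_wave (h i hi) _, Finset.mul_sum]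

theorem coef_conj (φ : (Fin d → ℝ) → ℂ) (k : Fin d → ℤ) :
    coef (fun x => (starRingEnd ℂ) (φ x)) k = (starRingEnd ℂ) (coef φ (-k)) := by
  rw [coef, coef, map_mul, map_inv₀, Complex.conj_ofReal, ← integral_conj]
  congr 1
  refine integral_congr_ae (Eventually.of_forall fun x => ?_)
  show (starRingEnd ℂ) (φ x) * wave (-k) x = (starRingEnd ℂ) (φ x * wave (- -k) x)
  rw [map_mul, neg_neg, wave_neg]

/-- Dominated interchange of Fourier coefficients and sums. -/
theorem hasSum_coef {ι : Type*} [Countable ι] {f : ι → (Fin d → ℝ) → ℂ} {u : ι → ℝ}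
    (hf : ∀ i, Continuous (f i)) (hu : Summable u) (h : ∀ i x, ‖f i x‖ ≤ u i) (k : Fin d → ℤ) :
    HasSum (fun i => coef (f i) k) (coef (fun x => ∑' i, f i x) k) := by
  refine HasSum.mul_left _ ?_
  refine hasSum_integral_of_dominated_convergence (fun i _ => u i)
    (fun i => ((hf i).mul (contDiff_wave _).continuous).aestronglyMeasurable) (fun i => ?_)
    (Eventually.of_forall fun _ => hu) ?_ (Eventually.of_forall fun x => ?_)
  · refine Eventually.of_forall fun x => ?_
    rw [norm_mul, norm_wave, mul_one]
    exact h i x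
  · exact integrableOn_const (μ := volume) (isCompact_Icc (α := Fin d → ℝ)).measure_lt_top.ne
  · exact (Summable.of_norm_bounded hu fun i => h i x).hasSum.mul_right _

/-- The derivative of a periodic function has mean zero, by the divergence theorem on the cell. -/
theorem integral_partialD {φ : (Fin d → ℝ) → ℂ} (h : Smooth φ) (μ : Fin d) :
    ∫ x in cell d, TorusAction.partialD μ φ x = 0 := by
  obtain _ | n := d
  · exact μ.elim0
  have hle : (0 : Fin (n + 1) → ℝ) ≤ fun _ => 2 * Real.pi := fun _ => by
    show (0 : ℝ) ≤ _
    positivity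
  have hdiv := integral_divergence_of_hasFDerivAt_off_countable' (0 : Fin (n + 1) → ℝ)
    (fun _ => 2 * Real.pi) hle (fun i x => if i = μ then φ x else 0)
    (fun i x => if i = μ then fderiv ℝ φ x else 0) ∅ Set.countable_empty (fun i => ?_)
    (fun x _ i => ?_) ?_
  · have h1 : ∀ x, ∑ i, (if i = μ then fderiv ℝ φ x else 0) (Pi.single i (1 : ℝ))
        = TorusAction.partialD μ φ x := fun x => by
      rw [Finset.sum_eq_single μ]
      · rw [if_pos rfl, TorusAction.partialD]
      · intro i _ hi
        rw [if_neg hi]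
        rfl
      · simp
    simp only [h1] at hdiv
    rw [cell, hdiv]
    refine Finset.sum_eq_zero fun i _ => ?_
    by_cases hi : i = μ
    · subst hi
      rw [sub_eq_zero]
      refine integral_congr_ae (Eventually.of_forall fun x => ?_)
      simp only [if_true]
      have h2 := h.2 i (i.insertNth 0 x)
      refine Eq.trans ?_ h2
      congr 1
      ext j
      obtain rfl | ⟨j, rfl⟩ := Fin.eq_self_or_eq_succAbove i j
      · simp
      · simp
    · simp [hi]
  · split_ifs
    · exact h.continuous.continuousOn
    · exact continuousOn_const
  · split_ifs
    · exact (h.differentiable x).hasFDerivAt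
    · exact hasFDerivAt_const _ _
  · refine Continuous.integrableOn_Icc ?_
    refine continuous_finsetSum _ fun i _ => ?_
    split_ifs
    · exact (h.1.continuous_fderiv (by simp)).clm_apply continuous_const
    · exact continuous_const

theorem partialD_mul {φ ψ : (Fin d → ℝ) → ℂ} (h : Smooth φ) (h' : Smooth ψ) (μ : Fin d)
    (x : Fin d → ℝ) : TorusAction.partialD μ (fun x => φ x * ψ x) x
      = TorusAction.partialD μ φ x * ψ x + φ x * TorusAction.partialD μ ψ x := by
  have := ((h.differentiable x).hasFDerivAt.mul (h'.differentiable x).hasFDerivAt).fderiv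
  rw [TorusAction.partialD, show (fun x => φ x * ψ x) = φ * ψ from rfl, this]
  simp [TorusAction.partialD]
  ring

theorem coef_partialD {φ : (Fin d → ℝ) → ℂ} (h : Smooth φ) (μ : Fin d) (k : Fin d → ℤ) :
    coef (TorusAction.partialD μ φ) k = Complex.I * (k μ : ℂ) * coef φ k := by
  have h1 := integral_partialD (h.mul (smooth_wave (-k))) μ
  have h2 : ∀ x, TorusAction.partialD μ (fun x => φ x * wave (-k) x) x
      = TorusAction.partialD μ φ x * wave (-k) x
        + (-(Complex.I * (k μ : ℂ))) * (φ x * wave (-k) x) := fun x => by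
    rw [partialD_mul h (smooth_wave _), partialD_wave]
    simp
    ring
  simp only [h2] at h1
  have i1 := integrableOn_mul_wave (h.partialD μ).continuous (-k)
  have i2 := integrableOn_mul_wave h.continuous (-k)
  rw [integral_add i1 (i2.const_mul _), integral_const_mul] at h1
  rw [coef, coef, ← mul_assoc, mul_comm (Complex.I * _), mul_assoc]
  congr 1
  linear_combination h1

theorem coef_wave (k l : Fin d → ℤ) : coef (wave l) k = if k = l then 1 else 0 := by
  split_ifs with h
  · subst h
    have h1 : ∀ x, wave k x * wave (-k) x = 1 := fun x => by
      rw [← wave_add, add_neg_cancel, wave_zero]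
    simp only [coef, h1]
    rw [setIntegral_const, volume_real_cell]
    have : (((2 * Real.pi) ^ d : ℝ) : ℂ) ≠ 0 := by
      exact_mod_cast (by positivity : (2 * Real.pi) ^ d ≠ 0)
    rw [Complex.real_smul, mul_one, inv_mul_cancel₀ this]
  · obtain ⟨μ, hμ⟩ := Function.ne_iff.1 h
    have h1 := coef_partialD (smooth_wave l) μ k
    rw [show TorusAction.partialD μ (wave l) = fun x => Complex.I * (l μ : ℂ) * wave l x from
      funext fun x => partialD_wave l μ x, coef_const_mul] at h1
    have h2 : (Complex.I * ((l μ : ℂ) - k μ)) * coef (wave l) k = 0 := by linear_combination h1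
    refine (mul_eq_zero.1 h2).resolve_left (mul_ne_zero Complex.I_ne_zero (sub_ne_zero.2 ?_))
    exact_mod_cast Ne.symm hμ

end TorusFourier

namespace TorusFourier

open MeasureTheory Filter Topology Pointwise

variable {d : ℕ}

/-! ### Rapidly decreasing sequences -/

/-- The submultiplicative weight `1 + ∑ |k_μ|`. -/
def wt (k : Fin d → ℤ) : ℝ := 1 + ∑ μ, |(k μ : ℝ)|

theorem one_le_wt (k : Fin d → ℤ) : 1 ≤ wt k := by
  have : 0 ≤ ∑ μ, |(k μ : ℝ)| := Finset.sum_nonneg fun _ _ => abs_nonneg _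
  rw [wt]
  linarith

theorem wt_pos (k : Fin d → ℤ) : 0 < wt k := zero_lt_one.trans_le (one_le_wt k)

theorem wt_add_le (k l : Fin d → ℤ) : wt (k + l) ≤ wt k * wt l := by
  have h1 : ∑ μ, |((k + l) μ : ℝ)| ≤ ∑ μ, |(k μ : ℝ)| + ∑ μ, |(l μ : ℝ)| := by
    rw [← Finset.sum_add_distrib]
    refine Finset.sum_le_sum fun μ _ => ?_
    push_cast [Pi.add_apply]
    exact abs_add_le _ _
  have hk : 0 ≤ ∑ μ, |(k μ : ℝ)| := Finset.sum_nonneg fun _ _ => abs_nonneg _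
  have hl : 0 ≤ ∑ μ, |(l μ : ℝ)| := Finset.sum_nonneg fun _ _ => abs_nonneg _
  rw [wt, wt, wt]
  nlinarith [mul_nonneg hk hl]

theorem summable_prod_pi {f : ℤ → ℝ} (hf : Summable f) (h0 : ∀ k, 0 ≤ f k) :
    ∀ d : ℕ, Summable fun k : Fin d → ℤ => ∏ μ, f (k μ)
  | 0 => Summable.of_finite
  | d + 1 => by
    have h1 := hf.mul_of_nonneg (summable_prod_pi hf h0 d) h0
      (fun k => Finset.prod_nonneg fun μ _ => h0 _)
    rw [← (Fin.consEquiv fun _ : Fin (d + 1) => ℤ).summable_iff]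
    refine h1.congr fun x => ?_
    simp [Fin.prod_univ_succ, Fin.consEquiv]

theorem summable_inv_sq_int : Summable fun k : ℤ => ((1 + |(k : ℝ)|) ^ 2)⁻¹ := by
  have h : Summable fun n : ℕ => ((1 + (n : ℝ)) ^ 2)⁻¹ := by
    have := (summable_nat_add_iff 1).2 (Real.summable_nat_pow_inv (p := 2).2 (by norm_num))
    refine this.congr fun n => ?_
    push_cast
    ring
  refine Summable.of_nat_of_neg ?_ ?_
  · simpa using h
  · simpa using h

theorem summable_wt_inv : Summable fun k : Fin d → ℤ => (wt k ^ (2 * d))⁻¹ := by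
  refine Summable.of_nonneg_of_le (fun k => by have := wt_pos k; positivity) (fun k => ?_)
    (summable_prod_pi summable_inv_sq_int (fun k => by positivity) d)
  rw [Finset.prod_inv_distrib]
  refine inv_anti₀ (Finset.prod_pos fun μ _ => by positivity) ?_
  rw [Finset.prod_pow, mul_comm, pow_mul]
  refine pow_le_pow_left₀ (Finset.prod_nonneg fun μ _ => by positivity) ?_ 2
  refine (Finset.prod_le_prod (fun μ _ => by positivity) fun μ _ => ?_).trans
    (le_of_eq (by simp : ∏ _μ : Fin d, wt k = wt k ^ d))
  rw [wt]
  have := Finset.single_le_sum (f := fun μ => |(k μ : ℝ)|) (fun _ _ => abs_nonneg _)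
    (Finset.mem_univ μ)
  linarith

/-- Sequences that decay faster than any power. -/
def RapidDecay (c : (Fin d → ℤ) → ℂ) : Prop := ∀ n : ℕ, ∃ C, ∀ k, wt k ^ n * ‖c k‖ ≤ C

theorem RapidDecay.summable {c : (Fin d → ℤ) → ℂ} (h : RapidDecay c) (n : ℕ) :
    Summable fun k => wt k ^ n * ‖c k‖ := by
  obtain ⟨C, hC⟩ := h (n + 2 * d)
  refine Summable.of_nonneg_of_le (fun k => by have := wt_pos k; positivity) (fun k => ?_)
    (summable_wt_inv.mul_left C)
  have := wt_pos k
  rw [← div_eq_mul_inv, le_div_iff₀ (by positivity)]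
  refine le_trans (le_of_eq ?_) (hC k)
  rw [pow_add]
  ring

theorem RapidDecay.summable_norm {c : (Fin d → ℤ) → ℂ} (h : RapidDecay c) :
    Summable fun k => ‖c k‖ := by
  simpa using h.summable 0

theorem Smooth.exists_bound {φ : (Fin d → ℝ) → ℂ} (h : Smooth φ) :
    ∃ C, ∀ k, ‖coef φ k‖ ≤ C := by
  obtain ⟨C, hC⟩ := (isCompact_Icc (a := (0 : Fin d → ℝ)) (b := fun _ => 2 * Real.pi)).exists_bound_of_continuousOn
    h.continuous.continuousOn
  refine ⟨C, fun k => ?_⟩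
  have h1 : ‖∫ x in cell d, φ x * wave (-k) x‖ ≤ C * volume.real (cell d) := by
    refine norm_setIntegral_le_of_norm_le_const
      (isCompact_Icc (α := Fin d → ℝ)).measure_lt_top fun x hx => ?_
    rw [norm_mul, norm_wave, mul_one]
    exact hC x hx
  have hv : 0 < (2 * Real.pi) ^ d := by positivity
  rw [volume_real_cell] at h1
  rw [coef, norm_mul, norm_inv, Complex.norm_real, Real.norm_eq_abs, abs_of_pos hv,
    inv_mul_le_iff₀ hv, mul_comm _ C]
  exact h1

/-- Integration by parts: a derivative multiplies the coefficients by a component of the momentum.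
-/
theorem Smooth.rapidDecay {φ : (Fin d → ℝ) → ℂ} (h : Smooth φ) : RapidDecay (coef φ) := by
  intro n
  induction n generalizing φ with
  | zero =>
    obtain ⟨C, hC⟩ := h.exists_bound
    exact ⟨C, fun k => by simpa using hC k⟩
  | succ n ih =>
    obtain ⟨C, hC⟩ := ih h
    choose C' hC' using fun μ => ih (h.partialD μ)
    refine ⟨C + ∑ μ, C' μ, fun k => ?_⟩
    have h1 : wt k ^ (n + 1) * ‖coef φ k‖ = wt k ^ n * ‖coef φ k‖
        + ∑ μ, wt k ^ n * ‖coef (TorusAction.partialD μ φ) k‖ := by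
      have h2 : ∀ μ, wt k ^ n * ‖coef (TorusAction.partialD μ φ) k‖
          = |(k μ : ℝ)| * (wt k ^ n * ‖coef φ k‖) := fun μ => by
        rw [coef_partialD h, norm_mul, norm_mul, Complex.norm_I, Complex.norm_intCast]
        ring
      simp only [h2]
      rw [← Finset.sum_mul, pow_succ]
      nth_rewrite 2 [wt]
      ring
    rw [h1]
    exact add_le_add (hC k) (Finset.sum_le_sum fun μ _ => hC' μ k)

/-! ### Fourier series -/

/-- The function with Fourier coefficients `c`. -/
def synth (c : (Fin d → ℤ) → ℂ) (x : Fin d → ℝ) : ℂ := ∑' k, c k * wave k x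

theorem norm_phase_le (k : Fin d → ℤ) : ‖phase k‖ ≤ wt k := by
  refine ContinuousLinearMap.opNorm_le_bound _ (wt_pos k).le fun x => ?_
  rw [phase_apply, wt, add_mul, Finset.sum_mul]
  refine (norm_sum_le _ _).trans ((Finset.sum_le_sum fun μ _ => ?_).trans
    (le_add_of_nonneg_left (by positivity)))
  rw [norm_mul, Real.norm_eq_abs]
  exact mul_le_mul_of_nonneg_left (norm_le_pi_norm x μ) (abs_nonneg _)

theorem norm_iteratedFDeriv_wave_le (n : ℕ) (k : Fin d → ℤ) (x : Fin d → ℝ) :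
    ‖iteratedFDeriv ℝ n (wave k) x‖ ≤ wt k ^ n := by
  obtain ⟨e, he⟩ : ∃ e : ℝ → ℂ, e = fun s : ℝ => Complex.exp (Complex.I * (s : ℂ)) := ⟨_, rfl⟩
  have hd : ∀ s, HasDerivAt e (Complex.I * e s) s := fun s => by
    have h1 : HasDerivAt (fun s : ℝ => Complex.I * (s : ℂ)) (Complex.I * 1) s :=
      (Complex.ofRealCLM.hasDerivAt (x := s)).const_mul _
    have := h1.cexp
    rw [he]
    convert! this using 1
    ring
  have hi : ∀ n, iteratedDeriv n e = fun s => Complex.I ^ n * e s := fun n => by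
    induction n with
    | zero => simp
    | succ n ih =>
      rw [iteratedDeriv_succ, ih]
      funext s
      rw [((hd s).const_mul _).deriv, pow_succ]
      ring
  have hc : ContDiff ℝ ∞ e := by
    rw [he]
    exact Complex.contDiff_exp.comp (contDiff_const.mul Complex.ofRealCLM.contDiff)
  have hw : wave k = e ∘ phase k := by
    rw [he]
    rfl
  rw [hw, (phase k).iteratedFDeriv_comp_right hc x (i := n) (by exact_mod_cast le_top)]
  refine (ContinuousMultilinearMap.norm_compContinuousLinearMap_le _ _).trans ?_
  rw [norm_iteratedFDeriv_eq_norm_iteratedDeriv, hi]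
  have h1 : ‖Complex.I ^ n * e (phase k x)‖ = 1 := by
    rw [norm_mul, norm_pow, Complex.norm_I, one_pow, one_mul, he]
    show ‖Complex.exp (Complex.I * _)‖ = 1
    rw [mul_comm, Complex.norm_exp_ofReal_mul_I]
  rw [h1, one_mul, Finset.prod_const, Finset.card_univ, Fintype.card_fin]
  exact pow_le_pow_left₀ (norm_nonneg _) (norm_phase_le k) n

theorem RapidDecay.smooth_synth {c : (Fin d → ℤ) → ℂ} (h : RapidDecay c) : Smooth (synth c) := by
  constructor
  · refine contDiff_tsum (N := ⊤) (v := fun n k => wt k ^ n * ‖c k‖)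
      (fun k => contDiff_const.mul (contDiff_wave k)) (fun n _ => h.summable n) fun n k x _ => ?_
    have : (fun x => c k * wave k x) = c k • wave k := rfl
    rw [this, iteratedFDeriv_const_smul_apply
      ((contDiff_wave k).contDiffAt.of_le (by exact_mod_cast le_top)), norm_smul, mul_comm]
    exact mul_le_mul_of_nonneg_right (norm_iteratedFDeriv_wave_le n k x) (norm_nonneg _)
  · intro μ x
    simp only [synth, isPeriodic_wave _ μ x]

theorem RapidDecay.coef_synth {c : (Fin d → ℤ) → ℂ} (h : RapidDecay c) (k : Fin d → ℤ) :
    coef (synth c) k = c k := by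
  have h1 := hasSum_coef (f := fun l x => c l * wave l x)
    (fun l => continuous_const.mul (contDiff_wave l).continuous) h.summable_norm
    (fun l x => by rw [norm_mul, norm_wave, mul_one]) k
  simp only [coef_const_mul, coef_wave] at h1
  refine h1.unique ?_
  convert! hasSum_ite_eq k (c k) using 2 with l
  by_cases hl : l = k
  · simp [hl]
  · simp [hl, Ne.symm hl]

theorem apply_add_int_smul {φ : (Fin d → ℝ) → ℂ} (h : TorusAction.IsPeriodic φ) (n : Fin d → ℤ)
    (x : Fin d → ℝ) : φ (fun μ => x μ + n μ * (2 * Real.pi)) = φ x := by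
  have h1 : ∀ s : Finset (Fin d), φ (x + ∑ μ ∈ s, Pi.single μ (n μ * (2 * Real.pi))) = φ x := by
    intro s
    induction s using Finset.induction_on with
    | empty => simp
    | insert μ s hs ih =>
      rw [Finset.sum_insert hs, add_comm (Pi.single μ _), ← add_assoc]
      have hp : Function.Periodic (fun r : ℝ => φ (x + ∑ μ ∈ s, Pi.single μ (n μ * (2 * Real.pi))
          + Pi.single μ r)) (2 * Real.pi) := fun r => by
        show φ _ = φ _
        rw [Pi.single_add, ← add_assoc]
        exact h μ _
      have := hp.int_mul (n μ) 0
      simp only [zero_add, Pi.single_zero, add_zero] at this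
      exact this.trans ih
  rw [← h1 Finset.univ]
  congr 1
  ext μ
  simp [Finset.sum_apply, Pi.single_apply]

/-- Fourier inversion on the torus. -/
theorem Smooth.hasSum_wave {φ : (Fin d → ℝ) → ℂ} (h : Smooth φ) (x : Fin d → ℝ) :
    HasSum (fun k => coef φ k * wave k x) (φ x) := by
  obtain ⟨π, hπ⟩ : ∃ π : (Fin d → ℝ) → UnitAddTorus (Fin d),
      π = Pi.map fun _ (s : ℝ) => (s : UnitAddCircle) := ⟨_, rfl⟩
  have hq : IsOpenQuotientMap π := by
    rw [hπ]
    exact IsOpenQuotientMap.piMap fun _ => QuotientAddGroup.isOpenQuotientMap_mk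
  obtain ⟨f₀, hf₀⟩ : ∃ f₀ : UnitAddTorus (Fin d) → ℂ,
      f₀ = fun y => φ fun μ => 2 * Real.pi * Function.surjInv hq.surjective y μ := ⟨_, rfl⟩
  have hf : ∀ y, f₀ (π y) = φ fun μ => 2 * Real.pi * y μ := fun y => by
    have h1 := Function.surjInv_eq hq.surjective (π y)
    obtain ⟨z, hz⟩ : ∃ z, z = Function.surjInv hq.surjective (π y) := ⟨_, rfl⟩
    rw [← hz] at h1
    have h2 : ∀ μ, ∃ n : ℤ, z μ = y μ + n := fun μ => by
      have h3 : ((z μ : ℝ) : UnitAddCircle) = (y μ : ℝ) := by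
        have := congrFun h1 μ
        rwa [hπ] at this
      obtain ⟨n, hn⟩ := (QuotientAddGroup.eq_iff_sub_mem.1 h3 :
        z μ - y μ ∈ AddSubgroup.zmultiples (1 : ℝ))
      refine ⟨n, ?_⟩
      simp only [zsmul_eq_mul, mul_one] at hn
      linarith
    choose n hn using h2
    rw [hf₀]
    show φ (fun μ => 2 * Real.pi * Function.surjInv hq.surjective (π y) μ) = _
    rw [← hz]
    refine Eq.trans ?_ (apply_add_int_smul h.2 n _)
    congr 1
    funext μ
    rw [hn]
    ring
  have hcont : Continuous f₀ := by
    rw [hq.isQuotientMap.continuous_iff]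
    have : f₀ ∘ π = fun y => φ fun μ => 2 * Real.pi * y μ := funext hf
    rw [this]
    exact h.continuous.comp (continuous_pi fun μ => continuous_const.mul (continuous_apply μ))
  have hm : ∀ (k : Fin d → ℤ) (y : Fin d → ℝ),
      UnitAddTorus.mFourier k (π y) = wave k fun μ => 2 * Real.pi * y μ := fun k y => by
    rw [UnitAddTorus.mFourier, hπ, wave, phase_apply]
    simp only [ContinuousMap.coe_mk, Pi.map_apply, fourier_coe_apply]
    rw [← Complex.exp_sum]
    congr 1
    push_cast
    rw [Finset.mul_sum]
    refine Finset.sum_congr rfl fun μ _ => ?_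
    ring
  have hc : ∀ k, UnitAddTorus.mFourierCoeff f₀ k = coef φ k := fun k => by
    rw [UnitAddTorus.mFourierCoeff_eq_integral f₀ k 0, coef]
    have e1 : ∀ y : Fin d → ℝ, UnitAddTorus.mFourier (-k) (fun i => (y i : UnitAddCircle))
        • f₀ (fun i => (y i : UnitAddCircle))
        = (fun x => φ x * wave (-k) x) ((2 * Real.pi) • y) := fun y => by
      have h1 : (fun i => (y i : UnitAddCircle)) = π y := by rw [hπ]; rfl
      rw [h1, hm, hf, smul_eq_mul, mul_comm]
      rfl
    simp only [e1]
    have e2 : {x : Fin d → ℝ | ∀ i, x i ∈ Set.Ioc ((0 : Fin d → ℝ) i) ((0 : Fin d → ℝ) i + 1)}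
        = Set.univ.pi fun i => Set.Ioc ((0 : Fin d → ℝ) i) ((fun _ => 1 : Fin d → ℝ) i) := by
      ext x
      simp
    have e3 : (volume.restrict (Set.univ.pi fun i => Set.Ioc ((0 : Fin d → ℝ) i)
        ((fun _ => 1 : Fin d → ℝ) i))) = volume.restrict (Set.Icc (0 : Fin d → ℝ) fun _ => 1) :=
      Measure.restrict_congr_set Measure.univ_pi_Ioc_ae_eq_Icc
    have e4 : (2 * Real.pi) • Set.Icc (0 : Fin d → ℝ) (fun _ => 1) = cell d := by
      have h0 : (0 : ℝ) < 2 * Real.pi := by positivity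
      ext x
      rw [Set.mem_smul_set_iff_inv_smul_mem₀ h0.ne', cell, Set.mem_Icc, Set.mem_Icc, Pi.le_def,
        Pi.le_def, Pi.le_def, Pi.le_def]
      refine and_congr (forall_congr' fun μ => ?_) (forall_congr' fun μ => ?_)
      · show 0 ≤ (2 * Real.pi)⁻¹ * x μ ↔ 0 ≤ x μ
        rw [le_inv_mul_iff₀ h0, mul_zero]
      · show (2 * Real.pi)⁻¹ * x μ ≤ 1 ↔ x μ ≤ 2 * Real.pi
        rw [inv_mul_le_iff₀ h0, mul_one]
    have e5 := Measure.setIntegral_comp_smul_of_pos volume (fun x => φ x * wave (-k) x)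
      (Set.Icc (0 : Fin d → ℝ) fun _ => 1) (R := 2 * Real.pi) (by positivity)
    rw [e2, e3, e5, e4, Module.finrank_fin_fun, Complex.real_smul, Complex.ofReal_inv]
  have hs : Summable (UnitAddTorus.mFourierCoeff (⟨f₀, hcont⟩ : C(UnitAddTorus (Fin d), ℂ))) := by
    have : UnitAddTorus.mFourierCoeff (⟨f₀, hcont⟩ : C(UnitAddTorus (Fin d), ℂ)) = coef φ := funext hc
    rw [this]
    exact Summable.of_norm h.rapidDecay.summable_norm
  have h1 := UnitAddTorus.hasSum_mFourier_series_apply_of_summable hs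
    (π fun μ => (2 * Real.pi)⁻¹ * x μ)
  have hx : (fun μ => 2 * Real.pi * ((2 * Real.pi)⁻¹ * x μ)) = x := by
    funext μ
    exact mul_inv_cancel_left₀ (by positivity) _
  have hv : (⟨f₀, hcont⟩ : C(UnitAddTorus (Fin d), ℂ)) (π fun μ => (2 * Real.pi)⁻¹ * x μ) = φ x := by
    show f₀ _ = _
    rw [hf, hx]
  rw [hv] at h1
  refine h1.congr_fun ?_
  intro k
  rw [hm, hx, smul_eq_mul]
  congr 1
  exact (hc k).symm

/-- The Fourier coefficients of a product are a convolution. -/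
theorem hasSum_coef_mul {φ ψ : (Fin d → ℝ) → ℂ} (h : Smooth φ) (h' : Smooth ψ) (k : Fin d → ℤ) :
    HasSum (fun l => coef φ (k - l) * coef ψ l) (coef (fun x => φ x * ψ x) k) := by
  obtain ⟨C, hC⟩ : ∃ C, ∀ x, ‖φ x‖ ≤ C := by
    refine ⟨∑' k, ‖coef φ k‖, fun x => ?_⟩
    rw [← (h.hasSum_wave x).tsum_eq]
    refine (tsum_of_norm_bounded h.rapidDecay.summable_norm.hasSum fun k => ?_)
    rw [norm_mul, norm_wave, mul_one]
  have h1 := hasSum_coef (f := fun l x => φ x * (coef ψ l * wave l x))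
    (u := fun l => C * ‖coef ψ l‖)
    (fun l => h.continuous.mul (continuous_const.mul (contDiff_wave l).continuous))
    (h'.rapidDecay.summable_norm.mul_left C)
    (fun l x => by
      rw [norm_mul, norm_mul, norm_wave, mul_one]
      exact mul_le_mul_of_nonneg_right (hC x) (norm_nonneg _)) k
  have h2 : (fun x => ∑' l, φ x * (coef ψ l * wave l x)) = fun x => φ x * ψ x := by
    funext x
    rw [tsum_mul_left, (h'.hasSum_wave x).tsum_eq]
  rw [h2] at h1
  refine h1.congr_fun fun l => ?_
  have h3 : (fun x => φ x * (coef ψ l * wave l x)) = fun x => coef ψ l * (φ x * wave l x) :=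
    funext fun x => by ring
  rw [h3, coef_const_mul, mul_comm]
  congr 1
  rw [coef, coef]
  congr 1
  refine integral_congr_ae (Eventually.of_forall fun x => ?_)
  show φ x * wave (-(k - l)) x = φ x * wave l x * wave (-k) x
  rw [mul_assoc, ← wave_add]
  congr 2
  abel

end TorusFourier

namespace DiracModel

open TorusFourier Matrix Kronecker Finset TorusAction

variable {d N : ℕ} {g : Matrix (Fin d) (Fin d) ℝ}
  {γ : Fin d → Matrix (Fin (2 ^ (d / 2))) (Fin (2 ^ (d / 2))) ℂ}

/-! ### Gamma matrices -/

/-- The trace of a product of four matrices with scalar anticommutators. -/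
theorem trace_mul_four {n : Type*} [Fintype n] [DecidableEq n] {A B C D : Matrix n n ℂ}
    {ab ac ad bc bd cd : ℂ} (hab : A * B + B * A = (2 * ab) • 1) (hac : A * C + C * A = (2 * ac) • 1)
    (had : A * D + D * A = (2 * ad) • 1) (hbc : B * C + C * B = (2 * bc) • 1)
    (hbd : B * D + D * B = (2 * bd) • 1) (hcd : C * D + D * C = (2 * cd) • 1) :
    (A * B * C * D).trace = Fintype.card n * (ab * cd - ac * bd + ad * bc) := by
  have h2 : ∀ {X Y : Matrix n n ℂ} {z : ℂ}, X * Y + Y * X = (2 * z) • 1 →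
      (X * Y).trace = Fintype.card n * z := fun {X Y z} h => by
    have h1 := congrArg trace h
    rw [trace_add, trace_mul_comm Y X, trace_smul, trace_one, smul_eq_mul] at h1
    linear_combination h1 / 2
  have e : A * B * C * D + B * C * D * A
      = (2 * ab) • (C * D) - (2 * ac) • (B * D) + (2 * ad) • (B * C) := by
    have e1 : (2 * ab) • (C * D) = (A * B + B * A) * (C * D) := by
      rw [hab, smul_mul_assoc, Matrix.one_mul]
    have e2 : (2 * ac) • (B * D) = B * (A * C + C * A) * D := by
      rw [hac, mul_smul_comm, Matrix.mul_one, smul_mul_assoc]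
    have e3 : (2 * ad) • (B * C) = B * C * (A * D + D * A) := by
      rw [had, mul_smul_comm, Matrix.mul_one]
    rw [e1, e2, e3]
    noncomm_ring
  have h3 := congrArg trace e
  rw [trace_add, trace_add, trace_sub, trace_smul, trace_smul, trace_smul, h2 hcd, h2 hbd, h2 hbc,
    trace_mul_comm (B * C * D) A, ← Matrix.mul_assoc, ← Matrix.mul_assoc, smul_eq_mul, smul_eq_mul,
    smul_eq_mul] at h3
  linear_combination h3 / 2

/-- `q_μ γ^μ`. -/
def slash (γ : Fin d → Matrix (Fin (2 ^ (d / 2))) (Fin (2 ^ (d / 2))) ℂ) (q : Fin d → ℤ) :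
    Matrix (Fin (2 ^ (d / 2))) (Fin (2 ^ (d / 2))) ℂ := ∑ μ, (q μ : ℂ) • γ μ

theorem slash_neg (q : Fin d → ℤ) : slash γ (-q) = -slash γ q := by
  simp [slash]

theorem isHermitian_slash (hγ : IsGamma g γ) (q : Fin d → ℤ) :
    (slash γ q)ᴴ = slash γ q := by
  rw [slash, conjTranspose_sum]
  refine sum_congr rfl fun μ _ => ?_
  rw [conjTranspose_smul, (hγ.herm μ).eq]
  simp

theorem slash_anticomm_gamma (hγ : IsGamma g γ) (q : Fin d → ℤ) (ν : Fin d) :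
    slash γ q * γ ν + γ ν * slash γ q = (2 * (LatticeGaussian.upper g⁻¹ q ν : ℂ)) • 1 := by
  have hs : ∀ μ ν, γ μ * γ ν + γ ν * γ μ = (2 * (g⁻¹ ν μ : ℂ)) • 1 := fun μ ν => by
    rw [add_comm, hγ.clifford]
    push_cast
    rfl
  rw [slash, sum_mul, mul_sum, ← sum_add_distrib, LatticeGaussian.upper]
  push_cast
  rw [mul_sum, sum_smul]
  refine sum_congr rfl fun μ _ => ?_
  rw [smul_mul_assoc, mul_smul_comm, ← smul_add, hs, smul_smul]
  congr 1
  ring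

theorem slash_anticomm_slash (hγ : IsGamma g γ) (q k : Fin d → ℤ) :
    slash γ q * slash γ k + slash γ k * slash γ q
      = (2 * (LatticeGaussian.ip g⁻¹ k q : ℂ)) • 1 := by
  have h : slash γ k = ∑ ν, (k ν : ℂ) • γ ν := rfl
  rw [h, sum_mul, mul_sum, ← sum_add_distrib, ← LatticeGaussian.sum_upper_mul]
  push_cast
  rw [mul_sum, sum_smul]
  refine sum_congr rfl fun ν _ => ?_
  rw [smul_mul_assoc, mul_smul_comm, ← smul_add, slash_anticomm_gamma hγ, smul_smul]
  congr 1
  ring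

theorem slash_mul_self (hγ : IsGamma g γ) (q : Fin d → ℤ) :
    slash γ q * slash γ q = (LatticeGaussian.qf g⁻¹ q : ℂ) • 1 := by
  have h := slash_anticomm_slash hγ q q
  rw [← two_smul ℂ (slash γ q * slash γ q), mul_smul, LatticeGaussian.ip_self] at h
  exact smul_right_injective _ (two_ne_zero' ℂ) h

theorem trace_gamma_mul_gamma (hγ : IsGamma g γ) (μ ν : Fin d) :
    (γ μ * γ ν).trace = 2 ^ (d / 2) * (g⁻¹ μ ν : ℂ) := by
  have h1 := congrArg trace (hγ.clifford μ ν)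
  rw [trace_add, trace_mul_comm (γ ν), trace_smul, trace_one, smul_eq_mul, Fintype.card_fin] at h1
  push_cast at h1
  linear_combination h1 / 2

theorem trace_slash_gamma_slash_gamma (hg : g.PosDef) (hγ : IsGamma g γ)
    (k q : Fin d → ℤ) (μ ν : Fin d) : (slash γ k * γ μ * slash γ q * γ ν).trace
      = 2 ^ (d / 2) * ((LatticeGaussian.upper g⁻¹ k μ : ℂ) * LatticeGaussian.upper g⁻¹ q ν
        - LatticeGaussian.ip g⁻¹ k q * g⁻¹ μ ν
        + LatticeGaussian.upper g⁻¹ k ν * LatticeGaussian.upper g⁻¹ q μ) := by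
  have hc : γ μ * γ ν + γ ν * γ μ = (2 * (g⁻¹ μ ν : ℂ)) • 1 := by
    rw [hγ.clifford]
    push_cast
    rfl
  have h := trace_mul_four (slash_anticomm_gamma hγ k μ) (slash_anticomm_slash hγ k q)
    (slash_anticomm_gamma hγ k ν) ((add_comm _ _).trans (slash_anticomm_gamma hγ q μ)) hc
    (slash_anticomm_gamma hγ q ν)
  rw [h, Fintype.card_fin, LatticeGaussian.ip_comm hg.inv q k]
  push_cast
  ring

/-! ### The Dirac operator in momentum space -/

/-- The symbol `-q_μ γ^μ` of the free Dirac operator, on `ℂ^(2^m) ⊗ ℂ^N`. -/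
def symbol (N : ℕ) (γ : Fin d → Matrix (Fin (2 ^ (d / 2))) (Fin (2 ^ (d / 2))) ℂ) (q : Fin d → ℤ) :
    Matrix (Fib d N) (Fib d N) ℂ :=
  (-slash γ q) ⊗ₖ (1 : Matrix (Fin N) (Fin N) ℂ)

/-- The normalised Fourier coefficients of the potential. -/
def modeCoef (𝒜 : GaugeField d N) (r : Fin d → ℤ) (μ : Fin d) :
    Matrix (Fin N) (Fin N) ℂ := fun a b => coef (fun x => 𝒜.A μ x a b) r

/-- The Fourier coefficients of `i γ^μ A_μ`. -/
def pot (γ : Fin d → Matrix (Fin (2 ^ (d / 2))) (Fin (2 ^ (d / 2))) ℂ)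
    (𝒜 : GaugeField d N) (r : Fin d → ℤ) :
    Matrix (Fib d N) (Fib d N) ℂ :=
  ∑ μ, (Complex.I • γ μ) ⊗ₖ modeCoef 𝒜 r μ

theorem isHermitian_symbol (hγ : IsGamma g γ) (q : Fin d → ℤ) :
    (symbol N γ q).IsHermitian := by
  rw [IsHermitian, symbol, conjTranspose_kronecker, conjTranspose_neg, isHermitian_slash hγ,
    conjTranspose_one]

theorem symbol_neg (q : Fin d → ℤ) : symbol N γ (-q) = -symbol N γ q := by
  rw [symbol, symbol, slash_neg]
  ext i j
  simp [kroneckerMap_apply]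

theorem symbol_mul_self (hγ : IsGamma g γ) (q : Fin d → ℤ) :
    symbol N γ q * symbol N γ q = (LatticeGaussian.qf g⁻¹ q : ℂ) • 1 := by
  rw [symbol, ← mul_kronecker_mul, neg_mul_neg, slash_mul_self hγ, Matrix.one_mul, smul_kronecker,
    one_kronecker_one]

theorem smooth_gauge (𝒜 : GaugeField d N) (μ : Fin d) (a b : Fin N) :
    Smooth fun x => 𝒜.A μ x a b :=
  ⟨𝒜.smooth μ a b, fun ν x => by
    show 𝒜.A μ _ a b = 𝒜.A μ x a b
    rw [𝒜.periodic μ ν x]⟩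

theorem modeCoef_neg (𝒜 : GaugeField d N) (r : Fin d → ℤ) (μ : Fin d) :
    modeCoef 𝒜 (-r) μ = -(modeCoef 𝒜 r μ)ᴴ := by
  ext a b
  have h : (fun x => 𝒜.A μ x a b) = fun x => (-1) * (starRingEnd ℂ) (𝒜.A μ x b a) := by
    funext x
    have := congrFun (congrFun (𝒜.antiherm μ x) a) b
    rw [conjTranspose_apply, Matrix.neg_apply] at this
    rw [starRingEnd_apply, this]
    ring
  rw [modeCoef, h, coef_const_mul, coef_conj, neg_neg, Matrix.neg_apply, conjTranspose_apply,
    neg_one_mul]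
  rfl

theorem pot_neg (hγ : IsGamma g γ) (𝒜 : GaugeField d N) (r : Fin d → ℤ) :
    pot γ 𝒜 (-r) = (pot γ 𝒜 r)ᴴ := by
  rw [pot, pot, conjTranspose_sum]
  refine sum_congr rfl fun μ _ => ?_
  rw [conjTranspose_kronecker, conjTranspose_smul, (hγ.herm μ).eq, modeCoef_neg]
  ext i j
  simp [kroneckerMap_apply]

theorem modeCoef_scale (𝒜 : GaugeField d N) (ε : ℝ) (r : Fin d → ℤ) (μ : Fin d) :
    modeCoef (𝒜.scale ε) r μ = (ε : ℂ) • modeCoef 𝒜 r μ := by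
  ext a b
  exact coef_const_mul _ _ _

theorem pot_scale (𝒜 : GaugeField d N) (ε : ℝ) (r : Fin d → ℤ) :
    pot γ (𝒜.scale ε) r = (ε : ℂ) • pot γ 𝒜 r := by
  rw [pot, pot, smul_sum]
  refine sum_congr rfl fun μ _ => ?_
  rw [modeCoef_scale, kronecker_smul]

theorem pot_apply (𝒜 : GaugeField d N) (r : Fin d → ℤ) (i j : Fib d N) :
    pot γ 𝒜 r i j = ∑ μ, Complex.I * γ μ i.1 j.1 * modeCoef 𝒜 r μ i.2 j.2 := by
  rw [pot, Matrix.sum_apply]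
  rfl

/-- The total size of the entries of the potential at momentum `r`. -/
def potBound (γ : Fin d → Matrix (Fin (2 ^ (d / 2))) (Fin (2 ^ (d / 2))) ℂ)
    (𝒜 : GaugeField d N) (r : Fin d → ℤ) : ℝ := ∑ i, ∑ j, ‖pot γ 𝒜 r i j‖

theorem potBound_nonneg (𝒜 : GaugeField d N) (r : Fin d → ℤ) : 0 ≤ potBound γ 𝒜 r :=
  sum_nonneg fun _ _ => sum_nonneg fun _ _ => norm_nonneg _

theorem summable_wt_mul_potBound (𝒜 : GaugeField d N) (n : ℕ) :
    Summable fun r => wt r ^ n * potBound γ 𝒜 r := by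
  simp only [potBound, mul_sum]
  refine summable_sum fun i _ => summable_sum fun j _ => ?_
  refine Summable.of_nonneg_of_le (fun r => by have := wt_pos r; positivity)
    (f := fun r => ∑ μ, ‖γ μ i.1 j.1‖ * (wt r ^ n * ‖modeCoef 𝒜 r μ i.2 j.2‖)) (fun r => ?_)
    (summable_sum fun μ _ => ((smooth_gauge 𝒜 μ i.2 j.2).rapidDecay.summable n).mul_left _)
  have := wt_pos r
  rw [pot_apply]
  refine (mul_le_mul_of_nonneg_left (norm_sum_le _ _) (by positivity)).trans (le_of_eq ?_)
  rw [mul_sum]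
  refine sum_congr rfl fun μ _ => ?_
  rw [norm_mul, norm_mul, Complex.norm_I]
  ring

theorem summable_potBound (𝒜 : GaugeField d N) : Summable (potBound γ 𝒜) := by
  simpa using summable_wt_mul_potBound (γ := γ) 𝒜 0

/-- The Fourier coefficients of a spinor field. -/
def coefVec (ψ : (Fin d → ℝ) → Fib d N → ℂ) (q : Fin d → ℤ) : Fib d N → ℂ :=
  fun i => coef (fun x => ψ x i) q

theorem smooth_spinor {ψ : (Fin d → ℝ) → Fib d N → ℂ}
    (h : ψ ∈ Spinors d N) (i : Fib d N) : Smooth fun x => ψ x i :=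
  ⟨contDiff_pi.1 h.1 i, fun ν x => congrFun (h.2 ν x) i⟩

theorem partialD_apply {ψ : (Fin d → ℝ) → Fib d N → ℂ}
    (h : ψ ∈ Spinors d N) (μ : Fin d) (x : Fin d → ℝ) (i : Fib d N) :
    TorusAction.partialD μ ψ x i = TorusAction.partialD μ (fun x => ψ x i) x := by
  have h1 := hasFDerivAt_pi'.1 ((h.1.differentiable (by simp) x).hasFDerivAt) i
  rw [TorusAction.partialD, TorusAction.partialD, h1.fderiv]
  rfl

/-- The Dirac operator in momentum space. -/
theorem hasSum_pot_mulVec (𝒜 : GaugeField d N)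
    {ψ : (Fin d → ℝ) → Fib d N → ℂ} (h : ψ ∈ Spinors d N)
    (q : Fin d → ℤ) (i : Fib d N) :
    HasSum (fun l => (pot γ 𝒜 (q - l) *ᵥ coefVec ψ l) i)
      (coefVec (TorusAction.diracFun γ 𝒜 ψ) q i - (symbol N γ q *ᵥ coefVec ψ q) i) := by
  have hA : ∀ μ b j, HasSum (fun l => modeCoef 𝒜 (q - l) μ i.2 b * coefVec ψ l j)
      (coef (fun x => 𝒜.A μ x i.2 b * ψ x j) q) := fun μ b j =>
    hasSum_coef_mul (smooth_gauge 𝒜 μ i.2 b) (smooth_spinor h j) q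
  have h1 : HasSum (fun l => (pot γ 𝒜 (q - l) *ᵥ coefVec ψ l) i)
      (∑ μ, ∑ τ, ∑ b, Complex.I * γ μ i.1 τ * coef (fun x => 𝒜.A μ x i.2 b * ψ x (τ, b)) q) := by
    have e : ∀ l, (pot γ 𝒜 (q - l) *ᵥ coefVec ψ l) i = ∑ μ, ∑ τ, ∑ b,
        Complex.I * γ μ i.1 τ * (modeCoef 𝒜 (q - l) μ i.2 b * coefVec ψ l (τ, b)) := fun l => by
      rw [mulVec, dotProduct]
      simp only [pot_apply, sum_mul]
      rw [sum_comm]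
      refine sum_congr rfl fun μ _ => ?_
      rw [Fintype.sum_prod_type]
      exact sum_congr rfl fun τ _ => sum_congr rfl fun b _ => by ring
    simp only [e]
    exact hasSum_sum fun μ _ => hasSum_sum fun τ _ => hasSum_sum fun b _ => (hA μ b (τ, b)).mul_left _
  convert! h1 using 1
  have hD : ∀ μ τ, Smooth fun x => TorusAction.partialD μ (fun x => ψ x (τ, i.2)) x := fun μ τ =>
    (smooth_spinor h (τ, i.2)).partialD μ
  have hM : ∀ μ τ b, Smooth fun x => 𝒜.A μ x i.2 b * ψ x (τ, b) := fun μ τ b =>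
    (smooth_gauge 𝒜 μ i.2 b).mul (smooth_spinor h (τ, b))
  have e2 : coefVec (TorusAction.diracFun γ 𝒜 ψ) q i
      = ∑ μ, ∑ τ, (Complex.I * γ μ i.1 τ * (Complex.I * (q μ : ℂ) * coefVec ψ q (τ, i.2))
        + ∑ b, Complex.I * γ μ i.1 τ * coef (fun x => 𝒜.A μ x i.2 b * ψ x (τ, b)) q) := by
    have e3 : (fun x => TorusAction.diracFun γ 𝒜 ψ x i) = fun x => ∑ μ, ∑ τ,
        ((Complex.I * γ μ i.1 τ) * TorusAction.partialD μ (fun x => ψ x (τ, i.2)) x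
          + ∑ b, (Complex.I * γ μ i.1 τ) * (𝒜.A μ x i.2 b * ψ x (τ, b))) := by
      funext x
      rw [TorusAction.diracFun, mul_sum]
      refine sum_congr rfl fun μ _ => ?_
      rw [mul_sum]
      refine sum_congr rfl fun τ _ => ?_
      rw [partialD_apply h, ← mul_assoc, mul_add, mul_sum]
    have c1 : ∀ μ τ, Continuous fun x =>
        (Complex.I * γ μ i.1 τ) * TorusAction.partialD μ (fun x => ψ x (τ, i.2)) x := fun μ τ =>
      continuous_const.mul (hD μ τ).continuous
    have c2 : ∀ μ τ b, Continuous fun x =>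
        (Complex.I * γ μ i.1 τ) * (𝒜.A μ x i.2 b * ψ x (τ, b)) := fun μ τ b =>
      continuous_const.mul (hM μ τ b).continuous
    have c3 : ∀ μ τ, Continuous fun x => ∑ b, (Complex.I * γ μ i.1 τ) * (𝒜.A μ x i.2 b * ψ x (τ, b)) :=
      fun μ τ => continuous_finsetSum _ fun b _ => c2 μ τ b
    have c4 : ∀ μ τ, Continuous fun x =>
        (Complex.I * γ μ i.1 τ) * TorusAction.partialD μ (fun x => ψ x (τ, i.2)) x
          + ∑ b, (Complex.I * γ μ i.1 τ) * (𝒜.A μ x i.2 b * ψ x (τ, b)) := fun μ τ =>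
      (c1 μ τ).add (c3 μ τ)
    have c5 : ∀ μ, Continuous fun x => ∑ τ,
        ((Complex.I * γ μ i.1 τ) * TorusAction.partialD μ (fun x => ψ x (τ, i.2)) x
          + ∑ b, (Complex.I * γ μ i.1 τ) * (𝒜.A μ x i.2 b * ψ x (τ, b))) := fun μ =>
      continuous_finsetSum _ fun τ _ => c4 μ τ
    rw [coefVec, e3]
    refine (coef_sum univ (fun μ _ => c5 μ) q).trans (sum_congr rfl fun μ _ => ?_)
    refine (coef_sum univ (fun τ _ => c4 μ τ) q).trans (sum_congr rfl fun τ _ => ?_)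
    refine Eq.trans (coef_add (c1 μ τ) (c3 μ τ) q) ?_
    rw [coef_const_mul, coef_partialD (smooth_spinor h (τ, i.2)), coef_sum univ fun b _ => c2 μ τ b]
    simp only [coef_const_mul]
    rfl
  have e4 : (symbol N γ q *ᵥ coefVec ψ q) i
      = ∑ μ, ∑ τ, Complex.I * γ μ i.1 τ * (Complex.I * (q μ : ℂ) * coefVec ψ q (τ, i.2)) := by
    rw [mulVec, dotProduct, Fintype.sum_prod_type, sum_comm (s := univ (α := Fin d))]
    refine sum_congr rfl fun τ _ => ?_
    rw [Finset.sum_eq_single i.2]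
    · simp only [symbol, kroneckerMap_apply, one_apply_eq, slash, Matrix.neg_apply, Matrix.sum_apply,
        Matrix.smul_apply, smul_eq_mul, mul_one, neg_mul, sum_mul, ← sum_neg_distrib]
      refine sum_congr rfl fun μ _ => ?_
      linear_combination (-(γ μ i.1 τ * (q μ : ℂ) * coefVec ψ q (τ, i.2))) * Complex.I_mul_I
    · intro b _ hb
      simp [symbol, kroneckerMap_apply, one_apply_ne (Ne.symm hb)]
    · simp
  rw [e2, e4, ← sum_sub_distrib]
  refine sum_congr rfl fun μ _ => ?_
  rw [← sum_sub_distrib]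
  exact sum_congr rfl fun τ _ => by ring

end DiracModel

namespace DiracModel

open TorusFourier Matrix Finset DiagonalPerturbation TorusAction

attribute [local instance] InnerProductSpace.toInner

variable {d N : ℕ} {g : Matrix (Fin d) (Fin d) ℝ}
  {γ : Fin d → Matrix (Fin (2 ^ (d / 2))) (Fin (2 ^ (d / 2))) ℂ}
  {U : (Fin d → ℤ) → Matrix (Fib d N) (Fib d N) ℂ}
  {e : (Fin d → ℤ) → Fib d N → ℝ}

/-! ### The Dirac operator as a perturbed diagonal operator -/

/-- The unitary matrices `U q` diagonalise the symbol of the free Dirac operator, with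
eigenvalues `e q`. -/
structure Diagonalizes (γ : Fin d → Matrix (Fin (2 ^ (d / 2))) (Fin (2 ^ (d / 2))) ℂ)
    (U : (Fin d → ℤ) → Matrix (Fib d N) (Fib d N) ℂ)
    (e : (Fin d → ℤ) → Fib d N → ℝ) : Prop where
  left : ∀ q, (U q)ᴴ * U q = 1
  right : ∀ q, U q * (U q)ᴴ = 1
  eq : ∀ q, symbol N γ q = U q * diagonal (fun i => (e q i : ℂ)) * (U q)ᴴ

theorem exists_diagonalizes (N : ℕ) (hγ : IsGamma g γ) :
    ∃ (U : (Fin d → ℤ) → Matrix (Fib d N) (Fib d N) ℂ)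
      (e : (Fin d → ℤ) → Fib d N → ℝ), Diagonalizes γ U e := by
  refine ⟨fun q => (isHermitian_symbol (N := N) hγ q).eigenvectorUnitary,
    fun q => (isHermitian_symbol (N := N) hγ q).eigenvalues, fun q => ?_, fun q => ?_, fun q => ?_⟩
  · exact mem_unitaryGroup_iff'.1 (isHermitian_symbol hγ q).eigenvectorUnitary.2
  · exact mem_unitaryGroup_iff.1 (isHermitian_symbol hγ q).eigenvectorUnitary.2
  · have := (isHermitian_symbol (N := N) hγ q).spectral_theorem
    rw [Unitary.conjStarAlgAut_apply] at this
    exact this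

namespace Diagonalizes

theorem norm_le (h : Diagonalizes γ U e) (q : Fin d → ℤ) (i j : Fib d N) :
    ‖U q i j‖ ≤ 1 := entry_norm_bound_of_unitary (mem_unitaryGroup_iff'.2 (h.left q)) i j

theorem conjTranspose_mul_symbol (h : Diagonalizes γ U e) (q : Fin d → ℤ) :
    (U q)ᴴ * symbol N γ q = diagonal (fun i => (e q i : ℂ)) * (U q)ᴴ := by
  rw [h.eq q, ← Matrix.mul_assoc, ← Matrix.mul_assoc, h.left, Matrix.one_mul]

theorem sq_eq (h : Diagonalizes γ U e) (hγ : IsGamma g γ) (q : Fin d → ℤ)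
    (i : Fib d N) : e q i ^ 2 = LatticeGaussian.qf g⁻¹ q := by
  have h1 : diagonal (fun i => (e q i : ℂ)) * diagonal (fun i => (e q i : ℂ))
      = (LatticeGaussian.qf g⁻¹ q : ℂ) • (1 : Matrix (Fib d N) (Fib d N) ℂ) := by
    have h2 : (U q)ᴴ * (symbol N γ q * symbol N γ q) * U q
        = diagonal (fun i => (e q i : ℂ)) * diagonal (fun i => (e q i : ℂ)) := by
      rw [← Matrix.mul_assoc, h.conjTranspose_mul_symbol, Matrix.mul_assoc (diagonal _),
        h.conjTranspose_mul_symbol, Matrix.mul_assoc, Matrix.mul_assoc, h.left, Matrix.mul_one]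
    rw [← h2, symbol_mul_self hγ, mul_smul_comm, smul_mul_assoc, Matrix.mul_one, h.left]
  have h3 := congrFun (congrFun h1 i) i
  rw [diagonal_mul_diagonal, diagonal_apply_eq, Matrix.smul_apply, one_apply_eq, smul_eq_mul,
    mul_one] at h3
  have h4 : e q i * e q i = LatticeGaussian.qf g⁻¹ q := by exact_mod_cast h3
  rw [pow_two, h4]

end Diagonalizes

/-- The matrix elements of the potential in the basis that diagonalises the free operator. -/
def kernel (γ : Fin d → Matrix (Fin (2 ^ (d / 2))) (Fin (2 ^ (d / 2))) ℂ)
    (U : (Fin d → ℤ) → Matrix (Fib d N) (Fib d N) ℂ)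
    (𝒜 : GaugeField d N) (x y : (Fin d → ℤ) × Fib d N) : ℂ :=
  ((U x.1)ᴴ * pot γ 𝒜 (x.1 - y.1) * U y.1) x.2 y.2

theorem kernel_herm (hγ : IsGamma g γ) (𝒜 : GaugeField d N)
    (x y : (Fin d → ℤ) × Fib d N) :
    kernel γ U 𝒜 y x = (starRingEnd ℂ) (kernel γ U 𝒜 x y) := by
  have h : (U y.1)ᴴ * pot γ 𝒜 (y.1 - x.1) * U x.1
      = ((U x.1)ᴴ * pot γ 𝒜 (x.1 - y.1) * U y.1)ᴴ := by
    rw [← neg_sub x.1 y.1, pot_neg hγ, conjTranspose_mul, conjTranspose_mul,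
      conjTranspose_conjTranspose, Matrix.mul_assoc]
  rw [kernel, h, conjTranspose_apply]
  rfl

theorem norm_kernel_le (hU : Diagonalizes γ U e) (𝒜 : GaugeField d N)
    (x y : (Fin d → ℤ) × Fib d N) :
    ‖kernel γ U 𝒜 x y‖ ≤ potBound γ 𝒜 (x.1 - y.1) := by
  rw [kernel, mul_apply, potBound, sum_comm]
  refine (norm_sum_le _ _).trans (sum_le_sum fun k _ => ?_)
  rw [norm_mul]
  refine (mul_le_of_le_one_right (norm_nonneg _) (hU.norm_le _ _ _)).trans ?_
  rw [mul_apply]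
  refine (norm_sum_le _ _).trans (sum_le_sum fun l _ => ?_)
  rw [norm_mul, conjTranspose_apply, norm_star]
  exact mul_le_of_le_one_left (norm_nonneg _) (hU.norm_le _ _ _)

theorem hasSum_prod_fst {α ι : Type*} [Fintype ι] {f : α → ℝ} (hf : Summable f) (h0 : ∀ a, 0 ≤ f a) :
    HasSum (fun x : α × ι => f x.1) (Fintype.card ι * ∑' a, f a) := by
  have hs : Summable fun x : α × ι => f x.1 := by
    rw [summable_prod_of_nonneg fun x => h0 x.1]
    refine ⟨fun a => Summable.of_finite, ?_⟩
    simp only [tsum_fintype, sum_const, card_univ, nsmul_eq_mul]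
    exact hf.mul_left _
  have h1 := hs.hasSum
  rwa [hs.tsum_prod' fun a => Summable.of_finite, tsum_congr fun a => show
    ∑' _ : ι, f a = Fintype.card ι * f a by simp, tsum_mul_left] at h1

theorem isKernel_kernel (hγ : IsGamma g γ) (hU : Diagonalizes γ U e)
    (𝒜 : GaugeField d N) : ∃ M, IsKernel (kernel γ U 𝒜) M := by
  have h0 := potBound_nonneg (γ := γ) 𝒜
  have hs := summable_potBound (γ := γ) 𝒜
  have h1 : ∀ x : (Fin d → ℤ) × Fib d N,
      HasSum (fun y : (Fin d → ℤ) × Fib d N => potBound γ 𝒜 (x.1 - y.1))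
        (Fintype.card (Fib d N) * ∑' r, potBound γ 𝒜 r) := fun x => by
    have h2 := hasSum_prod_fst (ι := Fib d N)
      ((Equiv.subLeft x.1).summable_iff.2 hs) (fun _ => h0 _)
    rwa [show ∑' a, (potBound γ 𝒜 ∘ Equiv.subLeft x.1) a = ∑' r, potBound γ 𝒜 r from
      (Equiv.subLeft x.1).tsum_eq _] at h2
  have h3 : ∀ x, Summable fun y => ‖kernel γ U 𝒜 x y‖ := fun x =>
    Summable.of_nonneg_of_le (fun _ => norm_nonneg _) (norm_kernel_le hU 𝒜 x) (h1 x).summable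
  refine ⟨Fintype.card (Fib d N) * ∑' r, potBound γ 𝒜 r + 1, ?_, kernel_herm hγ 𝒜, h3,
    fun x => ?_⟩
  · have : 0 ≤ ∑' r, potBound γ 𝒜 r := tsum_nonneg h0
    positivity
  · have := (h3 x).tsum_le_tsum (norm_kernel_le hU 𝒜 x) (h1 x).summable
    rw [(h1 x).tsum_eq] at this
    linarith

theorem memlp_model (hU : Diagonalizes γ U e) {ψ : (Fin d → ℝ) → Fib d N → ℂ}
    (h : ψ ∈ Spinors d N) :
    Memℓp (fun x : (Fin d → ℤ) × Fib d N => ((U x.1)ᴴ *ᵥ coefVec ψ x.1) x.2) 2 := by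
  have h1 : ∀ q i, ‖((U q)ᴴ *ᵥ coefVec ψ q) i‖ ≤ ∑ j, ‖coefVec ψ q j‖ := fun q i => by
    rw [mulVec, dotProduct]
    refine (norm_sum_le _ _).trans (sum_le_sum fun j _ => ?_)
    rw [norm_mul, conjTranspose_apply, norm_star]
    exact mul_le_of_le_one_left (norm_nonneg _) (hU.norm_le _ _ _)
  have hs : Summable fun q => ∑ j, ‖coefVec ψ q j‖ :=
    summable_sum fun j _ => (smooth_spinor h j).rapidDecay.summable_norm
  have h0 : ∀ q, 0 ≤ ∑ j, ‖coefVec ψ q j‖ := fun q => sum_nonneg fun _ _ => norm_nonneg _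
  apply memlp_two
  have hs2 : Summable fun q => (∑ j, ‖coefVec ψ q j‖) ^ 2 := by
    refine Summable.of_nonneg_of_le (fun q => sq_nonneg _) (fun q => ?_)
      (hs.mul_left (∑' q, ∑ j, ‖coefVec ψ q j‖))
    rw [pow_two]
    exact mul_le_mul_of_nonneg_right (hs.le_tsum q fun _ _ => h0 _) (h0 q)
  refine Summable.of_nonneg_of_le (fun _ => sq_nonneg _) (fun x => ?_)
    (hasSum_prod_fst (ι := Fib d N) hs2 fun _ => sq_nonneg _).summable
  exact pow_le_pow_left₀ (norm_nonneg _) (h1 _ _) 2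

theorem coefVec_add {φ ψ : (Fin d → ℝ) → Fib d N → ℂ}
    (h : φ ∈ Spinors d N) (h' : ψ ∈ Spinors d N) (q : Fin d → ℤ) :
    coefVec (φ + ψ) q = coefVec φ q + coefVec ψ q := by
  funext i
  exact coef_add (smooth_spinor h i).continuous (smooth_spinor h' i).continuous q

theorem coefVec_smul (c : ℂ) (ψ : (Fin d → ℝ) → Fib d N → ℂ) (q : Fin d → ℤ) :
    coefVec (c • ψ) q = c • coefVec ψ q := by
  funext i
  exact coef_const_mul c _ q

/-- The expansion of spinor fields in the eigenbasis of the free Dirac operator. -/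
def model (hU : Diagonalizes γ U e) :
    Spinors d N →ₗ[ℂ] Seq ((Fin d → ℤ) × Fib d N) where
  toFun ψ := ⟨fun x => ((U x.1)ᴴ *ᵥ coefVec ψ.1 x.1) x.2, memlp_model hU ψ.2⟩
  map_add' φ ψ := by
    ext x
    show ((U x.1)ᴴ *ᵥ coefVec (φ.1 + ψ.1) x.1) x.2
      = ((U x.1)ᴴ *ᵥ coefVec φ.1 x.1) x.2 + ((U x.1)ᴴ *ᵥ coefVec ψ.1 x.1) x.2
    rw [coefVec_add φ.2 ψ.2, mulVec_add]
    rfl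
  map_smul' c ψ := by
    ext x
    show ((U x.1)ᴴ *ᵥ coefVec (c • ψ.1) x.1) x.2 = c * ((U x.1)ᴴ *ᵥ coefVec ψ.1 x.1) x.2
    rw [coefVec_smul, mulVec_smul]
    rfl

theorem model_apply (hU : Diagonalizes γ U e) (ψ : Spinors d N)
    (x : (Fin d → ℤ) × Fib d N) :
    model hU ψ x = ((U x.1)ᴴ *ᵥ coefVec ψ.1 x.1) x.2 := rfl

theorem model_injective (hU : Diagonalizes γ U e) : Function.Injective (model hU) := by
  rw [injective_iff_map_eq_zero]
  intro ψ h
  have h1 : ∀ q, (U q)ᴴ *ᵥ coefVec ψ.1 q = 0 := fun q => by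
    funext i
    have := congrArg (fun v : Seq ((Fin d → ℤ) × Fib d N) => v (q, i)) h
    exact this
  have h2 : ∀ q, coefVec ψ.1 q = 0 := fun q => by
    rw [← one_mulVec (coefVec ψ.1 q), ← hU.right q, ← mulVec_mulVec, h1, mulVec_zero]
  apply Subtype.ext
  funext x i
  have h3 := (smooth_spinor ψ.2 i).hasSum_wave x
  have h4 : ∀ k, coef (fun x => ψ.1 x i) k = 0 := fun k => congrFun (h2 k) i
  simp only [h4, zero_mul] at h3
  exact h3.unique hasSum_zero

/-- In the eigenbasis of the free operator, the Dirac operator is diagonal up to the kernel of the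
potential. -/
theorem model_dirac (hU : Diagonalizes γ U e) (𝒜 : GaugeField d N)
    {B : Seq ((Fin d → ℤ) × Fib d N) →L[ℂ] Seq ((Fin d → ℤ) × Fib d N)}
    (hB : ∀ v x, HasSum (fun y => kernel γ U 𝒜 x y * v y) (B v x)) (ψ : Spinors d N)
    (x : (Fin d → ℤ) × Fib d N) :
    model hU (TorusAction.dirac γ 𝒜 ψ) x = (e x.1 x.2 : ℂ) * model hU ψ x + B (model hU ψ) x := by
  obtain ⟨q, i⟩ := x
  have h1 := (hB (model hU ψ) (q, i)).prod_fiberwise (g := fun l =>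
    ((U q)ᴴ *ᵥ (pot γ 𝒜 (q - l) *ᵥ coefVec ψ.1 l)) i) fun l => by
      have e1 : ((U q)ᴴ *ᵥ (pot γ 𝒜 (q - l) *ᵥ coefVec ψ.1 l)) i
          = ∑ j, kernel γ U 𝒜 (q, i) (l, j) * model hU ψ (l, j) := by
        have e2 : (U q)ᴴ *ᵥ (pot γ 𝒜 (q - l) *ᵥ coefVec ψ.1 l)
            = ((U q)ᴴ * pot γ 𝒜 (q - l) * U l) *ᵥ ((U l)ᴴ *ᵥ coefVec ψ.1 l) := by
          rw [mulVec_mulVec, mulVec_mulVec, Matrix.mul_assoc _ (U l), hU.right, Matrix.mul_one]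
        rw [e2]
        rfl
      rw [e1]
      exact hasSum_fintype _
  have h2 : HasSum (fun l => ((U q)ᴴ *ᵥ (pot γ 𝒜 (q - l) *ᵥ coefVec ψ.1 l)) i)
      (∑ j, (U q)ᴴ i j * (coefVec (TorusAction.diracFun γ 𝒜 ψ.1) q j
        - (symbol N γ q *ᵥ coefVec ψ.1 q) j)) :=
    hasSum_sum fun j _ => (hasSum_pot_mulVec 𝒜 ψ.2 q j).mul_left _
  have h3 : (∑ j, (U q)ᴴ i j * (coefVec (TorusAction.diracFun γ 𝒜 ψ.1) q j
        - (symbol N γ q *ᵥ coefVec ψ.1 q) j))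
      = model hU (TorusAction.dirac γ 𝒜 ψ) (q, i) - (e q i : ℂ) * model hU ψ (q, i) := by
    have e3 : ((U q)ᴴ *ᵥ (symbol N γ q *ᵥ coefVec ψ.1 q)) i
        = (e q i : ℂ) * ((U q)ᴴ *ᵥ coefVec ψ.1 q) i := by
      rw [mulVec_mulVec, hU.conjTranspose_mul_symbol, ← mulVec_mulVec, mulVec_diagonal]
    rw [model_apply, model_apply, ← e3]
    simp only [mul_sub, sum_sub_distrib]
    rfl
  have h4 := h1.unique (h3 ▸ h2)
  linear_combination -h4

/-- The eigenvalues of the free Dirac operator grow linearly. -/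
theorem exists_wt_le (hg : g.PosDef) (hγ : IsGamma g γ) (hU : Diagonalizes γ U e) :
    ∃ K, 0 < K ∧ ∀ q i, wt q ≤ 1 + K * |e q i| := by
  obtain ⟨C, hC, h⟩ := LatticeGaussian.exists_sum_sq_le hg.inv
  refine ⟨d * √C + 1, by positivity, fun q i => ?_⟩
  have h1 : ∀ μ, |(q μ : ℝ)| ≤ √C * |e q i| := fun μ => by
    rw [← Real.sqrt_sq_eq_abs (e q i), ← Real.sqrt_mul hC.le, hU.sq_eq hγ]
    refine Real.abs_le_sqrt (le_trans ?_ (h (LatticeGaussian.vec q)))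
    exact single_le_sum (f := fun μ => LatticeGaussian.vec q μ ^ 2) (fun _ _ => sq_nonneg _)
      (mem_univ μ)
  have h2 : ∑ μ, |(q μ : ℝ)| ≤ d * (√C * |e q i|) :=
    (sum_le_card_nsmul _ _ _ fun μ _ => h1 μ).trans (by simp)
  rw [wt]
  nlinarith [abs_nonneg (e q i)]

/-- Eigenvectors of the model are rapidly decreasing: the eigenvalue equation gains one power of
decay at a time. -/
theorem exists_wt_pow_mul_eig_le (hg : g.PosDef) (hγ : IsGamma g γ)
    (hU : Diagonalizes γ U e) (𝒜 : GaugeField d N)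
    {B : Seq ((Fin d → ℤ) × Fib d N) →L[ℂ] Seq ((Fin d → ℤ) × Fib d N)}
    (hB : ∀ v x, HasSum (fun y => kernel γ U 𝒜 x y * v y) (B v x)) {lam : ℝ}
    {w : Seq ((Fin d → ℤ) × Fib d N)} (hw : IsEig (fun x => e x.1 x.2) B lam w) (n : ℕ) :
    ∃ C, ∀ q, wt q ^ n * ∑ i, ‖w (q, i)‖ ≤ C := by
  obtain ⟨K, hK, hwt⟩ := exists_wt_le hg hγ hU
  induction n with
  | zero =>
    refine ⟨Fintype.card (Fib d N) * ‖w‖, fun q => ?_⟩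
    rw [pow_zero, one_mul]
    refine (sum_le_card_nsmul _ _ _ fun i _ => lp.norm_apply_le_norm two_ne_zero w (q, i)).trans ?_
    rw [card_univ, nsmul_eq_mul]
  | succ n ih =>
    obtain ⟨C, hC⟩ := ih
    have hsum := summable_wt_mul_potBound (γ := γ) 𝒜 n
    obtain ⟨S, hS⟩ : ∃ S, S = ∑' r, wt r ^ n * potBound γ 𝒜 r := ⟨_, rfl⟩
    -- convolution with the potential preserves the decay, the weight being submultiplicative
    have hBw : ∀ q i, wt q ^ n * ‖B w (q, i)‖ ≤ S * C := fun q i => by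
      have h1 := (hB w (q, i)).prod_fiberwise fun l =>
        hasSum_fintype fun j => kernel γ U 𝒜 (q, i) (l, j) * w (l, j)
      have h2 : HasSum (fun l => wt (q - l) ^ n * potBound γ 𝒜 (q - l) * C) (S * C) := by
        rw [hS]
        exact ((Equiv.subLeft q).hasSum_iff.2 hsum.hasSum).mul_right C
      have hq := wt_pos q
      have h3 := tsum_of_norm_bounded (f := fun l => ((wt q ^ n : ℝ) : ℂ)
        * ∑ j, kernel γ U 𝒜 (q, i) (l, j) * w (l, j)) h2 fun l => by
          have hl := wt_pos l
          have hql := wt_pos (q - l)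
          have h4 : ‖∑ j, kernel γ U 𝒜 (q, i) (l, j) * w (l, j)‖
              ≤ potBound γ 𝒜 (q - l) * ∑ j, ‖w (l, j)‖ := by
            rw [mul_sum]
            refine (norm_sum_le _ _).trans (sum_le_sum fun j _ => ?_)
            rw [norm_mul]
            exact mul_le_mul_of_nonneg_right (norm_kernel_le hU 𝒜 (q, i) (l, j)) (norm_nonneg _)
          have h5 : wt q ^ n ≤ wt (q - l) ^ n * wt l ^ n := by
            rw [← mul_pow]
            refine pow_le_pow_left₀ hq.le ?_ n
            have := wt_add_le (q - l) l
            rwa [sub_add_cancel] at this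
          have hp := potBound_nonneg (γ := γ) 𝒜 (q - l)
          have hj : 0 ≤ ∑ j, ‖w (l, j)‖ := sum_nonneg fun _ _ => norm_nonneg _
          rw [norm_mul, Complex.norm_real, Real.norm_eq_abs, abs_of_nonneg (by positivity)]
          calc wt q ^ n * ‖∑ j, kernel γ U 𝒜 (q, i) (l, j) * w (l, j)‖
              ≤ (wt (q - l) ^ n * wt l ^ n) * (potBound γ 𝒜 (q - l) * ∑ j, ‖w (l, j)‖) :=
                mul_le_mul h5 h4 (norm_nonneg _) (by positivity)
            _ = wt (q - l) ^ n * potBound γ 𝒜 (q - l) * (wt l ^ n * ∑ j, ‖w (l, j)‖) := by ring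
            _ ≤ _ := mul_le_mul_of_nonneg_left (hC l) (by positivity)
      rw [tsum_mul_left, h1.tsum_eq, norm_mul, Complex.norm_real, Real.norm_eq_abs,
        abs_of_nonneg (by positivity)] at h3
      exact h3
    refine ⟨C + K * |lam| * C + Fintype.card (Fib d N) * (K * (S * C)), fun q => ?_⟩
    have hq := wt_pos q
    have h1 : ∀ i, wt q ^ (n + 1) * ‖w (q, i)‖
        ≤ (1 + K * |lam|) * (wt q ^ n * ‖w (q, i)‖) + K * (S * C) := fun i => by
      have h2 : |e q i| * ‖w (q, i)‖ ≤ |lam| * ‖w (q, i)‖ + ‖B w (q, i)‖ := by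
        have h3 : (e q i : ℂ) * w (q, i) = lam * w (q, i) - B w (q, i) := by
          linear_combination hw (q, i)
        have h4 := congrArg norm h3
        rw [norm_mul, Complex.norm_real, Real.norm_eq_abs] at h4
        rw [h4]
        refine (norm_sub_le _ _).trans (le_of_eq ?_)
        rw [norm_mul, Complex.norm_real, Real.norm_eq_abs]
      have hn : 0 ≤ ‖w (q, i)‖ := norm_nonneg _
      calc wt q ^ (n + 1) * ‖w (q, i)‖ = wt q ^ n * (wt q * ‖w (q, i)‖) := by ring
        _ ≤ wt q ^ n * ((1 + K * |e q i|) * ‖w (q, i)‖) :=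
          mul_le_mul_of_nonneg_left (mul_le_mul_of_nonneg_right (hwt q i) hn) (by positivity)
        _ = wt q ^ n * ‖w (q, i)‖ + K * (wt q ^ n * (|e q i| * ‖w (q, i)‖)) := by ring
        _ ≤ wt q ^ n * ‖w (q, i)‖ + K * (wt q ^ n * (|lam| * ‖w (q, i)‖ + ‖B w (q, i)‖)) :=
          add_le_add le_rfl (mul_le_mul_of_nonneg_left (mul_le_mul_of_nonneg_left h2
            (by positivity)) hK.le)
        _ = (1 + K * |lam|) * (wt q ^ n * ‖w (q, i)‖) + K * (wt q ^ n * ‖B w (q, i)‖) := by ring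
        _ ≤ _ := add_le_add le_rfl (mul_le_mul_of_nonneg_left (hBw q i) hK.le)
    rw [mul_sum]
    refine (sum_le_sum fun i _ => h1 i).trans ?_
    rw [sum_add_distrib, ← mul_sum, ← mul_sum, sum_const, card_univ, nsmul_eq_mul]
    have h5 := mul_le_mul_of_nonneg_left (hC q) (by positivity : 0 ≤ 1 + K * |lam|)
    linarith

/-- Eigenvectors of the model decay rapidly, hence are the coefficients of smooth spinors. -/
theorem isModel_dirac (hg : g.PosDef) (hγ : IsGamma g γ) (hU : Diagonalizes γ U e)
    (𝒜 : GaugeField d N)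
    {B : Seq ((Fin d → ℤ) × Fib d N) →L[ℂ] Seq ((Fin d → ℤ) × Fib d N)}
    (hB : ∀ v x, HasSum (fun y => kernel γ U 𝒜 x y * v y) (B v x)) :
    IsModel (TorusAction.dirac γ 𝒜) (fun x => e x.1 x.2) B (model hU) := by
  refine ⟨model_injective hU, fun ψ x => model_dirac hU 𝒜 hB ψ x, fun lam w hw => ?_⟩
  have hc : ∀ i, RapidDecay fun q => (U q *ᵥ fun j => w (q, j)) i := fun i n => by
    obtain ⟨C, hC⟩ := exists_wt_pow_mul_eig_le hg hγ hU 𝒜 hB hw n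
    refine ⟨C, fun q => le_trans ?_ (hC q)⟩
    have := wt_pos q
    refine mul_le_mul_of_nonneg_left ?_ (by positivity)
    show ‖∑ j, U q i j * w (q, j)‖ ≤ _
    refine (norm_sum_le _ _).trans (sum_le_sum fun j _ => ?_)
    rw [norm_mul]
    exact mul_le_of_le_one_left (norm_nonneg _) (hU.norm_le _ _ _)
  refine ⟨⟨fun x i => synth (fun q => (U q *ᵥ fun j => w (q, j)) i) x,
    contDiff_pi.2 fun i => (hc i).smooth_synth.1, fun μ x => funext fun i =>
      (hc i).smooth_synth.2 μ x⟩, ?_⟩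
  ext x
  rw [model_apply]
  have h1 : coefVec (fun x i => synth (fun q => (U q *ᵥ fun j => w (q, j)) i) x) x.1
      = U x.1 *ᵥ fun j => w (x.1, j) := funext fun i => (hc i).coef_synth x.1
  rw [h1, mulVec_mulVec, hU.left, one_mulVec]

end DiracModel

namespace LatticeGaussian

open Real Filter Topology DiagonalPerturbation

variable {d : ℕ} {Q : Matrix (Fin d) (Fin d) ℝ}

/-! ### The vacuum polarisation tensor -/

/-- The summand of the vacuum polarisation at external momentum `p`, with `q` and `q + p` the
momenta of the loop. -/
def loopTerm (Q : Matrix (Fin d) (Fin d) ℝ) (t : ℝ) (p : Fin d → ℤ) (ν σ : Fin d) (q : Fin d → ℤ) :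
    ℝ :=
  Q ν σ * (qf Q p / 2 * heatDiff Q t p q + (heat Q t (q + p) + heat Q t q) / 2)
    + heatDiff Q t p q * (upper Q (q + p) ν * upper Q q σ + upper Q (q + p) σ * upper Q q ν)

/-- The vacuum polarisation tensor of the quadratic spectral action. -/
def polarization (Q : Matrix (Fin d) (Fin d) ℝ) (t : ℝ) (p : Fin d → ℤ) (ν σ : Fin d) : ℝ :=
  ∑' q, loopTerm Q t p ν σ q

theorem summable_mul_heat_of_sq {f : (Fin d → ℤ) → ℝ} {t : ℝ} (h0 : Summable (heat Q t))
    (h : Summable fun q => f q * f q * heat Q t q) : Summable fun q => f q * heat Q t q := by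
  refine Summable.of_norm_bounded (h0.add h) fun q => ?_
  rw [norm_mul, norm_eq_abs, norm_eq_abs, abs_of_pos (heat_pos _ _)]
  have h1 : |f q| ≤ 1 + f q * f q := by
    rw [abs_le]
    constructor <;> nlinarith [sq_nonneg (f q - 1), sq_nonneg (f q + 1)]
  have := mul_le_mul_of_nonneg_right h1 (heat_pos (Q := Q) t q).le
  linarith

/-- The longitudinal part of the loop sum is elementary, because `(q+p)² - q²` cancels the
denominator of the divided difference. -/
theorem hasSum_loopTerm (hQ : Q.PosDef) {t : ℝ} (ht : 0 < t) {p : Fin d → ℤ} (hp : p ≠ 0)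
    (ν σ : Fin d) : HasSum (loopTerm Q t p ν σ) (actionForm Q t p ν σ
      - (qf Q p / 2 * ∑' q, heatDiff Q t p q + ∑' q, heat Q t q) / qf Q p
        * (upper Q p ν * upper Q p σ)) := by
  have hP := (qf_pos hQ hp).ne'
  have s0 := summable_heat hQ ht
  have sG := summable_heatDiff hQ ht p
  have sY := summable_perp_mul_heatDiff hQ ht hp ν σ
  have e0 := s0.hasSum
  have e1 : HasSum (fun q => heat Q t (q + p)) (∑' q, heat Q t q) := by
    have := (summable_comp_add s0 p).hasSum
    rwa [tsum_comp_add] at this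
  -- sums of odd functions vanish
  have ex : HasSum (fun q => ip Q p q * heat Q t q) 0 := by
    have hs : Summable fun q => ip Q p q * heat Q t q :=
      summable_mul_heat_of_sq s0 (by simpa [pow_two] using summable_ip_pow_mul_heat hQ ht p 1)
    have := hs.hasSum
    rwa [tsum_odd fun q => by rw [ip_neg_right, heat_neg, neg_mul]] at this
  have ex1 : HasSum (fun q => (ip Q p q + qf Q p) * heat Q t (q + p)) 0 := by
    have := (Equiv.addRight p).hasSum_iff.2 ex
    refine this.congr_fun fun q => ?_
    show _ = ip Q p (q + p) * heat Q t (q + p)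
    rw [ip_add_right, ip_self]
  have ey : ∀ ν, HasSum (fun q => perp Q p q ν * heat Q t q) 0 := fun ν => by
    have hs : Summable fun q => perp Q p q ν * heat Q t q :=
      summable_mul_heat_of_sq s0 (summable_perp_mul_heat hQ ht hp ν ν)
    have := hs.hasSum
    rwa [tsum_odd fun q => by rw [perp_neg, heat_neg, neg_mul]] at this
  have ey1 : ∀ ν, HasSum (fun q => perp Q p q ν * heat Q t (q + p)) 0 := fun ν => by
    have := (Equiv.addRight p).hasSum_iff.2 (ey ν)
    refine this.congr_fun fun q => ?_
    show _ = perp Q p (q + p) ν * heat Q t (q + p)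
    rw [perp_add hQ hp]
  have hG : ∀ q, heatDiff Q t p q * (2 * ip Q p q + qf Q p) = heat Q t (q + p) - heat Q t q :=
    fun q => by
      have := expDiff_mul_sub t (qf Q (q + p)) (qf Q q)
      rw [qf_add hQ] at this
      rw [heatDiff, heat, heat, qf_add hQ, ← this]
      ring
  have key := (((sG.hasSum.mul_left (qf Q p / 2)).add ((e1.add e0).div_const 2)).mul_left (Q ν σ)).add
    ((sY.hasSum.mul_left 2).add (((((ey1 ν).sub (ey ν)).mul_left (upper Q p σ / qf Q p)).add
      (((ey1 σ).sub (ey σ)).mul_left (upper Q p ν / qf Q p))).add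
      (((((ex1.mul_left 2).sub (e1.mul_left (qf Q p))).sub ((ex.mul_left 2).add
        (e0.mul_left (qf Q p)))).sub (sG.hasSum.mul_left (qf Q p ^ 2))).mul_left
          (upper Q p ν * upper Q p σ / (2 * qf Q p ^ 2)))))
  -- `q` is split into its parts along `p` and orthogonal to it
  convert! key using 1
  · funext q
    have h1 := hG q
    have hu : ∀ ν, upper Q q ν = perp Q p q ν + upper Q p ν / qf Q p * ip Q p q := fun ν => by
      rw [perp_eq]
      ring
    rw [loopTerm, upper_add, upper_add, hu, hu]
    obtain ⟨G, hG'⟩ : ∃ G, G = heatDiff Q t p q := ⟨_, rfl⟩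
    obtain ⟨x, hx⟩ : ∃ x, x = ip Q p q := ⟨_, rfl⟩
    obtain ⟨P, hP'⟩ : ∃ P, P = qf Q p := ⟨_, rfl⟩
    rw [← hG', ← hx, ← hP'] at h1 ⊢
    rw [← hP'] at hP
    have h2 : heat Q t (q + p) = heat Q t q + G * (2 * x + P) := by linarith
    rw [h2]
    field_simp
    ring
  · rw [actionForm]
    field_simp
    ring

theorem loopTerm_zero (t : ℝ) (ν σ : Fin d) (q : Fin d → ℤ) :
    loopTerm Q t 0 ν σ q = heat Q t q * (Q ν σ - 2 * t * (upper Q q ν * upper Q q σ)) := by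
  rw [loopTerm, heatDiff, add_zero, expDiff_self, qf_zero, heat]
  ring

theorem summable_loopTerm (hQ : Q.PosDef) {t : ℝ} (ht : 0 < t) (p : Fin d → ℤ) (ν σ : Fin d) :
    Summable (loopTerm Q t p ν σ) := by
  by_cases hp : p = 0
  · subst hp
    have s0 := summable_heat hQ ht
    have hT : ∀ ν, Q ν ν ≤ Q.trace := fun ν =>
      Finset.single_le_sum (f := fun i => Q i i) (fun i _ => (hQ.diag_pos).le) (Finset.mem_univ ν)
    have s1 : Summable fun q => upper Q q ν * upper Q q σ * heat Q t q := by
      refine summable_mul_heat hQ ht (C := Q.trace) (k := 1) fun q => ?_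
      have h1 := (sq_upper_le hQ q ν).trans (mul_le_mul_of_nonneg_right (hT ν) (qf_nonneg hQ q))
      have h2 := (sq_upper_le hQ q σ).trans (mul_le_mul_of_nonneg_right (hT σ) (qf_nonneg hQ q))
      rw [pow_one, abs_le]
      constructor <;> nlinarith [sq_nonneg (upper Q q ν + upper Q q σ),
        sq_nonneg (upper Q q ν - upper Q q σ)]
    refine ((s0.mul_left (Q ν σ)).sub (s1.mul_left (2 * t))).congr fun q => ?_
    rw [loopTerm_zero]
    ring
  · exact (hasSum_loopTerm hQ ht hp ν σ).summable

theorem sum_mul_perp (hQ : Q.PosDef) {p : Fin d → ℤ} (hp : p ≠ 0) (q : Fin d → ℤ) :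
    ∑ ν, (p ν : ℝ) * perp Q p q ν = 0 := by
  have h1 : ∀ ν, (p ν : ℝ) * perp Q p q ν
      = upper Q q ν * (p ν : ℝ) - ip Q p q / qf Q p * (upper Q p ν * (p ν : ℝ)) := fun ν => by
    rw [perp_eq]
    ring
  simp only [h1]
  rw [Finset.sum_sub_distrib, ← Finset.mul_sum, sum_upper_mul, sum_upper_mul_self,
    div_mul_cancel₀ _ (qf_pos hQ hp).ne', sub_self]

theorem sum_mul_actionForm (hQ : Q.PosDef) {t : ℝ} (ht : 0 < t) {p : Fin d → ℤ} (hp : p ≠ 0)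
    (σ : Fin d) : ∑ ν, (p ν : ℝ) * actionForm Q t p ν σ
      = (qf Q p / 2 * ∑' q, heatDiff Q t p q + ∑' q, heat Q t q) * upper Q p σ := by
  have hY := fun ν => summable_perp_mul_heatDiff hQ ht hp ν σ
  have h1 : ∑ ν, (p ν : ℝ) * ∑' q, perp Q p q ν * perp Q p q σ * heatDiff Q t p q = 0 := by
    simp only [← tsum_mul_left]
    rw [← Summable.tsum_finsetSum fun ν _ => (hY ν).mul_left _]
    have h2 : ∀ q, ∑ ν, (p ν : ℝ) * (perp Q p q ν * perp Q p q σ * heatDiff Q t p q) = 0 := fun q => by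
      have : ∀ ν, (p ν : ℝ) * (perp Q p q ν * perp Q p q σ * heatDiff Q t p q)
          = ((p ν : ℝ) * perp Q p q ν) * (perp Q p q σ * heatDiff Q t p q) := fun ν => by ring
      simp only [this]
      rw [← Finset.sum_mul, sum_mul_perp hQ hp, zero_mul]
    simp only [h2, tsum_zero]
  have h3 : upper Q p σ = ∑ ν, (p ν : ℝ) * Q ν σ := by
    rw [upper]
    refine Finset.sum_congr rfl fun ν _ => ?_
    have : Q σ ν = Q ν σ := by simpa using hQ.isHermitian.apply ν σ
    rw [this, mul_comm]
  rw [h3]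
  have h4 : ∀ ν, (p ν : ℝ) * actionForm Q t p ν σ
      = (qf Q p / 2 * ∑' q, heatDiff Q t p q + ∑' q, heat Q t q) * ((p ν : ℝ) * Q ν σ)
        + 2 * ((p ν : ℝ) * ∑' q, perp Q p q ν * perp Q p q σ * heatDiff Q t p q) := fun ν => by
    rw [actionForm]
    ring
  simp only [h4]
  rw [Finset.sum_add_distrib, ← Finset.mul_sum, ← Finset.mul_sum, h1, mul_zero, add_zero]

theorem actionForm_comm (hQ : Q.PosDef) (t : ℝ) (p : Fin d → ℤ) (ν σ : Fin d) :
    actionForm Q t p ν σ = actionForm Q t p σ ν := by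
  have : Q ν σ = Q σ ν := by simpa using hQ.isHermitian.apply σ ν
  rw [actionForm, actionForm, this]
  simp only [mul_comm (perp Q p _ ν)]

end LatticeGaussian

namespace FormFactor

open LatticeGaussian Finset TorusFourier TorusAction

variable {d N : ℕ} {g : Matrix (Fin d) (Fin d) ℝ} {p : Fin d → ℤ}
  {F F' : Tensor2 d N}

/-! ### The form factor on the modes of a potential -/

theorem sum_upper_mul_self_complex (p : Fin d → ℤ) :
    ∑ ν, (upper g⁻¹ p ν : ℂ) * (p ν : ℂ) = qf g⁻¹ p := by
  rw [← sum_upper_mul_self]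
  push_cast
  rfl

/-- On the field of a potential, the form factor is the vacuum polarisation: the longitudinal part
of the latter drops out. -/
theorem evalForm_formFactor_eq (hg : g.PosDef) {Λ : ℝ} (hΛ : 0 < Λ) (hp : p ≠ 0)
    {a b : Fin d → Matrix (Fin N) (Fin N) ℂ}
    (ha : ∀ μ ν, F μ ν = Complex.I • ((p μ : ℂ) • a ν - (p ν : ℂ) • a μ))
    (hb : ∀ μ ν, F' μ ν = Complex.I • (((-p) μ : ℂ) • b ν - ((-p) ν : ℂ) • b μ)) :
    evalForm (formFactor g Λ p) F' F = (formConst d Λ : ℂ)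
      * ∑ ν, ∑ σ, (polarization g⁻¹ (Λ ^ 2)⁻¹ p ν σ : ℂ) * (b ν * a σ).trace := by
  have ht : 0 < (Λ ^ 2)⁻¹ := by positivity
  have hP := (qf_pos hg.inv hp).ne'
  have hPc : (qf g⁻¹ p : ℂ) ≠ 0 := by exact_mod_cast hP
  have hb' : ∀ μ ν, F' μ ν = Complex.I • ((p μ : ℂ) • (-b ν) - (p ν : ℂ) • (-b μ)) := fun μ ν => by
    rw [hb]
    simp
  obtain ⟨τ, hτ⟩ : ∃ τ : Fin d → Fin d → ℂ, τ = fun ν σ => (b ν * a σ).trace := ⟨_, rfl⟩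
  obtain ⟨u, hu⟩ : ∃ u : Fin d → ℂ, u = fun ν => (upper g⁻¹ p ν : ℂ) := ⟨_, rfl⟩
  obtain ⟨P, hPP⟩ : ∃ P : ℂ, P = qf g⁻¹ p := ⟨_, rfl⟩
  -- the four terms of the product of the divergences
  have hdiv : ∀ ν σ, divPair g p F' F ν σ = P ^ 2 * τ ν σ - P * p σ * ∑ β, u β * τ ν β
      - P * p ν * ∑ α, u α * τ α σ + p ν * p σ * ∑ α, u α * ∑ β, u β * τ α β := fun ν σ => by
    have h1 : ∀ X : Matrix (Fin N) (Fin N) ℂ, (X * ∑ μ, (upper g⁻¹ p μ : ℂ) • a μ).trace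
        = ∑ β, u β * (X * a β).trace := fun X => by
      rw [Matrix.mul_sum, Matrix.trace_sum, hu]
      exact sum_congr rfl fun β _ => by rw [Matrix.mul_smul, Matrix.trace_smul, smul_eq_mul]
    have h2 : ∀ X : Matrix (Fin N) (Fin N) ℂ, ((∑ μ, (upper g⁻¹ p μ : ℂ) • b μ) * X).trace
        = ∑ α, u α * (b α * X).trace := fun X => by
      rw [Matrix.sum_mul, Matrix.trace_sum, hu]
      exact sum_congr rfl fun β _ => by rw [Matrix.smul_mul, Matrix.trace_smul, smul_eq_mul]
    have h3 : divg g p F' ν = (-Complex.I) • ((qf g⁻¹ p : ℂ) • b ν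
        - (p ν : ℂ) • ∑ μ, (upper g⁻¹ p μ : ℂ) • b μ) := by
      rw [divg_of_isModeAt hb']
      simp only [smul_neg, sum_neg_distrib]
      module
    rw [divPair, h3, divg_of_isModeAt ha, Matrix.smul_mul, Matrix.mul_smul, smul_smul, neg_mul,
      Complex.I_mul_I, neg_neg, one_smul, sub_mul, mul_sub, mul_sub]
    simp only [Matrix.smul_mul, Matrix.mul_smul, Matrix.trace_sub, Matrix.trace_smul, smul_eq_mul, h1,
      h2]
    have hswap : ∑ β, u β * ∑ α, u α * (b α * a β).trace
        = ∑ α, u α * ∑ β, u β * (b α * a β).trace := by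
      simp only [mul_sum]
      rw [sum_comm]
      exact sum_congr rfl fun _ _ => sum_congr rfl fun _ _ => mul_left_comm _ _ _
    rw [← hPP, hτ, ← hswap]
    ring
  obtain ⟨α, hα⟩ : ∃ α : ℝ, α = qf g⁻¹ p / 2 * ∑' q, heatDiff g⁻¹ (Λ ^ 2)⁻¹ p q
    + ∑' q, heat g⁻¹ (Λ ^ 2)⁻¹ q := ⟨_, rfl⟩
  obtain ⟨T, hT⟩ : ∃ T : Fin d → Fin d → ℂ, T = fun ν σ => (actionForm g⁻¹ (Λ ^ 2)⁻¹ p ν σ : ℂ) :=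
    ⟨_, rfl⟩
  have hpol : ∀ ν σ, (polarization g⁻¹ (Λ ^ 2)⁻¹ p ν σ : ℂ) = T ν σ - α / P * (u ν * u σ) :=
    fun ν σ => by
      rw [polarization, (hasSum_loopTerm hg.inv ht hp ν σ).tsum_eq, ← hα, hT, hPP, hu]
      push_cast
      ring
  have hl : ∀ σ, ∑ ν, (p ν : ℂ) * T ν σ = α * u σ := fun σ => by
    have := congrArg (fun z : ℝ => (z : ℂ)) (sum_mul_actionForm hg.inv ht hp σ)
    rw [← hα] at this
    rw [hT, hu]
    push_cast at this
    exact this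
  have hr : ∀ ν, ∑ σ, (p σ : ℂ) * T ν σ = α * u ν := fun ν => by
    rw [← hl]
    refine sum_congr rfl fun σ _ => ?_
    rw [hT]
    show _ * ((actionForm g⁻¹ (Λ ^ 2)⁻¹ p ν σ : ℝ) : ℂ) = _
    rw [actionForm_comm hg.inv]
  have huP : ∑ σ, (p σ : ℂ) * u σ = P := by
    rw [hPP, ← sum_upper_mul_self_complex, hu]
    exact sum_congr rfl fun σ _ => mul_comm _ _
  obtain ⟨Y, hY⟩ : ∃ Y : ℂ, Y = ∑ ν, u ν * ∑ σ, u σ * τ ν σ := ⟨_, rfl⟩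
  have t2 : ∑ ν, ∑ σ, T ν σ * (p σ * ∑ β, u β * τ ν β) = α * Y := by
    rw [hY, mul_sum]
    refine sum_congr rfl fun ν _ => ?_
    have : ∀ σ, T ν σ * (p σ * ∑ β, u β * τ ν β) = ((p σ : ℂ) * T ν σ) * ∑ β, u β * τ ν β :=
      fun σ => by ring
    simp only [this]
    rw [← sum_mul, hr]
    ring
  have t3 : ∑ ν, ∑ σ, T ν σ * (p ν * ∑ μ, u μ * τ μ σ) = α * Y := by
    rw [sum_comm]
    have e : Y = ∑ σ, u σ * ∑ ν, u ν * τ ν σ := by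
      rw [hY]
      simp only [mul_sum]
      rw [sum_comm]
      exact sum_congr rfl fun σ _ => sum_congr rfl fun ν _ => by ring
    rw [e, mul_sum]
    refine sum_congr rfl fun σ _ => ?_
    have : ∀ ν, T ν σ * (p ν * ∑ μ, u μ * τ μ σ) = ((p ν : ℂ) * T ν σ) * ∑ μ, u μ * τ μ σ :=
      fun ν => by ring
    simp only [this]
    rw [← sum_mul, hl]
    ring
  have t4 : ∑ ν, ∑ σ, T ν σ * (p ν * p σ * Y) = α * P * Y := by
    rw [sum_comm]
    have : ∀ σ, ∑ ν, T ν σ * (p ν * p σ * Y) = (α * Y) * ((p σ : ℂ) * u σ) := fun σ => by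
      have h : ∀ ν, T ν σ * (p ν * p σ * Y) = ((p ν : ℂ) * T ν σ) * (p σ * Y) := fun ν => by ring
      simp only [h]
      rw [← sum_mul, hl]
      ring
    simp only [this]
    rw [← mul_sum, huP]
    ring
  have hsum : contractForm g p (actionForm g⁻¹ (Λ ^ 2)⁻¹ p) F' F
      = P ^ 2 * ∑ ν, ∑ σ, T ν σ * τ ν σ - P * (α * Y) - P * (α * Y) + α * P * Y := by
    rw [← t4]
    nth_rewrite 1 [← t2]
    rw [← t3, contractForm]
    simp only [mul_sum, ← sum_sub_distrib, ← sum_add_distrib]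
    refine sum_congr rfl fun ν _ => sum_congr rfl fun σ _ => ?_
    rw [hdiv, ← hY, hT]
    simp only [← mul_sum]
    ring
  have hpi : ∑ ν, ∑ σ, (polarization g⁻¹ (Λ ^ 2)⁻¹ p ν σ : ℂ) * (b ν * a σ).trace
      = ∑ ν, ∑ σ, T ν σ * τ ν σ - α / P * Y := by
    rw [hY, mul_sum, ← sum_sub_distrib]
    refine sum_congr rfl fun ν _ => ?_
    rw [mul_sum, mul_sum, ← sum_sub_distrib]
    refine sum_congr rfl fun σ _ => ?_
    rw [hpol, hτ]
    ring
  rw [evalForm_formFactor, hsum, hpi, Complex.ofReal_div, Complex.ofReal_pow, ← hPP]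
  rw [← hPP] at hPc
  field_simp
  ring

/-- The field strength of a potential in Fourier space. -/
theorem modeF_eq (𝒜 : GaugeField d N) (k : Fin d → ℤ) (μ ν : Fin d) :
    modeF 𝒜 k μ ν = Complex.I • ((k μ : ℂ) • modeA 𝒜 k ν
      - (k ν : ℂ) • modeA 𝒜 k μ) := by
  ext a b
  have h1 := (DiracModel.smooth_gauge 𝒜 ν a b).partialD μ
  have h2 := (DiracModel.smooth_gauge 𝒜 μ a b).partialD ν
  have h3 : (fun x => TorusAction.partialD μ (fun y => 𝒜.A ν y a b) x
      - TorusAction.partialD ν (fun y => 𝒜.A μ y a b) x)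
      = fun x => TorusAction.partialD μ (fun y => 𝒜.A ν y a b) x
        + (-1) * TorusAction.partialD ν (fun y => 𝒜.A μ y a b) x := funext fun x => by ring
  rw [modeF, fourier_eq_coef, h3, coef_add h1.continuous (h2.const_mul (-1)).continuous,
    coef_const_mul, coef_partialD (DiracModel.smooth_gauge 𝒜 ν a b),
    coef_partialD (DiracModel.smooth_gauge 𝒜 μ a b)]
  simp only [Matrix.smul_apply, Matrix.sub_apply, modeA, fourier_eq_coef, smul_eq_mul]
  ring

theorem trace_modeA_mul (𝒜 : GaugeField d N) (k l : Fin d → ℤ) (μ ν : Fin d) :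
    (modeA 𝒜 k μ * modeA 𝒜 l ν).trace = (((2 * Real.pi) ^ d : ℝ) : ℂ)
      * (DiracModel.modeCoef 𝒜 k μ * DiracModel.modeCoef 𝒜 l ν).trace := by
  have h1 : ∀ k μ, modeA 𝒜 k μ = (((2 * Real.pi) ^ ((d : ℝ) / 2) : ℝ) : ℂ)
      • DiracModel.modeCoef 𝒜 k μ := fun k μ => by
    ext a b
    exact fourier_eq_coef _ _
  have h2 : (2 * Real.pi) ^ d = (2 * Real.pi) ^ ((d : ℝ) / 2) * (2 * Real.pi) ^ ((d : ℝ) / 2) := by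
    rw [← Real.rpow_add (by positivity), add_halves, Real.rpow_natCast]
  rw [h1, h1, Matrix.smul_mul, Matrix.mul_smul, smul_smul, Matrix.trace_smul, h2, smul_eq_mul]
  push_cast
  rfl

/-- The contribution of momentum `r` to the quadratic spectral action. -/
def quadTerm (g : Matrix (Fin d) (Fin d) ℝ) (Λ : ℝ) (𝒜 : GaugeField d N)
    (r : Fin d → ℤ) : ℂ :=
  ((2 ^ (d / 2) * (Λ ^ 2)⁻¹ : ℝ) : ℂ) * ∑ ν, ∑ σ, (polarization g⁻¹ (Λ ^ 2)⁻¹ r ν σ : ℂ)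
    * (DiracModel.modeCoef 𝒜 (-r) ν * DiracModel.modeCoef 𝒜 r σ).trace

theorem quadTerm_eq_evalForm (hg : g.PosDef) {Λ : ℝ} (hΛ : 0 < Λ) (𝒜 : GaugeField d N)
    {r : Fin d → ℤ} (hr : r ≠ 0) : quadTerm g Λ 𝒜 r = evalForm (formFactor g Λ r)
      (modeF 𝒜 (-r)) (modeF 𝒜 r) := by
  have hb : ∀ μ ν, modeF 𝒜 (-r) μ ν = Complex.I • (((-r) μ : ℂ) • modeA 𝒜 (-r) ν
      - ((-r) ν : ℂ) • modeA 𝒜 (-r) μ) := fun μ ν => by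
    rw [modeF_eq]
  have hc : (((2 * Real.pi) ^ d : ℝ) : ℂ) ≠ 0 := by
    exact_mod_cast (by positivity : (2 * Real.pi) ^ d ≠ 0)
  rw [evalForm_formFactor_eq hg hΛ hr (fun μ ν => modeF_eq 𝒜 r μ ν) hb]
  simp only [trace_modeA_mul]
  simp only [mul_left_comm _ (((2 * Real.pi) ^ d : ℝ) : ℂ), ← mul_sum]
  rw [← mul_assoc, quadTerm, formConst, Complex.ofReal_div, mul_comm (((2 * Real.pi) ^ d : ℝ) : ℂ),
    div_mul_cancel₀ _ hc]

/-- At zero momentum the polarisation is the sum that multiplies the constant mode of the potential.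
-/
theorem quadTerm_zero {Λ : ℝ} (hΛ : 0 < Λ) (𝒜 : GaugeField d N) :
    quadTerm g Λ 𝒜 0 = TorusAction.zeroModeTerm g Λ 𝒜 := by
  have hc : (((2 * Real.pi) ^ d : ℝ) : ℂ) ≠ 0 := by
    exact_mod_cast (by positivity : (2 * Real.pi) ^ d ≠ 0)
  have h1 : ∀ ν σ, (∑' q : Fin d → ℤ, Real.exp (-(TorusAction.sq g q) / Λ ^ 2)
      * (2 * Λ ^ 2 * g⁻¹ ν σ - 4 * TorusAction.up g q ν * TorusAction.up g q σ))
      = 2 * Λ ^ 2 * polarization g⁻¹ (Λ ^ 2)⁻¹ 0 ν σ := fun ν σ => by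
    rw [polarization, ← tsum_mul_left]
    refine tsum_congr fun q => ?_
    rw [loopTerm_zero, heat, sq_eq, up_eq]
    have e : -(qf g⁻¹ q) / Λ ^ 2 = -(Λ ^ 2)⁻¹ * qf g⁻¹ q := by ring
    rw [e]
    field_simp
    ring
  rw [quadTerm, TorusAction.zeroModeTerm, mul_sum, mul_sum]
  refine sum_congr rfl fun ν _ => ?_
  rw [mul_sum, mul_sum]
  refine sum_congr rfl fun σ _ => ?_
  rw [h1, trace_modeA_mul, neg_zero]
  have hΛc : (Λ : ℂ) ≠ 0 := by exact_mod_cast hΛ.ne'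
  have hπ : (Real.pi : ℂ) ≠ 0 := by exact_mod_cast Real.pi_ne_zero
  push_cast
  field_simp

end FormFactor

namespace DiracModel

open Matrix Finset DiagonalPerturbation LatticeGaussian Filter Topology TorusAction
open scoped Kronecker

attribute [local instance] InnerProductSpace.toInner

variable {d N : ℕ} {g : Matrix (Fin d) (Fin d) ℝ}
  {γ : Fin d → Matrix (Fin (2 ^ (d / 2))) (Fin (2 ^ (d / 2))) ℂ}
  {U : (Fin d → ℤ) → Matrix (Fib d N) (Fib d N) ℂ}
  {e : (Fin d → ℤ) → Fib d N → ℝ}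

/-! ### The second-order expansion of the spectral action -/

theorem sum_mul_norm_sq {n : Type*} [Fintype n] [DecidableEq n] (U V P : Matrix n n ℂ)
    (f h : n → ℂ) : ∑ i, ∑ j, f i * h j * ((‖(Uᴴ * P * V) i j‖ ^ 2 : ℝ) : ℂ)
      = ((U * diagonal f * Uᴴ) * P * (V * diagonal h * Vᴴ) * Pᴴ).trace := by
  have h1 : ((U * diagonal f * Uᴴ) * P * (V * diagonal h * Vᴴ) * Pᴴ).trace
      = (diagonal f * (Uᴴ * P * V) * (diagonal h * (Uᴴ * P * V)ᴴ)).trace := by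
    simp only [conjTranspose_mul, conjTranspose_conjTranspose, Matrix.mul_assoc]
    rw [trace_mul_comm]
    simp only [Matrix.mul_assoc]
  rw [h1, trace]
  refine sum_congr rfl fun i _ => ?_
  rw [diag_apply, mul_apply]
  refine sum_congr rfl fun j _ => ?_
  rw [diagonal_mul, diagonal_mul, conjTranspose_apply]
  have h2 : (((‖(Uᴴ * P * V) i j‖ ^ 2 : ℝ)) : ℂ) = (Uᴴ * P * V) i j * star ((Uᴴ * P * V) i j) := by
    rw [Complex.ofReal_pow]
    exact (Complex.mul_conj' _).symm
  rw [h2]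
  ring

theorem trace_pot_mul_pot (hγ : IsGamma g γ) (𝒜 : GaugeField d N)
    (r : Fin d → ℤ) : (pot γ 𝒜 r * pot γ 𝒜 (-r)).trace
      = -2 ^ (d / 2) * ∑ μ, ∑ ν, (g⁻¹ μ ν : ℂ) * (modeCoef 𝒜 r μ * modeCoef 𝒜 (-r) ν).trace := by
  rw [pot, pot, Matrix.sum_mul, trace_sum, mul_sum]
  refine sum_congr rfl fun μ _ => ?_
  rw [Matrix.mul_sum, trace_sum, mul_sum]
  refine sum_congr rfl fun ν _ => ?_
  rw [← mul_kronecker_mul, trace_kronecker, Matrix.smul_mul, Matrix.mul_smul, smul_smul, trace_smul,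
    trace_gamma_mul_gamma hγ, Complex.I_mul_I, smul_eq_mul]
  ring

theorem trace_mul_sum_mul_mul_sum {n ι : Type*} [Fintype n] [Fintype ι] (S R : Matrix n n ℂ)
    (X Y : ι → Matrix n n ℂ) : (S * (∑ μ, X μ) * R * ∑ ν, Y ν).trace
      = ∑ μ, ∑ ν, (S * X μ * R * Y ν).trace := by
  simp only [Matrix.mul_sum, Matrix.sum_mul, trace_sum]
  exact sum_comm

theorem trace_symbol_pot_symbol_pot (hg : g.PosDef) (hγ : IsGamma g γ)
    (𝒜 : GaugeField d N) (k q r : Fin d → ℤ) :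
    (symbol N γ k * pot γ 𝒜 r * symbol N γ q * pot γ 𝒜 (-r)).trace
      = -2 ^ (d / 2) * ∑ μ, ∑ ν, ((upper g⁻¹ k μ : ℂ) * upper g⁻¹ q ν - ip g⁻¹ k q * g⁻¹ μ ν
        + upper g⁻¹ k ν * upper g⁻¹ q μ) * (modeCoef 𝒜 r μ * modeCoef 𝒜 (-r) ν).trace := by
  rw [pot, pot]
  refine (trace_mul_sum_mul_mul_sum (symbol N γ k) (symbol N γ q) _ _).trans ?_
  rw [mul_sum]
  refine sum_congr rfl fun μ _ => ?_
  rw [mul_sum]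
  refine sum_congr rfl fun ν _ => ?_
  rw [symbol, symbol, ← mul_kronecker_mul, ← mul_kronecker_mul, ← mul_kronecker_mul,
    trace_kronecker, Matrix.one_mul, Matrix.mul_one]
  have h : -slash γ k * (Complex.I • γ μ) * -slash γ q * (Complex.I • γ ν)
      = (-1 : ℂ) • (slash γ k * γ μ * slash γ q * γ ν) := by
    simp only [Matrix.neg_mul, Matrix.mul_neg, Matrix.smul_mul, Matrix.mul_smul, smul_neg,
      neg_neg, smul_smul, Complex.I_mul_I]
  rw [h, trace_smul, trace_slash_gamma_slash_gamma hg hγ, smul_eq_mul]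
  ring

/-- The term of first order vanishes, because the symbol is odd in the momentum. -/
theorem tsum_gauss'_mul_kernel (hγ : IsGamma g γ)
    (hU : Diagonalizes γ U e) (𝒜 : GaugeField d N) {t : ℝ} (ht : 0 < t)
    (hμ : ∀ s : ℝ, 0 < s → Summable fun x : (Fin d → ℤ) × Fib d N =>
      Real.exp (-s * e x.1 x.2 ^ 2)) :
    ∑' x : (Fin d → ℤ) × Fib d N, gauss' t (e x.1 x.2) * (kernel γ U 𝒜 x x).re = 0 := by
  have hs : Summable fun x : (Fin d → ℤ) × Fib d N =>
      gauss' t (e x.1 x.2) * (kernel γ U 𝒜 x x).re := by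
    refine Summable.of_norm_bounded ((summable_gauss' ht hμ).mul_right (potBound γ 𝒜 0)) fun x => ?_
    rw [norm_mul, Real.norm_eq_abs, Real.norm_eq_abs]
    refine mul_le_mul_of_nonneg_left ((Complex.abs_re_le_norm _).trans ?_) (abs_nonneg _)
    have := norm_kernel_le hU 𝒜 x x
    rwa [sub_self] at this
  rw [hs.tsum_prod' fun q => Summable.of_finite]
  have h1 : ∀ q, ∑' i, gauss' t (e q i) * (kernel γ U 𝒜 (q, i) (q, i)).re
      = -2 * t * heat g⁻¹ t q * (symbol N γ q * pot γ 𝒜 0).trace.re := fun q => by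
    have h2 : (symbol N γ q * pot γ 𝒜 0).trace
        = ∑ i, (e q i : ℂ) * kernel γ U 𝒜 (q, i) (q, i) := by
      rw [hU.eq q, Matrix.mul_assoc, Matrix.mul_assoc, trace_mul_comm, Matrix.mul_assoc, trace]
      refine sum_congr rfl fun i _ => ?_
      rw [diag_apply, diagonal_mul, kernel, sub_self]
    rw [h2, Complex.re_sum, mul_sum, tsum_fintype]
    refine sum_congr rfl fun i _ => ?_
    rw [gauss', hU.sq_eq hγ, heat, Complex.re_ofReal_mul]
    ring
  rw [tsum_congr h1]
  refine tsum_odd fun q => ?_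
  rw [symbol_neg, heat_neg, Matrix.neg_mul, trace_neg, Complex.neg_re, mul_neg]

/-- Pairs of states, as external momentum, loop momentum and fibre indices. -/
def pairEquiv (κ ι : Type*) [AddCommGroup κ] : (κ × κ) × (ι × ι) ≃ (κ × ι) × (κ × ι) where
  toFun z := ((z.1.2 + z.1.1, z.2.1), (z.1.2, z.2.2))
  invFun w := ((w.1.1 - w.2.1, w.2.1), (w.1.2, w.2.2))
  left_inv z := by simp
  right_inv w := by simp

/-- The trace over the fibre at fixed momenta produces the summand of the vacuum polarisation. -/
theorem sum_fibre (hg : g.PosDef) (hγ : IsGamma g γ) (hU : Diagonalizes γ U e)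
    (𝒜 : GaugeField d N) (t : ℝ) (r q : Fin d → ℤ) :
    ∑ i, ∑ j, ((-t * ‖kernel γ U 𝒜 (q + r, i) (q, j)‖ ^ 2
        * ((e q j ^ 2 + e (q + r) i ^ 2) / 2 * expDiff t (e q j ^ 2) (e (q + r) i ^ 2)
          + (Real.exp (-t * e q j ^ 2) + Real.exp (-t * e (q + r) i ^ 2)) / 2
          + e q j * e (q + r) i * expDiff t (e q j ^ 2) (e (q + r) i ^ 2)) : ℝ) : ℂ)
      = ((2 ^ (d / 2) * t : ℝ) : ℂ) * ∑ ν, ∑ σ, (loopTerm g⁻¹ t r ν σ q : ℂ)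
        * (modeCoef 𝒜 (-r) ν * modeCoef 𝒜 r σ).trace := by
  obtain ⟨G, hG⟩ : ∃ G, G = heatDiff g⁻¹ t r q := ⟨_, rfl⟩
  obtain ⟨a, ha⟩ : ∃ a, a = (qf g⁻¹ q + qf g⁻¹ (q + r)) / 2 * G
    + (heat g⁻¹ t q + heat g⁻¹ t (q + r)) / 2 := ⟨_, rfl⟩
  have h1 : ∀ i j, ((-t * ‖kernel γ U 𝒜 (q + r, i) (q, j)‖ ^ 2
        * ((e q j ^ 2 + e (q + r) i ^ 2) / 2 * expDiff t (e q j ^ 2) (e (q + r) i ^ 2)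
          + (Real.exp (-t * e q j ^ 2) + Real.exp (-t * e (q + r) i ^ 2)) / 2
          + e q j * e (q + r) i * expDiff t (e q j ^ 2) (e (q + r) i ^ 2)) : ℝ) : ℂ)
      = (-t * a : ℂ) * ((1 : ℂ) * (1 : ℂ)
          * ((‖((U (q + r))ᴴ * pot γ 𝒜 r * U q) i j‖ ^ 2 : ℝ) : ℂ))
        + (-t * G : ℂ) * ((e (q + r) i : ℂ) * (e q j : ℂ)
          * ((‖((U (q + r))ᴴ * pot γ 𝒜 r * U q) i j‖ ^ 2 : ℝ) : ℂ)) := fun i j => by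
    have hk : kernel γ U 𝒜 (q + r, i) (q, j) = ((U (q + r))ᴴ * pot γ 𝒜 r * U q) i j := by
      rw [kernel]
      simp only [add_sub_cancel_left]
    rw [hk, hU.sq_eq hγ, hU.sq_eq hγ, expDiff_comm, ha]
    rw [heatDiff] at hG
    rw [← hG, heat, heat]
    push_cast
    ring
  have hone : ∀ k, U k * diagonal (fun _ => (1 : ℂ)) * (U k)ᴴ = 1 := fun k => by
    rw [diagonal_one, Matrix.mul_one, hU.right]
  refine (sum_congr rfl fun i _ => sum_congr rfl fun j _ => h1 i j).trans ?_
  refine Eq.trans ?_ (Eq.trans (congrArg₂ (fun x y : ℂ => (-t * a : ℂ) * x + (-t * G : ℂ) * y)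
    (sum_mul_norm_sq (U (q + r)) (U q) (pot γ 𝒜 r) (fun _ => 1) (fun _ => 1))
    (sum_mul_norm_sq (U (q + r)) (U q) (pot γ 𝒜 r) (fun i => (e (q + r) i : ℂ))
      (fun j => (e q j : ℂ)))) ?_)
  · simp only [mul_sum, sum_add_distrib]
  rw [hone, hone, ← hU.eq, ← hU.eq, Matrix.one_mul, Matrix.mul_one,
    ← pot_neg hγ, trace_pot_mul_pot hγ, trace_symbol_pot_symbol_pot hg hγ]
  have hip : ip g⁻¹ (q + r) q = (qf g⁻¹ q + qf g⁻¹ (q + r) - qf g⁻¹ r) / 2 := by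
    rw [ip_comm hg.inv, ip_add_right, ip_self, qf_add hg.inv, ip_comm hg.inv q r]
    ring
  rw [sum_comm (s := univ) (t := univ) (f := fun ν σ => (loopTerm g⁻¹ t r ν σ q : ℂ)
    * (modeCoef 𝒜 (-r) ν * modeCoef 𝒜 r σ).trace)]
  simp only [mul_sum, ← sum_add_distrib]
  refine sum_congr rfl fun μ _ => sum_congr rfl fun ν _ => ?_
  have hsym : g⁻¹ ν μ = g⁻¹ μ ν := by simpa using hg.inv.isHermitian.apply μ ν
  rw [trace_mul_comm (modeCoef 𝒜 (-r) ν), hip, loopTerm, ← hG, ha, hsym]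
  push_cast
  ring

/-- The coefficient of second order of the spectral action, as a sum over the external momentum. -/
theorem hasSum_quadTerm (hg : g.PosDef) (hγ : IsGamma g γ) (hU : Diagonalizes γ U e)
    (𝒜 : GaugeField d N) {Λ : ℝ} (hΛ : 0 < Λ) {M : ℝ} (hb : IsKernel (kernel γ U 𝒜) M)
    (hμ : ∀ s : ℝ, 0 < s → Summable fun x : (Fin d → ℤ) × Fib d N =>
      Real.exp (-s * e x.1 x.2 ^ 2)) :
    HasSum (FormFactor.quadTerm g Λ 𝒜)
      ((∑' p : ((Fin d → ℤ) × Fib d N) × ((Fin d → ℤ) × Fib d N),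
        ‖kernel γ U 𝒜 p.1 p.2‖ ^ 2
          * gaussDiff (Λ ^ 2)⁻¹ (e p.2.1 p.2.2) (e p.1.1 p.1.2) : ℝ) : ℂ) := by
  have ht : 0 < (Λ ^ 2)⁻¹ := by positivity
  have h1 := (hb.summable_gaussDiff ht hμ).hasSum
  have h2 := (Equiv.prodComm ((Fin d → ℤ) × Fib d N)
    ((Fin d → ℤ) × Fib d N)).hasSum_iff.2 h1
  -- symmetrisation in the two states
  have h3 := (h1.add h2).div_const 2
  rw [add_self_div_two] at h3
  obtain ⟨Ψ, hΨ⟩ : ∃ Ψ : ((Fin d → ℤ) × Fib d N) × ((Fin d → ℤ) × Fib d N)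
      → ℝ, Ψ = fun p => -(Λ ^ 2)⁻¹ * ‖kernel γ U 𝒜 p.1 p.2‖ ^ 2
        * ((e p.2.1 p.2.2 ^ 2 + e p.1.1 p.1.2 ^ 2) / 2
            * expDiff (Λ ^ 2)⁻¹ (e p.2.1 p.2.2 ^ 2) (e p.1.1 p.1.2 ^ 2)
          + (Real.exp (-(Λ ^ 2)⁻¹ * e p.2.1 p.2.2 ^ 2)
            + Real.exp (-(Λ ^ 2)⁻¹ * e p.1.1 p.1.2 ^ 2)) / 2
          + e p.2.1 p.2.2 * e p.1.1 p.1.2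
            * expDiff (Λ ^ 2)⁻¹ (e p.2.1 p.2.2 ^ 2) (e p.1.1 p.1.2 ^ 2)) := ⟨_, rfl⟩
  have h4 : HasSum Ψ _ := h3.congr_fun fun p => by
    have hn := congrArg norm (kernel_herm (U := U) hγ 𝒜 p.1 p.2)
    rw [RCLike.norm_conj] at hn
    have hd := gaussDiff_add_gaussDiff (Λ ^ 2)⁻¹ (e p.2.1 p.2.2) (e p.1.1 p.1.2)
    simp only [Function.comp_apply, Equiv.prodComm_apply, Prod.fst_swap, Prod.snd_swap]
    rw [hn, ← mul_add, hd, hΨ]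
    ring
  have h5 := ((pairEquiv (Fin d → ℤ) (Fib d N)).hasSum_iff.2
    (Complex.hasSum_ofReal.2 h4)).prod_fiberwise
    (g := fun z => ∑ w, (Ψ (pairEquiv (Fin d → ℤ) (Fib d N) (z, w)) : ℂ))
    fun z => hasSum_fintype fun w => (Ψ (pairEquiv (Fin d → ℤ) (Fib d N) (z, w)) : ℂ)
  refine HasSum.prod_fiberwise (f := fun z : (Fin d → ℤ) × (Fin d → ℤ) =>
    ((2 ^ (d / 2) * (Λ ^ 2)⁻¹ : ℝ) : ℂ) * ∑ ν, ∑ σ, (loopTerm g⁻¹ (Λ ^ 2)⁻¹ z.1 ν σ z.2 : ℂ)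
        * (modeCoef 𝒜 (-z.1) ν * modeCoef 𝒜 z.1 σ).trace) ?_ fun r => ?_
  · refine h5.congr_fun fun z => ?_
    rw [← sum_fibre hg hγ hU 𝒜, hΨ]
    conv_rhs => rw [Fintype.sum_prod_type]
    rfl
  · have hp : ∀ ν σ, HasSum (fun q => (loopTerm g⁻¹ (Λ ^ 2)⁻¹ r ν σ q : ℂ))
        (polarization g⁻¹ (Λ ^ 2)⁻¹ r ν σ : ℂ) := fun ν σ =>
      Complex.hasSum_ofReal.2 (summable_loopTerm hg.inv ht r ν σ).hasSum
    rw [FormFactor.quadTerm]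
    dsimp only
    refine HasSum.mul_left _ (hasSum_sum fun ν _ => hasSum_sum fun σ _ => ?_)
    exact (hp ν σ).mul_right _

/-- The expansion of the spectral action to second order in the potential. -/
theorem spectralAction_dirac_expansion (hg : g.PosDef) (hγ : IsGamma g γ)
    (𝒜 : GaugeField d N) {Λ : ℝ} (hΛ : 0 < Λ) :
    (∀ ε : ℝ, TorusAction.IsTraceClassAction
      (TorusAction.dirac γ (𝒜.scale ε)) TorusAction.fExp Λ) ∧
    (Summable fun p : {p : Fin d → ℤ // p ≠ 0} => evalForm
      (FormFactor.formFactor g Λ p.1) (modeF 𝒜 (-p.1)) (modeF 𝒜 p.1)) ∧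
    (fun ε : ℝ =>
        ((TorusAction.spectralAction (TorusAction.dirac γ (𝒜.scale ε)) TorusAction.fExp Λ
          - TorusAction.spectralAction (TorusAction.dirac γ (𝒜.scale 0))
              TorusAction.fExp Λ : ℝ) : ℂ)
        - (ε : ℂ) ^ 2 * (TorusAction.zeroModeTerm g Λ 𝒜
            + ∑' p : {p : Fin d → ℤ // p ≠ 0}, evalForm
                (FormFactor.formFactor g Λ p.1) (modeF 𝒜 (-p.1))
                (modeF 𝒜 p.1)))
      =o[𝓝 0] fun ε : ℝ => ε ^ 2 := by
  have ht : 0 < (Λ ^ 2)⁻¹ := by positivity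
  obtain ⟨U, e, hU⟩ := exists_diagonalizes N hγ
  obtain ⟨M, hb⟩ := isKernel_kernel hγ hU 𝒜
  have hμ : ∀ s : ℝ, 0 < s → Summable fun x : (Fin d → ℤ) × Fib d N =>
      Real.exp (-s * e x.1 x.2 ^ 2) := fun s hs => by
    simp only [hU.sq_eq hγ]
    exact (hasSum_prod_fst (summable_heat hg.inv hs) fun q => (heat_pos s q).le).summable
  have hT : ∀ ε : ℝ, IsModel (TorusAction.dirac γ (𝒜.scale ε)) (fun x => e x.1 x.2)
      ((ε : ℂ) • hb.op) (model hU) := fun ε => by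
    refine isModel_dirac hg hγ hU (𝒜.scale ε) fun v x => ?_
    have h1 : ∀ y, kernel γ U (𝒜.scale ε) x y = ε * kernel γ U 𝒜 x y := fun y => by
      rw [kernel, pot_scale, Matrix.mul_smul, Matrix.smul_mul]
      rfl
    simp only [h1, mul_assoc]
    exact (hb.hasSum_op v x).mul_left (ε : ℂ)
  obtain ⟨htc, hexp⟩ := hb.spectralAction_expansion hΛ hμ hT
  rw [tsum_gauss'_mul_kernel hγ hU 𝒜 ht hμ] at hexp
  have hq := hasSum_quadTerm hg hγ hU 𝒜 hΛ hb hμ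
  have hsub : Summable fun p : {p : Fin d → ℤ // p ≠ 0} => FormFactor.quadTerm g Λ 𝒜 p.1 :=
    hq.summable.subtype _
  have hev : ∀ p : {p : Fin d → ℤ // p ≠ 0}, FormFactor.quadTerm g Λ 𝒜 p.1 = evalForm
      (FormFactor.formFactor g Λ p.1) (modeF 𝒜 (-p.1)) (modeF 𝒜 p.1) :=
    fun p => FormFactor.quadTerm_eq_evalForm hg hΛ 𝒜 p.2
  have htot := hq.unique (((hasSum_unique fun p : ({0} : Set (Fin d → ℤ)) =>
    FormFactor.quadTerm g Λ 𝒜 p.1).add_isCompl (t := {p | p ≠ 0}) isCompl_compl hsub.hasSum))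
  simp only [Set.default_coe_singleton, FormFactor.quadTerm_zero hΛ] at htot
  simp only [hev] at hsub
  refine ⟨htc, hsub, ?_⟩
  rw [← tsum_congr hev]
  refine (Complex.isLittleO_ofReal_left.2 hexp).congr_left fun ε => ?_
  have htot' : _ = TorusAction.zeroModeTerm g Λ 𝒜
    + ∑' p : {p : Fin d → ℤ // p ≠ 0}, FormFactor.quadTerm g Λ 𝒜 p.1 := htot
  rw [← htot']
  push_cast
  ring

end DiracModel

end

theorem mainTheorem3 (d N : ℕ) (hd : 0 < d) (hN : 0 < N) (g : Matrix (Fin d) (Fin d) ℝ) (hg : g.PosDef)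
    (γ : Fin d → Matrix (Fin (2 ^ (d / 2))) (Fin (2 ^ (d / 2))) ℂ)
    (hγ : TorusAction.IsGamma g γ) :
    ∃ W : ℝ → (Fin d → ℤ) → Fin d → Fin d → Fin d → Fin d → ℝ,
      -- the spectral action up to second order in the field, with form factor `W`
      (∀ (𝒜 : TorusAction.GaugeField d N) (Λ : ℝ), 0 < Λ →
        (∀ ε : ℝ, TorusAction.IsTraceClassAction
          (TorusAction.dirac γ (𝒜.scale ε)) TorusAction.fExp Λ) ∧
        (Summable fun p : {p : Fin d → ℤ // p ≠ 0} => TorusAction.evalForm (W Λ p.1)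
          (TorusAction.modeF 𝒜 (-p.1)) (TorusAction.modeF 𝒜 p.1)) ∧
        (fun ε : ℝ =>
            ((TorusAction.spectralAction (TorusAction.dirac γ (𝒜.scale ε)) TorusAction.fExp Λ
              - TorusAction.spectralAction (TorusAction.dirac γ (𝒜.scale 0))
                  TorusAction.fExp Λ : ℝ) : ℂ)
            - (ε : ℂ) ^ 2 * (TorusAction.zeroModeTerm g Λ 𝒜
                + ∑' p : {p : Fin d → ℤ // p ≠ 0}, TorusAction.evalForm (W Λ p.1)
                    (TorusAction.modeF 𝒜 (-p.1)) (TorusAction.modeF 𝒜 p.1)))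
          =o[nhds 0] fun ε : ℝ => ε ^ 2) ∧
      -- large momenta at fixed `Λ`, up to `O(p⁻⁶)`
      (∀ Λ : ℝ, 0 < Λ → ∃ C : ℝ, ∀ p : Fin d → ℤ, p ≠ 0 →
        ∀ F' F : TorusAction.Tensor2 d N,
          TorusAction.IsModeAt (-p) F' → TorusAction.IsModeAt p F →
          ‖TorusAction.evalForm (W Λ p) F' F - TorusAction.largeMomentum g Λ p F' F‖
            ≤ C / TorusAction.sq g p ^ 3 * TorusAction.tnorm F' * TorusAction.tnorm F) ∧
      -- the action behaves like `p⁻⁴` at large momenta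
      (∀ Λ : ℝ, 0 < Λ → ∃ c C P : ℝ, 0 < c ∧ ∀ p : Fin d → ℤ, p ≠ 0 → P ≤ TorusAction.sq g p →
        ∀ F : TorusAction.Tensor2 d N, TorusAction.IsModeAt p F →
          c / TorusAction.sq g p ^ 2 * TorusAction.tnorm F ^ 2
            ≤ ‖TorusAction.evalForm (W Λ p) (TorusAction.conjMode F) F‖ ∧
          ‖TorusAction.evalForm (W Λ p) (TorusAction.conjMode F) F‖
            ≤ C / TorusAction.sq g p ^ 2 * TorusAction.tnorm F ^ 2) ∧
      -- the limit `Λ → ∞` of the large-momentum action, uniformly in `p`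
      (∀ δ : ℝ, 0 < δ → ∃ Λ₀ : ℝ, 0 < Λ₀ ∧ ∀ Λ : ℝ, Λ₀ ≤ Λ → ∀ p : Fin d → ℤ, p ≠ 0 →
        ∀ F' F : TorusAction.Tensor2 d N,
          TorusAction.IsModeAt (-p) F' → TorusAction.IsModeAt p F →
          ‖TorusAction.largeMomentum g Λ p F' F
              - ((TorusAction.wCoeff g Λ / TorusAction.sq g p ^ 2 : ℝ) : ℂ)
                * TorusAction.pairing g F' F‖
            ≤ δ * Λ ^ d / TorusAction.sq g p ^ 2
                * TorusAction.tnorm F' * TorusAction.tnorm F) ∧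
      -- the limits in the other order: first `Λ → ∞`, up to exponentially small terms ...
      (∃ c C : ℝ, 0 < c ∧ ∀ Λ : ℝ, 1 ≤ Λ → ∀ p : Fin d → ℤ, p ≠ 0 →
        ∀ F' F : TorusAction.Tensor2 d N,
          TorusAction.IsModeAt (-p) F' → TorusAction.IsModeAt p F →
          ‖TorusAction.evalForm (W Λ p) F' F
              - (TorusAction.largeCutoff g Λ (TorusAction.sq g p) : ℂ)
                * TorusAction.pairing g F' F‖
            ≤ C * Real.exp (-c * Λ ^ 2) * TorusAction.tnorm F' * TorusAction.tnorm F) ∧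
      -- ... and then `p → ∞`
      (∀ Λ : ℝ, 0 < Λ → Filter.Tendsto (fun z : ℝ => z ^ 2 * TorusAction.largeCutoff g Λ z)
        Filter.atTop (nhds (TorusAction.wCoeff g Λ))) ∧
      -- the action is exponentially small as `Λ → 0`
      (∃ c C : ℝ, 0 < c ∧ ∀ Λ : ℝ, 0 < Λ → Λ ≤ 1 → ∀ p : Fin d → ℤ, p ≠ 0 →
        ∀ F' F : TorusAction.Tensor2 d N,
          TorusAction.IsModeAt (-p) F' → TorusAction.IsModeAt p F →
          ‖TorusAction.evalForm (W Λ p) F' F‖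
            ≤ C * Real.exp (-c / Λ ^ 2) * TorusAction.tnorm F' * TorusAction.tnorm F ∧
          ‖TorusAction.largeMomentum g Λ p F' F‖
            ≤ C * Real.exp (-c / Λ ^ 2) / TorusAction.sq g p ^ 2
                * TorusAction.tnorm F' * TorusAction.tnorm F) := by
  refine ⟨FormFactor.formFactor g,
    fun 𝒜 Λ hΛ => DiracModel.spectralAction_dirac_expansion hg hγ 𝒜 hΛ, fun Λ hΛ => ?_,
    fun Λ hΛ => FormFactor.exists_form_bounds hg N hΛ, fun δ hδ => ?_, ?_,
    fun Λ hΛ => LatticeGaussian.tendsto_largeCutoff g hΛ, ?_⟩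
  · obtain ⟨C, -, h⟩ := FormFactor.exists_form_sub_largeMomentum hg N hΛ
    exact ⟨C, fun p hp F' F hF' hF => h p hp F' F (FormFactor.isModeAt_of_neg hF') hF⟩
  · obtain ⟨Λ₀, hΛ₀, h⟩ := FormFactor.exists_largeMomentum_sub_wCoeff hg N hδ
    exact ⟨Λ₀, hΛ₀, fun Λ hΛ p hp F' F hF' hF =>
      h Λ hΛ p hp F' F (FormFactor.isModeAt_of_neg hF') hF⟩
  · obtain ⟨c, C, hc, h⟩ := FormFactor.exists_form_sub_largeCutoff hg N
    exact ⟨c, C, hc, fun Λ hΛ p hp F' F hF' hF =>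
      h Λ hΛ p hp F' F (FormFactor.isModeAt_of_neg hF') hF⟩
  · obtain ⟨c, C, hc, h⟩ := FormFactor.exists_form_small hg N
    exact ⟨c, C, hc, fun Λ hΛ hΛ1 p hp F' F hF' hF =>
      h Λ hΛ hΛ1 p hp F' F (FormFactor.isModeAt_of_neg hF') hF⟩
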